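/- Work over $\mathbb{C}$ and let $1 \le r \le n$. Let $\mathbb{P}^{r-1} \subset \mathbb{P}^n$ be any linear subspace of dimension $r-1$, i.e. the image of the linear embedding of projective spaces of lines induced by an injective linear map $\mathbb{C}^r \to \mathbb{C}^{n+1}$. Let $\mathrm{Bl}_{\mathbb{P}^{r-1}}\mathbb{P}^n$ be the blow-up of $\mathbb{P}^n$ along $\mathbb{P}^{r-1}$. For a vector bundle $\mathcal{F}$ on a variety $X$ let $\mathscr{Z}(\mathcal{F}) \subset X$ denote the zero locus, as a closed subscheme, of a general global section of $\mathcal{F}$; a statement about $\mathscr{Z}(\mathcal{F})$ is to hold for all sections in some non-empty Zariski open subset of $H^0(X,\mathcal{F})$. Then there are isomorphisms of schemes over $\mathbb{C}$ $$\mathrm{Bl}_{\mathbb{P}^{r-1}}\mathbb{P}^n \;\cong\; \mathscr{Z}(\mathcal{Q}_2^{\oplus r}) \subset \mathrm{Fl}(1,r+1,n+1), \qquad \mathrm{Bl}_{\mathbb{P}^{r-1}}\mathbb{P}^n \;\cong\; \mathscr{Z}(\mathcal{Q}_{\mathbb{P}^{n-r}}(0,1)) \subset \mathbb{P}^{n-r}\times\mathbb{P}^n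 .$$ Here $\mathrm{Fl}(1,r+1,n+1)$ is the variety of flags $W_1 \subset W_2 \subset \mathbb{C}^{n+1}$ of subspaces with $\dim W_1 = 1$ and $\dim W_2 = r+1$, and $\mathcal{Q}_2$ is the tautological quotient bundle on it with fibre $\mathbb{C}^{n+1}/W_2$. Further, $\mathbb{P}^m$ is the space of lines in $\mathbb{C}^{m+1}$, and $\mathcal{Q}_{\mathbb{P}^{n-r}}(0,1)$ is the tensor product of the pullback of the tautological quotient bundle of $\mathbb{P}^{n-r}$ (with fibre $\mathbb{C}^{n-r+1}/L$ at a line $L$) and the pullback of $\mathcal{O}_{\mathbb{P}^n}(1)$. -/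

import Mathlib

open CategoryTheory Opposite AlgebraicGeometry TensorProduct

noncomputable section

namespace BlowupFlag

/-! ### Projective space and its linear subspaces -/

attribute [local instance] MvPolynomial.gradedAlgebra

/-- The grading by degree of `ℂ[x₀, …, x_{m-1}]`. -/
abbrev grading (m : ℕ) : ℕ → Submodule ℂ (MvPolynomial (Fin m) ℂ) :=
  MvPolynomial.homogeneousSubmodule (Fin m) ℂ

/-- The category of schemes over `ℂ`. -/
abbrev SchemeC := Over (Spec (CommRingCat.of ℂ))

/-- The projectivization (of lines) of `ℂ^m`: `Proj ℂ[x₀, …, x_{m-1}]` as a scheme over `ℂ`. -/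
def projOf (m : ℕ) : SchemeC :=
  Over.mk (Proj.toSpecZero (grading m) ≫
    Spec.map (CommRingCat.ofHom (algebraMap ℂ (grading m 0))))

/-- Projective space `ℙ^m` over `ℂ`. -/
abbrev projectiveSpace (m : ℕ) : SchemeC := projOf (m + 1)

/-- The substitution of linear forms dual to a linear map `j : ℂ^k → ℂ^m`: the `i`-th coordinate
function of `ℂ^m` goes to its pullback along `j`. -/
def subst {k m : ℕ} (j : (Fin k → ℂ) →ₗ[ℂ] (Fin m → ℂ)) :
    MvPolynomial (Fin m) ℂ →ₐ[ℂ] MvPolynomial (Fin k) ℂ :=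
  MvPolynomial.aeval fun i =>
    ∑ a : Fin k, MvPolynomial.C (j (Pi.single a 1) i) * MvPolynomial.X a

lemma subst_isHomogeneous {k m : ℕ} (j : (Fin k → ℂ) →ₗ[ℂ] (Fin m → ℂ)) {d : ℕ}
    {p : MvPolynomial (Fin m) ℂ} (hp : p ∈ grading m d) : subst j p ∈ grading k d := by
  have := MvPolynomial.IsHomogeneous.aeval (n := 1) hp
    (fun i => ∑ a : Fin k, MvPolynomial.C (j (Pi.single a 1) i) * MvPolynomial.X a)
    (fun i => MvPolynomial.IsHomogeneous.sum _ _ _ fun a _ => by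
      simpa using (MvPolynomial.isHomogeneous_C (Fin k) (j (Pi.single a 1) i)).mul
        (MvPolynomial.isHomogeneous_X ℂ a))
  rw [one_mul] at this
  exact this

/-- `subst j` as a graded ring homomorphism. -/
def substGraded {k m : ℕ} (j : (Fin k → ℂ) →ₗ[ℂ] (Fin m → ℂ)) :
    GradedRingHom (grading m) (grading k) where
  toRingHom := (subst j).toRingHom
  map_mem := fun hp => subst_isHomogeneous j hp

lemma subst_comp_of_leftInverse {k m : ℕ} (j : (Fin k → ℂ) →ₗ[ℂ] (Fin m → ℂ))
    (l : (Fin m → ℂ) →ₗ[ℂ] (Fin k → ℂ)) (h : l ∘ₗ j = LinearMap.id)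
    (p : MvPolynomial (Fin k) ℂ) : subst j (subst l p) = p := by
  have : (subst j).comp (subst l) = AlgHom.id ℂ _ := by
    apply MvPolynomial.algHom_ext
    intro a
    have key : ∀ b : Fin k, ∑ i : Fin m, l (Pi.single i 1) a * j (Pi.single b 1) i
        = if b = a then 1 else 0 := by
      intro b
      have h1 := congrFun (LinearMap.congr_fun h (Pi.single b 1)) a
      rw [LinearMap.comp_apply, LinearMap.pi_apply_eq_sum_univ l (j (Pi.single b 1))] at h1
      simp only [Finset.sum_apply, Pi.smul_apply, smul_eq_mul, LinearMap.id_apply,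
        Pi.single_apply] at h1
      rw [if_congr (eq_comm (a := b)) rfl rfl, ← h1]
      refine Finset.sum_congr rfl fun i _ => ?_
      have hs : (fun x => if i = x then (1 : ℂ) else 0) = Pi.single i 1 := by
        ext x
        simp [Pi.single_apply, eq_comm]
      rw [mul_comm, hs]
    simp only [subst, AlgHom.comp_apply, MvPolynomial.aeval_X, map_sum, map_mul,
      MvPolynomial.algHom_C, MvPolynomial.algebraMap_eq, Finset.mul_sum, AlgHom.id_apply]
    rw [Finset.sum_comm]
    simp only [← mul_assoc, ← Finset.sum_mul, ← MvPolynomial.C_mul, ← map_sum, key]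
    simp
  exact AlgHom.congr_fun this p

lemma irrelevant_le_map_substGraded {k m : ℕ} (j : (Fin k → ℂ) →ₗ[ℂ] (Fin m → ℂ))
    (hj : Function.Injective j) :
    HomogeneousIdeal.irrelevant (grading k) ≤
      (HomogeneousIdeal.irrelevant (grading m)).map (substGraded j) := by
  obtain ⟨l, hl⟩ := LinearMap.exists_leftInverse_of_injective j (LinearMap.ker_eq_bot.2 hj)
  refine (HomogeneousIdeal.irrelevant_le _).2 fun i hi p hp => ?_
  have h1 : subst l p ∈ HomogeneousIdeal.irrelevant (grading m) :=
    HomogeneousIdeal.mem_irrelevant_of_mem _ hi (subst_isHomogeneous l hp)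
  have h2 := Ideal.mem_map_of_mem (substGraded j) h1
  have h3 : substGraded j (subst l p) = p := subst_comp_of_leftInverse j l hl p
  rw [h3] at h2
  exact h2

/-- The linear embedding `ℙ(ℂ^k) ⟶ ℙ(ℂ^m)` induced by an injective linear map `ℂ^k → ℂ^m`. -/
def linearEmbedding {k m : ℕ} (j : (Fin k → ℂ) →ₗ[ℂ] (Fin m → ℂ)) (hj : Function.Injective j) :
    (projOf k).left ⟶ (projOf m).left :=
  Proj.map (substGraded j) (irrelevant_le_map_substGraded j hj)

/-! ### Blow-ups -/

/-- The closed subscheme defined by the ideal sheaf `J` is an effective Cartier divisor: locally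
`J` is generated by one nonzerodivisor. -/
def IsEffectiveCartier {Y : Scheme.{0}} (J : Y.IdealSheafData) : Prop :=
  ∀ y : Y, ∃ U : Y.affineOpens, y ∈ U.1 ∧
    ∃ f ∈ nonZeroDivisors Γ(Y, U.1), J.ideal U = Ideal.span {f}

/-- `b : B ⟶ X` is the blow-up of `X` along the closed subscheme defined by the ideal sheaf `I`:
it is terminal among the `X`-schemes to which `I` pulls back to an effective Cartier divisor. -/
structure IsBlowup {B X : Scheme.{0}} (b : B ⟶ X) (I : X.IdealSheafData) : Prop where
  isEffectiveCartier : IsEffectiveCartier (I.comap b)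
  existsUnique_lift : ∀ (T : Scheme.{0}) (f : T ⟶ X), IsEffectiveCartier (I.comap f) →
    ∃! g : T ⟶ B, g ≫ b = f

/-! ### Grassmannian and flag functors -/

/-- The functor of points of a scheme over `ℂ`: `A ↦ X(A) = Hom_ℂ(Spec A, X)`. -/
def points (X : SchemeC) : CommAlgCat.{0} ℂ ⥤ Type :=
  (algSpec (CommRingCat.of ℂ)).rightOp ⋙ yoneda.obj X

/-- The map of functors of points induced by a morphism of schemes over `ℂ`. -/
def pointsMap {X Y : SchemeC} (i : X ⟶ Y) : points X ⟶ points Y :=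
  Functor.whiskerLeft (algSpec (CommRingCat.of ℂ)).rightOp (yoneda.map i)

/-- `A^m`, written as `A ⊗ ℂ^m`. -/
abbrev Vec (A : Type) [CommRing A] [Algebra ℂ A] (m : ℕ) : Type := A ⊗[ℂ] (Fin m → ℂ)

/-- `Gr(k, ℂ^m)(A)`, for `k ≤ m`: the `A`-submodules `W` of `A^m` with `A^m ⧸ W` finite locally free
of constant rank `m - k`, that is, the subbundles of rank `k` of the trivial bundle of rank `m`. -/
abbrev Gr (k m : ℕ) (A : Type) [CommRing A] [Algebra ℂ A] : Type :=
  Module.Grassmannian A (Vec A m) (m - k)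

section BaseChange

variable {A B : Type} [CommRing A] [Algebra ℂ A] [CommRing B] [Algebra ℂ B] (f : A →ₐ[ℂ] B)

/-- The base change map `A^m → B^m`, which is `f` on each coordinate. -/
def vecMap (m : ℕ) : Vec A m →ₛₗ[f.toRingHom] Vec B m where
  toFun := TensorProduct.map f.toLinearMap LinearMap.id
  map_add' := map_add _
  map_smul' a v := by
    induction v using TensorProduct.induction_on with
    | zero => simp
    | tmul x y => simp [TensorProduct.smul_tmul']
    | add x y hx hy => rw [smul_add, map_add, hx, hy, map_add, smul_add]

/-- The pullback of a subbundle along `Spec B ⟶ Spec A`. -/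
abbrev Gr.map {k m : ℕ} (W : Gr k m A) : Gr k m B := Module.Grassmannian.map f W

lemma mem_grMap {k m : ℕ} (W : Gr k m A) {v : Vec A m} (hv : v ∈ W.toSubmodule) :
    vecMap f m v ∈ (Gr.map f W).toSubmodule := by
  let : Algebra A B := f.toAlgebra
  have : IsScalarTower ℂ A B :=
    IsScalarTower.of_algebraMap_eq' f.comp_algebraMap.symm
  rw [Gr.map, Module.Grassmannian.map_toSubmodule, LinearMap.mem_ker]
  have key : ∀ v : Vec A m, Module.Grassmannian.baseChangeMkQ B W.toSubmodule (vecMap f m v) =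
      1 ⊗ₜ[A] (W.toSubmodule.mkQ v) := by
    intro v
    induction v using TensorProduct.induction_on with
    | zero => rw [map_zero (vecMap f m), map_zero, map_zero, TensorProduct.tmul_zero]
    | tmul x y =>
      have h1 : vecMap f m (x ⊗ₜ y) = f x ⊗ₜ y := rfl
      have h2 : x ⊗ₜ[ℂ] y = x • ((1 : A) ⊗ₜ[ℂ] y) := by simp [TensorProduct.smul_tmul']
      have h3 : f x = x • (1 : B) := by
        rw [Algebra.smul_def, mul_one]; rfl
      rw [h1, h2, map_smul, TensorProduct.tmul_smul, TensorProduct.smul_tmul', ← h3]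
      simp [Module.Grassmannian.baseChangeMkQ]
    | add x y hx hy =>
      rw [map_add (vecMap f m), map_add, hx, hy, map_add, TensorProduct.tmul_add]
  rw [key, Submodule.mkQ_apply, (Submodule.Quotient.mk_eq_zero _).2 hv, TensorProduct.tmul_zero]

lemma grMap_mono {k₁ k₂ m : ℕ} {W₁ : Gr k₁ m A} {W₂ : Gr k₂ m A}
    (h : W₁.toSubmodule ≤ W₂.toSubmodule) :
    (Gr.map f W₁).toSubmodule ≤ (Gr.map f W₂).toSubmodule := by
  let : Algebra A B := f.toAlgebra
  have : IsScalarTower ℂ A B :=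
    IsScalarTower.of_algebraMap_eq' f.comp_algebraMap.symm
  intro v hv
  rw [Gr.map, Module.Grassmannian.map_toSubmodule, LinearMap.mem_ker] at hv ⊢
  have e : W₂.toSubmodule.mkQ = Submodule.factor h ∘ₗ W₁.toSubmodule.mkQ :=
    (Submodule.factor_comp_mk h).symm
  rw [Module.Grassmannian.baseChangeMkQ] at hv ⊢
  rw [e, LinearMap.baseChange_comp, LinearMap.comp_assoc, LinearMap.comp_apply, hv, map_zero]

/-- The base change map `A^m ⧸ W → B^m ⧸ W_B` on fibres of the tautological quotient bundle. -/
def quotMap {k m : ℕ} (W : Gr k m A) :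
    (Vec A m ⧸ W.toSubmodule) →ₛₗ[f.toRingHom] (Vec B m ⧸ (Gr.map f W).toSubmodule) :=
  Submodule.mapQ _ _ (vecMap f m) fun _ hv => mem_grMap f W hv

/-- The base change map `W → W_B` on fibres of the tautological subbundle. -/
def subMap {k m : ℕ} (W : Gr k m A) (w : W.toSubmodule) : (Gr.map f W).toSubmodule :=
  ⟨vecMap f m w, mem_grMap f W w.2⟩

end BaseChange

/-- The functor of points of the Grassmannian of `k`-dimensional subspaces of `ℂ^m`, for `k ≤ m`.
For `k = 1` this is the functor of points of the projective space of lines in `ℂ^m`. -/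
def grFunctor (k m : ℕ) : CommAlgCat.{0} ℂ ⥤ Type where
  obj A := Gr k m A
  map f := ↾fun W => Gr.map f.hom W
  map_id A := ConcreteCategory.hom_ext _ _ fun W => Module.Grassmannian.map_id _ A W
  map_comp f g :=
    ConcreteCategory.hom_ext _ _ fun W => Module.Grassmannian.map_comp _ f.hom g.hom W

/-- The `A`-points of the flag variety `Fl(k₁, k₂, m)`, for `k₁ ≤ k₂ ≤ m`: flags `W₁ ⊆ W₂ ⊆ A^m` of
subbundles of ranks `k₁` and `k₂`. -/
@[ext] structure Flag (k₁ k₂ m : ℕ) (A : Type) [CommRing A] [Algebra ℂ A] where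
  W₁ : Gr k₁ m A
  W₂ : Gr k₂ m A
  le : W₁.toSubmodule ≤ W₂.toSubmodule

/-- The pullback of a flag along `Spec B ⟶ Spec A`. -/
abbrev Flag.map {k₁ k₂ m : ℕ} {A B : Type} [CommRing A] [Algebra ℂ A] [CommRing B] [Algebra ℂ B]
    (f : A →ₐ[ℂ] B) (W : Flag k₁ k₂ m A) : Flag k₁ k₂ m B :=
  ⟨Gr.map f W.W₁, Gr.map f W.W₂, grMap_mono f W.le⟩

/-- The functor of points of the flag variety `Fl(k₁, k₂, m)`. -/
def flagFunctor (k₁ k₂ m : ℕ) : CommAlgCat.{0} ℂ ⥤ Type where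
  obj A := Flag k₁ k₂ m A
  map f := ↾fun W => Flag.map f.hom W
  map_id A := ConcreteCategory.hom_ext _ _ fun W => Flag.ext
    (Module.Grassmannian.map_id _ A W.W₁) (Module.Grassmannian.map_id _ A W.W₂)
  map_comp f g := ConcreteCategory.hom_ext _ _ fun W => Flag.ext
    (Module.Grassmannian.map_comp _ f.hom g.hom W.W₁)
    (Module.Grassmannian.map_comp _ f.hom g.hom W.W₂)

/-! ### Global sections of the two bundles -/

/-- The `ℂ`-vector space of global sections of the bundle `𝒬₂^{⊕ r}` on `Fl(k₁, k₂, m)`, where `𝒬₂`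
is the tautological quotient bundle with fibre `A^m ⧸ W₂` at the flag `(W₁ ⊆ W₂)`. A global section
assigns to each `A`-point an element of the fibre there, compatibly with base change. -/
def sectionsQuot (k₁ k₂ m r : ℕ) :
    Submodule ℂ (∀ (A : CommAlgCat.{0} ℂ) (W : Flag k₁ k₂ m A),
      Fin r → Vec A m ⧸ W.W₂.toSubmodule) where
  carrier := {s | ∀ (A B : CommAlgCat.{0} ℂ) (f : A →ₐ[ℂ] B) (W : Flag k₁ k₂ m A) (a : Fin r),
    s B (W.map f) a = quotMap f W.W₂ (s A W a)}
  add_mem' {s t} hs ht A B f W a := by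
    simp only [Pi.add_apply, hs A B f W a, ht A B f W a, map_add]
  zero_mem' A B f W a := by
    simp only [Pi.zero_apply, map_zero]
  smul_mem' c s hs A B f W a := by
    have h2 : f.toRingHom (algebraMap ℂ A c) = algebraMap ℂ B c := f.commutes c
    simp only [Pi.smul_apply, hs A B f W a]
    rw [← algebraMap_smul B c, ← algebraMap_smul A c, map_smulₛₗ, h2]

/-- The `ℂ`-vector space of global sections of `𝒬_{ℙ^p}(0,1)` on `ℙ^p × ℙ^q`. As `𝒪(1)` is the dual
of the tautological line subbundle `𝒪(-1) ⊆ 𝒪^{q+1}`, this is the bundle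
`ℋom(pr₂^* 𝒪(-1), pr₁^* 𝒬)`, whose fibre at a pair of lines `(L, M)` is `Hom(M, A^{p+1} ⧸ L)`.
A global section assigns to each `A`-point an element of the fibre there, compatibly with base
change. -/
def sectionsTwistedQuot (p q : ℕ) :
    Submodule ℂ (∀ (A : CommAlgCat.{0} ℂ) (L : Gr 1 (p + 1) A) (M : Gr 1 (q + 1) A),
      M.toSubmodule →ₗ[A] (Vec A (p + 1) ⧸ L.toSubmodule)) where
  carrier := {s | ∀ (A B : CommAlgCat.{0} ℂ) (f : A →ₐ[ℂ] B) (L : Gr 1 (p + 1) A)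
    (M : Gr 1 (q + 1) A) (v : M.toSubmodule),
    s B (L.map f) (M.map f) (subMap f M v) = quotMap f L (s A L M v)}
  add_mem' {s t} hs ht A B f L M v := by
    simp only [Pi.add_apply, LinearMap.add_apply, hs A B f L M v, ht A B f L M v, map_add]
  zero_mem' A B f L M v := by
    simp only [Pi.zero_apply, LinearMap.zero_apply, map_zero]
  smul_mem' c s hs A B f L M v := by
    have h2 : f.toRingHom (algebraMap ℂ A c) = algebraMap ℂ B c := f.commutes c
    simp only [Pi.smul_apply, LinearMap.smul_apply, hs A B f L M v]
    rw [← algebraMap_smul B c, ← algebraMap_smul A c, map_smulₛₗ, h2]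

/-! ### Zero loci of general sections -/

/-- `i : Z ⟶ X` is the closed subscheme of `X` whose points are those `x ∈ X(A)` for which
`vanishes A x` holds (below: at which a given section of a bundle on `X` is zero). -/
structure IsZeroLocus {Z X : SchemeC} (i : Z ⟶ X)
    (vanishes : ∀ A : CommAlgCat.{0} ℂ, (points X).obj A → Prop) : Prop where
  isClosedImmersion : IsClosedImmersion i.left
  exists_iff : ∀ (A : CommAlgCat.{0} ℂ) (x : (points X).obj A),
    (∃ z : (points Z).obj A, (pointsMap i).app A z = x) ↔ vanishes A x

/-- For an identification `e` of `F` with the flag variety `Fl(k₁, k₂, m)`: `i : Z ⟶ F` is the zero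
locus of the section `s` of `𝒬₂^{⊕ r}`. -/
def IsZeroLocusQuot {k₁ k₂ m r : ℕ} {F Z : SchemeC} (e : points F ≅ flagFunctor k₁ k₂ m)
    (s : sectionsQuot k₁ k₂ m r) (i : Z ⟶ F) : Prop :=
  IsZeroLocus i fun A x => s.1 A (e.hom.app A x) = 0

/-- For identifications `e₁`, `e₂` of `X`, `Y` with the spaces of lines in `ℂ^(p+1)`, `ℂ^(q+1)`:
`i : Z ⟶ X × Y` is the zero locus of the section `s` of `𝒬_{ℙ^p}(0,1)`. -/
def IsZeroLocusTwistedQuot {p q : ℕ} {X Y Z : SchemeC} (e₁ : points X ≅ grFunctor 1 (p + 1))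
    (e₂ : points Y ≅ grFunctor 1 (q + 1)) (s : sectionsTwistedQuot p q) (i : Z ⟶ X ⨯ Y) : Prop :=
  IsZeroLocus i fun A x =>
    s.1 A (e₁.hom.app A ((pointsMap Limits.prod.fst).app A x))
      (e₂.hom.app A ((pointsMap Limits.prod.snd).app A x)) = 0

/-- `P` holds for a general element of the `ℂ`-vector space `H`: it holds on a nonempty principal
Zariski open subset, the complement of the zero set of a nonzero polynomial function on `H`. -/
def ForGeneral {H : Type*} [AddCommGroup H] [Module ℂ H] (P : H → Prop) : Prop :=
  ∃ f ∈ Algebra.adjoin ℂ (Set.range fun (l : Module.Dual ℂ H) (x : H) => l x),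
    f ≠ 0 ∧ ∀ x, f x ≠ 0 → P x

end BlowupFlag

end

open CategoryTheory Opposite AlgebraicGeometry TensorProduct
noncomputable section
namespace BlowupFlag
attribute [local instance] MvPolynomial.gradedAlgebra
attribute [-simp] AlgHom.toRingHom_eq_coe

/-! ### Vectors over an algebra and their base change -/

section Vectors

variable {A B C : Type} [CommRing A] [Algebra ℂ A] [CommRing B] [Algebra ℂ B]
  [CommRing C] [Algebra ℂ C] (f : A →ₐ[ℂ] B) (g : B →ₐ[ℂ] C)

/-! Let `π : ℂ^(n+1) → ℂ^(n-r+1)` be a surjection whose kernel is the image of `j`, completed to a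
`Splitting`. All three schemes are compared with one incidence functor, `linePairFunctor S.π`: pairs
of lines `(L, M)` with `π(M) ⊆ L`. It is represented by a closed subscheme `B` of `ℙ^(n-r) × ℙ^n`
(`exists_incidence`). The comparisons are made on algebra-valued points, which suffices because
schemes over `ℂ` embed fully faithfully into functors on algebras (`exists_iso_of_points_iso`).

`B` is the blow-up (`isBlowup_incidence`). Locally `L` is spanned by `g` with one coordinate `1`,
and `M` by `j(t) + t₀ σ(g)` with one of the coordinates `t`, `t₀` equal to `1`. So `B` has
polynomial charts, and on them the center pulls back to the ideal of `t₀`, generated by a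
nonzerodivisor. Conversely, let a morphism to `ℙ^n` be given locally by a line `M` spanned by `v`,
and let the coordinates of `π(v)` generate an ideal `(d)` with `d` a nonzerodivisor. Then `π(v) / d`
is unimodular and spans a line `L` (`exists_line_of_coordIdeal`). This `L` is the only possible one,
since `d` cancels in a projective quotient (`line_eq_of_coordIdeal`). Uniqueness also makes the
local lifts glue.

The zero loci are of the same kind. A linear map `g` gives a section of `𝒬(0,1)` that vanishes at
`(L, M)` exactly when `g(M) ⊆ L`. Vectors `v` give a section of `𝒬₂^{⊕ r}` that vanishes at `W₁ ⊆
W₂` exactly when `W₂` contains them. If they span `ker π`, then `W₂ = π⁻¹(L)`, and the inclusion `W₁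
⊆ W₂` is incidence. Any two surjections of the same shape differ by an automorphism of the source,
so the incidence functor does not depend on the choice.

It remains to know that a general section has this form. All global sections are given by constant
vectors or by linear maps (`exists_eq_constSection`, `exists_eq_linSection`). For this, functionals
are applied to a section along a pencil of flags. The two affine charts of the pencil give
polynomials with `F(c) = c G(1/c)`, as for a section of `𝒪(1)` on `ℙ^1`, so the value at `1` is the
sum of the two end values (`eval_one_eq_add`). An exchange argument turns this into an element of
the double dual, that is, a constant vector (`IsPencilAdditive.exists_const`). Complex points are
enough, because flags are locally pulled back from polynomial rings. General position is then the
nonvanishing of a minor. For `r = n` both bundles are zero, and this case is treated separately.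

Representability rests on two facts: `Proj` represents lines (`exists_projOf_iso`), and the Plücker
equations cut out a scheme with the charts and gluing of the Grassmannian (`exists_grassmannian`).
The flag variety is then closed in a product of two Grassmannians. -/

/-- The coordinates of a vector in `A ⊗ ℂ^m`. -/
def vecEquiv (A : Type) [CommRing A] [Algebra ℂ A] (m : ℕ) : Vec A m ≃ₗ[A] (Fin m → A) :=
  TensorProduct.piScalarRight ℂ A A (Fin m)

@[simp] lemma vecEquiv_tmul {m : ℕ} (a : A) (v : Fin m → ℂ) (i : Fin m) :
    vecEquiv A m (a ⊗ₜ v) i = v i • a := by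
  simp [vecEquiv]

@[simp] lemma vecMap_tmul {m : ℕ} (a : A) (v : Fin m → ℂ) :
    vecMap f m (a ⊗ₜ v) = f a ⊗ₜ v := rfl

lemma vecMap_smul {m : ℕ} (a : A) (v : Vec A m) : vecMap f m (a • v) = f a • vecMap f m v :=
  map_smulₛₗ _ _ _

lemma vecEquiv_vecMap {m : ℕ} (v : Vec A m) (i : Fin m) :
    vecEquiv B m (vecMap f m v) i = f (vecEquiv A m v i) := by
  induction v using TensorProduct.induction_on with
  | zero => simp
  | tmul x y => simp
  | add x y hx hy => simp only [map_add, Pi.add_apply, hx, hy]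

lemma vecMap_vecMap {m : ℕ} (v : Vec A m) :
    vecMap g m (vecMap f m v) = vecMap (g.comp f) m v := by
  apply (vecEquiv C m).injective
  ext i
  simp [vecEquiv_vecMap]

/-- The vector with given coordinates. -/
def toVec {m : ℕ} (a : Fin m → A) : Vec A m := (vecEquiv A m).symm a

@[simp] lemma vecEquiv_toVec {m : ℕ} (a : Fin m → A) : vecEquiv A m (toVec a) = a :=
  (vecEquiv A m).apply_symm_apply a

@[simp] lemma toVec_vecEquiv {m : ℕ} (v : Vec A m) : toVec (vecEquiv A m v) = v :=
  (vecEquiv A m).symm_apply_apply v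

lemma vecMap_toVec {m : ℕ} (a : Fin m → A) : vecMap f m (toVec a) = toVec (fun i => f (a i)) := by
  apply (vecEquiv B m).injective
  ext i
  simp [vecEquiv_vecMap]

lemma vecMap_baseChange {m m' : ℕ} (φ : (Fin m → ℂ) →ₗ[ℂ] (Fin m' → ℂ)) (v : Vec A m) :
    vecMap f m' (φ.baseChange A v) = φ.baseChange B (vecMap f m v) := by
  induction v using TensorProduct.induction_on with
  | zero => simp
  | tmul x y => simp
  | add x y hx hy => simp only [map_add, hx, hy]

/-- The basis of constant vectors attached to a basis of `ℂ^m`. -/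
def constBasis (A : Type) [CommRing A] [Algebra ℂ A] {m : ℕ} {ι : Type*}
    (b : Module.Basis ι ℂ (Fin m → ℂ)) : Module.Basis ι A (Vec A m) :=
  Algebra.TensorProduct.basis A b

@[simp] lemma constBasis_apply {m : ℕ} {ι : Type*}
    (b : Module.Basis ι ℂ (Fin m → ℂ)) (i : ι) : constBasis A b i = 1 ⊗ₜ b i := by
  simp [constBasis]

/-- The constant basis vectors of `B^m` are images of those of `A^m`, which are combinations of `S`.
-/
lemma span_vecMap_eq_top {m : ℕ} {S : Set (Vec A m)} (hS : Submodule.span A S = ⊤) :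
    Submodule.span B (vecMap f m '' S) = ⊤ := by
  rw [eq_top_iff, ← (constBasis B (Pi.basisFun ℂ (Fin m))).span_eq, Submodule.span_le]
  rintro _ ⟨i, rfl⟩
  have h : ((1 : A) ⊗ₜ[ℂ] (Pi.basisFun ℂ (Fin m) i) : Vec A m) ∈ Submodule.span A S := by
    rw [hS]; trivial
  have key : ∀ v ∈ Submodule.span A S, vecMap f m v ∈ Submodule.span B (vecMap f m '' S) := by
    intro v hv
    induction hv using Submodule.span_induction with
    | mem x hx => exact Submodule.subset_span ⟨x, hx, rfl⟩
    | zero => simp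
    | add x y _ _ hx hy => rw [map_add]; exact add_mem hx hy
    | smul a x _ hx => rw [vecMap_smul]; exact Submodule.smul_mem _ _ hx
  have := key _ h
  rw [vecMap_tmul, map_one] at this
  simpa using this

end Vectors

/-! ### Subbundles of the trivial bundle -/

section Subbundles

variable {k m : ℕ} {A B C : Type} [CommRing A] [Algebra ℂ A] [CommRing B] [Algebra ℂ B]
  [CommRing C] [Algebra ℂ C]

lemma gr_injective {W W' : Gr k m A} (h : W.toSubmodule = W'.toSubmodule) : W = W' :=
  Module.Grassmannian.ext h

/-- An inclusion of subbundles of the same rank is an equality. -/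
lemma gr_eq_of_le {W W' : Gr k m A} (h : W.toSubmodule ≤ W'.toSubmodule) : W = W' := by
  apply gr_injective
  refine le_antisymm h fun v hv => ?_
  -- The surjection `A^m ⧸ W → A^m ⧸ W'` has kernel `W' ⧸ W`. Source and target are projective of
  -- the same rank, so the kernel is zero.
  have hb := Module.bijective_of_surjective_of_rankAtStalk_eq (φ := Submodule.factor h)
    (Submodule.factor_surjective h)
    (fun I _ => by rw [W.rankAtStalk_eq, W'.rankAtStalk_eq])
  rw [← Submodule.Quotient.mk_eq_zero]
  apply hb.1
  rw [map_zero, ← Submodule.mkQ_apply, ← LinearMap.comp_apply, Submodule.factor_comp_mk,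
    Submodule.mkQ_apply, Submodule.Quotient.mk_eq_zero]
  exact hv

/-- The pullback of a subbundle is by definition the kernel of `baseChangeMkQ`. Knowing this map on
pulled back vectors, which span `B^m`, determines it. -/
lemma baseChangeMkQ_vecMap (f : A →ₐ[ℂ] B) (N : Submodule A (Vec A m)) (v : Vec A m) :
    letI : Algebra A B := f.toAlgebra
    letI : IsScalarTower ℂ A B := IsScalarTower.of_algebraMap_eq' f.comp_algebraMap.symm
    Module.Grassmannian.baseChangeMkQ B N (vecMap f m v) = 1 ⊗ₜ[A] (N.mkQ v) := by
  let : Algebra A B := f.toAlgebra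
  have : IsScalarTower ℂ A B := IsScalarTower.of_algebraMap_eq' f.comp_algebraMap.symm
  induction v using TensorProduct.induction_on with
  | zero => rw [map_zero (vecMap f m), map_zero, map_zero, TensorProduct.tmul_zero]
  | tmul x y =>
    have h1 : vecMap f m (x ⊗ₜ y) = f x ⊗ₜ y := rfl
    have h2 : x ⊗ₜ[ℂ] y = x • ((1 : A) ⊗ₜ[ℂ] y) := by simp [TensorProduct.smul_tmul']
    have h3 : f x = x • (1 : B) := by
      rw [Algebra.smul_def, mul_one]; rfl
    rw [h1, h2, map_smul, TensorProduct.tmul_smul, TensorProduct.smul_tmul', ← h3]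
    simp [Module.Grassmannian.baseChangeMkQ]
  | add x y hx hy =>
    rw [map_add (vecMap f m), map_add, hx, hy, map_add, TensorProduct.tmul_add]

/-- The pullback of a subbundle is spanned by the pullbacks of its sections. -/
lemma grMap_eq_span (f : A →ₐ[ℂ] B) (W : Gr k m A) :
    (Gr.map f W).toSubmodule = Submodule.span B (vecMap f m '' W.toSubmodule) := by
  refine le_antisymm ?_ (Submodule.span_le.2 ?_)
  swap
  · rintro _ ⟨v, hv, rfl⟩
    exact mem_grMap f W hv
  let : Algebra A B := f.toAlgebra
  have : IsScalarTower ℂ A B := IsScalarTower.of_algebraMap_eq' f.comp_algebraMap.symm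
  set N := Submodule.span B (vecMap f m '' W.toSubmodule)
  let l : Vec A m →ₗ[A] (Vec B m ⧸ N) :=
    { toFun := fun v => N.mkQ (vecMap f m v)
      map_add' := fun v w => by simp only [map_add]
      map_smul' := fun a v => by
        rw [vecMap_smul, map_smul, RingHom.id_apply, ← algebraMap_smul B a]; rfl }
  let l' : (Vec A m ⧸ W.toSubmodule) →ₗ[A] (Vec B m ⧸ N) := W.toSubmodule.liftQ l fun v hv => by
    change N.mkQ (vecMap f m v) = 0
    rw [Submodule.mkQ_apply, Submodule.Quotient.mk_eq_zero]
    exact Submodule.subset_span ⟨v, hv, rfl⟩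
  -- The projection modulo `N` factors through `B ⊗ (A^m ⧸ W)`, so a vector that dies there lies in
  -- `N`.
  have key : (l'.liftBaseChange B) ∘ₗ (Module.Grassmannian.baseChangeMkQ B W.toSubmodule) =
      N.mkQ := by
    refine LinearMap.ext_on (span_vecMap_eq_top f (S := Set.univ) Submodule.span_univ) ?_
    rintro _ ⟨v, -, rfl⟩
    rw [LinearMap.comp_apply, baseChangeMkQ_vecMap, LinearMap.liftBaseChange_tmul, one_smul]
    rfl
  intro v hv
  rw [Gr.map, Module.Grassmannian.map_toSubmodule, LinearMap.mem_ker] at hv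
  rw [← Submodule.Quotient.mk_eq_zero, ← Submodule.mkQ_apply, ← key, LinearMap.comp_apply, hv,
    map_zero]

@[simp] lemma quotMap_mk (f : A →ₐ[ℂ] B) (W : Gr k m A) (v : Vec A m) :
    quotMap f W (Submodule.Quotient.mk v) = Submodule.Quotient.mk (vecMap f m v) := rfl

lemma quotMap_smul (f : A →ₐ[ℂ] B) (W : Gr k m A) (a : A) (v : Vec A m ⧸ W.toSubmodule) :
    quotMap f W (a • v) = f a • quotMap f W v :=
  map_smulₛₗ _ _ _

lemma grMap_comp (f : A →ₐ[ℂ] B) (g : B →ₐ[ℂ] C) (W : Gr k m A) :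
    Gr.map (g.comp f) W = Gr.map g (Gr.map f W) :=
  Module.Grassmannian.map_comp _ f g W

/-- A subbundle whose spanning sections pull back into `W'` pulls back to `W'`. -/
lemma grMap_eq_of_span {f : A →ₐ[ℂ] B} {W : Gr k m A} {W' : Gr k m B} {S : Set (Vec A m)}
    (hS : W.toSubmodule = Submodule.span A S) (h : ∀ v ∈ S, vecMap f m v ∈ W'.toSubmodule) :
    Gr.map f W = W' := by
  apply gr_eq_of_le
  rw [grMap_eq_span, Submodule.span_le, hS]
  rintro _ ⟨v, hv, rfl⟩
  induction hv using Submodule.span_induction with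
  | mem x hx => exact h x hx
  | zero => simp
  | add x y _ _ hx hy => rw [map_add]; exact add_mem hx hy
  | smul a x _ hx => rw [vecMap_smul]; exact Submodule.smul_mem _ _ hx

/-- A functional on `A^m ⧸ W` extends to the base change. -/
lemma exists_functional_map (f : A →ₐ[ℂ] B) (W : Gr k m A)
    (φ : (Vec A m ⧸ W.toSubmodule) →ₗ[A] A) :
    ∃ ψ : (Vec B m ⧸ (Gr.map f W).toSubmodule) →ₗ[B] B,
      ∀ q, ψ (quotMap f W q) = f (φ q) := by
  let : Algebra A B := f.toAlgebra
  have : IsScalarTower ℂ A B := IsScalarTower.of_algebraMap_eq' f.comp_algebraMap.symm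
  let b := constBasis B (Pi.basisFun ℂ (Fin m))
  -- Prescribing `ψ` on constant basis vectors forces `hψ`, and `hψ` shows that `ψ` kills the
  -- generators of the pulled back subbundle.
  let ψ : Vec B m →ₗ[B] B := b.constr B
    fun i => f (φ (Submodule.Quotient.mk (1 ⊗ₜ Pi.basisFun ℂ (Fin m) i)))
  have hψ : ∀ v : Vec A m, ψ (vecMap f m v) = f (φ (Submodule.Quotient.mk v)) := by
    intro v
    have hv : v ∈ Submodule.span A (Set.range (constBasis A (Pi.basisFun ℂ (Fin m)))) := by
      rw [Module.Basis.span_eq]; trivial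
    induction hv using Submodule.span_induction with
    | mem x hx =>
      obtain ⟨i, rfl⟩ := hx
      have : vecMap f m (constBasis A (Pi.basisFun ℂ (Fin m)) i) = b i := by simp [b]
      rw [this, Module.Basis.constr_basis]
      simp
    | zero => simp
    | add x y _ _ hx hy => rw [map_add, map_add, hx, hy, Submodule.Quotient.mk_add, map_add, map_add]
    | smul a x _ hx =>
      rw [vecMap_smul, map_smul, hx, Submodule.Quotient.mk_smul, map_smul, smul_eq_mul, smul_eq_mul,
        map_mul]
  refine ⟨Submodule.liftQ _ ψ ?_, ?_⟩
  · rw [grMap_eq_span, Submodule.span_le]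
    rintro _ ⟨v, hv, rfl⟩
    rw [SetLike.mem_coe, LinearMap.mem_ker, hψ, (Submodule.Quotient.mk_eq_zero _).2 hv, map_zero,
      map_zero]
  · intro q
    obtain ⟨v, rfl⟩ := Submodule.Quotient.mk_surjective _ q
    rw [quotMap_mk]
    exact hψ v

/-- A finite projective module has a dual basis. -/
lemma exists_dual_family {R M : Type*} [CommRing R] [AddCommGroup M] [Module R M]
    [Module.Finite R M] [Module.Projective R M] :
    ∃ (d : ℕ) (x : Fin d → M) (φ : Fin d → M →ₗ[R] R), ∀ y, y = ∑ i, φ i y • x i := by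
  obtain ⟨d, p, hp⟩ := Module.Finite.exists_fin' R M
  obtain ⟨s, hs⟩ := Module.projective_lifting_property p LinearMap.id hp
  refine ⟨d, fun i => p (Pi.single i 1), fun i => (LinearMap.proj i).comp s, fun y => ?_⟩
  conv_lhs => rw [← LinearMap.id_apply (R := R) y, ← hs, LinearMap.comp_apply]
  conv_lhs => rw [LinearMap.pi_apply_eq_sum_univ p (s y)]
  refine Finset.sum_congr rfl fun i _ => ?_
  simp only [LinearMap.comp_apply, LinearMap.proj_apply]
  congr 2
  ext j
  simp [Pi.single_apply, eq_comm]

/-- The pullback of an element of a fibre of the quotient bundle vanishes iff the values of all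
functionals do. -/
lemma quotMap_eq_zero_iff (f : A →ₐ[ℂ] B) (W : Gr k m A) (q : Vec A m ⧸ W.toSubmodule) :
    quotMap f W q = 0 ↔ ∀ φ : (Vec A m ⧸ W.toSubmodule) →ₗ[A] A, f (φ q) = 0 := by
  constructor
  · intro h φ
    obtain ⟨ψ, hψ⟩ := exists_functional_map f W φ
    rw [← hψ, h, map_zero]
  · intro h
    obtain ⟨d, x, φ, hφ⟩ := exists_dual_family (R := A) (M := Vec A m ⧸ W.toSubmodule)
    rw [hφ q, map_sum]
    refine Finset.sum_eq_zero fun i _ => ?_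
    rw [quotMap_smul, h, zero_smul]

/-- This turns membership after base change into equations over `A`, namely the values of
functionals on the quotient. The closedness of all incidence conditions below rests on it. -/
lemma vecMap_mem_grMap_iff (f : A →ₐ[ℂ] B) (W : Gr k m A) (v : Vec A m) :
    vecMap f m v ∈ (Gr.map f W).toSubmodule ↔
      ∀ φ : (Vec A m ⧸ W.toSubmodule) →ₗ[A] A, f (φ (Submodule.Quotient.mk v)) = 0 := by
  rw [← quotMap_eq_zero_iff, quotMap_mk, Submodule.Quotient.mk_eq_zero]

lemma mem_iff_functional (W : Gr k m A) (v : Vec A m) :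
    v ∈ W.toSubmodule ↔ ∀ φ : (Vec A m ⧸ W.toSubmodule) →ₗ[A] A,
      φ (Submodule.Quotient.mk v) = 0 := by
  rw [← Submodule.Quotient.mk_eq_zero]
  refine ⟨fun h φ => by rw [h, map_zero], fun h => ?_⟩
  obtain ⟨d, x, φ, hφ⟩ := exists_dual_family (R := A) (M := Vec A m ⧸ W.toSubmodule)
  rw [hφ (Submodule.Quotient.mk v)]
  exact Finset.sum_eq_zero fun i _ => by rw [h, zero_smul]

/-- If elements killed by `f` are killed by powers of `h`, and the pullback of `v` along `f` lies in
the subbundle, then a multiple of `v` by a power of `h` does. -/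
lemma exists_pow_smul_mem (f : A →ₐ[ℂ] B) (h : A)
    (hf : ∀ a, f a = 0 → ∃ n : ℕ, h ^ n * a = 0) (W : Gr k m A) (v : Vec A m)
    (hv : vecMap f m v ∈ (Gr.map f W).toSubmodule) : ∃ n : ℕ, h ^ n • v ∈ W.toSubmodule := by
  obtain ⟨d, x, φ, hφ⟩ := exists_dual_family (R := A) (M := Vec A m ⧸ W.toSubmodule)
  rw [vecMap_mem_grMap_iff] at hv
  choose n hn using fun i => hf _ (hv (φ i))
  -- The sum of the exponents dominates each of them, so one power serves the whole dual family.
  refine ⟨∑ i, n i, ?_⟩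
  rw [← Submodule.Quotient.mk_eq_zero, Submodule.Quotient.mk_smul, hφ (Submodule.Quotient.mk v),
    Finset.smul_sum]
  refine Finset.sum_eq_zero fun i _ => ?_
  rw [← Finset.sum_erase_add _ _ (Finset.mem_univ i), pow_add, mul_smul, smul_smul (h ^ n i), hn,
    zero_smul, smul_zero]

/-! ### Constructions of subbundles -/

/-- A submodule whose quotient is identified with a finite projective module of rank `m - k`. -/
def grOfEquiv (N : Submodule A (Vec A m)) {P : Type*} [AddCommGroup P] [Module A P]
    [Module.Finite A P] [Module.Projective A P] (e : P ≃ₗ[A] (Vec A m ⧸ N))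
    (hP : ∀ p, Module.rankAtStalk (R := A) P p = m - k) : Gr k m A where
  toSubmodule := N
  finite_quotient := Module.Finite.equiv e
  projective_quotient := Module.Projective.of_equiv e
  rankAtStalk_eq p := by
    rw [← hP p, Module.rankAtStalk_eq_of_equiv e]

lemma rankAtStalk_fun {R : Type*} [CommRing R] {ι : Type*} [Fintype ι] {d : ℕ}
    (h : Fintype.card ι = d) (p : PrimeSpectrum R) :
    Module.rankAtStalk (R := R) (ι → R) p = d := by
  have : Nontrivial R := PrimeSpectrum.nontrivial p
  rw [Module.rankAtStalk_eq_finrank_of_free]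
  simp [h]

/-- The kernel of a surjection onto a free module of rank `m - k`. -/
def grOfKer {ι : Type*} [Fintype ι] (h : Vec A m →ₗ[A] (ι → A)) (hs : Function.Surjective h)
    (hι : Fintype.card ι = m - k) : Gr k m A :=
  grOfEquiv (LinearMap.ker h) (h.quotKerEquivOfSurjective hs).symm (rankAtStalk_fun hι)

@[simp] lemma grOfKer_toSubmodule {ι : Type*} [Fintype ι] (h : Vec A m →ₗ[A] (ι → A))
    (hs : Function.Surjective h) (hι : Fintype.card ι = m - k) :
    (grOfKer h hs hι).toSubmodule = LinearMap.ker h := rfl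

/-- The line spanned by a unimodular vector. -/
def grOfUnimodular (v : Vec A m) (φ : Vec A m →ₗ[A] A) (h : φ v = 1) : Gr 1 m A :=
  have hc : IsCompl (Submodule.span A {v}) (LinearMap.ker φ) := by
    constructor
    · rw [Submodule.disjoint_def]
      intro x hx hx'
      obtain ⟨a, rfl⟩ := Submodule.mem_span_singleton.1 hx
      rw [LinearMap.mem_ker, map_smul, h, smul_eq_mul, mul_one] at hx'
      rw [hx', zero_smul]
    · rw [codisjoint_iff, eq_top_iff]
      intro x _
      rw [← add_sub_cancel (φ x • v) x]
      refine Submodule.add_mem_sup (Submodule.smul_mem _ _ (Submodule.mem_span_singleton_self v)) ?_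
      rw [LinearMap.mem_ker, map_sub, map_smul, h, smul_eq_mul, mul_one, sub_self]
  let s : Vec A m →ₗ[A] LinearMap.ker φ := (LinearMap.id - φ.smulRight v).codRestrict _ (by
      intro x; simp [h])
  have hs : s ∘ₗ (LinearMap.ker φ).subtype = LinearMap.id := by
    ext x
    have : φ x = 0 := x.2
    change (x : Vec A m) - φ x • v = x
    rw [this, zero_smul, sub_zero]
  have hp : Module.Projective A (LinearMap.ker φ) := .of_split _ s hs
  have hf : Module.Finite A (LinearMap.ker φ) :=
    .of_surjective s fun x => ⟨x, LinearMap.congr_fun hs x⟩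
  grOfEquiv (Submodule.span A {v}) (P := LinearMap.ker φ)
    (Submodule.quotientEquivOfIsCompl _ _ hc).symm (fun p => by
      -- The line is free of rank one, so comparing ranks in `A × ker φ ≃ A^m` gives the complement
      -- rank `m - 1`.
      let e : A ≃ₗ[A] Submodule.span A {v} := LinearEquiv.ofBijective
        (LinearMap.toSpanSingleton A _ ⟨v, Submodule.mem_span_singleton_self v⟩) ⟨by
          intro a b hab
          have := congrArg φ (congrArg Subtype.val hab)
          simpa [h] using this, by
          rintro ⟨x, hx⟩
          obtain ⟨a, rfl⟩ := Submodule.mem_span_singleton.1 hx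
          exact ⟨a, rfl⟩⟩
      let e' : (A × LinearMap.ker φ) ≃ₗ[A] (Fin m → A) :=
        (e.prodCongr (LinearEquiv.refl A _)).trans
          ((Submodule.prodEquivOfIsCompl _ _ hc).trans (vecEquiv A m))
      have h1 := congrFun (Module.rankAtStalk_eq_of_equiv (R := A) (M := A × LinearMap.ker φ)
        (N := Fin m → A) e') p
      have : Nontrivial A := PrimeSpectrum.nontrivial p
      rw [Module.rankAtStalk_prod, Pi.add_apply, rankAtStalk_fun (Fintype.card_fin m),
        Module.rankAtStalk_self] at h1
      simp only [Pi.one_apply] at h1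
      omega)

@[simp] lemma grOfUnimodular_toSubmodule (v : Vec A m) (φ : Vec A m →ₗ[A] A) (h : φ v = 1) :
    (grOfUnimodular v φ h).toSubmodule = Submodule.span A {v} := rfl

end Subbundles

/-! ### Localizations and Zariski sheaves on algebras -/

/-- The localization of an algebra away from an element. -/
abbrev away (A : CommAlgCat.{0} ℂ) (h : A) : CommAlgCat.{0} ℂ :=
  CommAlgCat.of ℂ (Localization.Away h)

/-- The localization homomorphism. -/
abbrev locHom {A : Type} [CommRing A] [Algebra ℂ A] (h : A) : A →ₐ[ℂ] Localization.Away h :=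
  IsScalarTower.toAlgHom ℂ A (Localization.Away h)

section LocHom

variable {A B : Type} [CommRing A] [Algebra ℂ A] [CommRing B] [Algebra ℂ B]

lemma locHom_self_isUnit (h : A) : IsUnit (locHom h h) :=
  IsLocalization.Away.algebraMap_isUnit _

lemma exists_pow_mul_eq_zero (h a : A) (ha : locHom h a = 0) : ∃ n : ℕ, h ^ n * a = 0 := by
  obtain ⟨⟨_, n, rfl⟩, hn⟩ :=
    (IsLocalization.map_eq_zero_iff (Submonoid.powers h) (Localization.Away h) a).1 ha
  exact ⟨n, hn⟩

/-- The extension of a homomorphism to a localization. -/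
def awayLift (h : A) (f : A →ₐ[ℂ] B) (hu : IsUnit (f h)) : Localization.Away h →ₐ[ℂ] B :=
  IsLocalization.liftAlgHom (M := Submonoid.powers h) (f := f) (by
    rintro ⟨_, n, rfl⟩
    rw [map_pow]
    exact hu.pow n)

@[simp] lemma awayLift_locHom (h : A) (f : A →ₐ[ℂ] B) (hu : IsUnit (f h)) (a : A) :
    awayLift h f hu (locHom h a) = f a :=
  IsLocalization.lift_eq _ _

lemma awayLift_comp (h : A) (f : A →ₐ[ℂ] B) (hu : IsUnit (f h)) :
    (awayLift h f hu).comp (locHom h) = f :=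
  AlgHom.ext (awayLift_locHom h f hu)

end LocHom

/-- The localization homomorphism as a morphism of algebras. -/
abbrev loc (A : CommAlgCat.{0} ℂ) (h : A) : A ⟶ away A h := CommAlgCat.ofHom (locHom h)

/-- The sheaf property for finite or infinite covers of spectra by principal open subsets. -/
structure IsZariskiSheaf (G : CommAlgCat.{0} ℂ ⥤ Type) : Prop where
  sep : ∀ (A : CommAlgCat.{0} ℂ) (S : Set A), Ideal.span S = ⊤ → ∀ x y : G.obj A,
    (∀ h ∈ S, G.map (loc A h) x = G.map (loc A h) y) → x = y
  glue : ∀ (A : CommAlgCat.{0} ℂ) (S : Set A), Ideal.span S = ⊤ →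
    ∀ x : ∀ h : S, G.obj (away A h.1),
    (∀ (h h' : S) (B : CommAlgCat.{0} ℂ) (a : away A h.1 ⟶ B) (b : away A h'.1 ⟶ B),
      loc A h.1 ≫ a = loc A h'.1 ≫ b → G.map a (x h) = G.map b (x h')) →
    ∃ y : G.obj A, ∀ h : S, G.map (loc A h.1) y = x h

/-! ### Standard charts of the Grassmannian -/

section Charts

variable {k m : ℕ} {A B : Type} [CommRing A] [Algebra ℂ A] [CommRing B] [Algebra ℂ B]

/-- The projection to a coordinate subspace with kernel given by the matrix `X`. -/
def chartHom (ε : Fin (m - k) ⊕ Fin k ≃ Fin m) (X : Fin (m - k) × Fin k → A) :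
    Vec A m →ₗ[A] (Fin (m - k) → A) :=
  LinearMap.pi fun i =>
    (LinearMap.proj (ε (Sum.inl i)) + ∑ j, X (i, j) • LinearMap.proj (ε (Sum.inr j))) ∘ₗ
      (vecEquiv A m).toLinearMap

lemma chartHom_apply (ε : Fin (m - k) ⊕ Fin k ≃ Fin m) (X : Fin (m - k) × Fin k → A)
    (v : Vec A m) (i : Fin (m - k)) : chartHom ε X v i =
      vecEquiv A m v (ε (Sum.inl i)) + ∑ j, X (i, j) * vecEquiv A m v (ε (Sum.inr j)) := by
  simp [chartHom]

lemma chartHom_surjective (ε : Fin (m - k) ⊕ Fin k ≃ Fin m) (X : Fin (m - k) × Fin k → A) :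
    Function.Surjective (chartHom ε X) := by
  intro c
  refine ⟨toVec fun l => Sum.elim c 0 (ε.symm l), ?_⟩
  ext i
  simp [chartHom_apply]

/-- The subbundle with matrix `X` in the standard chart `ε`. -/
def chartPt (ε : Fin (m - k) ⊕ Fin k ≃ Fin m) (X : Fin (m - k) × Fin k → A) : Gr k m A :=
  grOfKer (chartHom ε X) (chartHom_surjective ε X) (Fintype.card_fin _)

lemma mem_chartPt (ε : Fin (m - k) ⊕ Fin k ≃ Fin m) (X : Fin (m - k) × Fin k → A) (v : Vec A m) :
    v ∈ (chartPt ε X).toSubmodule ↔ ∀ i, vecEquiv A m v (ε (Sum.inl i)) +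
      ∑ j, X (i, j) * vecEquiv A m v (ε (Sum.inr j)) = 0 := by
  rw [chartPt, grOfKer_toSubmodule, LinearMap.mem_ker, funext_iff]
  simp [chartHom_apply]

lemma grMap_chartPt (f : A →ₐ[ℂ] B) (ε : Fin (m - k) ⊕ Fin k ≃ Fin m)
    (X : Fin (m - k) × Fin k → A) : Gr.map f (chartPt ε X) = chartPt ε (fun p => f (X p)) := by
  refine grMap_eq_of_span (Submodule.span_eq _).symm fun v hv => ?_
  rw [SetLike.mem_coe, mem_chartPt] at hv
  rw [mem_chartPt]
  intro i
  have := congrArg f (hv i)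
  rw [map_zero] at this
  simpa [vecEquiv_vecMap] using this

/-- The frame of the subbundle `chartPt ε X`. -/
def chartFrame (ε : Fin (m - k) ⊕ Fin k ≃ Fin m) (X : Fin (m - k) × Fin k → A) (j : Fin k) :
    Vec A m :=
  toVec fun l => Sum.elim (fun i => - X (i, j)) (fun j' => if j' = j then 1 else 0) (ε.symm l)

lemma chartFrame_mem (ε : Fin (m - k) ⊕ Fin k ≃ Fin m) (X : Fin (m - k) × Fin k → A)
    (j : Fin k) : chartFrame ε X j ∈ (chartPt ε X).toSubmodule := by
  rw [mem_chartPt]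
  intro i
  simp [chartFrame]

lemma chartPt_eq_span (ε : Fin (m - k) ⊕ Fin k ≃ Fin m) (X : Fin (m - k) × Fin k → A) :
    (chartPt ε X).toSubmodule = Submodule.span A (Set.range (chartFrame ε X)) := by
  refine le_antisymm (fun v hv => ?_) (Submodule.span_le.2 ?_)
  · rw [mem_chartPt] at hv
    have : v = ∑ j, vecEquiv A m v (ε (Sum.inr j)) • chartFrame ε X j := by
      apply (vecEquiv A m).injective
      ext l
      obtain ⟨l, rfl⟩ := ε.surjective l
      rw [map_sum, Finset.sum_apply]
      simp only [map_smul, Pi.smul_apply, chartFrame, vecEquiv_toVec, Equiv.symm_apply_apply]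
      rcases l with i | j
      · rw [eq_neg_of_add_eq_zero_left (hv i), ← Finset.sum_neg_distrib]
        refine Finset.sum_congr rfl fun j _ => ?_
        simp only [Sum.elim_inl, smul_eq_mul]
        ring
      · simp
    rw [this]
    exact Submodule.sum_mem _ fun j _ => Submodule.smul_mem _ _ (Submodule.subset_span ⟨j, rfl⟩)
  · rintro _ ⟨j, rfl⟩
    exact chartFrame_mem ε X j

/-- Every subbundle is locally in a standard chart. -/
lemma exists_chart (hk : k ≤ m) (W : Gr k m A) (𝔭 : Ideal A) [𝔭.IsPrime] :
    ∃ h ∉ 𝔭, ∃ (ε : Fin (m - k) ⊕ Fin k ≃ Fin m) (X : Fin (m - k) × Fin k → Localization.Away h),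
      Gr.map (locHom h) W = chartPt ε X := by
  classical
  let Q := Vec A m ⧸ W.toSubmodule
  let R := Localization.AtPrime 𝔭
  let L := LocalizedModule 𝔭.primeCompl Q
  let ι := LocalizedModule.mkLinearMap 𝔭.primeCompl Q
  let e : Fin m → Q := fun i => Submodule.Quotient.mk (constBasis A (Pi.basisFun ℂ (Fin m)) i)
  have he : Submodule.span A (Set.range e) = ⊤ := by
    have : Set.range e = W.toSubmodule.mkQ '' Set.range (constBasis A (Pi.basisFun ℂ (Fin m))) := by
      rw [← Set.range_comp]; rfl
    rw [this, Submodule.span_image, Module.Basis.span_eq, Submodule.map_top, Submodule.range_mkQ]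
  have hv : Submodule.span R (Set.range fun i => ι (e i)) = ⊤ := by
    have := span_eq_top_of_isLocalizedModule R 𝔭.primeCompl ι he
    rwa [← Set.range_comp] at this
  have : Module.FinitePresentation A Q := Module.finitePresentation_of_projective A Q
  -- Over the local ring a basis of the quotient can be chosen among the images of the standard
  -- vectors. Its indices become the first summand of `ε`.
  obtain ⟨κ, a, b, hb⟩ := Module.exists_basis_of_span_of_flat (R := R) (M := L) _ hv
  have hfin : Finite κ := Module.Finite.finite_basis b
  have := Fintype.ofFinite κ
  have hcard : Fintype.card κ = m - k := by
    rw [← W.rankAtStalk_eq ⟨𝔭, inferInstance⟩, Module.rankAtStalk, Module.finrank_eq_card_basis b]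
  have ha : Function.Injective a := by
    intro x y hxy
    apply b.injective
    rw [hb, hb, hxy]
  let e₀ : Fin (m - k) ≃ κ := (Fintype.equivFinOfCardEq hcard).symm
  have hc2 : Fintype.card ((Set.range a)ᶜ : Set (Fin m)) = k := by
    rw [Fintype.card_compl_set, Fintype.card_fin, Set.card_range_of_injective ha, hcard]
    omega
  let ε : Fin (m - k) ⊕ Fin k ≃ Fin m :=
    ((e₀.trans (Equiv.ofInjective a ha)).sumCongr (Fintype.equivFinOfCardEq hc2).symm).trans
      (Equiv.Set.sumCompl (Set.range a))
  have hε : ∀ i, ε (Sum.inl i) = a (e₀ i) := fun i => by simp [ε]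
  -- The remaining standard vectors are expressed in this basis over the local ring; clearing
  -- denominators gives relations over `A`.
  have key : ∀ j : Fin k, ∃ (h : A) (d : Fin (m - k) → A), h ∉ 𝔭 ∧
      h • e (ε (Sum.inr j)) = ∑ i, d i • e (ε (Sum.inl i)) := by
    intro j
    obtain ⟨s, hs⟩ := IsLocalization.exist_integer_multiples_of_finite 𝔭.primeCompl
      (fun i : Fin (m - k) => b.repr (ι (e (ε (Sum.inr j)))) (e₀ i))
    choose d hd using hs
    have h0 : ι (s.1 • e (ε (Sum.inr j))) = ι (∑ i, d i • e (ε (Sum.inl i))) := by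
      rw [map_smul, map_sum, ← b.sum_repr (ι (e (ε (Sum.inr j)))), Finset.smul_sum,
        ← e₀.sum_comp]
      refine Finset.sum_congr rfl fun i _ => ?_
      rw [hb, map_smul, hε, ← algebraMap_smul R (d i), hd, smul_assoc]
    rw [IsLocalizedModule.eq_iff_exists 𝔭.primeCompl ι] at h0
    obtain ⟨t, ht⟩ := h0
    refine ⟨t * s, fun i => t * d i, 𝔭.primeCompl.mul_mem t.2 s.2, ?_⟩
    rw [Submonoid.smul_def, Submonoid.smul_def, smul_smul, Finset.smul_sum] at ht
    simpa only [smul_smul] using ht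
  choose h d hh hd using key
  refine ⟨∏ j, h j, fun hmem => ?_, ε, ?_⟩
  · obtain ⟨j, -, hj⟩ := (Ideal.IsPrime.prod_mem_iff (p := 𝔭)).1 hmem
    exact hh j hj
  let B := Localization.Away (∏ j, h j)
  have hu : ∀ j, IsUnit (locHom (∏ j, h j) (h j)) := fun j => by
    have h1 : IsUnit (locHom (∏ j, h j) (∏ j, h j)) := IsLocalization.Away.algebraMap_isUnit _
    rw [map_prod] at h1
    exact isUnit_of_dvd_unit (Finset.dvd_prod_of_mem (fun x => locHom (∏ j, h j) (h x)) (Finset.mem_univ j)) h1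
  choose u huu using fun j => (hu j).exists_left_inv
  refine ⟨fun p => u p.2 * locHom (∏ j, h j) (d p.2 p.1), ?_⟩
  symm
  -- Both subbundles have rank `k`, so it is enough that the frame of the chart lies in the
  -- localized `W`. The frame vectors are the relations `w` divided by the units `h j`.
  apply gr_eq_of_le
  rw [chartPt_eq_span, Submodule.span_le]
  rintro _ ⟨j, rfl⟩
  let w : Vec A m := h j • constBasis A (Pi.basisFun ℂ (Fin m)) (ε (Sum.inr j)) -
    ∑ i, d j i • constBasis A (Pi.basisFun ℂ (Fin m)) (ε (Sum.inl i))
  have hw : w ∈ W.toSubmodule := by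
    rw [← Submodule.Quotient.mk_eq_zero, Submodule.Quotient.mk_sub, sub_eq_zero,
      Submodule.Quotient.mk_smul, ← Submodule.mkQ_apply _ (∑ i, _), map_sum]
    simp only [map_smul]
    exact hd j
  have : chartFrame ε (fun p => u p.2 * locHom (∏ j, h j) (d p.2 p.1)) j =
      u j • vecMap (locHom (∏ j, h j)) m w := by
    apply (vecEquiv B m).injective
    ext l
    obtain ⟨l, rfl⟩ := ε.surjective l
    rw [map_smul, Pi.smul_apply, vecEquiv_vecMap]
    simp only [w, map_sub, map_smul, map_sum, Pi.sub_apply, Pi.smul_apply, Finset.sum_apply,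
      constBasis_apply, vecEquiv_tmul, Pi.basisFun_apply, chartFrame, vecEquiv_toVec,
      Equiv.symm_apply_apply, Pi.single_apply, EmbeddingLike.apply_eq_iff_eq]
    rcases l with i | j'
    · simp [apply_ite (algebraMap A (Localization.Away (∏ j, h j)))]
    · by_cases hj : j' = j
      · subst hj
        simpa using (huu j').symm
      · simp [hj]
  rw [this]
  exact Submodule.smul_mem _ _ (mem_grMap _ W hw)

end Charts

/-! ### The Grassmannian functor is a Zariski sheaf -/

section GrSheaf

variable {k m : ℕ}

lemma span_image_locHom {A : Type} [CommRing A] [Algebra ℂ A] {S : Set A}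
    (hS : Ideal.span S = ⊤) (h : A) : Ideal.span (Set.image (locHom h) S) = ⊤ := by
  have := congrArg (Ideal.map (locHom h).toRingHom) hS
  rwa [Ideal.map_span, Ideal.map_top] at this

/-- The comparison of the localization at `t` with the iterated localization at `h` and `t`. -/
def locCompare (A : CommAlgCat.{0} ℂ) (h t : A) : away A t ⟶ away (away A h) (locHom h t) :=
  CommAlgCat.ofHom (awayLift t ((locHom (locHom h t)).comp (locHom h)) (locHom_self_isUnit _))

lemma loc_locCompare (A : CommAlgCat.{0} ℂ) (h t : A) :
    loc A t ≫ locCompare A h t = loc A h ≫ loc (away A h) (locHom h t) :=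
  CommAlgCat.hom_ext (awayLift_comp t ((locHom (locHom h t)).comp (locHom h))
    (locHom_self_isUnit (locHom h t)))

/-- Finitely many members of a cover already generate the unit ideal. What is glued from them
restricts correctly to any other member, because the two sides agree on its intersections with the
finite subcover. -/
lemma isZariskiSheaf_of_finite {G : CommAlgCat.{0} ℂ ⥤ Type}
    (sep : ∀ (A : CommAlgCat.{0} ℂ) (S : Set A), Ideal.span S = ⊤ → ∀ x y : G.obj A,
      (∀ h ∈ S, G.map (loc A h) x = G.map (loc A h) y) → x = y)
    (glue : ∀ (A : CommAlgCat.{0} ℂ) (S : Set A), S.Finite → Ideal.span S = ⊤ →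
      ∀ x : ∀ h : S, G.obj (away A h.1),
      (∀ (h h' : S) (B : CommAlgCat.{0} ℂ) (a : away A h.1 ⟶ B) (b : away A h'.1 ⟶ B),
        loc A h.1 ≫ a = loc A h'.1 ≫ b → G.map a (x h) = G.map b (x h')) →
      ∃ y : G.obj A, ∀ h : S, G.map (loc A h.1) y = x h) : IsZariskiSheaf G := by
  refine ⟨sep, fun A S hS x hx => ?_⟩
  obtain ⟨T, hTS, hT⟩ := (Ideal.span_eq_top_iff_finite S).1 hS
  obtain ⟨y, hy⟩ := glue A T T.finite_toSet hT (fun h => x ⟨h.1, hTS h.2⟩)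
    (fun h h' B a b hab => hx ⟨h.1, hTS h.2⟩ ⟨h'.1, hTS h'.2⟩ B a b hab)
  refine ⟨y, fun h => ?_⟩
  refine sep (away A h.1) (Set.image (locHom h.1) T) (span_image_locHom hT h.1) _ _ ?_
  rintro _ ⟨t, ht, rfl⟩
  have h1 := hx ⟨t, hTS ht⟩ h _ (locCompare A h.1 t) (loc _ _) (loc_locCompare A h.1 t)
  refine Eq.trans ?_ h1
  rw [← Functor.map_comp_apply, ← loc_locCompare, Functor.map_comp_apply]
  exact congrArg _ (hy ⟨t, ht⟩)

lemma exists_vecMap_eq_smul {A : Type} [CommRing A] [Algebra ℂ A] (t : A)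
    (w : Vec (Localization.Away t) m) :
    ∃ (n : ℕ) (v : Vec A m), vecMap (locHom t) m v = locHom t (t ^ n) • w := by
  obtain ⟨⟨_, n, rfl⟩, hs⟩ := IsLocalization.exist_integer_multiples_of_finite
    (Submonoid.powers t) (vecEquiv _ m w)
  choose d hd using hs
  refine ⟨n, toVec d, ?_⟩
  apply (vecEquiv _ m).injective
  ext i
  rw [vecEquiv_vecMap, vecEquiv_toVec, map_smul, Pi.smul_apply]
  exact (hd i).trans (Algebra.smul_def _ _)

/-- A vector of `W` is moved into `W'` by a power of each member of the cover, hence lies in `W'`.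
Equality of ranks does the rest. -/
lemma grFunctor_sep (A : CommAlgCat.{0} ℂ) (S : Set A) (hS : Ideal.span S = ⊤)
    (W W' : Gr k m A) (h : ∀ t ∈ S, Gr.map (locHom t) W = Gr.map (locHom t) W') : W = W' := by
  apply gr_eq_of_le
  intro v hv
  refine Submodule.mem_of_span_eq_top_of_smul_pow_mem _ S hS v fun t => ?_
  refine exists_pow_smul_mem (locHom t.1) t.1 (exists_pow_mul_eq_zero t.1) W' v ?_
  rw [← h t t.2]
  exact mem_grMap _ _ hv

/-- The glued submodule consists of the vectors whose images lie in every local piece. Its quotient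
localizes to the given quotients, so finite presentation and flatness descend from the cover and
together give projectivity. -/
lemma grFunctor_glue (A : CommAlgCat.{0} ℂ) (S : Set A) (hfin : S.Finite) (hS : Ideal.span S = ⊤)
    (x : ∀ h : S, Gr k m (Localization.Away h.1))
    (hx : ∀ (h h' : S) (B : CommAlgCat.{0} ℂ) (a : Localization.Away h.1 →ₐ[ℂ] B)
      (b : Localization.Away h'.1 →ₐ[ℂ] B), a.comp (locHom h.1) = b.comp (locHom h'.1) →
      Gr.map a (x h) = Gr.map b (x h')) :
    ∃ W : Gr k m A, ∀ h : S, Gr.map (locHom h.1) W = x h := by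
  have := hfin.fintype
  let W : Submodule A (Vec A m) := ⨅ t : S, (x t).toSubmodule.comap (vecMap (locHom t.1) m)
  have hW : ∀ v, v ∈ W ↔ ∀ t : S, vecMap (locHom t.1) m v ∈ (x t).toSubmodule := by
    intro v
    simp [W]
  -- On the overlap of `t` and `t'` the compatibility puts `v` into the piece over `t'`, so a power
  -- of `t` does so over `t'` itself. Finiteness of the cover allows one exponent.
  have claim : ∀ (t : S) (v : Vec A m), vecMap (locHom t.1) m v ∈ (x t).toSubmodule →
      ∃ n : ℕ, t.1 ^ n • v ∈ W := by
    intro t v hv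
    have h1 : ∀ t' : S, ∃ n : ℕ, vecMap (locHom t'.1) m (t.1 ^ n • v) ∈ (x t').toSubmodule := by
      intro t'
      let B := Localization.Away (locHom t'.1 t.1)
      let b : Localization.Away t'.1 →ₐ[ℂ] B := locHom (locHom t'.1 t.1)
      let a : Localization.Away t.1 →ₐ[ℂ] B :=
        awayLift t.1 (b.comp (locHom t'.1)) (locHom_self_isUnit _)
      have hab : a.comp (locHom t.1) = b.comp (locHom t'.1) := awayLift_comp _ _ _
      have h2 := hx t t' (CommAlgCat.of ℂ B) a b hab
      have h3 := mem_grMap a (x t) hv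
      rw [vecMap_vecMap, hab, ← vecMap_vecMap] at h3
      have h4 : vecMap b m (vecMap (locHom t'.1) m v) ∈ (Gr.map b (x t')).toSubmodule := by
        rw [← h2]; exact h3
      obtain ⟨n, hn⟩ := exists_pow_smul_mem b (locHom t'.1 t.1)
        (exists_pow_mul_eq_zero _) (x t') _ h4
      refine ⟨n, ?_⟩
      rwa [vecMap_smul, map_pow]
    choose n hn using h1
    refine ⟨∑ t', n t', (hW _).2 fun t' => ?_⟩
    classical
    rw [← Finset.sum_erase_add _ _ (Finset.mem_univ t'), pow_add, mul_smul, vecMap_smul]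
    exact Submodule.smul_mem _ _ (hn t')
  let φ : ∀ t : S, (Vec A m ⧸ W) →ₗ[A] (Vec (Localization.Away t.1) m ⧸ (x t).toSubmodule) :=
    fun t => W.liftQ
      { toFun := fun v => (x t).toSubmodule.mkQ (vecMap (locHom t.1) m v)
        map_add' := fun v w => by simp only [map_add]
        map_smul' := fun a v => by
          rw [vecMap_smul, map_smul, RingHom.id_apply, ← algebraMap_smul (Localization.Away t.1) a]
          rfl } (fun v hv => by
        change (x t).toSubmodule.mkQ (vecMap (locHom t.1) m v) = 0
        rw [Submodule.mkQ_apply, Submodule.Quotient.mk_eq_zero]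
        exact (hW v).1 hv t)
  have hφ : ∀ (t : S) (v : Vec A m), φ t (Submodule.Quotient.mk v) =
      Submodule.Quotient.mk (vecMap (locHom t.1) m v) := fun t v => rfl
  have hloc : ∀ t : S, IsLocalizedModule (Submonoid.powers t.1) (φ t) := by
    intro t
    refine ⟨fun s => ?_, fun y => ?_, fun {y y'} hy => ?_⟩
    · have := isLocalizedModule_id (Submonoid.powers t.1)
        (Vec (Localization.Away t.1) m ⧸ (x t).toSubmodule) (Localization.Away t.1)
      exact this.map_units s
    · obtain ⟨w, rfl⟩ := Submodule.Quotient.mk_surjective _ y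
      obtain ⟨n, v, hv⟩ := exists_vecMap_eq_smul t.1 w
      refine ⟨(Submodule.Quotient.mk v, ⟨t.1 ^ n, n, rfl⟩), ?_⟩
      rw [hφ, hv, Submodule.Quotient.mk_smul, Submonoid.smul_def]
      exact (algebraMap_smul (Localization.Away t.1) _ _).symm
    · obtain ⟨v, rfl⟩ := Submodule.Quotient.mk_surjective _ y
      obtain ⟨v', rfl⟩ := Submodule.Quotient.mk_surjective _ y'
      rw [hφ, hφ, Submodule.Quotient.eq, ← map_sub] at hy
      obtain ⟨n, hn⟩ := claim t _ hy
      refine ⟨⟨t.1 ^ n, n, rfl⟩, ?_⟩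
      change Submodule.Quotient.mk (t.1 ^ n • v) = Submodule.Quotient.mk (t.1 ^ n • v')
      rw [Submodule.Quotient.eq]
      convert hn using 1
      exact (smul_sub _ _ _).symm
  have hfp : Module.FinitePresentation A (Vec A m ⧸ W) :=
    Module.FinitePresentation.of_localizationSpan' S hS
      (Rₚ := fun t => Localization.Away t.1) φ fun t => Module.finitePresentation_of_projective _ _
  have hflat : Module.Flat A (Vec A m ⧸ W) := by
    refine Module.flat_of_isLocalized_span A (Vec A m ⧸ W) S hS
      (fun t => Vec (Localization.Away t.1) m ⧸ (x t).toSubmodule) φ fun t => ?_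
    have : Module.Flat A (Localization.Away t.1) := IsLocalization.flat _ (Submonoid.powers t.1)
    exact Module.Flat.trans A (Localization.Away t.1) _
  have hproj : Module.Projective A (Vec A m ⧸ W) := Module.Flat.projective_of_finitePresentation
  refine ⟨⟨W, inferInstance, hproj, fun p => ?_⟩, fun t => ?_⟩
  -- The rank at a prime can be computed in any member of the cover that contains the prime.
  · obtain ⟨t, ht, htp⟩ : ∃ t ∈ S, t ∉ p.asIdeal := by
      by_contra! hc
      exact p.2.ne_top (top_le_iff.1 (hS ▸ Ideal.span_le.2 hc))
    have hp : p ∈ Set.range (PrimeSpectrum.comap (algebraMap A (Localization.Away t))) := by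
      rw [PrimeSpectrum.localization_away_comap_range (Localization.Away t) t]
      exact htp
    obtain ⟨p', rfl⟩ := hp
    have := hloc ⟨t, ht⟩
    rw [← (x ⟨t, ht⟩).rankAtStalk_eq p']
    exact (Module.rankAtStalk_isBaseChange (IsLocalizedModule.isBaseChange
      (Submonoid.powers t) (Localization.Away t) (φ ⟨t, ht⟩)) p').symm
  · exact grMap_eq_of_span (Submodule.span_eq _).symm fun v hv => (hW v).1 hv t

/-- The functor of points of the Grassmannian is a Zariski sheaf. -/
lemma isZariskiSheaf_grFunctor : IsZariskiSheaf (grFunctor k m) :=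
  isZariskiSheaf_of_finite (fun A S hS W W' h => grFunctor_sep A S hS W W' h)
    (fun A S hfin hS x hx => grFunctor_glue A S hfin hS x fun h h' B a b hab =>
      hx h h' B (CommAlgCat.ofHom a) (CommAlgCat.ofHom b) (by
        ext y
        exact AlgHom.congr_fun hab y))

end GrSheaf

/-! ### Natural transformations from charts -/

section Descent

variable {G G' : CommAlgCat.{0} ℂ ⥤ Type}

/-- The elements of `A` on whose localizations `x` comes from a chart. -/
def chartSet {ι : Type*} {R : ι → CommAlgCat.{0} ℂ} (u : ∀ i, G.obj (R i))
    {A : CommAlgCat.{0} ℂ} (x : G.obj A) : Set A :=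
  {s | ∃ (i : ι) (f : R i ⟶ away A s), G.map (loc A s) x = G.map f (u i)}

/-- The charts `u` cover `G` Zariski locally. -/
def IsChartCover {ι : Type*} {R : ι → CommAlgCat.{0} ℂ} (u : ∀ i, G.obj (R i)) : Prop :=
  ∀ (A : CommAlgCat.{0} ℂ) (x : G.obj A) (𝔭 : Ideal A), 𝔭.IsPrime → ∃ s ∉ 𝔭, s ∈ chartSet u x

lemma span_eq_top_of_forall_prime {A : Type*} [CommRing A] {S : Set A}
    (h : ∀ 𝔭 : Ideal A, 𝔭.IsPrime → ∃ s ∉ 𝔭, s ∈ S) : Ideal.span S = ⊤ := by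
  by_contra hS
  obtain ⟨𝔪, hm, hle⟩ := Ideal.exists_le_maximal _ hS
  obtain ⟨s, hs, hsS⟩ := h 𝔪 hm.isPrime
  exact hs (hle (Ideal.subset_span hsS))

lemma span_image_eq_top {A B : Type} [CommRing A] [Algebra ℂ A] [CommRing B] [Algebra ℂ B]
    (f : A →ₐ[ℂ] B) {S : Set A} (hS : Ideal.span S = ⊤) : Ideal.span (Set.image f S) = ⊤ := by
  have := congrArg (Ideal.map f.toRingHom) hS
  rwa [Ideal.map_span, Ideal.map_top] at this

/-- The map of localizations induced by a homomorphism. -/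
def awayMapHom {A B : CommAlgCat.{0} ℂ} (t : A ⟶ B) (s : A) : away A s ⟶ away B (t.hom s) :=
  CommAlgCat.ofHom (awayLift s ((locHom (t.hom s)).comp t.hom) (locHom_self_isUnit (t.hom s)))

lemma loc_awayMapHom {A B : CommAlgCat.{0} ℂ} (t : A ⟶ B) (s : A) :
    loc A s ≫ awayMapHom t s = t ≫ loc B (t.hom s) :=
  CommAlgCat.hom_ext (awayLift_comp s ((locHom (t.hom s)).comp t.hom)
    (locHom_self_isUnit (t.hom s)))

variable {ι : Type*} {R : ι → CommAlgCat.{0} ℂ} {u : ∀ i, G.obj (R i)}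

lemma natTrans_ext_of_charts (hu : IsChartCover u) (hG' : IsZariskiSheaf G') {η θ : G ⟶ G'}
    (h : ∀ i, η.app _ (u i) = θ.app _ (u i)) : η = θ := by
  refine NatTrans.ext (funext fun A => ConcreteCategory.hom_ext _ _ fun x => ?_)
  refine hG'.sep A (chartSet u x) (span_eq_top_of_forall_prime (hu A x)) _ _ ?_
  rintro s ⟨i, f, hf⟩
  rw [← NatTrans.naturality_apply, ← NatTrans.naturality_apply, hf, NatTrans.naturality_apply,
    NatTrans.naturality_apply, h]

/-- The value at `x` is glued from the values forced on the localizations where `x` comes from a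
chart. The characterization in `key` covers every base change of `x` that comes from a chart, and
this stronger form yields naturality. -/
lemma exists_natTrans_of_charts (hu : IsChartCover u) (hG' : IsZariskiSheaf G')
    (u' : ∀ i, G'.obj (R i))
    (h : ∀ (i j : ι) (A : CommAlgCat.{0} ℂ) (f : R i ⟶ A) (g : R j ⟶ A),
      G.map f (u i) = G.map g (u j) → G'.map f (u' i) = G'.map g (u' j)) :
    ∃ η : G ⟶ G', ∀ i, η.app _ (u i) = u' i := by
  have key : ∀ (A : CommAlgCat.{0} ℂ) (x : G.obj A), ∃ y : G'.obj A,
      ∀ (i : ι) (B : CommAlgCat.{0} ℂ) (t : A ⟶ B) (f : R i ⟶ B),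
        G.map t x = G.map f (u i) → G'.map t y = G'.map f (u' i) := by
    intro A x
    have hS := span_eq_top_of_forall_prime (hu A x)
    choose i f hf using fun s : chartSet u x => s.2
    obtain ⟨y, hy⟩ := hG'.glue A (chartSet u x) hS (fun s => G'.map (f s) (u' (i s))) (by
      intro s s' B a b hab
      rw [← Functor.map_comp_apply, ← Functor.map_comp_apply]
      apply h
      rw [Functor.map_comp_apply, Functor.map_comp_apply, ← hf, ← hf, ← Functor.map_comp_apply,
        ← Functor.map_comp_apply, hab])
    refine ⟨y, fun j B t g hg => ?_⟩
    refine hG'.sep B (Set.image t.hom (chartSet u x)) (span_image_eq_top t.hom hS) _ _ ?_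
    rintro _ ⟨s, hs, rfl⟩
    rw [← Functor.map_comp_apply, ← loc_awayMapHom, Functor.map_comp_apply, hy ⟨s, hs⟩,
      ← Functor.map_comp_apply, ← Functor.map_comp_apply]
    apply h
    rw [Functor.map_comp_apply, Functor.map_comp_apply, ← hf, ← hg, ← Functor.map_comp_apply,
        ← Functor.map_comp_apply, loc_awayMapHom]
  choose T hT using key
  refine ⟨⟨fun A => ↾(T A), fun A B t => ?_⟩, fun i => ?_⟩
  · ext x
    change T B (G.map t x) = G'.map t (T A x)
    refine hG'.sep B (chartSet u (G.map t x)) (span_eq_top_of_forall_prime (hu _ _)) _ _ ?_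
    rintro s ⟨i, f, hf⟩
    rw [hT B (G.map t x) i _ _ f hf, ← Functor.map_comp_apply]
    symm
    apply hT
    rw [← hf, Functor.map_comp_apply]
  · change T _ (u i) = u' i
    have := hT (R i) (u i) i (R i) (𝟙 _) (𝟙 _) rfl
    simpa using this

/-- Two Zariski sheaves covered by charts with the same gluing relations are isomorphic. -/
lemma exists_iso_of_charts (hG : IsZariskiSheaf G) (hG' : IsZariskiSheaf G')
    (hu : IsChartCover u) {u' : ∀ i, G'.obj (R i)} (hu' : IsChartCover u')
    (h : ∀ (i j : ι) (A : CommAlgCat.{0} ℂ) (f : R i ⟶ A) (g : R j ⟶ A),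
      G.map f (u i) = G.map g (u j) ↔ G'.map f (u' i) = G'.map g (u' j)) :
    ∃ e : G ≅ G', ∀ i, e.hom.app _ (u i) = u' i := by
  obtain ⟨η, hη⟩ := exists_natTrans_of_charts hu hG' u' fun i j A f g => (h i j A f g).1
  obtain ⟨θ, hθ⟩ := exists_natTrans_of_charts hu' hG u fun i j A f g => (h i j A f g).2
  refine ⟨⟨η, θ, natTrans_ext_of_charts hu hG fun i => ?_,
    natTrans_ext_of_charts hu' hG' fun i => ?_⟩, hη⟩
  · simp [hη, hθ]
  · simp [hη, hθ]

end Descent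

/-! ### Functors of points -/

section Points

lemma hom_ext_of_spec {X Y : Scheme.{0}} {f g : X ⟶ Y}
    (h : ∀ (R : CommRingCat.{0}) (a : Spec R ⟶ X), a ≫ f = a ≫ g) : f = g :=
  X.affineCover.hom_ext _ _ fun _ => h _ _

/-- Agreement on the fibre products of the cover is tested on their affine points, the only data
that functors of points provide. -/
lemma exists_glue_hom {X Y : Scheme.{0}} (𝒰 : X.OpenCover) (g : ∀ i, 𝒰.X i ⟶ Y)
    (h : ∀ (i j : 𝒰.I₀) (R : CommRingCat.{0}) (a : Spec R ⟶ 𝒰.X i) (b : Spec R ⟶ 𝒰.X j),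
      a ≫ 𝒰.f i = b ≫ 𝒰.f j → a ≫ g i = b ≫ g j) :
    ∃ f : X ⟶ Y, ∀ i, 𝒰.f i ≫ f = g i := by
  refine ⟨𝒰.glueMorphisms g fun i j => hom_ext_of_spec fun R a => ?_, fun i =>
    𝒰.ι_glueMorphisms g _ i⟩
  have := h i j R (a ≫ Limits.pullback.fst _ _) (a ≫ Limits.pullback.snd _ _) (by
    rw [Category.assoc, Category.assoc, Limits.pullback.condition])
  simpa using this

/-- The spectrum of an algebra as a scheme over `ℂ`. -/
abbrev specC (A : CommAlgCat.{0} ℂ) : SchemeC := (algSpec (CommRingCat.of ℂ)).obj (op A)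

/-- The algebra structure on a ring `R` given by a morphism `Spec R ⟶ Spec ℂ`. -/
def algOf (R : CommRingCat.{0}) (t : Spec R ⟶ Spec (CommRingCat.of ℂ)) : CommAlgCat.{0} ℂ :=
  letI : Algebra ℂ R := (Spec.preimage t).hom.toAlgebra
  CommAlgCat.of ℂ R

lemma specC_algOf_hom (R : CommRingCat.{0}) (t : Spec R ⟶ Spec (CommRingCat.of ℂ)) :
    (specC (algOf R t)).hom = t :=
  Spec.map_preimage t

/-- A morphism `Spec R ⟶ X` as a point of the scheme `X` over `ℂ`. -/
def mkPt {X : SchemeC} {R : CommRingCat.{0}} {t : Spec R ⟶ Spec (CommRingCat.of ℂ)}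
    (a : Spec R ⟶ X.left) (h : a ≫ X.hom = t) : specC (algOf R t) ⟶ X :=
  Over.homMk a (h.trans (specC_algOf_hom R t).symm)

lemma specC_map_preimage {A B : CommAlgCat.{0} ℂ} (a : specC A ⟶ specC B) :
    ∃ f : B ⟶ A, (algSpec (CommRingCat.of ℂ)).map f.op = a := by
  obtain ⟨f, hf⟩ := (algSpec.fullyFaithful (R := CommRingCat.of ℂ)).map_surjective a
  exact ⟨f.unop, hf⟩

lemma points_map {X : SchemeC} {A B : CommAlgCat.{0} ℂ} (f : A ⟶ B) (x : (points X).obj A) :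
    (points X).map f x = (algSpec (CommRingCat.of ℂ)).map f.op ≫ x := rfl

lemma pointsMap_app {X Y : SchemeC} (i : X ⟶ Y) {A : CommAlgCat.{0} ℂ} (x : (points X).obj A) :
    (pointsMap i).app A x = (show specC A ⟶ X from x) ≫ i := rfl

lemma pointsMap_comp {X Y Z : SchemeC} (i : X ⟶ Y) (j : Y ⟶ Z) :
    pointsMap (i ≫ j) = pointsMap i ≫ pointsMap j := by
  simp [pointsMap]
  rfl

lemma pointsMap_id (X : SchemeC) : pointsMap (𝟙 X) = 𝟙 (points X) := by
  simp [pointsMap]; rfl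

lemma schemeC_hom_ext {X Y : SchemeC} {f g : X ⟶ Y}
    (h : ∀ (A : CommAlgCat.{0} ℂ) (x : specC A ⟶ X), x ≫ f = x ≫ g) : f = g := by
  ext1
  refine hom_ext_of_spec fun R a => ?_
  exact congrArg (fun q => q.left) (h _ (mkPt (X := X) a rfl))

lemma pointsMap_injective {X Y : SchemeC} {f g : X ⟶ Y} (h : pointsMap f = pointsMap g) :
    f = g :=
  schemeC_hom_ext fun A x => congrArg (fun q : points X ⟶ points Y => q.app A x) h

lemma natTrans_specC {X Y : SchemeC} (θ : points X ⟶ points Y) {A B : CommAlgCat.{0} ℂ}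
    (a : specC A ⟶ specC B) (x : (points X).obj B) :
    θ.app A (a ≫ x : specC A ⟶ X) = (a ≫ (θ.app B x : specC B ⟶ Y) : specC A ⟶ Y) := by
  obtain ⟨f, rfl⟩ := specC_map_preimage a
  exact NatTrans.naturality_apply θ f x

/-- Every natural transformation of functors of points comes from a morphism. -/
lemma exists_pointsMap_eq {X Y : SchemeC} (θ : points X ⟶ points Y) :
    ∃ f : X ⟶ Y, pointsMap f = θ := by
  have 𝒰 : X.left.AffineOpenCover := X.left.affineOpenCover
  let p := fun i => mkPt (X := X) (𝒰.f i) rfl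
  -- On an affine point that factors through a member of the cover, `θ` is dictated by its value on
  -- that member.
  have key : ∀ (i : 𝒰.I₀) (R : CommRingCat.{0})
      (t : Spec R ⟶ Spec (CommRingCat.of ℂ)) (y : specC (algOf R t) ⟶ X)
      (a : Spec R ⟶ Spec (𝒰.X i)), a ≫ 𝒰.f i = y.left →
      a ≫ (θ.app _ (p i) : specC _ ⟶ Y).left = (θ.app _ y : specC _ ⟶ Y).left := by
    intro i R t y a ha
    have ht : y.left ≫ X.hom = t := (Over.w y).trans (specC_algOf_hom R t)
    let a' : specC (algOf R t) ⟶ specC (algOf _ (𝒰.f i ≫ X.hom)) := mkPt a (by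
      rw [← ht, ← ha]
      exact (congrArg (fun q => a ≫ q) (specC_algOf_hom _ _)).trans (Category.assoc _ _ _).symm)
    have h1 : a' ≫ p i = y := Over.OverMorphism.ext ha
    have h2 := natTrans_specC θ a' (p i)
    rw [h1] at h2
    exact congrArg (fun q => q.left) h2.symm
  obtain ⟨f, hf⟩ := exists_glue_hom 𝒰.openCover
    (fun i => (θ.app _ (p i) : specC _ ⟶ Y).left)
    (fun i j R a b hab => by
      let y := mkPt (X := X) (a ≫ 𝒰.f i) rfl
      exact (key i R _ y a rfl).trans (key j R _ y b hab.symm).symm)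
  have hleft : ∀ (A : CommAlgCat.{0} ℂ) (x : specC A ⟶ X), x.left ≫ f =
      (θ.app A x : specC A ⟶ Y).left := by
    intro A x
    -- A general affine point does not factor through a single member, so the cover is pulled back
    -- to it first.
    let 𝒱 : (specC A).left.OpenCover := 𝒰.openCover.pullback₁ x.left
    refine Scheme.Cover.hom_ext 𝒱 _ _ fun i => hom_ext_of_spec fun R c => ?_
    let c' := mkPt (X := specC A) (c ≫ 𝒱.f i) rfl
    let d := c ≫ Limits.pullback.snd x.left (𝒰.f i)
    have hd : d ≫ 𝒰.f i = (c' ≫ x).left := by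
      have h := congrArg (fun q => c ≫ q)
        (Limits.pullback.condition (f := x.left) (g := 𝒰.f i))
      exact (Category.assoc _ _ _).trans (h.symm.trans (Category.assoc _ _ _).symm)
    have h1 := key i R _ (c' ≫ x) d hd
    have h2 := congrArg (fun q : specC _ ⟶ Y => q.left) (natTrans_specC θ c' x)
    have h3 := congrArg (fun q => d ≫ q) (hf i)
    refine (Category.assoc _ _ _).symm.trans ?_
    refine (congrArg (fun q => q ≫ f) hd.symm).trans ?_
    exact (Category.assoc _ _ _).trans (h3.trans (h1.trans h2))
  refine ⟨Over.homMk f ?_, ?_⟩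
  · refine hom_ext_of_spec fun R a => ?_
    have h1 := hleft _ (mkPt (X := X) a rfl)
    have h2 := Over.w (θ.app _ (mkPt (X := X) a rfl) : specC _ ⟶ Y)
    rw [← h1] at h2
    exact (Category.assoc _ _ _).symm.trans (h2.trans (specC_algOf_hom _ _))
  · refine NatTrans.ext (funext fun A => ConcreteCategory.hom_ext _ _ fun x => ?_)
    exact Over.OverMorphism.ext (hleft A x)

/-- Full faithfulness of the functor of points on algebras, applied to both directions. The
isomorphisms of the theorem are produced through it. -/
lemma exists_iso_of_points_iso {X Y : SchemeC} (e : points X ≅ points Y) :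
    ∃ f : X ≅ Y, pointsMap f.hom = e.hom := by
  obtain ⟨f, hf⟩ := exists_pointsMap_eq e.hom
  obtain ⟨g, hg⟩ := exists_pointsMap_eq e.inv
  refine ⟨⟨f, g, pointsMap_injective ?_, pointsMap_injective ?_⟩, hf⟩
  · rw [pointsMap_comp, hf, hg, e.hom_inv_id, pointsMap_id]
  · rw [pointsMap_comp, hf, hg, e.inv_hom_id, pointsMap_id]

/-- Functors of points are Zariski sheaves. -/
lemma isZariskiSheaf_points (X : SchemeC) : IsZariskiSheaf (points X) := by
  have hS' : ∀ (A : CommAlgCat.{0} ℂ) (S : Set A), Ideal.span S = ⊤ →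
      Ideal.span (Set.range (Subtype.val : S → A)) = ⊤ := fun A S hS => by simpa using hS
  refine ⟨fun A S hS x y h => ?_, fun A S hS x h => ?_⟩
  · refine Over.OverMorphism.ext ((Scheme.affineOpenCoverOfSpanRangeEqTop (R := CommRingCat.of A)
      _ (hS' A S hS)).openCover.hom_ext _ _ fun i => ?_)
    exact congrArg (fun q : specC _ ⟶ X => q.left) (h i.1 i.2)
  · let 𝒰 := (Scheme.affineOpenCoverOfSpanRangeEqTop (R := CommRingCat.of A)
      _ (hS' A S hS)).openCover
    have hstr : ∀ i : S, 𝒰.f i ≫ (specC A).hom = (specC (away A i.1)).hom := fun i =>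
      Over.w ((algSpec (CommRingCat.of ℂ)).map (loc A i.1).op)
    obtain ⟨f, hf⟩ := exists_glue_hom 𝒰 (fun i => (show specC (away A i.1) ⟶ X from x i).left)
      (fun i j R a b hab => by
        have ha : a ≫ (specC (away A i.1)).hom = (a ≫ 𝒰.f i) ≫ (specC A).hom := by
          rw [← hstr i]
          exact (Category.assoc _ _ _).symm
        have hb : b ≫ (specC (away A j.1)).hom = (a ≫ 𝒰.f i) ≫ (specC A).hom := by
          rw [hab, ← hstr j]
          exact (Category.assoc _ _ _).symm
        obtain ⟨a', ha'⟩ := specC_map_preimage (mkPt (X := specC (away A i.1)) a ha)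
        obtain ⟨b', hb'⟩ := specC_map_preimage (mkPt (X := specC (away A j.1)) b hb)
        have := h i j _ a' b' (by
          apply Quiver.Hom.op_inj
          apply (algSpec.fullyFaithful (R := CommRingCat.of ℂ)).map_injective
          rw [op_comp, op_comp, Functor.map_comp, Functor.map_comp, ha', hb']
          exact Over.OverMorphism.ext hab)
        rw [points_map, points_map, ha', hb'] at this
        exact congrArg (fun q : specC _ ⟶ X => q.left) this)
    have hw : f ≫ X.hom = (specC A).hom := by
      refine 𝒰.hom_ext _ _ fun i => ?_
      rw [← Category.assoc, hf i]
      exact (Over.w (show specC (away A i.1) ⟶ X from x i)).trans (hstr i).symm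
    exact ⟨Over.homMk f hw, fun i => Over.OverMorphism.ext (hf i)⟩

end Points

/-! ### Closed subfunctors and zero loci -/

section IdealSheaf

/-- The preimage of `U` is all of `Spec B`, so the map on sections over `U` is `q` up to the
identification of `B` with its global sections. -/
lemma ideal_le_ker_of_le_ker {X : Scheme.{0}} (K : X.IdealSheafData) {U : X.Opens} (hU : IsAffineOpen U)
    {B : CommRingCat.{0}} (q : Γ(X, U) ⟶ B) (h : K ≤ (Spec.map q ≫ hU.fromSpec).ker) :
    K.ideal ⟨U, hU⟩ ≤ RingHom.ker q.hom := by
  have hle : (⊤ : (Spec B).Opens) ≤ (Spec.map q ≫ hU.fromSpec) ⁻¹ᵁ U := by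
    rw [Scheme.Hom.comp_preimage, hU.fromSpec_preimage_self]
    exact le_rfl
  have h1 := hU.SpecMap_appLE_fromSpec (Spec.map q ≫ hU.fromSpec) (isAffineOpen_top _) hle
  rw [← Category.assoc, cancel_mono, IsAffineOpen.fromSpec_top,
    ← Spec.map_preimage (Spec B).isoSpec.inv, ← Spec.map_comp] at h1
  have h2 := Spec.map_injective h1
  have h3 : Function.Injective (Spec.preimage (Spec B).isoSpec.inv).hom := by
    have : IsIso (Spec.map (Spec.preimage (Spec B).isoSpec.inv)) := by
      rw [Spec.map_preimage]; infer_instance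
    exact (isIso_SpecMap_iff.1 this).1
  intro x hx
  have h4 : (Spec.map q ≫ hU.fromSpec).app U x = 0 :=
    Scheme.Hom.ideal_ker_le _ ⟨U, hU⟩ (h ⟨U, hU⟩ hx)
  have h5 : (Spec.map q ≫ hU.fromSpec).appLE U ⊤ hle x = 0 := by
    rw [Scheme.Hom.appLE, CommRingCat.comp_apply, h4, map_zero]
  rw [h2] at h5
  exact h3 (h5.trans (map_zero _).symm)

/-- A homomorphism that kills the ideal factors through the quotient, so the morphism factors
through the closed subscheme of `K`. -/
lemma le_ker_of_ideal_le_ker {X : Scheme.{0}} (K : X.IdealSheafData) {U : X.Opens} (hU : IsAffineOpen U)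
    {B : CommRingCat.{0}} (q : Γ(X, U) ⟶ B) (h : K.ideal ⟨U, hU⟩ ≤ RingHom.ker q.hom) :
    K ≤ (Spec.map q ≫ hU.fromSpec).ker := by
  let q' : CommRingCat.of (Γ(X, U) ⧸ K.ideal ⟨U, hU⟩) ⟶ B :=
    CommRingCat.ofHom (Ideal.Quotient.lift _ q.hom h)
  have h1 : (Spec.map q' ≫ K.subschemeCover.f (⟨U, hU⟩ : X.affineOpens)) ≫ K.subschemeι =
      Spec.map q ≫ hU.fromSpec := by
    have h2 := (K.subschemeCover_map_subschemeι ⟨U, hU⟩).trans (K.glueDataObjι_ι ⟨U, hU⟩)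
    refine (Category.assoc _ _ _).trans ((congrArg (fun z => Spec.map q' ≫ z) h2).trans ?_)
    refine (Category.assoc _ _ _).symm.trans ?_
    refine congrArg (fun z => z ≫ hU.fromSpec) ?_
    exact (Spec.map_comp _ _).symm.trans (congrArg Spec.map (CommRingCat.hom_ext (by
      ext x; rfl)))
  rw [← h1]
  exact K.ker_subschemeι.ge.trans (Scheme.Hom.le_ker_comp _ _)

lemma le_ker_iff {X : Scheme.{0}} (K : X.IdealSheafData) {U : X.Opens} (hU : IsAffineOpen U)
    {B : CommRingCat.{0}} (q : Γ(X, U) ⟶ B) :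
    K ≤ (Spec.map q ≫ hU.fromSpec).ker ↔ K.ideal ⟨U, hU⟩ ≤ RingHom.ker q.hom :=
  ⟨ideal_le_ker_of_le_ker K hU q, le_ker_of_ideal_le_ker K hU q⟩

/-- Every morphism from a spectrum factors locally through a given basis of affine opens. -/
lemma exists_away_factor {X : Scheme.{0}} {A : CommAlgCat.{0} ℂ}
    (p : Spec (CommRingCat.of A) ⟶ X) (𝔭 : Ideal A) (h𝔭 : 𝔭.IsPrime) (W : X.Opens)
    (hW : p ⟨𝔭, h𝔭⟩ ∈ W) :
    ∃ (h : A), h ∉ 𝔭 ∧ ∃ (U : X.Opens) (hU : IsAffineOpen U), U ≤ W ∧ p ⟨𝔭, h𝔭⟩ ∈ U ∧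
      ∃ (q : Γ(X, U) ⟶ CommRingCat.of (away A h)),
      Spec.map (CommRingCat.ofHom (loc A h).hom.toRingHom) ≫ p =
        Spec.map q ≫ hU.fromSpec := by
  obtain ⟨_, ⟨U, hU', rfl⟩, hxU, hUW⟩ :=
      X.isBasis_affineOpens.exists_subset_of_mem_open hW W.isOpen
  have hU : IsAffineOpen U := hU'
  obtain ⟨_, ⟨_, ⟨h, rfl⟩, rfl⟩, hp, hle⟩ :=
    PrimeSpectrum.isBasis_basic_opens.exists_subset_of_mem_open (a := (⟨𝔭, h𝔭⟩ : PrimeSpectrum A))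
      (u := ((p ⁻¹ᵁ U : (Spec (CommRingCat.of A)).Opens) : Set (Spec (CommRingCat.of A)))) hxU (p ⁻¹ᵁ U).isOpen
  refine ⟨h, hp, U, hU, hUW, hxU, ?_⟩
  let j : Spec (CommRingCat.of (away A h)) ⟶ Spec (CommRingCat.of A) :=
    Spec.map (CommRingCat.ofHom (loc A h).hom.toRingHom)
  have hr : Set.range (j ≫ p) ⊆ Set.range hU.fromSpec := by
    rintro _ ⟨y, rfl⟩
    rw [hU.range_fromSpec, Scheme.Hom.comp_apply]
    apply hle
    have : j y ∈ Set.range (PrimeSpectrum.comap (algebraMap A (Localization.Away h))) := ⟨y, rfl⟩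
    rw [PrimeSpectrum.localization_away_comap_range (Localization.Away h) h] at this
    exact this
  refine ⟨Spec.preimage (IsOpenImmersion.lift hU.fromSpec (j ≫ p) hr), ?_⟩
  rw [Spec.map_preimage, IsOpenImmersion.lift_fac]

end IdealSheaf

/-! ### Conditions on points that are cut out by ideals. -/

section ClosedConditions

variable {G : CommAlgCat.{0} ℂ ⥤ Type}

/-- The condition `V` on the elements of `G` is closed: the locus where it holds is cut out by an
ideal. -/
def IsClosedCondition (V : ∀ A : CommAlgCat.{0} ℂ, G.obj A → Prop) : Prop :=
  ∀ (A : CommAlgCat.{0} ℂ) (x : G.obj A), ∃ I : Ideal A,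
    ∀ (B : CommAlgCat.{0} ℂ) (f : A ⟶ B), V B (G.map f x) ↔ I ≤ RingHom.ker f.hom

/-- The ideal cutting out the locus of a closed condition. -/
def closedIdeal {V : ∀ A : CommAlgCat.{0} ℂ, G.obj A → Prop} (hV : IsClosedCondition V)
    {A : CommAlgCat.{0} ℂ} (x : G.obj A) : Ideal A := (hV A x).choose

lemma map_iff_closedIdeal_le {V : ∀ A : CommAlgCat.{0} ℂ, G.obj A → Prop}
    (hV : IsClosedCondition V) {A B : CommAlgCat.{0} ℂ} (x : G.obj A) (f : A ⟶ B) :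
    V B (G.map f x) ↔ closedIdeal hV x ≤ RingHom.ker f.hom :=
  (hV A x).choose_spec B f

lemma iff_closedIdeal_eq_bot {V : ∀ A : CommAlgCat.{0} ℂ, G.obj A → Prop}
    (hV : IsClosedCondition V) {A : CommAlgCat.{0} ℂ} (x : G.obj A) :
    V A x ↔ closedIdeal hV x = ⊥ := by
  have := map_iff_closedIdeal_le hV x (𝟙 A)
  rw [Functor.map_id_apply] at this
  rw [this, ← le_bot_iff]
  refine forall₂_congr fun a _ => ?_
  simp [RingHom.mem_ker]

lemma map_of_closedCondition {V : ∀ A : CommAlgCat.{0} ℂ, G.obj A → Prop}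
    (hV : IsClosedCondition V) {A B : CommAlgCat.{0} ℂ} (f : A ⟶ B) {x : G.obj A} (hx : V A x) :
    V B (G.map f x) := by
  rw [map_iff_closedIdeal_le hV, (iff_closedIdeal_eq_bot hV x).1 hx]
  exact bot_le

/-- The test homomorphisms are the projections to `A ⧸ I` and `A ⧸ J`. This is the standard way
below to identify two ideals by their meaning. -/
lemma eq_of_forall_le_ker_iff {A : CommAlgCat.{0} ℂ} {I J : Ideal A}
    (h : ∀ (B : CommAlgCat.{0} ℂ) (f : A ⟶ B), I ≤ RingHom.ker f.hom ↔ J ≤ RingHom.ker f.hom) :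
    I = J := by
  have key : ∀ K : Ideal A, RingHom.ker (CommAlgCat.ofHom (Ideal.Quotient.mkₐ ℂ K)).hom = K :=
    fun K => Ideal.Quotient.mkₐ_ker ℂ K
  apply le_antisymm
  · have := (h _ (CommAlgCat.ofHom (Ideal.Quotient.mkₐ ℂ J))).2
    rw [key] at this
    exact this le_rfl
  · have := (h _ (CommAlgCat.ofHom (Ideal.Quotient.mkₐ ℂ I))).1
    rw [key] at this
    exact this le_rfl

/-- The same homomorphisms out of `B` kill both ideals. Applied to restrictions to basic opens, this
makes the ideals of a closed condition an ideal sheaf. -/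
lemma closedIdeal_map {V : ∀ A : CommAlgCat.{0} ℂ, G.obj A → Prop}
    (hV : IsClosedCondition V) {A B : CommAlgCat.{0} ℂ} (t : A ⟶ B) (x : G.obj A) :
    closedIdeal hV (G.map t x) = (closedIdeal hV x).map t.hom.toRingHom := by
  refine eq_of_forall_le_ker_iff fun C f => ?_
  rw [← map_iff_closedIdeal_le hV, ← Functor.map_comp_apply, map_iff_closedIdeal_le hV,
    Ideal.map_le_iff_le_comap]
  rfl

/-- The obstruction is an ideal that dies in every localization of a cover, hence is zero. -/
lemma of_locally {V : ∀ A : CommAlgCat.{0} ℂ, G.obj A → Prop}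
    (hV : IsClosedCondition V) {A : CommAlgCat.{0} ℂ} (x : G.obj A)
    (h : ∀ 𝔭 : Ideal A, 𝔭.IsPrime → ∃ s ∉ 𝔭, V (away A s) (G.map (loc A s) x)) : V A x := by
  have hS := span_eq_top_of_forall_prime (S := {s | V (away A s) (G.map (loc A s) x)}) h
  rw [iff_closedIdeal_eq_bot hV, eq_bot_iff]
  intro a ha
  rw [Ideal.mem_bot]
  refine Submodule.mem_of_span_eq_top_of_smul_pow_mem ⊥ _ hS a fun s => ?_
  exact exists_pow_mul_eq_zero s.1 a ((map_iff_closedIdeal_le hV x _).1 s.2 ha)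

end ClosedConditions

/-! ### Zero loci of closed conditions on schemes. -/

section ZeroLocus

variable {X : SchemeC} {V : ∀ A : CommAlgCat.{0} ℂ, (points X).obj A → Prop}

lemma points_map_left {A B : CommAlgCat.{0} ℂ} (f : A ⟶ B) (x : (points X).obj A) :
    ((points X).map f x : specC B ⟶ X).left =
      Spec.map (CommRingCat.ofHom f.hom.toRingHom) ≫ (show specC A ⟶ X from x).left := rfl

/-- The tautological point of an affine open subscheme. -/
def affinePt (X : SchemeC) {U : X.left.Opens} (hU : IsAffineOpen U) :
    specC (algOf Γ(X.left, U) (hU.fromSpec ≫ X.hom)) ⟶ X :=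
  mkPt hU.fromSpec rfl

/-- A ring homomorphism from the sections over an affine open as a homomorphism of algebras. -/
lemma exists_algHom_of_factor {U : X.left.Opens} (hU : IsAffineOpen U) {B : CommAlgCat.{0} ℂ}
    (q : Γ(X.left, U) ⟶ CommRingCat.of B) (p : specC B ⟶ X)
    (hp : p.left = Spec.map q ≫ hU.fromSpec) :
    ∃ f : algOf Γ(X.left, U) (hU.fromSpec ≫ X.hom) ⟶ B, f.hom.toRingHom = q.hom ∧
      (points X).map f (affinePt X hU) = p := by
  let a : specC B ⟶ specC (algOf Γ(X.left, U) (hU.fromSpec ≫ X.hom)) :=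
    Over.homMk (Spec.map q) (by
      refine (congrArg (fun z => Spec.map q ≫ z) (specC_algOf_hom _ _)).trans ?_
      rw [← Category.assoc]
      refine (congrArg (fun z => z ≫ X.hom) hp.symm).trans (Over.w p))
  obtain ⟨f, hf⟩ := specC_map_preimage a
  refine ⟨f, ?_, ?_⟩
  · have := congrArg (fun z => z.left) hf
    exact congrArg (fun z => z.hom) (Spec.map_injective this)
  · refine Eq.trans (congrArg (fun z => z ≫ affinePt X hU) hf) ?_
    exact Over.OverMorphism.ext hp.symm

/-- The ideal sheaf of a closed condition. -/
def closedIdealSheaf (hV : IsClosedCondition V) : X.left.IdealSheafData where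
  ideal U := closedIdeal hV (affinePt X U.2)
  map_ideal_basicOpen U f := by
    obtain ⟨t, ht, ht'⟩ := exists_algHom_of_factor (X := X) U.2
      (B := algOf Γ(X.left, (X.left.affineBasicOpen f).1)
        ((X.left.affineBasicOpen f).2.fromSpec ≫ X.hom))
      (X.left.presheaf.map (homOfLE <| X.left.basicOpen_le f).op)
      (affinePt X (X.left.affineBasicOpen f).2) (U.2.map_fromSpec _ _).symm
    have := closedIdeal_map hV t (affinePt X U.2)
    rw [ht', ht] at this
    exact this.symm

/-- Both sides say that `q` kills the ideal attached to the tautological point of `U`. -/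
lemma closedIdealSheaf_le_ker_iff (hV : IsClosedCondition V) {U : X.left.Opens} (hU : IsAffineOpen U)
    {B : CommAlgCat.{0} ℂ} (q : Γ(X.left, U) ⟶ CommRingCat.of B) (p : specC B ⟶ X)
    (hp : p.left = Spec.map q ≫ hU.fromSpec) :
    closedIdealSheaf hV ≤ p.left.ker ↔ V B p := by
  obtain ⟨f, hf, hf'⟩ := exists_algHom_of_factor hU q p hp
  have h1 := map_iff_closedIdeal_le hV (affinePt X hU) f
  rw [hf'] at h1
  rw [h1, hp]
  refine (le_ker_iff _ hU q).trans ?_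
  rw [← hf]
  rfl

lemma exists_lift_iff {Z Y X : SchemeC} (i : Z ⟶ X) [IsClosedImmersion i.left] (p : Y ⟶ X) :
    (∃ z : Y ⟶ Z, z ≫ i = p) ↔ i.left.ker ≤ p.left.ker := by
  constructor
  · rintro ⟨z, rfl⟩
    exact Scheme.Hom.le_ker_comp z.left i.left
  · intro hp
    refine ⟨Over.homMk (IsClosedImmersion.lift i.left p.left hp) ?_, ?_⟩
    · refine Eq.trans ?_ (Over.w p)
      refine Eq.trans ?_ (congrArg (fun w => w ≫ X.hom) (IsClosedImmersion.lift_fac i.left p.left hp))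
      refine Eq.trans ?_ (Category.assoc _ _ _).symm
      exact congrArg (fun w => IsClosedImmersion.lift i.left p.left hp ≫ w) (Over.w i).symm
    · exact Over.OverMorphism.ext (IsClosedImmersion.lift_fac i.left p.left hp)

/-- Closed conditions have zero loci. -/
lemma exists_isZeroLocus (hV : IsClosedCondition V) :
    ∃ (Z : SchemeC) (i : Z ⟶ X), IsZeroLocus i V := by
  obtain ⟨J, hJ⟩ : ∃ J, J = closedIdealSheaf hV := ⟨_, rfl⟩
  obtain ⟨Z, i, hi, hlift⟩ : ∃ (Z : SchemeC) (i : Z ⟶ X), IsClosedImmersion i.left ∧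
      ∀ (A : CommAlgCat.{0} ℂ) (p : specC A ⟶ X), (∃ z, z ≫ i = p) ↔ J ≤ p.left.ker := by
    let Z : SchemeC := Over.mk (J.subschemeι ≫ X.hom)
    let i : Z ⟶ X := Over.homMk J.subschemeι rfl
    have hi : IsClosedImmersion i.left := inferInstanceAs (IsClosedImmersion J.subschemeι)
    refine ⟨Z, i, hi, fun A p => (exists_lift_iff i p).trans ?_⟩
    exact iff_of_eq (congrArg (fun K => K ≤ p.left.ker) J.ker_subschemeι)
  have hmono : Mono i := by
    have : Mono i.left := inferInstance
    exact Over.mono_of_mono_left i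
  -- Locally on the source every point lands in an affine open, where the ideal sheaf detects the
  -- condition.
  have hloc : ∀ (A : CommAlgCat.{0} ℂ) (p : specC A ⟶ X) (𝔭 : Ideal A), 𝔭.IsPrime →
      ∃ h ∉ 𝔭, (J ≤ ((points X).map (loc A h) p : specC _ ⟶ X).left.ker ↔
        V (away A h) ((points X).map (loc A h) p)) := by
    intro A p 𝔭 h𝔭
    obtain ⟨h, hh, U, hU, -, -, q, hq⟩ := exists_away_factor p.left 𝔭 h𝔭 ⊤ trivial
    rw [hJ]
    exact ⟨h, hh, closedIdealSheaf_le_ker_iff hV hU q _ ((points_map_left (loc A h) p).trans hq)⟩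
  refine ⟨Z, i, hi, fun A p => ⟨?_, fun hp => ?_⟩⟩
  · rintro ⟨z, rfl⟩
    refine of_locally hV _ fun 𝔭 h𝔭 => ?_
    obtain ⟨h, hh, hiff⟩ := hloc A _ 𝔭 h𝔭
    refine ⟨h, hh, hiff.1 ?_⟩
    rw [← NatTrans.naturality_apply]
    exact (hlift _ _).1 ⟨_, rfl⟩
  · let S : Set A := {s | ∃ z, (pointsMap i).app (away A s) z = (points X).map (loc A s) p}
    have hS : Ideal.span S = ⊤ := by
      refine span_eq_top_of_forall_prime fun 𝔭 h𝔭 => ?_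
      obtain ⟨h, hh, hiff⟩ := hloc A p 𝔭 h𝔭
      refine ⟨h, hh, ?_⟩
      have hle := hiff.2 (map_of_closedCondition hV _ hp)
      exact (hlift _ _).2 hle
    choose z hz using fun s : S => s.2
    -- Local factorizations through `Z` are unique, `i` being a monomorphism, so they agree on
    -- overlaps and glue.
    obtain ⟨y, hy⟩ := (isZariskiSheaf_points Z).glue A S hS z (by
      intro s s' B a b hab
      have : (pointsMap i).app B ((points Z).map a (z s)) =
          (pointsMap i).app B ((points Z).map b (z s')) := by
        rw [NatTrans.naturality_apply, NatTrans.naturality_apply, hz, hz,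
          ← Functor.map_comp_apply, ← Functor.map_comp_apply, hab]
      exact (cancel_mono i).1 this)
    refine ⟨y, (isZariskiSheaf_points X).sep A S hS _ _ fun s hs => ?_⟩
    rw [← NatTrans.naturality_apply, hy ⟨s, hs⟩]
    exact hz ⟨s, hs⟩

/-- Pullbacks of the ideal sheaf of a zero locus are given by the ideals of the closed condition. -/
lemma comap_ker_ideal_eq {Z : SchemeC} {i : Z ⟶ X} (hi : IsZeroLocus i V)
    (hV : IsClosedCondition V) {T : SchemeC} (f : T ⟶ X) {U : T.left.Opens} (hU : IsAffineOpen U) :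
    (i.left.ker.comap f.left).ideal ⟨U, hU⟩ = closedIdeal hV (affinePt T hU ≫ f) := by
  have := hi.isClosedImmersion
  -- A homomorphism kills either ideal exactly when the corresponding point of `X` factors through
  -- `Z`.
  refine eq_of_forall_le_ker_iff (A := algOf Γ(T.left, U) (hU.fromSpec ≫ T.hom)) fun B q => ?_
  have h1 := map_iff_closedIdeal_le hV (affinePt T hU ≫ f) q
  refine Iff.trans ?_ h1
  rw [← hi.exists_iff]
  let p : specC B ⟶ X := (points X).map q (affinePt T hU ≫ f)
  have hp : p.left = (Spec.map (CommRingCat.ofHom q.hom.toRingHom) ≫ hU.fromSpec) ≫ f.left :=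
    (Category.assoc _ _ _).symm
  have h2 := le_ker_iff (i.left.ker.comap f.left) hU (B := CommRingCat.of B)
    (CommRingCat.ofHom q.hom.toRingHom)
  refine h2.symm.trans ?_
  rw [← Scheme.IdealSheafData.le_map_iff_comap_le, Scheme.IdealSheafData.map_ker]
  refine Iff.trans ?_ (exists_lift_iff i p).symm
  rw [hp]
  rfl

end ZeroLocus

/-! ### Points of projective space -/

section AwayEval

open HomogeneousLocalization

variable {m : ℕ} {A : Type} [CommRing A] [Algebra ℂ A]

/-- Evaluation of homogeneous fractions with denominator a power of `s` at a vector `w` such that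
`s(w)` is a unit. -/
def awayEval (w : Fin m → A) (s : MvPolynomial (Fin m) ℂ) (hu : IsUnit (MvPolynomial.aeval w s)) :
    Away (grading m) s →+* A :=
  (IsLocalization.Away.lift (S := Localization.Away s) s (g := (MvPolynomial.aeval w).toRingHom)
    hu).comp (algebraMap (Away (grading m) s) (Localization.Away s))

lemma awayEval_mk (w : Fin m → A) {s : MvPolynomial (Fin m) ℂ} (hu : IsUnit (MvPolynomial.aeval w s))
    {d : ℕ} (hs : s ∈ grading m d) (n : ℕ) (a : MvPolynomial (Fin m) ℂ)
    (ha : a ∈ grading m (n • d)) :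
    awayEval w s hu (Away.mk (grading m) hs n a ha) * MvPolynomial.aeval w s ^ n =
      MvPolynomial.aeval w a := by
  have h1 : MvPolynomial.aeval w s = IsLocalization.Away.lift (S := Localization.Away s) s
      (g := (MvPolynomial.aeval w).toRingHom) hu (algebraMap _ _ s) :=
    (IsLocalization.Away.lift_eq s hu s).symm
  have h2 : MvPolynomial.aeval w a = IsLocalization.Away.lift (S := Localization.Away s) s
      (g := (MvPolynomial.aeval w).toRingHom) hu (algebraMap _ _ a) :=
    (IsLocalization.Away.lift_eq s hu a).symm
  rw [h2, awayEval, RingHom.comp_apply, HomogeneousLocalization.algebraMap_apply,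
    Away.val_mk]
  conv_lhs => rw [h1]
  rw [← map_pow, ← map_mul]
  congr 1
  rw [Localization.mk_eq_mk', ← map_pow]
  exact IsLocalization.mk'_spec (Localization.Away s) a
    (⟨s ^ n, n, rfl⟩ : Submonoid.powers s)

/-- Elements of the degree-zero localization are fractions `a / s^n`, and the equation determines
their values because `s(w)` is a unit. Identities between evaluations are checked through this
criterion. -/
lemma eq_awayEval_of_forall {w : Fin m → A} {s : MvPolynomial (Fin m) ℂ}
    {hu : IsUnit (MvPolynomial.aeval w s)} {d : ℕ} (hs : s ∈ grading m d)
    {φ : Away (grading m) s →+* A} (h : ∀ (n : ℕ) (a : MvPolynomial (Fin m) ℂ)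
      (ha : a ∈ grading m (n • d)), φ (Away.mk (grading m) hs n a ha) *
        MvPolynomial.aeval w s ^ n = MvPolynomial.aeval w a) : φ = awayEval w s hu := by
  ext x
  obtain ⟨n, a, ha, rfl⟩ := Away.mk_surjective (grading m) hs x
  exact (hu.pow n).mul_right_cancel ((h n a ha).trans (awayEval_mk w hu hs n a ha).symm)

lemma awayEval_comp_awayMap (w : Fin m → A) {s t : MvPolynomial (Fin m) ℂ} {d e : ℕ}
    (hs : s ∈ grading m d) (ht : t ∈ grading m e) (hu : IsUnit (MvPolynomial.aeval w s))
    (hu' : IsUnit (MvPolynomial.aeval w (s * t))) :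
    (awayEval w (s * t) hu').comp (awayMap (grading m) ht rfl) = awayEval w s hu := by
  refine eq_awayEval_of_forall hs fun n a ha => ?_
  have h1 := awayEval_mk w hu' (SetLike.mul_mem_graded hs ht) n (a * t ^ n)
    (by
      rw [smul_add]
      exact SetLike.mul_mem_graded ha (SetLike.pow_mem_graded n ht))
  rw [RingHom.comp_apply, awayMap_mk]
  rw [map_mul, map_mul, map_pow, mul_pow, ← mul_assoc] at h1
  rw [map_mul] at hu'
  exact ((isUnit_of_mul_isUnit_right hu').pow n).mul_right_cancel h1

lemma aeval_smul_of_mem (c : A) (w : Fin m → A) {a : MvPolynomial (Fin m) ℂ} {d : ℕ}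
    (ha : a ∈ grading m d) :
    MvPolynomial.aeval (c • w) a = c ^ d * MvPolynomial.aeval w a := by
  rw [MvPolynomial.aeval_def, MvPolynomial.aeval_def, MvPolynomial.eval₂_eq',
    MvPolynomial.eval₂_eq', Finset.mul_sum]
  refine Finset.sum_congr rfl fun e he => ?_
  have h1 : ∑ i, e i = d := by
    have := ha (MvPolynomial.mem_support_iff.1 he)
    rw [Finsupp.weight_apply, Finsupp.sum_fintype _ _ (by simp)] at this
    simpa using this
  simp only [Pi.smul_apply, smul_eq_mul, mul_pow]
  rw [Finset.prod_mul_distrib, Finset.prod_pow_eq_pow_sum, h1]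
  ring

lemma awayEval_smul {c : A} (w : Fin m → A) {s : MvPolynomial (Fin m) ℂ} {d : ℕ}
    (hs : s ∈ grading m d) (hu : IsUnit (MvPolynomial.aeval w s))
    (hu' : IsUnit (MvPolynomial.aeval (c • w) s)) :
    awayEval (c • w) s hu' = awayEval w s hu := by
  symm
  refine eq_awayEval_of_forall hs fun n a ha => ?_
  rw [aeval_smul_of_mem c w hs, aeval_smul_of_mem c w ha, mul_pow, ← awayEval_mk w hu hs n a ha]
  rw [← pow_mul, smul_eq_mul, mul_comm d n]
  ring

lemma comp_awayEval {B : Type} [CommRing B] [Algebra ℂ B] (f : A →ₐ[ℂ] B) (w : Fin m → A)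
    {s : MvPolynomial (Fin m) ℂ} {d : ℕ}
    (hs : s ∈ grading m d) (hu : IsUnit (MvPolynomial.aeval w s))
    (hu' : IsUnit (MvPolynomial.aeval (fun i => f (w i)) s)) :
    f.toRingHom.comp (awayEval w s hu) = awayEval (fun i => f (w i)) s hu' := by
  refine eq_awayEval_of_forall hs fun n a ha => ?_
  have h1 : ∀ p : MvPolynomial (Fin m) ℂ, MvPolynomial.aeval (fun i => f (w i)) p =
      f (MvPolynomial.aeval w p) := fun p => (MvPolynomial.comp_aeval_apply w f p).symm
  rw [h1, h1, ← map_pow, ← awayEval_mk w hu hs n a ha, map_mul]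
  rfl

end AwayEval

/-! ### Points of projective space given by homogeneous coordinates. -/

section ProjPoint

open HomogeneousLocalization

variable {m : ℕ} {A : CommAlgCat.{0} ℂ}

lemma spec_awayEval_awayι_hom (w : Fin m → A) {s : MvPolynomial (Fin m) ℂ} {d : ℕ}
    (hs : s ∈ grading m d) (hd : 0 < d) (hu : IsUnit (MvPolynomial.aeval w s)) :
    (Spec.map (CommRingCat.ofHom (awayEval w s hu)) ≫ Proj.awayι (grading m) s hs hd) ≫
      (projOf m).hom = (specC A).hom := by
  have h : (awayEval w s hu).comp ((fromZeroRingHom (grading m) _).comp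
      (algebraMap ℂ (grading m 0))) = algebraMap ℂ A := by
    ext c
    have : (fromZeroRingHom (grading m) (Submonoid.powers s) (algebraMap ℂ (grading m 0) c)).val =
        algebraMap (MvPolynomial (Fin m) ℂ) (Localization.Away s) (MvPolynomial.C c) := by
      rw [fromZeroRingHom]
      exact Localization.mk_one_eq_algebraMap _
    rw [RingHom.comp_apply, RingHom.comp_apply, awayEval, RingHom.comp_apply,
      HomogeneousLocalization.algebraMap_apply, this, IsLocalization.Away.lift_eq]
    exact MvPolynomial.aeval_C w c
  have h1 := Proj.awayι_toSpecZero (grading m) s hs hd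
  change (Spec.map (CommRingCat.ofHom (awayEval w s hu)) ≫ Proj.awayι (grading m) s hs hd) ≫
    Proj.toSpecZero (grading m) ≫
    Spec.map (CommRingCat.ofHom (algebraMap ℂ (grading m 0))) = _
  rw [Category.assoc, reassoc_of% h1, ← Spec.map_comp, ← Spec.map_comp]
  exact congrArg (fun z => Spec.map (CommRingCat.ofHom z)) h

/-- The point of projective space with homogeneous coordinates `w` such that `s(w)` is a unit. -/
def projPt (w : Fin m → A) {s : MvPolynomial (Fin m) ℂ} {d : ℕ}
    (hs : s ∈ grading m d) (hd : 0 < d) (hu : IsUnit (MvPolynomial.aeval w s)) :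
    (points (projOf m)).obj A :=
  Over.homMk (U := specC A)
    (Spec.map (CommRingCat.ofHom (awayEval w s hu)) ≫ Proj.awayι (grading m) s hs hd)
    (spec_awayEval_awayι_hom w hs hd hu)

lemma projPt_left (w : Fin m → A) {s : MvPolynomial (Fin m) ℂ} {d : ℕ}
    (hs : s ∈ grading m d) (hd : 0 < d) (hu : IsUnit (MvPolynomial.aeval w s)) :
    (projPt w hs hd hu : specC A ⟶ projOf m).left =
      Spec.map (CommRingCat.ofHom (awayEval w s hu)) ≫ Proj.awayι (grading m) s hs hd := rfl

/-- The evaluation at `w` on the smaller chart `D(st)` restricts the one on `D(s)`. Passing through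
a product links two arbitrary choices of denominator. -/
lemma projPt_mul (w : Fin m → A) {s t : MvPolynomial (Fin m) ℂ} {d e : ℕ}
    (hs : s ∈ grading m d) (hd : 0 < d) (ht : t ∈ grading m e)
    (hu : IsUnit (MvPolynomial.aeval w s)) (hst : s * t ∈ grading m (d + e))
    (hu' : IsUnit (MvPolynomial.aeval w (s * t))) :
    projPt w hst (hd.trans_le (d.le_add_right e)) hu' = projPt w hs hd hu := by
  apply Over.OverMorphism.ext
  rw [projPt_left, projPt_left, ← Proj.SpecMap_awayMap_awayι (grading m) hs hd ht rfl,
    ← Category.assoc, ← Spec.map_comp, ← CommRingCat.ofHom_comp, awayEval_comp_awayMap w hs ht hu]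

/-- The point does not depend on the invertible homogeneous function. -/
lemma projPt_indep (w : Fin m → A) {s t : MvPolynomial (Fin m) ℂ} {d e : ℕ}
    (hs : s ∈ grading m d) (hd : 0 < d) (hu : IsUnit (MvPolynomial.aeval w s))
    (ht : t ∈ grading m e) (he : 0 < e) (hu' : IsUnit (MvPolynomial.aeval w t)) :
    projPt w hs hd hu = projPt w ht he hu' := by
  have h1 : IsUnit (MvPolynomial.aeval w (s * t)) := by rw [map_mul]; exact hu.mul hu'
  have h2 : IsUnit (MvPolynomial.aeval w (t * s)) := by rw [map_mul]; exact hu'.mul hu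
  rw [← projPt_mul w hs hd ht hu (SetLike.mul_mem_graded hs ht) h1,
    ← projPt_mul w ht he hs hu' (SetLike.mul_mem_graded ht hs) h2]
  congr 1
  · exact mul_comm _ _
  · exact add_comm _ _

lemma projPt_smul (c : A) (w : Fin m → A) {s : MvPolynomial (Fin m) ℂ} {d : ℕ}
    (hs : s ∈ grading m d) (hd : 0 < d) (hu : IsUnit (MvPolynomial.aeval w s))
    (hu' : IsUnit (MvPolynomial.aeval (c • w) s)) :
    projPt (c • w) hs hd hu' = projPt w hs hd hu := by
  apply Over.OverMorphism.ext
  rw [projPt_left, projPt_left, awayEval_smul w hs hu]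

lemma map_projPt {B : CommAlgCat.{0} ℂ} (f : A ⟶ B) (w : Fin m → A) {s : MvPolynomial (Fin m) ℂ}
    {d : ℕ} (hs : s ∈ grading m d) (hd : 0 < d) (hu : IsUnit (MvPolynomial.aeval w s))
    (hu' : IsUnit (MvPolynomial.aeval (fun i => f.hom (w i)) s)) :
    (points (projOf m)).map f (projPt w hs hd hu) = projPt (fun i => f.hom (w i)) hs hd hu' := by
  apply Over.OverMorphism.ext
  rw [projPt_left, ← comp_awayEval f.hom w hs hu, CommRingCat.ofHom_comp, Spec.map_comp,
    Category.assoc]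
  rfl

lemma X_mem_grading (i : Fin m) : (MvPolynomial.X i : MvPolynomial (Fin m) ℂ) ∈ grading m 1 :=
  MvPolynomial.isHomogeneous_X ℂ i

/-- The point of projective space with homogeneous coordinates `w` such that `w i` is a unit. -/
def coordPt (w : Fin m → A) (i : Fin m) (hu : IsUnit (w i)) : (points (projOf m)).obj A :=
  projPt w (X_mem_grading i) one_pos (by rwa [MvPolynomial.aeval_X])

lemma map_coordPt {B : CommAlgCat.{0} ℂ} (f : A ⟶ B) (w : Fin m → A) (i : Fin m)
    (hu : IsUnit (w i)) : (points (projOf m)).map f (coordPt w i hu) =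
      coordPt (fun i => f.hom (w i)) i (hu.map f.hom) := map_projPt _ _ _ _ _ _

lemma val_fromZero (s : MvPolynomial (Fin m) ℂ) (c : ℂ) :
    (fromZeroRingHom (grading m) (Submonoid.powers s) (algebraMap ℂ (grading m 0) c)).val =
      algebraMap (MvPolynomial (Fin m) ℂ) (Localization.Away s) (MvPolynomial.C c) := by
  rw [fromZeroRingHom]
  exact Localization.mk_one_eq_algebraMap _

/-- Every ring homomorphism from a standard chart of projective space is an evaluation. -/
lemma exists_eq_awayEval (i : Fin m) (φ : Away (grading m) (MvPolynomial.X i) →+* A)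
    (hφ : φ.comp ((fromZeroRingHom (grading m) _).comp (algebraMap ℂ (grading m 0))) =
      algebraMap ℂ A) :
    ∃ (w : Fin m → A) (hw : w i = 1),
      φ = awayEval w (MvPolynomial.X i) (by rw [MvPolynomial.aeval_X, hw]; exact isUnit_one) := by
  -- The coordinates of the point are the images of the fractions `X_l / X_i`.
  let x : Fin m → Away (grading m) (MvPolynomial.X i) := fun l =>
    Away.mk (grading m) (X_mem_grading i) 1 (MvPolynomial.X l) (X_mem_grading l)
  let w : Fin m → A := fun l => φ (x l)
  have hx : x i = 1 := by
    apply val_injective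
    rw [Away.val_mk, val_one, Localization.mk_eq_mk']
    simp
  have hw : w i = 1 := by simp only [w, hx, map_one]
  refine ⟨w, hw, eq_awayEval_of_forall (X_mem_grading i) fun n a ha => ?_⟩
  let θ : MvPolynomial (Fin m) ℂ →+* Away (grading m) (MvPolynomial.X i) :=
    MvPolynomial.eval₂Hom ((fromZeroRingHom (grading m) _).comp (algebraMap ℂ (grading m 0))) x
  have h1 : ∀ a, φ (θ a) = MvPolynomial.aeval w a := by
    intro a
    have : φ.comp θ = (MvPolynomial.aeval w).toRingHom := by
      refine MvPolynomial.ringHom_ext (fun c => ?_) fun l => ?_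
      · simp only [θ, RingHom.comp_apply, MvPolynomial.coe_eval₂Hom, MvPolynomial.eval₂_C]
        exact (RingHom.congr_fun hφ c).trans (MvPolynomial.aeval_C w c).symm
      · simp only [θ, RingHom.comp_apply, MvPolynomial.coe_eval₂Hom, MvPolynomial.eval₂_X]
        exact (MvPolynomial.aeval_X w l).symm
    exact RingHom.congr_fun this a
  let c : Localization.Away (MvPolynomial.X i : MvPolynomial (Fin m) ℂ) :=
    Localization.mk 1 ⟨MvPolynomial.X i, Submonoid.mem_powers _⟩
  let y : Fin m → Localization.Away (MvPolynomial.X i : MvPolynomial (Fin m) ℂ) := fun l =>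
    algebraMap (MvPolynomial (Fin m) ℂ) _ (MvPolynomial.X l)
  have h2 : ∀ a, (θ a).val = MvPolynomial.aeval (c • y) a := by
    intro a
    have : (algebraMap (Away (grading m) (MvPolynomial.X i)) (Localization.Away _)).comp θ =
        (MvPolynomial.aeval (c • y)).toRingHom := by
      refine MvPolynomial.ringHom_ext (fun b => ?_) fun l => ?_
      · simp only [θ, RingHom.comp_apply, MvPolynomial.coe_eval₂Hom, MvPolynomial.eval₂_C]
        refine Eq.trans ?_ (MvPolynomial.aeval_C _ b).symm
        exact (val_fromZero _ b).trans rfl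
      · simp only [θ, RingHom.comp_apply, MvPolynomial.coe_eval₂Hom, MvPolynomial.eval₂_X]
        refine Eq.trans ?_ (MvPolynomial.aeval_X _ l).symm
        refine (Away.val_mk (grading m) 1 (X_mem_grading i) _ (X_mem_grading l)).trans ?_
        rw [Pi.smul_apply, smul_eq_mul]
        refine Eq.trans ?_ (congrArg (fun z => c * z) (Localization.mk_one_eq_algebraMap _))
        rw [Localization.mk_mul]
        congr 1
        · simp
        · ext; simp
    exact RingHom.congr_fun this a
  -- By homogeneity, `a / X_i^n` is the polynomial `a` evaluated at the fractions `X_l / X_i`.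
  have h3 : Away.mk (grading m) (X_mem_grading i) n a ha = θ a := by
    apply val_injective
    have ha' : a ∈ grading m n := by simpa using ha
    rw [h2, aeval_smul_of_mem c _ ha', Away.val_mk]
    have : MvPolynomial.aeval y a =
        algebraMap _ _ a := by
      have := MvPolynomial.comp_aeval_apply (R := ℂ) (MvPolynomial.X : Fin m → MvPolynomial (Fin m) ℂ)
        (IsScalarTower.toAlgHom ℂ (MvPolynomial (Fin m) ℂ)
          (Localization.Away (MvPolynomial.X i : MvPolynomial (Fin m) ℂ))) a
      rw [MvPolynomial.aeval_X_left_apply] at this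
      exact this.symm
    rw [this, ← Localization.mk_one_eq_algebraMap, Localization.mk_pow, Localization.mk_mul]
    congr 1
    · simp
    · ext; simp
  rw [h3, h1, MvPolynomial.aeval_X, hw, one_pow, mul_one]

end ProjPoint

/-! ### Projective space as the space of lines. -/

section ProjGr

open HomogeneousLocalization

variable {m : ℕ} {A : CommAlgCat.{0} ℂ}

lemma coordPt_smul_eq {c : A} {w w' : Fin m → A} (h : w' = c • w) (i j : Fin m)
    (hu : IsUnit (w i)) (hu' : IsUnit (w' j)) : coordPt w i hu = coordPt w' j hu' := by
  subst h
  have h1 : IsUnit (w j) := by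
    rw [Pi.smul_apply, smul_eq_mul] at hu'
    exact isUnit_of_mul_isUnit_right hu'
  have h2 : IsUnit (MvPolynomial.aeval w (MvPolynomial.X j : MvPolynomial (Fin m) ℂ)) := by
    rwa [MvPolynomial.aeval_X]
  exact (projPt_indep w _ _ _ (X_mem_grading j) one_pos h2).trans
    (projPt_smul c w (X_mem_grading j) one_pos h2 _).symm

/-- Equal points factor through the intersection of the two charts, where `(X_l / X_i) (X_i / X_j) =
X_l / X_j`. Evaluating this identity gives the factor `w' i / w i`. -/
lemma exists_smul_of_coordPt_eq {w w' : Fin m → A} {i j : Fin m}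
    {hu : IsUnit (w i)} {hu' : IsUnit (w' j)} (h : coordPt w i hu = coordPt w' j hu') :
    ∃ c : A, w' = c • w := by
  have hu1 : IsUnit (MvPolynomial.aeval w (MvPolynomial.X i : MvPolynomial (Fin m) ℂ)) := by
    rwa [MvPolynomial.aeval_X]
  have hu1' : IsUnit (MvPolynomial.aeval w' (MvPolynomial.X j : MvPolynomial (Fin m) ℂ)) := by
    rwa [MvPolynomial.aeval_X]
  let F := Proj.awayι (grading m) _ (X_mem_grading i) one_pos
  let F' := Proj.awayι (grading m) _ (X_mem_grading j) one_pos
  have h0 : Spec.map (CommRingCat.ofHom (awayEval w _ hu1)) ≫ F =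
      Spec.map (CommRingCat.ofHom (awayEval w' _ hu1')) ≫ F' :=
    congrArg (fun z : specC A ⟶ projOf m => z.left) h
  let e := Proj.pullbackAwayιIso (grading m) (X_mem_grading i) one_pos (X_mem_grading j) one_pos rfl
  let ψ := Spec.preimage (Limits.pullback.lift _ _ h0 ≫ e.hom)
  have h1 : awayEval w _ hu1 = ψ.hom.comp (awayMap (grading m) (X_mem_grading j) rfl) := by
    have : Spec.map (CommRingCat.ofHom (awayEval w _ hu1)) =
        Spec.map ψ ≫ Spec.map (CommRingCat.ofHom (awayMap (grading m) (X_mem_grading j) rfl)) := by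
      rw [Spec.map_preimage, Category.assoc, Proj.pullbackAwayιIso_hom_SpecMap_awayMap_left,
        Limits.pullback.lift_fst]
    rw [← Spec.map_comp] at this
    exact congrArg CommRingCat.Hom.hom (Spec.map_injective this)
  have h2 : awayEval w' _ hu1' = ψ.hom.comp (awayMap (grading m) (X_mem_grading i)
      (mul_comm _ _)) := by
    have : Spec.map (CommRingCat.ofHom (awayEval w' _ hu1')) =
        Spec.map ψ ≫ Spec.map (CommRingCat.ofHom (awayMap (grading m) (X_mem_grading i)
          (mul_comm _ _))) := by
      rw [Spec.map_preimage, Category.assoc, Proj.pullbackAwayιIso_hom_SpecMap_awayMap_right,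
        Limits.pullback.lift_snd]
    rw [← Spec.map_comp] at this
    exact congrArg CommRingCat.Hom.hom (Spec.map_injective this)
  obtain ⟨c, hc⟩ := hu.exists_right_inv
  refine ⟨c * w' i, funext fun l => ?_⟩
  let x := fun l => Away.mk (grading m) (X_mem_grading i) 1 (MvPolynomial.X l) (X_mem_grading l)
  let x' := fun l => Away.mk (grading m) (X_mem_grading j) 1 (MvPolynomial.X l) (X_mem_grading l)
  have hx : ∀ l, awayEval w _ hu1 (x l) * w i = w l := fun l => by
    have := awayEval_mk w hu1 (X_mem_grading i) 1 _ (X_mem_grading l)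
    simpa using this
  have hx' : ∀ l, awayEval w' _ hu1' (x' l) * w' j = w' l := fun l => by
    have := awayEval_mk w' hu1' (X_mem_grading j) 1 _ (X_mem_grading l)
    simpa using this
  have key : awayMap (grading m) (X_mem_grading j) rfl (x l) *
      awayMap (grading m) (X_mem_grading i) (mul_comm _ _) (x' i) =
      awayMap (grading m) (X_mem_grading i) (mul_comm _ _) (x' l) := by
    apply val_injective
    rw [val_mul]
    simp only [x, x', awayMap_mk, Away.val_mk, Localization.mk_mul]
    rw [Localization.mk_eq_mk_iff, Localization.r_iff_exists]
    refine ⟨1, ?_⟩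
    simp only [pow_one, Submonoid.coe_one, one_mul, Submonoid.coe_mul]
    ring
  have key2 := congrArg ψ.hom key
  rw [map_mul] at key2
  have e1 : awayEval w _ hu1 (x l) * awayEval w' _ hu1' (x' i) = awayEval w' _ hu1' (x' l) := by
    rw [h1, h2]
    exact key2
  rw [Pi.smul_apply, smul_eq_mul, ← hx' l, ← hx' i, ← e1]
  conv_rhs => rw [← hx l]
  linear_combination (-(awayEval w _ hu1 (x l) * awayEval w' _ hu1' (x' i) * w' j)) * hc

/-- Every point of projective space locally has homogeneous coordinates. -/
lemma exists_coordPt (x : (points (projOf m)).obj A) (𝔭 : Ideal A) (h𝔭 : 𝔭.IsPrime) :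
    ∃ s ∉ 𝔭, ∃ (i : Fin m) (w : Fin m → away A s) (hu : IsUnit (w i)),
      (points (projOf m)).map (loc A s) x = coordPt w i hu := by
  let p : Spec (CommRingCat.of A) ⟶ (projOf m).left := (show specC A ⟶ projOf m from x).left
  have hcov : ⨆ i : Fin m, Proj.basicOpen (grading m) (MvPolynomial.X i) = ⊤ := by
    refine Proj.iSup_basicOpen_eq_top' _ _ (fun i => ⟨1, X_mem_grading i⟩) ?_
    rw [eq_top_iff]
    rintro a -
    have ha : a ∈ Algebra.adjoin ℂ (Set.range (MvPolynomial.X : Fin m → MvPolynomial (Fin m) ℂ)) := by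
      rw [MvPolynomial.adjoin_range_X]; trivial
    induction ha using Algebra.adjoin_induction with
    | mem x hx => exact Algebra.subset_adjoin hx
    | algebraMap r =>
      exact Subalgebra.algebraMap_mem _ (algebraMap ℂ (grading m 0) r)
    | add x y _ _ hx hy => exact add_mem hx hy
    | mul x y _ _ hx hy => exact mul_mem hx hy
  have hi : p ⟨𝔭, h𝔭⟩ ∈ ⨆ i : Fin m, Proj.basicOpen (grading m) (MvPolynomial.X i) := by
    rw [hcov]; trivial
  obtain ⟨i, hi⟩ := TopologicalSpace.Opens.mem_iSup.1 hi
  let F : Spec (CommRingCat.of (Away (grading m) (MvPolynomial.X i))) ⟶ (projOf m).left :=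
    Proj.awayι (grading m) _ (X_mem_grading i) one_pos
  have : IsOpenImmersion F := inferInstanceAs (IsOpenImmersion (Proj.awayι (grading m) _ _ _))
  have hF : F.opensRange = Proj.basicOpen (grading m) (MvPolynomial.X i) :=
    Proj.opensRange_awayι _ _ _ _
  rw [← hF] at hi
  obtain ⟨s, hs, U, hU, hUW, -, q, hq⟩ := exists_away_factor p 𝔭 h𝔭 F.opensRange hi
  refine ⟨s, hs, i, ?_⟩
  let g := IsOpenImmersion.lift F hU.fromSpec (by
    rw [hU.range_fromSpec]; exact hUW)
  let φ := Spec.preimage (Spec.map q ≫ g)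
  have h1 : Spec.map (CommRingCat.ofHom (loc A s).hom.toRingHom) ≫ p = Spec.map φ ≫ F := by
    rw [hq, Spec.map_preimage, Category.assoc, IsOpenImmersion.lift_fac]
  have h2 : φ.hom.comp ((fromZeroRingHom (grading m) _).comp (algebraMap ℂ (grading m 0))) =
      algebraMap ℂ (away A s) := by
    have h3 : Spec.map φ ≫ F ≫ (projOf m).hom = (specC (away A s)).hom := by
      have := Over.w ((points (projOf m)).map (loc A s) x : specC (away A s) ⟶ projOf m)
      rw [points_map_left] at this
      refine Eq.trans ((Category.assoc _ _ _).symm.trans ?_) this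
      exact congrArg (fun z => z ≫ (projOf m).hom) h1.symm
    have h4 : F ≫ (projOf m).hom = Spec.map (CommRingCat.ofHom
        ((fromZeroRingHom (grading m) _).comp (algebraMap ℂ (grading m 0)))) := by
      rw [CommRingCat.ofHom_comp, Spec.map_comp]
      refine Eq.trans (Category.assoc _ _ _).symm ?_
      exact congrArg (fun z => z ≫ _) (Proj.awayι_toSpecZero (grading m) _ _ _)
    rw [h4, ← Spec.map_comp] at h3
    exact congrArg CommRingCat.Hom.hom (Spec.map_injective h3)
  obtain ⟨w, hw, hφ⟩ := exists_eq_awayEval (A := away A s) i φ.hom h2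
  refine ⟨w, by rw [hw]; exact isUnit_one, ?_⟩
  apply Over.OverMorphism.ext
  rw [points_map_left]
  refine h1.trans ?_
  have : φ = CommRingCat.ofHom (awayEval w (MvPolynomial.X i)
      (by rw [MvPolynomial.aeval_X, hw]; exact isUnit_one)) := CommRingCat.hom_ext hφ
  rw [this]
  rfl

section LineOf

variable {A B : Type} [CommRing A] [Algebra ℂ A] [CommRing B] [Algebra ℂ B]

/-- The line with homogeneous coordinates `w` such that `w i` is a unit. -/
def lineOf (w : Fin m → A) (i : Fin m) (hu : IsUnit (w i)) : Gr 1 m A :=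
  grOfUnimodular (toVec w) ((↑hu.unit⁻¹ : A) • (LinearMap.proj i ∘ₗ (vecEquiv A m).toLinearMap))
    (by simp)

@[simp] lemma lineOf_toSubmodule (w : Fin m → A) (i : Fin m) (hu : IsUnit (w i)) :
    (lineOf w i hu).toSubmodule = Submodule.span A {toVec w} := rfl

lemma grMap_lineOf (f : A →ₐ[ℂ] B) (w : Fin m → A) (i : Fin m) (hu : IsUnit (w i)) :
    Gr.map f (lineOf w i hu) = lineOf (fun i => f (w i)) i (hu.map f) := by
  refine grMap_eq_of_span rfl ?_
  rintro _ rfl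
  rw [vecMap_toVec]
  exact Submodule.mem_span_singleton_self _

lemma lineOf_eq_iff {w w' : Fin m → A} {i j : Fin m} {hu : IsUnit (w i)} {hu' : IsUnit (w' j)} :
    lineOf w i hu = lineOf w' j hu' ↔ ∃ c : A, w' = c • w := by
  constructor
  · intro h
    have : toVec w' ∈ (lineOf w i hu).toSubmodule := by
      rw [h]; exact Submodule.mem_span_singleton_self _
    obtain ⟨c, hc⟩ := Submodule.mem_span_singleton.1 this
    refine ⟨c, ?_⟩
    have := congrArg (vecEquiv A m) hc
    simpa using this.symm
  · rintro ⟨c, rfl⟩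
    symm
    apply gr_eq_of_le
    rw [lineOf_toSubmodule, lineOf_toSubmodule, Submodule.span_singleton_le_iff_mem]
    exact Submodule.mem_span_singleton.2 ⟨c, by simp [toVec]⟩

/-- Every line locally has homogeneous coordinates, one of which is `1`. -/
lemma exists_lineOf (hm : 1 ≤ m) (W : Gr 1 m A) (𝔭 : Ideal A) [𝔭.IsPrime] :
    ∃ h ∉ 𝔭, ∃ (i : Fin m) (w : Fin m → Localization.Away h) (hw : w i = 1),
      Gr.map (locHom h) W = lineOf w i (by rw [hw]; exact isUnit_one) := by
  obtain ⟨h, hh, ε, X, hX⟩ := exists_chart hm W 𝔭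
  refine ⟨h, hh, ε (Sum.inr 0), vecEquiv _ m (chartFrame ε X 0), by simp [chartFrame], ?_⟩
  rw [hX]
  symm
  apply gr_eq_of_le
  rw [lineOf_toSubmodule, toVec_vecEquiv, Submodule.span_singleton_le_iff_mem]
  exact chartFrame_mem ε X 0

end LineOf

/-- The coordinate ring of the affine cone over a standard chart. -/
abbrev coneRing (i : Fin m) : CommAlgCat.{0} ℂ :=
  CommAlgCat.of ℂ (Localization.Away (MvPolynomial.X i : MvPolynomial (Fin m) ℂ))

/-- The tautological vector. -/
def coneVec (i : Fin m) : Fin m → coneRing i := fun l => locHom (MvPolynomial.X i) (MvPolynomial.X l)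

lemma coneVec_isUnit (i : Fin m) : IsUnit (coneVec i i) := locHom_self_isUnit _

/-- Working with the cone over a chart, rather than the chart itself, makes coordinate vectors pull
back without being normalized. -/
lemma exists_coneRing_hom (w : Fin m → A) (i : Fin m) (hu : IsUnit (w i)) :
    ∃ f : coneRing i ⟶ A, (fun l => f.hom (coneVec i l)) = w := by
  have hu' : IsUnit (MvPolynomial.aeval w (MvPolynomial.X i : MvPolynomial (Fin m) ℂ)) := by
    rwa [MvPolynomial.aeval_X]
  refine ⟨CommAlgCat.ofHom (awayLift _ (MvPolynomial.aeval w) hu'), funext fun l => ?_⟩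
  refine (awayLift_locHom _ _ hu' _).trans ?_
  rw [MvPolynomial.aeval_X]

lemma isChartCover_coordPt : IsChartCover fun i : Fin m => coordPt (coneVec i) i (coneVec_isUnit i) := by
  intro A x 𝔭 h𝔭
  obtain ⟨s, hs, i, w, hu, h⟩ := exists_coordPt x 𝔭 h𝔭
  obtain ⟨f, hf⟩ := exists_coneRing_hom w i hu
  refine ⟨s, hs, i, f, h.trans ?_⟩
  rw [map_coordPt]
  simp only [hf]

lemma isChartCover_lineOf (hm : 1 ≤ m) : IsChartCover (G := grFunctor 1 m)
    fun i : Fin m => (lineOf (coneVec i) i (coneVec_isUnit i) : Gr 1 m (coneRing i)) := by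
  intro A x 𝔭 h𝔭
  obtain ⟨s, hs, i, w, hw, h⟩ := exists_lineOf hm x 𝔭
  obtain ⟨f, hf⟩ := exists_coneRing_hom (A := away A s) w i (by rw [hw]; exact isUnit_one)
  refine ⟨s, hs, i, f, h.trans ?_⟩
  refine Eq.trans ?_ (grMap_lineOf f.hom _ i _).symm
  simp only [hf]

/-- Projective space represents the functor of lines, compatibly with homogeneous coordinates. -/
lemma exists_projOf_iso (hm : 1 ≤ m) : ∃ e : points (projOf m) ≅ grFunctor 1 m,
    ∀ (A : CommAlgCat.{0} ℂ) (w : Fin m → A) (i : Fin m) (hu : IsUnit (w i)),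
      e.hom.app A (coordPt w i hu) = lineOf w i hu := by
  obtain ⟨e, he⟩ := exists_iso_of_charts (isZariskiSheaf_points (projOf m))
    (isZariskiSheaf_grFunctor (k := 1) (m := m)) isChartCover_coordPt (isChartCover_lineOf hm) (by
      intro i j A f g
      rw [map_coordPt, map_coordPt]
      -- The gluing relation is the same on both sides: the coordinate vectors are proportional.
      refine Iff.trans ?_ ((lineOf_eq_iff (hu := (coneVec_isUnit i).map f.hom)
        (hu' := (coneVec_isUnit j).map g.hom)).symm.trans (Eq.congr (grMap_lineOf f.hom _ i _).symm
          (grMap_lineOf g.hom _ j _).symm))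
      exact ⟨exists_smul_of_coordPt_eq, fun ⟨c, hc⟩ => coordPt_smul_eq hc _ _ _ _⟩)
  refine ⟨e, fun A w i hu => ?_⟩
  obtain ⟨f, hf⟩ := exists_coneRing_hom w i hu
  have h1 : coordPt w i hu = (points (projOf m)).map f (coordPt (coneVec i) i (coneVec_isUnit i)) := by
    rw [map_coordPt]
    simp only [hf]
  have h2 := NatTrans.naturality_apply e.hom f (coordPt (coneVec i) i (coneVec_isUnit i))
  rw [h1, h2, he]
  refine (grMap_lineOf f.hom _ i _).trans ?_
  simp only [hf]

end ProjGr

/-! ### Comparison of functors of points -/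

section Comparison

/-- Two subfunctors with the same image are isomorphic. -/
lemma exists_iso_of_range_eq {G G' H : CommAlgCat.{0} ℂ ⥤ Type} (θ : G ⟶ H) (θ' : G' ⟶ H)
    (hθ : ∀ A, Function.Injective (θ.app A)) (hθ' : ∀ A, Function.Injective (θ'.app A))
    (h : ∀ A (y : H.obj A), (∃ x, θ.app A x = y) ↔ ∃ x, θ'.app A x = y) :
    ∃ e : G ≅ G', e.hom ≫ θ' = θ := by
  choose F hF using fun A x => (h A (θ.app A x)).1 ⟨x, rfl⟩
  choose F' hF' using fun A x => (h A (θ'.app A x)).2 ⟨x, rfl⟩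
  let η : G ⟶ G' :=
    { app := fun A => ↾(F A)
      naturality := fun A B f => ConcreteCategory.hom_ext _ _ fun x => hθ' B (by
        have h1 := NatTrans.naturality_apply θ f x
        have h2 := NatTrans.naturality_apply θ' f (F A x)
        refine (hF B (G.map f x)).trans (h1.trans ?_)
        rw [← hF A x]
        exact h2.symm) }
  let η' : G' ⟶ G :=
    { app := fun A => ↾(F' A)
      naturality := fun A B f => ConcreteCategory.hom_ext _ _ fun x => hθ B (by
        have h1 := NatTrans.naturality_apply θ' f x
        have h2 := NatTrans.naturality_apply θ f (F' A x)
        refine (hF' B (G'.map f x)).trans (h1.trans ?_)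
        rw [← hF' A x]
        exact h2.symm) }
  refine ⟨⟨η, η', ?_, ?_⟩, ?_⟩
  · exact NatTrans.ext (funext fun A => ConcreteCategory.hom_ext _ _ fun x => hθ A
      ((hF' A (F A x)).trans (hF A x)))
  · exact NatTrans.ext (funext fun A => ConcreteCategory.hom_ext _ _ fun x => hθ' A
      ((hF A (F' A x)).trans (hF' A x)))
  · exact NatTrans.ext (funext fun A => ConcreteCategory.hom_ext _ _ fun x => hF A x)

lemma IsZeroLocus.injective {Z X : SchemeC} {i : Z ⟶ X}
    {V : ∀ A : CommAlgCat.{0} ℂ, (points X).obj A → Prop} (h : IsZeroLocus i V)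
    (A : CommAlgCat.{0} ℂ) : Function.Injective ((pointsMap i).app A) := by
  intro x y hxy
  have := h.isClosedImmersion
  apply Over.OverMorphism.ext
  have h1 : (show specC A ⟶ Z from x).left ≫ i.left = (show specC A ⟶ Z from y).left ≫ i.left :=
    congrArg (fun z : specC A ⟶ X => z.left) hxy
  exact (cancel_mono i.left).1 h1

lemma injective_iso_app {G H : CommAlgCat.{0} ℂ ⥤ Type} (e : G ≅ H) (A : CommAlgCat.{0} ℂ) :
    Function.Injective (e.hom.app A) := by
  intro x y h
  have h1 : ∀ x, e.inv.app A (e.hom.app A x) = x := fun x =>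
    ConcreteCategory.congr_hom (e.hom_inv_id_app A) x
  rw [← h1 x, ← h1 y, h]

lemma iso_hom_inv_app {G H : CommAlgCat.{0} ℂ ⥤ Type} (e : G ≅ H) (A : CommAlgCat.{0} ℂ)
    (x : H.obj A) : e.hom.app A (e.inv.app A x) = x :=
  ConcreteCategory.congr_hom (e.inv_hom_id_app A) x

/-- Pullback of a closed condition along a natural transformation. -/
lemma IsClosedCondition.comp {G H : CommAlgCat.{0} ℂ ⥤ Type}
    {V : ∀ A : CommAlgCat.{0} ℂ, H.obj A → Prop} (hV : IsClosedCondition V) (θ : G ⟶ H) :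
    IsClosedCondition fun A x => V A (θ.app A x) := by
  intro A x
  obtain ⟨I, hI⟩ := hV A (θ.app A x)
  refine ⟨I, fun B f => ?_⟩
  exact (iff_of_eq (congrArg (V B) (NatTrans.naturality_apply θ f x))).trans (hI B f)

end Comparison

/-! ### Homogeneous equations -/

section Homogeneous

variable {m : ℕ} {A B : Type} [CommRing A] [Algebra ℂ A] [CommRing B] [Algebra ℂ B]

/-- A line locally has a generator that comes from a global section. -/
lemma exists_local_generator (hm : 1 ≤ m) (L : Gr 1 m A) (𝔭 : Ideal A) [𝔭.IsPrime] :
    ∃ h ∉ 𝔭, ∃ v ∈ L.toSubmodule, ∃ i, IsUnit (locHom h (vecEquiv A m v i)) ∧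
      (Gr.map (locHom h) L).toSubmodule =
        Submodule.span (Localization.Away h) {vecMap (locHom h) m v} := by
  obtain ⟨h, hh, i, w, hw, hL⟩ := exists_lineOf hm L 𝔭
  -- Two powers of `h` are needed: one lifts the coordinates of the generator to `A`, the other
  -- brings the lift into `L`.
  obtain ⟨n, v, hv⟩ := exists_vecMap_eq_smul h (toVec w)
  have h1 : vecMap (locHom h) m v ∈ (Gr.map (locHom h) L).toSubmodule := by
    rw [hL, lineOf_toSubmodule, hv]
    exact Submodule.smul_mem _ _ (Submodule.mem_span_singleton_self _)
  obtain ⟨n', hn'⟩ := exists_pow_smul_mem (locHom h) h (exists_pow_mul_eq_zero h) L v h1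
  have hu : IsUnit (locHom h (h ^ n') * locHom h (h ^ n)) := by
    rw [← map_mul, ← pow_add, map_pow]
    exact (locHom_self_isUnit h).pow _
  have h2 : vecMap (locHom h) m (h ^ n' • v) =
      (locHom h (h ^ n') * locHom h (h ^ n)) • toVec w := by
    rw [vecMap_smul, hv, smul_smul]
  refine ⟨h, hh, h ^ n' • v, hn', i, ?_, ?_⟩
  · rw [← vecEquiv_vecMap, h2, map_smul, vecEquiv_toVec, Pi.smul_apply, hw, smul_eq_mul, mul_one]
    exact hu
  · rw [hL, lineOf_toSubmodule, h2]
    exact (Submodule.span_singleton_smul_eq hu _).symm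

lemma aeval_vecMap (f : A →ₐ[ℂ] B) (P : MvPolynomial (Fin m) ℂ) (v : Vec A m) :
    MvPolynomial.aeval (vecEquiv B m (vecMap f m v)) P = f (MvPolynomial.aeval (vecEquiv A m v) P) := by
  have : vecEquiv B m (vecMap f m v) = fun i => f (vecEquiv A m v i) :=
    funext fun i => vecEquiv_vecMap f v i
  rw [this]
  exact (MvPolynomial.comp_aeval_apply (vecEquiv A m v) f P).symm

lemma eq_zero_of_locally (a : A)
    (h : ∀ 𝔭 : Ideal A, 𝔭.IsPrime → ∃ s ∉ 𝔭, locHom s a = 0) : a = 0 := by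
  have hS := span_eq_top_of_forall_prime (S := {s | locHom s a = 0}) h
  rw [← Submodule.mem_bot A]
  exact Submodule.mem_of_span_eq_top_of_smul_pow_mem ⊥ _ hS a fun s =>
    exists_pow_mul_eq_zero s.1 a s.2

/-- If a line is locally generated by `v`, so is every base change. -/
lemma exists_eq_smul_vecMap {h : A} {L : Gr 1 m A} {v : Vec A m}
    (hL : (Gr.map (locHom h) L).toSubmodule =
      Submodule.span (Localization.Away h) {vecMap (locHom h) m v})
    (g : A →ₐ[ℂ] B) (hg : IsUnit (g h)) :
    (Gr.map g L).toSubmodule = Submodule.span B {vecMap g m v} := by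
  have h1 : (awayLift h g hg).comp (locHom h) = g := awayLift_comp h g hg
  conv_lhs => rw [← h1, grMap_comp, grMap_eq_span, hL]
  refine le_antisymm (Submodule.span_le.2 ?_) ?_
  · rintro _ ⟨w, hw, rfl⟩
    obtain ⟨c, rfl⟩ := Submodule.mem_span_singleton.1 hw
    rw [vecMap_smul, vecMap_vecMap, h1]
    exact Submodule.smul_mem _ _ (Submodule.mem_span_singleton_self _)
  · rw [Submodule.span_singleton_le_iff_mem]
    refine Submodule.subset_span ⟨_, Submodule.mem_span_singleton_self _, ?_⟩
    rw [vecMap_vecMap, h1]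

/-- A homogeneous equation on a line holds after base change if it holds for the sections of
the original line after base change. -/
lemma aeval_eq_zero_of_mem_grMap (hm : 1 ≤ m) (f : A →ₐ[ℂ] B) (L : Gr 1 m A)
    {P : MvPolynomial (Fin m) ℂ} {d : ℕ} (hP : P ∈ grading m d)
    (h : ∀ p ∈ L.toSubmodule, f (MvPolynomial.aeval (vecEquiv A m p) P) = 0)
    (q : Vec B m) (hq : q ∈ (Gr.map f L).toSubmodule) :
    MvPolynomial.aeval (vecEquiv B m q) P = 0 := by
  refine eq_zero_of_locally _ fun 𝔮 h𝔮 => ?_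
  -- Near `𝔮` the pulled back line is spanned by a section of `L`. So `q` is a multiple of it, and
  -- homogeneity of `P` applies.
  obtain ⟨s, hs, v, hv, i, -, hL⟩ := exists_local_generator hm L (𝔮.comap f)
  refine ⟨f s, hs, ?_⟩
  have h1 := mem_grMap (locHom (f s)) _ hq
  rw [← grMap_comp, exists_eq_smul_vecMap hL _ (locHom_self_isUnit (f s))] at h1
  obtain ⟨c, hc⟩ := Submodule.mem_span_singleton.1 h1
  rw [← aeval_vecMap, ← hc, map_smul, aeval_smul_of_mem c _ hP, aeval_vecMap, AlgHom.comp_apply,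
    h v hv, map_zero, mul_zero]

/-- The lines on which the polynomials in `S` vanish. -/
def VanishOn (S : Set (MvPolynomial (Fin m) ℂ)) (A : CommAlgCat.{0} ℂ) (L : Gr 1 m A) : Prop :=
  ∀ P ∈ S, ∀ p ∈ L.toSubmodule, MvPolynomial.aeval (vecEquiv A m p) P = 0

lemma isClosedCondition_vanishOn (hm : 1 ≤ m) {S : Set (MvPolynomial (Fin m) ℂ)}
    (hS : ∀ P ∈ S, ∃ d, P ∈ grading m d) :
    IsClosedCondition (G := grFunctor 1 m) (VanishOn S) := by
  intro A L
  refine ⟨Ideal.span {a | ∃ P ∈ S, ∃ p ∈ (show Gr 1 m A from L).toSubmodule,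
    MvPolynomial.aeval (vecEquiv A m p) P = a}, fun B f => ?_⟩
  rw [Ideal.span_le]
  constructor
  · rintro h _ ⟨P, hP, p, hp, rfl⟩
    have := h P hP _ (mem_grMap f.hom L hp)
    rw [aeval_vecMap] at this
    exact this
  · intro h P hP q hq
    obtain ⟨d, hd⟩ := hS P hP
    exact aeval_eq_zero_of_mem_grMap hm f.hom L hd (fun p hp => h ⟨P, hP, p, hp, rfl⟩) q hq

lemma vanishOn_lineOf_iff {S : Set (MvPolynomial (Fin m) ℂ)} (hS : ∀ P ∈ S, ∃ d, P ∈ grading m d)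
    (A : CommAlgCat.{0} ℂ) (w : Fin m → A) (i : Fin m) (hu : IsUnit (w i)) :
    VanishOn S A (lineOf w i hu) ↔ ∀ P ∈ S, MvPolynomial.aeval w P = 0 := by
  constructor
  · intro h P hP
    have := h P hP (toVec w) (Submodule.mem_span_singleton_self _)
    rwa [vecEquiv_toVec] at this
  · intro h P hP p hp
    obtain ⟨c, rfl⟩ := Submodule.mem_span_singleton.1 hp
    obtain ⟨d, hd⟩ := hS P hP
    rw [map_smul, vecEquiv_toVec, aeval_smul_of_mem c _ hd, h P hP, mul_zero]

end Homogeneous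

/-! ### The Plücker embedding -/

section Plucker

variable {k m : ℕ} {A B : Type} [CommRing A] [Algebra ℂ A] [CommRing B] [Algebra ℂ B]

/-- The minor of a matrix with rows `I`. -/
def minor (M : Matrix (Fin m) (Fin k) A) (I : Fin k → Fin m) : A := (M.submatrix I id).det

lemma minor_mul (M : Matrix (Fin m) (Fin k) A) (g : Matrix (Fin k) (Fin k) A) (I : Fin k → Fin m) :
    minor (M * g) I = minor M I * g.det := by
  rw [minor, minor, ← Matrix.det_mul]
  rfl

lemma minor_of_not_injective (M : Matrix (Fin m) (Fin k) A) {I : Fin k → Fin m}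
    (hI : ¬ Function.Injective I) : minor M I = 0 := by
  obtain ⟨a, b, hab, hne⟩ : ∃ a b, I a = I b ∧ a ≠ b := by
    simpa [Function.Injective] using hI
  exact Matrix.det_zero_of_row_eq hne (by ext; simp [hab])

lemma map_minor (f : A →ₐ[ℂ] B) (M : Matrix (Fin m) (Fin k) A) (I : Fin k → Fin m) :
    f (minor M I) = minor (M.map f) I := by
  rw [minor, minor, AlgHom.map_det]
  rfl

/-- The determinant with one row replaced is given by Cramer's rule, applied to the transposed
block. -/
lemma minor_update (M : Matrix (Fin m) (Fin k) A) (I : Fin k → Fin m) (b : Fin k) (i : Fin m) :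
    minor M (Function.update I b i) = (M * (M.submatrix I id).adjugate) i b := by
  have h1 : M.submatrix (Function.update I b i) id = (M.submatrix I id).updateRow b (M i) := by
    ext a c
    by_cases h : a = b
    · subst h; simp
    · simp [h]
  rw [minor, h1, ← Matrix.cramer_transpose_apply, Matrix.cramer_eq_adjugate_mulVec,
    ← Matrix.adjugate_transpose, Matrix.mulVec_transpose]
  rfl

/-- By `minor_update` the matrix is block `I` times the adjugate of block `I₀`, and the adjugate has
determinant `det^(k-1)`. This is the relation that `pluckerRel` records. -/
lemma det_minor_update (M : Matrix (Fin m) (Fin k) A) (I₀ I : Fin k → Fin m) :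
    (Matrix.of fun a b => minor M (Function.update I₀ b (I a))).det =
      minor M I₀ ^ (k - 1) * minor M I := by
  have h1 : (Matrix.of fun a b => minor M (Function.update I₀ b (I a))) =
      M.submatrix I id * (M.submatrix I₀ id).adjugate := by
    ext a b
    rw [Matrix.of_apply, minor_update]
    rfl
  rw [h1, Matrix.det_mul, Matrix.det_adjugate, Fintype.card_fin, mul_comm]
  rfl

/-- The number of Plücker coordinates. -/
def pluckerDim (k m : ℕ) : ℕ := m ^ k

/-- The numbering of the Plücker coordinates. -/
def idx (k m : ℕ) : (Fin k → Fin m) ≃ Fin (pluckerDim k m) := finFunctionFinEquiv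

lemma one_le_pluckerDim (hk : 1 ≤ k) (hkm : k ≤ m) : 1 ≤ pluckerDim k m :=
  Nat.one_le_pow _ _ (hk.trans hkm)

attribute [irreducible] pluckerDim

/-- The vector of Plücker coordinates of a matrix. -/
def plucker (M : Matrix (Fin m) (Fin k) A) : Fin (pluckerDim k m) → A := fun l => minor M ((idx k m).symm l)

@[simp] lemma plucker_idx (M : Matrix (Fin m) (Fin k) A) (I : Fin k → Fin m) :
    plucker M (idx k m I) = minor M I := by
  simp [plucker]

/-- The Plücker coordinate as a variable. -/
abbrev pluckerX (I : Fin k → Fin m) : MvPolynomial (Fin (pluckerDim k m)) ℂ := MvPolynomial.X (idx k m I)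

/-- The quadratic-type relation between Plücker coordinates. -/
def pluckerRel (I₀ I : Fin k → Fin m) : MvPolynomial (Fin (pluckerDim k m)) ℂ :=
  pluckerX I₀ ^ (k - 1) * pluckerX I -
    (Matrix.of fun a b => pluckerX (Function.update I₀ b (I a))).det

/-- The equations of the image of the Plücker embedding. -/
def pluckerEqs (k m : ℕ) : Set (MvPolynomial (Fin (pluckerDim k m)) ℂ) :=
  Set.range (fun p : (Fin k → Fin m) × (Fin k → Fin m) => pluckerRel p.1 p.2) ∪
    Set.image pluckerX {I : Fin k → Fin m | ¬ Function.Injective I}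

lemma pluckerEqs_homogeneous (hk : 1 ≤ k) :
    ∀ P ∈ pluckerEqs k m, ∃ d, P ∈ grading (pluckerDim k m) d := by
  rintro _ (⟨⟨I₀, I⟩, rfl⟩ | ⟨I, -, rfl⟩)
  · refine ⟨k, sub_mem ?_ ?_⟩
    · have := SetLike.mul_mem_graded (SetLike.pow_mem_graded (k - 1) (X_mem_grading (idx k m I₀)))
        (X_mem_grading (idx k m I))
      rwa [smul_eq_mul, mul_one, Nat.sub_add_cancel hk] at this
    · rw [Matrix.det_apply]
      refine sum_mem fun σ _ => ?_
      rw [Units.smul_def]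
      refine zsmul_mem ?_ _
      have := MvPolynomial.IsHomogeneous.prod Finset.univ
        (fun i => (Matrix.of fun a b => pluckerX (Function.update I₀ b (I a))) (σ i) i)
        (fun _ => 1) (fun i _ => X_mem_grading _)
      simpa using this
  · exact ⟨1, X_mem_grading _⟩

lemma aeval_pluckerRel (w : Fin (pluckerDim k m) → A) (I₀ I : Fin k → Fin m) :
    MvPolynomial.aeval w (pluckerRel I₀ I) = w (idx k m I₀) ^ (k - 1) * w (idx k m I) -
      (Matrix.of fun a b => w (idx k m (Function.update I₀ b (I a)))).det := by
  rw [pluckerRel, map_sub, map_mul, map_pow, MvPolynomial.aeval_X, MvPolynomial.aeval_X,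
    AlgHom.map_det]
  congr 2
  ext a b
  simp

lemma aeval_plucker (M : Matrix (Fin m) (Fin k) A) (P) (hP : P ∈ pluckerEqs k m) :
    MvPolynomial.aeval (plucker M) P = 0 := by
  rcases hP with (⟨⟨I₀, I⟩, rfl⟩ | ⟨I, hI, rfl⟩)
  · rw [aeval_pluckerRel]
    simp only [plucker_idx, det_minor_update, sub_self]
  · rw [MvPolynomial.aeval_X, plucker_idx, minor_of_not_injective M hI]

/-- A solution of the Plücker equations with a coordinate `1` comes from a matrix. -/
lemma exists_eq_plucker (w : Fin (pluckerDim k m) → A) (hw : ∀ P ∈ pluckerEqs k m, MvPolynomial.aeval w P = 0)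
    (I₀ : Fin k → Fin m) (h0 : w (idx k m I₀) = 1) :
    ∃ M : Matrix (Fin m) (Fin k) A, M.submatrix I₀ id = 1 ∧ w = plucker M := by
  -- When block `I₀` is the identity, entry `(i, b)` equals the minor with the `b`-th index of `I₀`
  -- replaced by `i`. The matrix is thus forced.
  refine ⟨Matrix.of fun i b => w (idx k m (Function.update I₀ b i)), ?_, ?_⟩
  · ext a b
    rw [Matrix.submatrix_apply, Matrix.of_apply, Matrix.one_apply]
    split_ifs with h
    · subst h
      rw [id, Function.update_eq_self, h0]
    -- Off the diagonal the index takes the value `I₀ a` twice, and such coordinates are among the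
    -- equations.
    · have h1 : ¬ Function.Injective (Function.update I₀ (id b) (I₀ a)) := by
        intro hinj
        refine h (hinj (a₁ := a) (a₂ := b) ?_)
        have : Function.update I₀ b (I₀ a) a = Function.update I₀ b (I₀ a) b := by
          rw [Function.update_of_ne h, Function.update_self]
        exact this
      have := hw _ (Or.inr ⟨_, h1, rfl⟩)
      rwa [MvPolynomial.aeval_X] at this
  · ext l
    obtain ⟨I, rfl⟩ := (idx k m).surjective l
    have := hw _ (Or.inl ⟨(I₀, I), rfl⟩)
    rw [aeval_pluckerRel, h0, one_pow, one_mul, sub_eq_zero] at this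
    rw [this, plucker_idx]
    rfl

/-- Matrices with proportional Plücker coordinates have the same column space. -/
lemma exists_mul_of_plucker {M M' : Matrix (Fin m) (Fin k) A} {I₀ I₁ : Fin k → Fin m}
    (hM : M.submatrix I₀ id = 1) (hM' : M'.submatrix I₁ id = 1) {c : A}
    (h : plucker M' = c • plucker M) : ∃ g : Matrix (Fin k) (Fin k) A, M = M' * g := by
  have h1 : ∀ I, minor M' I = c * minor M I := fun I => by
    rw [← plucker_idx, h, Pi.smul_apply, smul_eq_mul, plucker_idx]
  have hc : IsUnit c := by
    have := h1 I₁
    rw [minor, hM', Matrix.det_one] at this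
    exact IsUnit.of_mul_eq_one _ this.symm
  obtain ⟨u, hu⟩ := hc.exists_left_inv
  -- Cramer's rule for `M'` expresses its `I₀` minors through this adjugate. These minors are `c`
  -- times the entries of `M`, and `c` is a unit because the minor `I₁` of `M'` is `1`.
  refine ⟨u • (M'.submatrix I₀ id).adjugate, ?_⟩
  ext i b
  have h2 := minor_update M' I₀ b i
  have h3 := minor_update M I₀ b i
  rw [hM, Matrix.adjugate_one, Matrix.mul_one] at h3
  rw [h1, h3] at h2
  rw [Matrix.mul_smul, Matrix.smul_apply, ← h2, smul_eq_mul, ← mul_assoc, hu, one_mul]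

end Plucker

/-! ### Grassmannians as schemes -/

section GrScheme

variable {k m : ℕ} {A B : Type} [CommRing A] [Algebra ℂ A] [CommRing B] [Algebra ℂ B]

/-- The frame of a subbundle in a standard chart, as a matrix. -/
def chartMat (ε : Fin (m - k) ⊕ Fin k ≃ Fin m) (X : Fin (m - k) × Fin k → A) :
    Matrix (Fin m) (Fin k) A := Matrix.of fun l b => vecEquiv A m (chartFrame ε X b) l

lemma chartMat_submatrix (ε : Fin (m - k) ⊕ Fin k ≃ Fin m) (X : Fin (m - k) × Fin k → A) :
    (chartMat ε X).submatrix (ε ∘ Sum.inr) id = 1 := by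
  ext a b
  simp [chartMat, chartFrame, Matrix.one_apply]

lemma chartMat_map (f : A →ₐ[ℂ] B) (ε : Fin (m - k) ⊕ Fin k ≃ Fin m)
    (X : Fin (m - k) × Fin k → A) : (chartMat ε X).map f = chartMat ε (fun p => f (X p)) := by
  ext l b
  obtain ⟨l, rfl⟩ := ε.surjective l
  rcases l with i | j
  · simp [chartMat, chartFrame]
  · simp [chartMat, chartFrame, apply_ite f]

lemma exists_chartMat (ε : Fin (m - k) ⊕ Fin k ≃ Fin m) (M : Matrix (Fin m) (Fin k) A)
    (hM : M.submatrix (ε ∘ Sum.inr) id = 1) : ∃ X, M = chartMat ε X := by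
  refine ⟨fun p => - M (ε (Sum.inl p.1)) p.2, ?_⟩
  ext l b
  obtain ⟨l, rfl⟩ := ε.surjective l
  rcases l with i | j
  · simp [chartMat, chartFrame]
  · have := congrFun (congrFun hM j) b
    simpa [chartMat, chartFrame, Matrix.one_apply] using this

lemma chartPt_le_of_mul {ε ε' : Fin (m - k) ⊕ Fin k ≃ Fin m} {X Y : Fin (m - k) × Fin k → A}
    {g : Matrix (Fin k) (Fin k) A} (h : chartMat ε X = chartMat ε' Y * g) :
    (chartPt ε X).toSubmodule ≤ (chartPt ε' Y).toSubmodule := by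
  rw [chartPt_eq_span ε X, Submodule.span_le]
  rintro _ ⟨b, rfl⟩
  have : chartFrame ε X b = ∑ a, g a b • chartFrame ε' Y a := by
    apply (vecEquiv A m).injective
    ext l
    have := congrFun (congrFun h l) b
    rw [Matrix.mul_apply] at this
    simp only [map_sum, map_smul, Finset.sum_apply, Pi.smul_apply, smul_eq_mul]
    refine this.trans (Finset.sum_congr rfl fun a _ => mul_comm _ _)
  rw [this]
  exact Submodule.sum_mem _ fun a _ => Submodule.smul_mem _ _ (chartFrame_mem ε' Y a)

lemma exists_mul_of_chartPt_eq {ε ε' : Fin (m - k) ⊕ Fin k ≃ Fin m}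
    {X Y : Fin (m - k) × Fin k → A} (h : chartPt ε X = chartPt ε' Y) :
    ∃ g : Matrix (Fin k) (Fin k) A, chartMat ε X = chartMat ε' Y * g := by
  have h1 : ∀ b, ∃ c : Fin k → A, ∑ a, c a • chartFrame ε' Y a = chartFrame ε X b := fun b => by
    have := chartFrame_mem ε X b
    rw [h, chartPt_eq_span] at this
    exact (Submodule.mem_span_range_iff_exists_fun A).1 this
  choose c hc using h1
  refine ⟨Matrix.of fun a b => c b a, ?_⟩
  ext l b
  rw [Matrix.mul_apply]
  have := congrFun (congrArg (vecEquiv A m) (hc b)) l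
  simp only [map_sum, map_smul, Finset.sum_apply, Pi.smul_apply, smul_eq_mul] at this
  refine this.symm.trans (Finset.sum_congr rfl fun a _ => mul_comm _ _)

/-- The line of Plücker coordinates in a standard chart. -/
def pluckerLine (ε : Fin (m - k) ⊕ Fin k ≃ Fin m) (X : Fin (m - k) × Fin k → A) :
    Gr 1 (pluckerDim k m) A :=
  lineOf (plucker (chartMat ε X)) (idx k m (ε ∘ Sum.inr)) (by
    rw [plucker_idx, minor, chartMat_submatrix, Matrix.det_one]; exact isUnit_one)

lemma grMap_pluckerLine (f : A →ₐ[ℂ] B) (ε : Fin (m - k) ⊕ Fin k ≃ Fin m)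
    (X : Fin (m - k) × Fin k → A) :
    Gr.map f (pluckerLine ε X) = pluckerLine ε (fun p => f (X p)) := by
  refine (grMap_lineOf _ _ _ _).trans ?_
  have : (fun i => f (plucker (chartMat ε X) i)) = plucker (chartMat ε (fun p => f (X p))) := by
    ext l
    rw [plucker, map_minor, chartMat_map]
    rfl
  simp only [pluckerLine, this]

/-- Proportional minors make the frames differ by a matrix, so the column spaces agree. Conversely,
a change of frame multiplies all minors by its determinant. The Grassmannian and its image therefore
have the same gluing relations. -/
lemma pluckerLine_eq_iff {ε ε' : Fin (m - k) ⊕ Fin k ≃ Fin m} {X Y : Fin (m - k) × Fin k → A} :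
    pluckerLine ε X = pluckerLine ε' Y ↔ chartPt ε X = chartPt ε' Y := by
  rw [pluckerLine, pluckerLine, lineOf_eq_iff]
  constructor
  · rintro ⟨c, hc⟩
    obtain ⟨g, hg⟩ := exists_mul_of_plucker (chartMat_submatrix ε X) (chartMat_submatrix ε' Y) hc
    exact gr_eq_of_le (chartPt_le_of_mul hg)
  · intro h
    obtain ⟨g, hg⟩ := exists_mul_of_chartPt_eq h.symm
    refine ⟨g.det, funext fun l => ?_⟩
    rw [plucker, hg, minor_mul, mul_comm]
    rfl

/-- The coordinate ring of a standard chart of the Grassmannian. -/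
abbrev chartRing (k m : ℕ) : CommAlgCat.{0} ℂ :=
  CommAlgCat.of ℂ (MvPolynomial (Fin (m - k) × Fin k) ℂ)

lemma isChartCover_chartPt (hkm : k ≤ m) : IsChartCover (G := grFunctor k m)
    fun ε : Fin (m - k) ⊕ Fin k ≃ Fin m =>
      (chartPt ε MvPolynomial.X : Gr k m (chartRing k m)) := by
  intro A W 𝔭 h𝔭
  obtain ⟨h, hh, ε, X, hX⟩ := exists_chart hkm W 𝔭
  refine ⟨h, hh, ε, CommAlgCat.ofHom (MvPolynomial.aeval X), hX.trans ?_⟩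
  refine Eq.trans ?_ (grMap_chartPt (MvPolynomial.aeval X) ε _).symm
  simp only [MvPolynomial.aeval_X]

/-- With one coordinate `I₀` normalized to `1`, a solution consists of the minors of a matrix with
identity block. If `I₀` is not injective, this coordinate is also `0`; the localization is then the
zero ring, where any chart will do. -/
lemma exists_pluckerLine (hk : 1 ≤ k) (hkm : k ≤ m) {A : CommAlgCat.{0} ℂ} (L : Gr 1 (pluckerDim k m) A)
    (hL : VanishOn (pluckerEqs k m) A L) (𝔭 : Ideal A) (h𝔭 : 𝔭.IsPrime) :
    ∃ h ∉ 𝔭, ∃ (ε : Fin (m - k) ⊕ Fin k ≃ Fin m) (X : Fin (m - k) × Fin k → away A h),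
      (grFunctor 1 (pluckerDim k m)).map (loc A h) L = pluckerLine (A := away A h) ε X := by
  have hN := one_le_pluckerDim hk hkm
  obtain ⟨h, hh, l, w, hw, hLw⟩ := exists_lineOf hN L 𝔭
  obtain ⟨I₀, rfl⟩ := (idx k m).surjective l
  have h1 : VanishOn (pluckerEqs k m) (away A h) (Gr.map (locHom h) L) :=
    map_of_closedCondition (isClosedCondition_vanishOn hN (pluckerEqs_homogeneous hk)) (loc A h) hL
  rw [hLw] at h1
  have h2 := (vanishOn_lineOf_iff (pluckerEqs_homogeneous hk) (away A h) w _ _).1 h1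
  obtain ⟨M, hM, rfl⟩ := exists_eq_plucker w h2 I₀ hw
  by_cases hI : Function.Injective I₀
  · have hc : Fintype.card ((Set.range I₀)ᶜ : Set (Fin m)) = m - k := by
      classical
      rw [Fintype.card_compl_set, Fintype.card_fin, Set.card_range_of_injective hI,
        Fintype.card_fin]
    classical
    obtain ⟨ε, rfl⟩ : ∃ ε : Fin (m - k) ⊕ Fin k ≃ Fin m, ε ∘ Sum.inr = I₀ :=
      ⟨(((Fintype.equivFinOfCardEq hc).symm).sumCongr (Equiv.ofInjective I₀ hI)).trans
        ((Equiv.sumComm _ _).trans (Equiv.Set.sumCompl (Set.range I₀))), by ext b; simp⟩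
    obtain ⟨X, hX⟩ := exists_chartMat ε M hM
    subst hX
    exact ⟨h, hh, ε, X, hLw⟩
  · have h0 : (1 : Localization.Away h) = 0 := by
      rw [← hw, plucker_idx, minor_of_not_injective M hI]
    have : Subsingleton (Localization.Away h) := subsingleton_of_zero_eq_one h0.symm
    have e : Fin (m - k) ⊕ Fin k ≃ Fin m := finSumFinEquiv.trans (finCongr (by omega))
    refine ⟨h, hh, e, 0, ?_⟩
    apply gr_injective
    have : Subsingleton (Vec (Localization.Away h) (pluckerDim k m)) := Module.subsingleton (Localization.Away h) _
    exact Subsingleton.elim _ _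

lemma vanishOn_pluckerLine (hk : 1 ≤ k) {A : CommAlgCat.{0} ℂ} (ε : Fin (m - k) ⊕ Fin k ≃ Fin m)
    (X : Fin (m - k) × Fin k → A) : VanishOn (pluckerEqs k m) A (pluckerLine ε X) :=
  (vanishOn_lineOf_iff (pluckerEqs_homogeneous hk) A _ _ _).2 fun P hP => aeval_plucker _ P hP

attribute [irreducible] pluckerLine

/-- A closed condition on lines defines a scheme. -/
lemma exists_closed_of_lines {N : ℕ} (hN : 1 ≤ N) {V : ∀ A : CommAlgCat.{0} ℂ, Gr 1 N A → Prop}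
    (hV : IsClosedCondition (G := grFunctor 1 N) V) :
    ∃ (Z : SchemeC) (θ : points Z ⟶ grFunctor 1 N), (∀ A, Function.Injective (θ.app A)) ∧
      (∀ (A : CommAlgCat.{0} ℂ) (L : Gr 1 N A), V A L → ∃ z, θ.app A z = L) ∧
      ∀ (A : CommAlgCat.{0} ℂ) z, V A (θ.app A z) := by
  obtain ⟨e, -⟩ := exists_projOf_iso hN
  obtain ⟨Z, i, hZ⟩ := exists_isZeroLocus (hV.comp e.hom)
  refine ⟨Z, pointsMap i ≫ e.hom, fun A x y hxy => hZ.injective A (injective_iso_app e A hxy),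
    fun A L hL => ?_, fun A z => ?_⟩
  · obtain ⟨z, hz⟩ := (hZ.exists_iff A (e.inv.app A L)).2
      ((iff_of_eq (congrArg (V A) (iso_hom_inv_app e A L))).2 hL)
    exact ⟨z, (congrArg (e.hom.app A) hz).trans (iso_hom_inv_app e A L)⟩
  · exact (hZ.exists_iff A ((pointsMap i).app A z)).1 ⟨z, rfl⟩

/-- Two Zariski sheaves covered by the same affine spaces with the same gluing are isomorphic. -/
lemma nonempty_iso_grFunctor_of_plucker (hk : 1 ≤ k) (hkm : k ≤ m) {Z : SchemeC}
    (θ : points Z ⟶ grFunctor 1 (pluckerDim k m)) (hθ : ∀ A, Function.Injective (θ.app A))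
    (hV : ∀ (A : CommAlgCat.{0} ℂ) (L : Gr 1 (pluckerDim k m) A),
      VanishOn (pluckerEqs k m) A L → ∃ z, θ.app A z = L)
    (hV' : ∀ (A : CommAlgCat.{0} ℂ) z, VanishOn (pluckerEqs k m) A (θ.app A z)) :
    Nonempty (points Z ≅ grFunctor k m) := by
  have h1 : ∀ ε : Fin (m - k) ⊕ Fin k ≃ Fin m, ∃ u, θ.app (chartRing k m) u =
      (pluckerLine ε MvPolynomial.X : Gr 1 (pluckerDim k m) (chartRing k m)) := fun ε =>
    (hV (chartRing k m) (pluckerLine ε MvPolynomial.X))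
      (vanishOn_pluckerLine (A := chartRing k m) hk ε MvPolynomial.X)
  choose u hu using h1
  have hmap : ∀ (A : CommAlgCat.{0} ℂ) (f : chartRing k m ⟶ A) ε,
      θ.app A ((points Z).map f (u ε)) =
        (pluckerLine ε (fun p => f.hom (MvPolynomial.X p)) : Gr 1 (pluckerDim k m) A) := by
    intro A f ε
    refine (NatTrans.naturality_apply θ f (u ε)).trans ?_
    refine (congrArg ((grFunctor 1 (pluckerDim k m)).map f) (hu ε)).trans ?_
    exact grMap_pluckerLine f.hom ε _
  have hcov : IsChartCover u := by
    intro A x 𝔭 h𝔭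
    obtain ⟨h, hh, ε, X, hX⟩ := exists_pluckerLine hk hkm (A := A) (θ.app A x) (hV' A x) 𝔭 h𝔭
    have h1 : (grFunctor 1 (pluckerDim k m)).map (loc A h) (θ.app A x) =
        (pluckerLine ε X : Gr 1 (pluckerDim k m) (away A h)) := hX
    let f : chartRing k m ⟶ away A h := CommAlgCat.ofHom (MvPolynomial.aeval X)
    have h2 : (fun p => f.hom (MvPolynomial.X p)) = X :=
      funext fun p => MvPolynomial.aeval_X X p
    have h3 := hmap (away A h) f ε
    rw [h2] at h3
    have h4 := NatTrans.naturality_apply θ (loc A h) x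
    have h5 : θ.app (away A h) ((points Z).map f (u ε)) =
        (grFunctor 1 (pluckerDim k m)).map (loc A h) (θ.app A x) := by
      rw [h3]
      exact h1.symm
    have h6 : θ.app (away A h) ((points Z).map (loc A h) x) =
        θ.app (away A h) ((points Z).map f (u ε)) := by
      rw [h5]
      exact h4
    have h7 := hθ _ h6
    exact ⟨h, hh, ε, f, h7⟩
  have hiff : ∀ (ε ε' : Fin (m - k) ⊕ Fin k ≃ Fin m) (A : CommAlgCat.{0} ℂ)
      (f g : chartRing k m ⟶ A), (points Z).map f (u ε) = (points Z).map g (u ε') ↔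
      (grFunctor k m).map f (chartPt ε MvPolynomial.X : Gr k m (chartRing k m)) =
        (grFunctor k m).map g (chartPt ε' MvPolynomial.X : Gr k m (chartRing k m)) := by
    intro ε ε' A f g
    rw [← (hθ A).eq_iff]
    refine (Eq.congr (hmap A f ε) (hmap A g ε')).trans (pluckerLine_eq_iff.trans ?_)
    exact Eq.congr (grMap_chartPt f.hom ε _).symm (grMap_chartPt g.hom ε' _).symm
  obtain ⟨e', -⟩ := exists_iso_of_charts (isZariskiSheaf_points Z)
    (isZariskiSheaf_grFunctor (k := k) (m := m)) hcov (isChartCover_chartPt hkm) hiff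
  exact ⟨e'⟩

/-- The Grassmannian functor is represented by a scheme. -/
lemma exists_grassmannian (hk : 1 ≤ k) (hkm : k ≤ m) :
    ∃ Z : SchemeC, Nonempty (points Z ≅ grFunctor k m) := by
  have hN := one_le_pluckerDim hk hkm
  obtain ⟨Z, θ, hθ, hV, hV'⟩ := exists_closed_of_lines hN
    (isClosedCondition_vanishOn hN (pluckerEqs_homogeneous (m := m) hk))
  exact ⟨Z, nonempty_iso_grFunctor_of_plucker hk hkm θ hθ hV hV'⟩

end GrScheme

/-! ### Points of products and of flag varieties -/

section Products

variable {X Y : SchemeC} {A B : CommAlgCat.{0} ℂ}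

/-- The point of a product with given components. -/
def prodPt (x : (points X).obj A) (y : (points Y).obj A) : (points (X ⨯ Y)).obj A :=
  (Limits.prod.lift (show specC A ⟶ X from x) (show specC A ⟶ Y from y) : specC A ⟶ X ⨯ Y)

lemma fst_prodPt (x : (points X).obj A) (y : (points Y).obj A) :
    (pointsMap Limits.prod.fst).app A (prodPt x y) = x :=
  Limits.prod.lift_fst (show specC A ⟶ X from x) (show specC A ⟶ Y from y)

lemma snd_prodPt (x : (points X).obj A) (y : (points Y).obj A) :
    (pointsMap Limits.prod.snd).app A (prodPt x y) = y :=
  Limits.prod.lift_snd (show specC A ⟶ X from x) (show specC A ⟶ Y from y)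

lemma prod_point_ext {x y : (points (X ⨯ Y)).obj A}
    (h₁ : (pointsMap Limits.prod.fst).app A x = (pointsMap Limits.prod.fst).app A y)
    (h₂ : (pointsMap Limits.prod.snd).app A x = (pointsMap Limits.prod.snd).app A y) : x = y :=
  Limits.prod.hom_ext (f := (show specC A ⟶ X ⨯ Y from x)) h₁ h₂

end Products

lemma exists_iso_of_bijective {G H : CommAlgCat.{0} ℂ ⥤ Type} (θ : G ⟶ H)
    (hθ : ∀ A, Function.Bijective (θ.app A)) : ∃ e : G ≅ H, e.hom = θ := by
  obtain ⟨e, he⟩ := exists_iso_of_range_eq θ (𝟙 H) (fun A => (hθ A).1)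
    (fun A x y h => h) (fun A y => ⟨fun _ => ⟨y, rfl⟩, fun _ => (hθ A).2 y⟩)
  exact ⟨e, by rw [← he, Category.comp_id]⟩

/-- A bijective map of functors given on elements. -/
lemma nonempty_iso_of_bijective {G H : CommAlgCat.{0} ℂ ⥤ Type}
    (F : ∀ A : CommAlgCat.{0} ℂ, G.obj A → H.obj A)
    (hF : ∀ (A B : CommAlgCat.{0} ℂ) (f : A ⟶ B) (x : G.obj A),
      F B (G.map f x) = H.map f (F A x))
    (hb : ∀ A, Function.Bijective (F A)) : Nonempty (G ≅ H) := by
  let θ : G ⟶ H :=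
    { app := fun A => ↾(F A)
      naturality := fun A B f => ConcreteCategory.hom_ext _ _ fun x => hF A B f x }
  obtain ⟨e, -⟩ := exists_iso_of_bijective θ hb
  exact ⟨e⟩

/-- Inclusion means that functionals on the quotient by the larger subbundle kill the sections of
the smaller one, and these sections span after base change. -/
lemma isClosedCondition_le {G : CommAlgCat.{0} ℂ ⥤ Type} {k k' m : ℕ}
    (a : G ⟶ grFunctor k m) (b : G ⟶ grFunctor k' m) :
    IsClosedCondition (G := G) fun A x =>
      (show Gr k m A from a.app A x).toSubmodule ≤ (show Gr k' m A from b.app A x).toSubmodule := by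
  intro A x
  let W : Gr k m A := a.app A x
  let W' : Gr k' m A := b.app A x
  refine ⟨Ideal.span {t | ∃ w ∈ W.toSubmodule, ∃ φ : (Vec A m ⧸ W'.toSubmodule) →ₗ[A] A,
    φ (Submodule.Quotient.mk w) = t}, fun B f => ?_⟩
  have h1 : a.app B (G.map f x) = Gr.map f.hom W := NatTrans.naturality_apply a f x
  have h2 : b.app B (G.map f x) = Gr.map f.hom W' := NatTrans.naturality_apply b f x
  refine (iff_of_eq (congrArg₂ (fun (U : Gr k m B) (U' : Gr k' m B) =>
    U.toSubmodule ≤ U'.toSubmodule) h1 h2)).trans ?_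
  rw [Ideal.span_le, grMap_eq_span f.hom W, Submodule.span_le]
  constructor
  · rintro h _ ⟨w, hw, φ, rfl⟩
    exact (vecMap_mem_grMap_iff f.hom W' w).1 (h ⟨w, hw, rfl⟩) φ
  · rintro h _ ⟨w, hw, rfl⟩
    exact (vecMap_mem_grMap_iff f.hom W' w).2 fun φ => h ⟨w, hw, φ, rfl⟩

/-- The flag functor is represented by a scheme. -/
lemma exists_flagScheme {k₁ k₂ m : ℕ} (hk₁ : 1 ≤ k₁) (hkm₁ : k₁ ≤ m) (hk₂ : 1 ≤ k₂)
    (hkm₂ : k₂ ≤ m) : ∃ F : SchemeC, Nonempty (points F ≅ flagFunctor k₁ k₂ m) := by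
  obtain ⟨X₁, ⟨e₁⟩⟩ := exists_grassmannian hk₁ hkm₁
  obtain ⟨X₂, ⟨e₂⟩⟩ := exists_grassmannian hk₂ hkm₂
  let a : points (X₁ ⨯ X₂) ⟶ grFunctor k₁ m := pointsMap Limits.prod.fst ≫ e₁.hom
  let b : points (X₁ ⨯ X₂) ⟶ grFunctor k₂ m := pointsMap Limits.prod.snd ≫ e₂.hom
  obtain ⟨F, i, hF⟩ := exists_isZeroLocus (isClosedCondition_le a b)
  let θ : points F ⟶ flagFunctor k₁ k₂ m :=
    { app := fun A => ↾fun z => ⟨a.app A ((pointsMap i).app A z), b.app A ((pointsMap i).app A z),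
        (hF.exists_iff A _).1 ⟨z, rfl⟩⟩
      naturality := fun A B f => ConcreteCategory.hom_ext _ _ fun z => Flag.ext
        (NatTrans.naturality_apply (pointsMap i ≫ a) f z)
        (NatTrans.naturality_apply (pointsMap i ≫ b) f z) }
  have hθ : ∀ A, Function.Bijective (θ.app A) := by
    intro A
    constructor
    · intro x y hxy
      refine hF.injective A (prod_point_ext (injective_iso_app e₁ A ?_)
        (injective_iso_app e₂ A ?_))
      · exact congrArg Flag.W₁ hxy
      · exact congrArg Flag.W₂ hxy
    · intro W
      let x := prodPt (e₁.inv.app A W.W₁) (e₂.inv.app A W.W₂)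
      have h1 : a.app A x = W.W₁ :=
        (congrArg (e₁.hom.app A) (fst_prodPt _ _)).trans (iso_hom_inv_app e₁ A W.W₁)
      have h2 : b.app A x = W.W₂ :=
        (congrArg (e₂.hom.app A) (snd_prodPt _ _)).trans (iso_hom_inv_app e₂ A W.W₂)
      obtain ⟨z, hz⟩ := (hF.exists_iff A x).2 (by
        rw [h1, h2]; exact W.le)
      exact ⟨z, Flag.ext ((congrArg (a.app A) hz).trans h1) ((congrArg (b.app A) hz).trans h2)⟩
  obtain ⟨e, -⟩ := exists_iso_of_bijective θ hθ
  exact ⟨F, ⟨e⟩⟩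

/-! ### Inverse images of subbundles under linear maps -/

section Comap

variable {k k' m m' : ℕ} {A B : Type} [CommRing A] [Algebra ℂ A] [CommRing B] [Algebra ℂ B]

lemma baseChange_comp_apply {m₁ m₂ m₃ : ℕ} (ψ : (Fin m₂ → ℂ) →ₗ[ℂ] (Fin m₃ → ℂ))
    (φ : (Fin m₁ → ℂ) →ₗ[ℂ] (Fin m₂ → ℂ)) (v : Vec A m₁) :
    ψ.baseChange A (φ.baseChange A v) = (ψ ∘ₗ φ).baseChange A v := by
  rw [LinearMap.baseChange_comp]
  rfl

lemma baseChange_leftInverse {φ : (Fin m → ℂ) →ₗ[ℂ] (Fin m' → ℂ)}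
    {σ : (Fin m' → ℂ) →ₗ[ℂ] (Fin m → ℂ)} (h : φ ∘ₗ σ = LinearMap.id) (v : Vec A m') :
    φ.baseChange A (σ.baseChange A v) = v := by
  rw [baseChange_comp_apply, h, LinearMap.baseChange_id]
  rfl

lemma baseChange_surjective {φ : (Fin m → ℂ) →ₗ[ℂ] (Fin m' → ℂ)} (hφ : Function.Surjective φ) :
    Function.Surjective (φ.baseChange A) := by
  obtain ⟨σ, hσ⟩ := φ.exists_rightInverse_of_surjective (LinearMap.range_eq_top.2 hφ)
  exact fun v => ⟨_, baseChange_leftInverse hσ v⟩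

/-- The inverse image of a subbundle under a surjective linear map. -/
def grComap (φ : (Fin m → ℂ) →ₗ[ℂ] (Fin m' → ℂ)) (hφ : Function.Surjective φ)
    (hk : m' - k' = m - k) (L : Gr k' m' A) : Gr k m A :=
  grOfEquiv (L.toSubmodule.comap (φ.baseChange A))
    ((Submodule.quotEquivOfEq _ _ (by rw [LinearMap.ker_comp, Submodule.ker_mkQ])).trans
      (LinearMap.quotKerEquivOfSurjective (L.toSubmodule.mkQ ∘ₗ φ.baseChange A)
        ((Submodule.mkQ_surjective _).comp (baseChange_surjective hφ)))).symm
    (fun p => by rw [L.rankAtStalk_eq, hk])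

lemma mem_grComap {φ : (Fin m → ℂ) →ₗ[ℂ] (Fin m' → ℂ)} {hφ : Function.Surjective φ}
    {hk : m' - k' = m - k} {L : Gr k' m' A} {v : Vec A m} :
    v ∈ (grComap φ hφ hk L).toSubmodule ↔ φ.baseChange A v ∈ L.toSubmodule := Iff.rfl

lemma grMap_grComap (f : A →ₐ[ℂ] B) {φ : (Fin m → ℂ) →ₗ[ℂ] (Fin m' → ℂ)}
    {hφ : Function.Surjective φ} {hk : m' - k' = m - k} (L : Gr k' m' A) :
    Gr.map f (grComap φ hφ hk L) = grComap φ hφ hk (Gr.map f L) := by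
  refine grMap_eq_of_span (Submodule.span_eq _).symm fun v hv => ?_
  rw [mem_grComap, ← vecMap_baseChange]
  exact mem_grMap f L hv

lemma grComap_injective {φ : (Fin m → ℂ) →ₗ[ℂ] (Fin m' → ℂ)} {hφ : Function.Surjective φ}
    {hk : m' - k' = m - k} {L L' : Gr k' m' A} (h : grComap φ hφ hk L = grComap φ hφ hk L') :
    L = L' := by
  apply gr_eq_of_le
  intro v hv
  obtain ⟨w, rfl⟩ := baseChange_surjective (A := A) hφ v
  rw [← mem_grComap (hφ := hφ) (hk := hk), ← h, mem_grComap]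
  exact hv

/-- A subbundle containing the kernel is an inverse image. -/
lemma exists_eq_grComap {φ : (Fin m → ℂ) →ₗ[ℂ] (Fin m' → ℂ)} (hφ : Function.Surjective φ)
    (hk : m' - k' = m - k) (W : Gr k m A)
    (hW : LinearMap.ker (φ.baseChange A) ≤ W.toSubmodule) :
    ∃ L : Gr k' m' A, grComap φ hφ hk L = W := by
  let N := W.toSubmodule.map (φ.baseChange A)
  have hN : N.comap (φ.baseChange A) = W.toSubmodule := by
    rw [Submodule.comap_map_eq, sup_eq_left.2 hW]
  let e : (Vec A m ⧸ W.toSubmodule) ≃ₗ[A] (Vec A m' ⧸ N) :=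
    (Submodule.quotEquivOfEq _ _ (by rw [LinearMap.ker_comp, Submodule.ker_mkQ, hN])).trans
      (LinearMap.quotKerEquivOfSurjective (N.mkQ ∘ₗ φ.baseChange A)
        ((Submodule.mkQ_surjective _).comp (baseChange_surjective hφ)))
  refine ⟨grOfEquiv N e (fun p => by rw [W.rankAtStalk_eq, hk]), gr_injective hN⟩

end Comap

/-! ### The incidence functors -/

/-- Pairs of lines `(L, M)` in `A^m` and `A^q` such that `g` maps `M` into `L`. -/
@[ext] structure LinePair {m q : ℕ} (g : (Fin q → ℂ) →ₗ[ℂ] (Fin m → ℂ)) (A : Type) [CommRing A]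
    [Algebra ℂ A] where
  L : Gr 1 m A
  M : Gr 1 q A
  le : M.toSubmodule ≤ L.toSubmodule.comap (g.baseChange A)

section Incidence

variable {m q : ℕ}

lemma LinePair.mk_congr {g : (Fin q → ℂ) →ₗ[ℂ] (Fin m → ℂ)} {A : Type} [CommRing A] [Algebra ℂ A]
    {L L' : Gr 1 m A} {M M' : Gr 1 q A} (hL : L = L') (hM : M = M')
    (h : M.toSubmodule ≤ L.toSubmodule.comap (g.baseChange A))
    (h' : M'.toSubmodule ≤ L'.toSubmodule.comap (g.baseChange A)) :
    (⟨L, M, h⟩ : LinePair g A) = ⟨L', M', h'⟩ := by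
  subst hL hM
  rfl

lemma linePair_map_le {A B : Type} [CommRing A] [Algebra ℂ A] [CommRing B] [Algebra ℂ B]
    (f : A →ₐ[ℂ] B) {g : (Fin q → ℂ) →ₗ[ℂ] (Fin m → ℂ)} (x : LinePair g A) :
    (Gr.map f x.M).toSubmodule ≤ (Gr.map f x.L).toSubmodule.comap (g.baseChange B) := by
  rw [grMap_eq_span f x.M, Submodule.span_le]
  rintro _ ⟨v, hv, rfl⟩
  rw [SetLike.mem_coe, Submodule.mem_comap, ← vecMap_baseChange]
  exact mem_grMap f x.L (x.le hv)

/-- The functor of pairs of lines `(L, M)` such that `g` maps `M` into `L`. -/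
def linePairFunctor (g : (Fin q → ℂ) →ₗ[ℂ] (Fin m → ℂ)) : CommAlgCat.{0} ℂ ⥤ Type where
  obj A := LinePair g A
  map f := ↾fun x => ⟨Gr.map f.hom x.L, Gr.map f.hom x.M, linePair_map_le f.hom x⟩
  map_id A := ConcreteCategory.hom_ext _ _ fun x => LinePair.ext
    (Module.Grassmannian.map_id _ A x.L) (Module.Grassmannian.map_id _ A x.M)
  map_comp f g := ConcreteCategory.hom_ext _ _ fun x => LinePair.ext
    (Module.Grassmannian.map_comp _ f.hom g.hom x.L)
    (Module.Grassmannian.map_comp _ f.hom g.hom x.M)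

/-- The isomorphism of incidence functors given by an automorphism of `ℂ^q`. -/
lemma nonempty_linePair_iso {g g' : (Fin q → ℂ) →ₗ[ℂ] (Fin m → ℂ)}
    (h : (Fin q → ℂ) ≃ₗ[ℂ] (Fin q → ℂ)) (hg : g' = g ∘ₗ h.toLinearMap) :
    Nonempty (linePairFunctor g ≅ linePairFunctor g') := by
  subst hg
  have hle : ∀ (A : CommAlgCat.{0} ℂ) (x : LinePair g A),
      (grComap (k := 1) h.toLinearMap h.surjective rfl x.M).toSubmodule ≤
        x.L.toSubmodule.comap ((g ∘ₗ h.toLinearMap).baseChange A) := fun A x v hv => by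
    rw [Submodule.mem_comap, ← baseChange_comp_apply]
    exact x.le hv
  refine nonempty_iso_of_bijective
    (fun A (x : LinePair g A) => (⟨x.L, _, hle A x⟩ : LinePair (g ∘ₗ h.toLinearMap) A)) ?_ ?_
  · intro A B f x
    exact LinePair.mk_congr rfl (grMap_grComap f.hom (LinePair.M x)).symm _ _
  · intro A
    constructor
    · intro (x : LinePair g A) (y : LinePair g A) hxy
      obtain ⟨h1, h2⟩ := (LinePair.mk.injEq _ _ _ _ _ _).mp hxy
      exact LinePair.ext h1 (grComap_injective h2)
    · intro (y : LinePair (g ∘ₗ h.toLinearMap) A)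
      have hker : LinearMap.ker (h.toLinearMap.baseChange A) ≤ y.M.toSubmodule := by
        intro v hv
        have h1 : h.symm.toLinearMap ∘ₗ h.toLinearMap = LinearMap.id := by ext; simp
        rw [← baseChange_leftInverse h1 v, LinearMap.mem_ker.1 hv, map_zero]
        exact zero_mem _
      obtain ⟨M, hM⟩ := exists_eq_grComap h.surjective rfl y.M hker
      have hle : M.toSubmodule ≤ y.L.toSubmodule.comap (g.baseChange A) := by
        intro v hv
        obtain ⟨w, rfl⟩ := baseChange_surjective (A := A) h.surjective v
        have := y.le (x := w) (by rw [← hM]; exact hv)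
        rwa [Submodule.mem_comap, ← baseChange_comp_apply] at this
      exact ⟨(⟨y.L, M, hle⟩ : LinePair g A), LinePair.mk_congr rfl hM _ y.le⟩

/-- Flags whose larger member contains given constant vectors. -/
@[ext] structure FlagOver (k m : ℕ) {r : ℕ} (v : Fin r → Fin m → ℂ) (A : Type) [CommRing A]
    [Algebra ℂ A] where
  W : Flag 1 k m A
  mem : ∀ a, (1 : A) ⊗ₜ[ℂ] v a ∈ W.W₂.toSubmodule

lemma FlagOver.mk_congr {k m r : ℕ} {v : Fin r → Fin m → ℂ} {A : Type} [CommRing A] [Algebra ℂ A]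
    {W₁ W₁' : Gr 1 m A} {W₂ W₂' : Gr k m A} (h₁ : W₁ = W₁') (h₂ : W₂ = W₂')
    (h : W₁.toSubmodule ≤ W₂.toSubmodule) (hv : ∀ a, (1 : A) ⊗ₜ[ℂ] v a ∈ W₂.toSubmodule)
    (h' : W₁'.toSubmodule ≤ W₂'.toSubmodule) (hv' : ∀ a, (1 : A) ⊗ₜ[ℂ] v a ∈ W₂'.toSubmodule) :
    (⟨⟨W₁, W₂, h⟩, hv⟩ : FlagOver k m v A) = ⟨⟨W₁', W₂', h'⟩, hv'⟩ := by
  subst h₁ h₂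
  rfl

/-- The functor of flags whose larger member contains given constant vectors. -/
def flagOverFunctor (k m : ℕ) {r : ℕ} (v : Fin r → Fin m → ℂ) : CommAlgCat.{0} ℂ ⥤ Type where
  obj A := FlagOver k m v A
  map f := ↾fun x => ⟨Flag.map f.hom x.W, fun a => by
    have := mem_grMap f.hom x.W.W₂ (x.mem a)
    rwa [vecMap_tmul, map_one] at this⟩
  map_id A := ConcreteCategory.hom_ext _ _ fun x => FlagOver.ext <| Flag.ext
    (Module.Grassmannian.map_id _ A x.W.W₁) (Module.Grassmannian.map_id _ A x.W.W₂)
  map_comp f g := ConcreteCategory.hom_ext _ _ fun x => FlagOver.ext <| Flag.ext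
    (Module.Grassmannian.map_comp _ f.hom g.hom x.W.W₁)
    (Module.Grassmannian.map_comp _ f.hom g.hom x.W.W₂)

/-- The kernel of the base change of a surjective map. -/
lemma ker_baseChange_le {r : ℕ} {g : (Fin q → ℂ) →ₗ[ℂ] (Fin m → ℂ)} (hg : Function.Surjective g)
    {v : Fin r → Fin q → ℂ} (hv : LinearMap.ker g ≤ Submodule.span ℂ (Set.range v))
    {A : Type} [CommRing A] [Algebra ℂ A] {N : Submodule A (Vec A q)}
    (hN : ∀ a, (1 : A) ⊗ₜ[ℂ] v a ∈ N) : LinearMap.ker (g.baseChange A) ≤ N := by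
  obtain ⟨σ, hσ⟩ := g.exists_rightInverse_of_surjective (LinearMap.range_eq_top.2 hg)
  -- `w - σ (g w)` is the projection to the kernel: on pure tensors its second factor lies in `ker
  -- g`.
  have h1 : ∀ w : Vec A q, w - σ.baseChange A (g.baseChange A w) ∈ N := by
    intro w
    induction w using TensorProduct.induction_on with
    | zero => simp
    | tmul a x =>
      have h2 : ∀ y ∈ Submodule.span ℂ (Set.range v), ∀ a : A, a ⊗ₜ[ℂ] y ∈ N := by
        intro y hy a
        induction hy using Submodule.span_induction with
        | mem x hx =>
          obtain ⟨i, rfl⟩ := hx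
          have := N.smul_mem a (hN i)
          rwa [TensorProduct.smul_tmul', smul_eq_mul, mul_one] at this
        | zero => simp
        | add x y _ _ hx hy => rw [TensorProduct.tmul_add]; exact add_mem hx hy
        | smul c x _ hx =>
          rw [TensorProduct.tmul_smul, ← algebraMap_smul A c]
          exact N.smul_mem _ hx
      rw [LinearMap.baseChange_tmul, LinearMap.baseChange_tmul, ← TensorProduct.tmul_sub]
      refine h2 _ (hv ?_) a
      rw [LinearMap.mem_ker, map_sub, ← LinearMap.comp_apply g σ, hσ, LinearMap.id_apply, sub_self]
    | add x y hx hy =>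
      have : x + y - σ.baseChange A (g.baseChange A (x + y)) =
          (x - σ.baseChange A (g.baseChange A x)) + (y - σ.baseChange A (g.baseChange A y)) := by
        rw [map_add, map_add]; abel
      rw [this]
      exact add_mem hx hy
  intro w hw
  have := h1 w
  rwa [LinearMap.mem_ker.1 hw, map_zero, sub_zero] at this

/-- Flags over the kernel of a surjection `g` correspond to pairs of lines incident along `g`. -/
lemma nonempty_linePair_iso_flagOver {k r : ℕ} {g : (Fin q → ℂ) →ₗ[ℂ] (Fin m → ℂ)}
    (hg : Function.Surjective g) {v : Fin r → Fin q → ℂ}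
    (hv : LinearMap.ker g = Submodule.span ℂ (Set.range v)) (hk : m - 1 = q - k) :
    Nonempty (linePairFunctor g ≅ flagOverFunctor k q v) := by
  have hmem : ∀ (A : CommAlgCat.{0} ℂ) (x : LinePair g A) (a : Fin r),
      (1 : A) ⊗ₜ[ℂ] v a ∈ (grComap g hg hk x.L).toSubmodule := fun A x a => by
    have h1 : g (v a) = 0 := by
      rw [← LinearMap.mem_ker, hv]; exact Submodule.subset_span ⟨a, rfl⟩
    rw [mem_grComap, LinearMap.baseChange_tmul, h1, TensorProduct.tmul_zero]
    exact zero_mem _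
  -- The flag is `M ⊆ g⁻¹(L)`. Taking inverse images preserves the corank, which is why `hk` is an
  -- equation between coranks.
  refine nonempty_iso_of_bijective (fun A (x : LinePair g A) =>
    (⟨⟨x.M, grComap g hg hk x.L, x.le⟩, hmem A x⟩ : FlagOver k q v A)) ?_ ?_
  · intro A B f x
    exact FlagOver.mk_congr rfl (grMap_grComap f.hom (LinePair.L x)).symm _ _ _ _
  · intro A
    constructor
    · intro (x : LinePair g A) (y : LinePair g A) hxy
      obtain ⟨h1, h2⟩ := (Flag.mk.injEq _ _ _ _ _ _).mp ((FlagOver.mk.injEq _ _ _ _).mp hxy)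
      exact LinePair.ext (grComap_injective h2) h1
    · intro (y : FlagOver k q v A)
      obtain ⟨L, hL⟩ := exists_eq_grComap (A := A) hg hk y.W.W₂
        (ker_baseChange_le hg hv.le y.mem)
      have hle : y.W.W₁.toSubmodule ≤ (grComap g hg hk L).toSubmodule := by
        rw [hL]; exact y.W.le
      exact ⟨(⟨L, y.W.W₁, hle⟩ : LinePair g A), FlagOver.mk_congr rfl hL _ _ y.W.le y.mem⟩

end Incidence

/-! ### Linear embeddings on points -/

section LinearEmbedding

open HomogeneousLocalization

variable {k m : ℕ}

lemma fromZero_eq_mk {s : MvPolynomial (Fin m) ℂ} {d : ℕ} (hs : s ∈ grading m d) (c : ℂ) :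
    fromZeroRingHom (grading m) (Submonoid.powers s) (algebraMap ℂ (grading m 0) c) =
      Away.mk (grading m) hs 0 (MvPolynomial.C c)
        (by rw [zero_smul]; exact MvPolynomial.isHomogeneous_C _ c) := by
  apply val_injective
  rw [val_fromZero, Away.val_mk, ← Localization.mk_one_eq_algebraMap]
  congr 1

lemma awayι_linearEmbedding_hom (j : (Fin k → ℂ) →ₗ[ℂ] (Fin m → ℂ)) (hj : Function.Injective j)
    {d : ℕ} (hd : 0 < d) (s : MvPolynomial (Fin m) ℂ) (hs : s ∈ grading m d) :
    Proj.awayι (grading k) (substGraded j s) ((substGraded j).2 hs) hd ≫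
      (Proj.map (substGraded j) (irrelevant_le_map_substGraded j hj) ≫ Proj.toSpecZero (grading m) ≫
        Spec.map (CommRingCat.ofHom (algebraMap ℂ (grading m 0)))) =
    Proj.awayι (grading k) (substGraded j s) ((substGraded j).2 hs) hd ≫
      (Proj.toSpecZero (grading k) ≫
        Spec.map (CommRingCat.ofHom (algebraMap ℂ (grading k 0)))) := by
  have h1 := Proj.awayι_comp_map (substGraded j) (irrelevant_le_map_substGraded j hj) hd s hs
  rw [reassoc_of% h1, Proj.awayι_toSpecZero_assoc, Proj.awayι_toSpecZero_assoc, ← Spec.map_comp,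
    ← Spec.map_comp, ← Spec.map_comp]
  congr 1
  refine CommRingCat.hom_ext (RingHom.ext fun c => ?_)
  change Away.map (substGraded j) _ (fromZeroRingHom (grading m) _ (algebraMap ℂ (grading m 0) c)) =
    fromZeroRingHom (grading k) _ (algebraMap ℂ (grading k 0) c)
  have h2 : substGraded j s ∈ grading k d := subst_isHomogeneous j hs
  rw [fromZero_eq_mk hs, Away.map_mk]
  refine Eq.trans ?_ (fromZero_eq_mk h2 c).symm
  congr 1
  exact MvPolynomial.algHom_C _ c

lemma linearEmbedding_hom (j : (Fin k → ℂ) →ₗ[ℂ] (Fin m → ℂ)) (hj : Function.Injective j) :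
    linearEmbedding j hj ≫ (projOf m).hom = (projOf k).hom := by
  refine (Proj.mapAffineOpenCover (substGraded j)
    (irrelevant_le_map_substGraded j hj)).openCover.hom_ext _ _ fun s => ?_
  exact awayι_linearEmbedding_hom j hj s.1.2 s.2.1 s.2.2

/-- The linear embedding as a morphism over `ℂ`. -/
def linearEmbeddingC (j : (Fin k → ℂ) →ₗ[ℂ] (Fin m → ℂ)) (hj : Function.Injective j) :
    projOf k ⟶ projOf m := Over.homMk (linearEmbedding j hj) (linearEmbedding_hom j hj)

variable {A : CommAlgCat.{0} ℂ}

lemma aeval_subst (j : (Fin k → ℂ) →ₗ[ℂ] (Fin m → ℂ)) (w : Fin k → A)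
    (P : MvPolynomial (Fin m) ℂ) : MvPolynomial.aeval w (subst j P) =
      MvPolynomial.aeval (vecEquiv A m (j.baseChange A (toVec w))) P := by
  have : (MvPolynomial.aeval w).comp (subst j) =
      (MvPolynomial.aeval (vecEquiv A m (j.baseChange A (toVec w))) :
        MvPolynomial (Fin m) ℂ →ₐ[ℂ] A) := by
    apply MvPolynomial.algHom_ext
    intro l
    rw [AlgHom.comp_apply, subst, MvPolynomial.aeval_X, MvPolynomial.aeval_X, map_sum]
    have h1 : toVec w = ∑ a, w a ⊗ₜ[ℂ] (Pi.single a 1 : Fin k → ℂ) := by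
      apply (vecEquiv A k).injective
      ext i
      simp [Pi.single_apply]
    rw [h1, map_sum, map_sum, Finset.sum_apply]
    refine Finset.sum_congr rfl fun a _ => ?_
    rw [map_mul, MvPolynomial.aeval_C, MvPolynomial.aeval_X, LinearMap.baseChange_tmul,
      vecEquiv_tmul, Algebra.smul_def]
  exact AlgHom.congr_fun this P

/-- The pullback of `X_l` is a linear form with unit value at `w`, so by `projPt_indep` it may
replace `X_i` as denominator. The embedding is then an explicit map of charts. -/
lemma linearEmbeddingC_coordPt (j : (Fin k → ℂ) →ₗ[ℂ] (Fin m → ℂ)) (hj : Function.Injective j)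
    (w : Fin k → A) (i : Fin k) (hu : IsUnit (w i)) (l : Fin m)
    (hu' : IsUnit (vecEquiv A m (j.baseChange A (toVec w)) l)) :
    (pointsMap (linearEmbeddingC j hj)).app A (coordPt w i hu) =
      coordPt (vecEquiv A m (j.baseChange A (toVec w))) l hu' := by
  have ht : substGraded j (MvPolynomial.X l) ∈ grading k 1 := subst_isHomogeneous j (X_mem_grading l)
  have hs : ∀ P, MvPolynomial.aeval w (substGraded j P) =
      MvPolynomial.aeval (vecEquiv A m (j.baseChange A (toVec w))) P := aeval_subst j w
  have hut : IsUnit (MvPolynomial.aeval w (substGraded j (MvPolynomial.X l))) := by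
    rwa [hs, MvPolynomial.aeval_X]
  have hul : IsUnit (MvPolynomial.aeval (vecEquiv A m (j.baseChange A (toVec w)))
      (MvPolynomial.X l : MvPolynomial (Fin m) ℂ)) := by
    rwa [MvPolynomial.aeval_X]
  have h1 : coordPt w i hu = projPt w ht one_pos hut := projPt_indep _ _ _ _ _ _ _
  rw [h1]
  apply Over.OverMorphism.ext
  have h2 : (awayEval w (substGraded j (MvPolynomial.X l)) hut).comp
      (Away.map (substGraded j) (MvPolynomial.X l)) = awayEval _ _ hul := by
    refine eq_awayEval_of_forall (X_mem_grading l) fun n a ha => ?_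
    rw [RingHom.comp_apply, Away.map_mk, ← hs, ← hs]
    exact awayEval_mk w hut ht n _ _
  change (Spec.map (CommRingCat.ofHom (awayEval w _ hut)) ≫ Proj.awayι (grading k) _ ht one_pos) ≫
    Proj.map (substGraded j) (irrelevant_le_map_substGraded j hj) =
    Spec.map (CommRingCat.ofHom (awayEval _ _ hul)) ≫ Proj.awayι (grading m) _ (X_mem_grading l) one_pos
  rw [← h2, CommRingCat.ofHom_comp, Spec.map_comp, Category.assoc, Category.assoc]
  congr 1
  exact Proj.awayι_comp_map (substGraded j) (irrelevant_le_map_substGraded j hj) one_pos _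
    (X_mem_grading l)

end LinearEmbedding

/-! ### Split exact sequences and subbundles of a constant subbundle -/

/-- A split short exact sequence `0 ⟶ ℂ^k ⟶ ℂ^m ⟶ ℂ^p ⟶ 0`. -/
structure Splitting (k p m : ℕ) where
  j : (Fin k → ℂ) →ₗ[ℂ] (Fin m → ℂ)
  ℓ : (Fin m → ℂ) →ₗ[ℂ] (Fin k → ℂ)
  π : (Fin m → ℂ) →ₗ[ℂ] (Fin p → ℂ)
  σ : (Fin p → ℂ) →ₗ[ℂ] (Fin m → ℂ)
  ℓ_j : ℓ ∘ₗ j = LinearMap.id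
  π_σ : π ∘ₗ σ = LinearMap.id
  π_j : π ∘ₗ j = 0
  ℓ_σ : ℓ ∘ₗ σ = 0
  sum : j ∘ₗ ℓ + σ ∘ₗ π = LinearMap.id

/-- The cokernel of `j` is identified with `ℂ^p` by dimension, and `σ` is a section of the
projection. The retraction `ℓ` is `x ↦ x - σ (π x)`, read in the image of `j`. -/
lemma exists_splitting {k p m : ℕ} (j : (Fin k → ℂ) →ₗ[ℂ] (Fin m → ℂ))
    (hj : Function.Injective j) (h : k + p = m) : ∃ S : Splitting k p m, S.j = j := by
  have hd : Module.finrank ℂ ((Fin m → ℂ) ⧸ LinearMap.range j) = p := by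
    have h1 := Submodule.finrank_quotient_add_finrank (LinearMap.range j)
    rw [LinearMap.finrank_range_of_inj hj, Module.finrank_fin_fun, Module.finrank_fin_fun] at h1
    omega
  let e : ((Fin m → ℂ) ⧸ LinearMap.range j) ≃ₗ[ℂ] (Fin p → ℂ) :=
    LinearEquiv.ofFinrankEq _ _ (by rw [hd, Module.finrank_fin_fun])
  let π := e.toLinearMap ∘ₗ (LinearMap.range j).mkQ
  have hπ : Function.Surjective π := e.surjective.comp (Submodule.mkQ_surjective _)
  have hker : LinearMap.ker π = LinearMap.range j := by
    rw [LinearMap.ker_comp, LinearEquiv.ker]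
    exact Submodule.ker_mkQ _
  obtain ⟨σ, hσ⟩ := π.exists_rightInverse_of_surjective (LinearMap.range_eq_top.2 hπ)
  let τ : (Fin m → ℂ) →ₗ[ℂ] (Fin m → ℂ) := LinearMap.id - σ ∘ₗ π
  have hmem : ∀ x, τ x ∈ LinearMap.range j := by
    intro x
    have : π (σ (π x)) = π x := LinearMap.congr_fun hσ (π x)
    rw [← hker, LinearMap.mem_ker, LinearMap.sub_apply, map_sub, LinearMap.comp_apply σ, this]
    simp
  let ℓ := (LinearEquiv.ofInjective j hj).symm.toLinearMap ∘ₗ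
    τ.codRestrict (LinearMap.range j) hmem
  have hjℓ : ∀ x, j (ℓ x) = x - σ (π x) := fun x => by
    have := (LinearEquiv.ofInjective j hj).apply_symm_apply
      (τ.codRestrict (LinearMap.range j) hmem x)
    exact congrArg Subtype.val this
  have hπj : ∀ x, π (j x) = 0 := fun x => by
    rw [← LinearMap.mem_ker, hker]; exact ⟨x, rfl⟩
  refine ⟨⟨j, ℓ, π, σ, ?_, hσ, LinearMap.ext hπj, ?_, ?_⟩, rfl⟩
  · ext1 x
    refine LinearMap.ext fun y => hj ?_
    simp [hjℓ, hπj]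
  · refine LinearMap.ext fun y => hj ?_
    have : π (σ y) = y := LinearMap.congr_fun hσ y
    rw [LinearMap.comp_apply, hjℓ, this, sub_self]
    simp
  · refine LinearMap.ext fun y => ?_
    rw [LinearMap.add_apply, LinearMap.comp_apply, hjℓ]
    simp

namespace Splitting

variable {k p m : ℕ} (S : Splitting k p m) {A B : Type} [CommRing A] [Algebra ℂ A] [CommRing B]
  [Algebra ℂ B]

lemma π_surjective : Function.Surjective S.π := fun y => ⟨S.σ y, LinearMap.congr_fun S.π_σ y⟩

lemma ker_π : LinearMap.ker S.π = LinearMap.range S.j := by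
  ext x
  constructor
  · intro hx
    refine ⟨S.ℓ x, ?_⟩
    have := LinearMap.congr_fun S.sum x
    rwa [LinearMap.add_apply, LinearMap.comp_apply S.σ, LinearMap.mem_ker.1 hx, map_zero,
      add_zero] at this
  · rintro ⟨y, rfl⟩
    exact LinearMap.congr_fun S.π_j y

lemma ℓ_j_apply (v : Vec A k) : S.ℓ.baseChange A (S.j.baseChange A v) = v :=
  baseChange_leftInverse S.ℓ_j v

lemma π_σ_apply (v : Vec A p) : S.π.baseChange A (S.σ.baseChange A v) = v :=
  baseChange_leftInverse S.π_σ v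

lemma π_j_apply (v : Vec A k) : S.π.baseChange A (S.j.baseChange A v) = 0 := by
  rw [baseChange_comp_apply, S.π_j, LinearMap.baseChange_zero]
  rfl

lemma ℓ_σ_apply (v : Vec A p) : S.ℓ.baseChange A (S.σ.baseChange A v) = 0 := by
  rw [baseChange_comp_apply, S.ℓ_σ, LinearMap.baseChange_zero]
  rfl

lemma sum_apply (v : Vec A m) :
    S.j.baseChange A (S.ℓ.baseChange A v) + S.σ.baseChange A (S.π.baseChange A v) = v := by
  rw [baseChange_comp_apply, baseChange_comp_apply, ← LinearMap.add_apply,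
    ← LinearMap.baseChange_add, S.sum, LinearMap.baseChange_id]
  rfl

/-- The surjection `A^m ⟶ A^k ⧸ W × A^p`. -/
def toProd (W : Submodule A (Vec A k)) : Vec A m →ₗ[A] (Vec A k ⧸ W) × (Fin p → A) :=
  (W.mkQ ∘ₗ S.ℓ.baseChange A).prod ((vecEquiv A p).toLinearMap ∘ₗ S.π.baseChange A)

lemma toProd_surjective (W : Submodule A (Vec A k)) : Function.Surjective (S.toProd W) := by
  rintro ⟨q, y⟩
  obtain ⟨w, rfl⟩ := Submodule.mkQ_surjective _ q
  refine ⟨S.j.baseChange A w + S.σ.baseChange A (toVec y), ?_⟩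
  simp only [toProd, LinearMap.prod_apply, Function.prod_apply, LinearMap.comp_apply, map_add,
    S.ℓ_j_apply, S.ℓ_σ_apply, S.π_j_apply, S.π_σ_apply, map_zero]
  rw [Prod.mk_add_mk, add_zero, zero_add]
  exact congrArg _ (vecEquiv_toVec y)

lemma mem_ker_toProd (W : Submodule A (Vec A k)) (v : Vec A m) :
    v ∈ LinearMap.ker (S.toProd W) ↔ S.ℓ.baseChange A v ∈ W ∧ S.π.baseChange A v = 0 := by
  rw [LinearMap.mem_ker, toProd, LinearMap.prod_apply, Function.prod_apply, Prod.mk_eq_zero]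
  exact and_congr (Submodule.Quotient.mk_eq_zero W) (LinearEquiv.map_eq_zero_iff (vecEquiv A p))

/-- The image of a line of `A^k` in `A^m`. -/
def push (hk : 1 ≤ k) (hm : k + p = m) (W : Gr 1 k A) : Gr 1 m A :=
  grOfEquiv (LinearMap.ker (S.toProd W.toSubmodule))
    ((S.toProd W.toSubmodule).quotKerEquivOfSurjective (S.toProd_surjective _)).symm (fun q => by
      have : Nontrivial A := PrimeSpectrum.nontrivial q
      rw [Module.rankAtStalk_prod, Pi.add_apply, rankAtStalk_fun (Fintype.card_fin p),
        W.rankAtStalk_eq]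
      omega)

lemma mem_push {hk : 1 ≤ k} {hm : k + p = m} {W : Gr 1 k A} {v : Vec A m} :
    v ∈ (S.push hk hm W).toSubmodule ↔
      S.ℓ.baseChange A v ∈ W.toSubmodule ∧ S.π.baseChange A v = 0 :=
  S.mem_ker_toProd _ _

lemma j_mem_push {hk : 1 ≤ k} {hm : k + p = m} {W : Gr 1 k A} {v : Vec A k} :
    S.j.baseChange A v ∈ (S.push hk hm W).toSubmodule ↔ v ∈ W.toSubmodule := by
  rw [S.mem_push, S.ℓ_j_apply, S.π_j_apply]
  simp

lemma push_injective {hk : 1 ≤ k} {hm : k + p = m} {W W' : Gr 1 k A}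
    (h : S.push hk hm W = S.push hk hm W') : W = W' := by
  refine gr_eq_of_le fun v hv => ?_
  rw [← S.j_mem_push (hk := hk) (hm := hm)] at hv ⊢
  rwa [← h]

lemma grMap_push (f : A →ₐ[ℂ] B) {hk : 1 ≤ k} {hm : k + p = m} (W : Gr 1 k A) :
    Gr.map f (S.push hk hm W) = S.push hk hm (Gr.map f W) := by
  refine grMap_eq_of_span (Submodule.span_eq _).symm fun v hv => ?_
  obtain ⟨h1, h2⟩ := S.mem_push.1 hv
  rw [S.mem_push, ← vecMap_baseChange, ← vecMap_baseChange, h2, map_zero]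
  exact ⟨mem_grMap f W h1, rfl⟩

/-- On vectors killed by `π` the composite `j ∘ ℓ` is the identity, so `M` is recovered from its
inverse image `N`. The isomorphism `A^m ⧸ M ≃ A^k ⧸ N × A^p` makes `A^k ⧸ N` projective of the right
rank. -/
lemma exists_eq_push (hk : 1 ≤ k) (hm : k + p = m) (M : Gr 1 m A)
    (hM : M.toSubmodule ≤ LinearMap.ker (S.π.baseChange A)) :
    ∃ W, S.push hk hm W = M := by
  let N := M.toSubmodule.comap (S.j.baseChange A)
  have h1 : LinearMap.ker (S.toProd N) = M.toSubmodule := by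
    ext v
    rw [S.mem_ker_toProd, Submodule.mem_comap]
    have h2 := S.sum_apply v
    constructor
    · rintro ⟨h3, h4⟩
      rw [h4, map_zero, add_zero] at h2
      rwa [h2] at h3
    · intro hv
      have h4 : S.π.baseChange A v = 0 := hM hv
      rw [h4, map_zero, add_zero] at h2
      rw [h2]
      exact ⟨hv, h4⟩
  let e : (Vec A m ⧸ M.toSubmodule) ≃ₗ[A] (Vec A k ⧸ N) × (Fin p → A) :=
    (Submodule.quotEquivOfEq _ _ h1.symm).trans
      ((S.toProd N).quotKerEquivOfSurjective (S.toProd_surjective _))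
  have hproj : Module.Projective A ((Vec A k ⧸ N) × (Fin p → A)) := Module.Projective.of_equiv e
  have hproj' : Module.Projective A (Vec A k ⧸ N) :=
    Module.Projective.of_split (LinearMap.inl A _ (Fin p → A)) (LinearMap.fst A _ _)
      (LinearMap.fst_comp_inl _ _ _)
  have hfin : Module.Finite A (Vec A k ⧸ N) := inferInstance
  refine ⟨grOfEquiv N (LinearEquiv.refl A _) (fun q => ?_), gr_injective h1⟩
  have : Nontrivial A := PrimeSpectrum.nontrivial q
  have h2 := congrFun (Module.rankAtStalk_eq_of_equiv e) q
  rw [Module.rankAtStalk_prod, Pi.add_apply, rankAtStalk_fun (Fintype.card_fin p),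
    M.rankAtStalk_eq] at h2
  omega

/-- The map of functors of lines induced by the inclusion. -/
def pushMap (hk : 1 ≤ k) (hm : k + p = m) : grFunctor 1 k ⟶ grFunctor 1 m where
  app _ := ↾fun W => S.push hk hm W
  naturality _ _ f := ConcreteCategory.hom_ext _ _ fun W => (S.grMap_push (hk := hk) (hm := hm) f.hom W).symm

end Splitting

/-! ### The linear embedding as a zero locus -/

section EmbeddingLocus

variable {k p m : ℕ}

/-- The image of a coordinate vector need not have a unit coordinate. Its coordinates do generate
the unit ideal, since `ℓ` recovers the unit `w i` from them. Hence the comparison may be made on the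
localizations at these coordinates. -/
lemma pointsMap_linearEmbeddingC (S : Splitting k p m) (hj : Function.Injective S.j) (hk : 1 ≤ k)
    (hm : k + p = m) (e' : points (projOf k) ≅ grFunctor 1 k)
    (he' : ∀ (A : CommAlgCat.{0} ℂ) (w : Fin k → A) (i : Fin k) (hu : IsUnit (w i)),
      e'.hom.app A (coordPt w i hu) = lineOf w i hu)
    (e : points (projOf m) ≅ grFunctor 1 m)
    (he : ∀ (A : CommAlgCat.{0} ℂ) (w : Fin m → A) (i : Fin m) (hu : IsUnit (w i)),
      e.hom.app A (coordPt w i hu) = lineOf w i hu) :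
    pointsMap (linearEmbeddingC S.j hj) ≫ e.hom = e'.hom ≫ S.pushMap hk hm := by
  have hunit : ∀ (A : CommAlgCat.{0} ℂ) (w : Fin k → A) (i : Fin k) (hu : IsUnit (w i)) (l : Fin m)
      (_ : IsUnit (vecEquiv A m (S.j.baseChange A (toVec w)) l)),
      (pointsMap (linearEmbeddingC S.j hj) ≫ e.hom).app A (coordPt w i hu) =
        (e'.hom ≫ S.pushMap hk hm).app A (coordPt w i hu) := by
    intro A w i hu l hu'
    refine (congrArg (e.hom.app A) (linearEmbeddingC_coordPt S.j hj w i hu l hu')).trans ?_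
    rw [he]
    refine Eq.trans ?_ (congrArg ((S.pushMap hk hm).app A) (he' A w i hu)).symm
    refine gr_eq_of_le (W' := S.push hk hm (lineOf w i hu)) ?_
    rw [lineOf_toSubmodule, Submodule.span_singleton_le_iff_mem, toVec_vecEquiv, S.j_mem_push]
    exact Submodule.mem_span_singleton_self _
  have hall : ∀ (A : CommAlgCat.{0} ℂ) (w : Fin k → A) (i : Fin k) (hu : IsUnit (w i)),
      (pointsMap (linearEmbeddingC S.j hj) ≫ e.hom).app A (coordPt w i hu) =
        (e'.hom ≫ S.pushMap hk hm).app A (coordPt w i hu) := by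
    intro A w i hu
    let I := Ideal.span (Set.range (vecEquiv A m (S.j.baseChange A (toVec w))))
    have hI : I = ⊤ := by
      refine Ideal.eq_top_of_isUnit_mem _ (?_ : w i ∈ I) hu
      have h1 : ∀ v : Vec A m, (∀ l, vecEquiv A m v l ∈ I) →
          vecEquiv A k (S.ℓ.baseChange A v) i ∈ I := by
        intro v hv
        have h2 : v = ∑ l, vecEquiv A m v l • (1 : A) ⊗ₜ[ℂ] (Pi.single l 1 : Fin m → ℂ) := by
          apply (vecEquiv A m).injective
          ext i
          simp [Pi.single_apply]
        rw [h2, map_sum, map_sum, Finset.sum_apply]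
        refine sum_mem fun l _ => ?_
        rw [map_smul, map_smul, Pi.smul_apply, smul_eq_mul]
        exact Ideal.mul_mem_right _ _ (hv l)
      have h2 := h1 _ fun l => Ideal.subset_span ⟨l, rfl⟩
      rwa [S.ℓ_j_apply, vecEquiv_toVec] at h2
    refine (isZariskiSheaf_grFunctor (k := 1) (m := m)).sep A _ hI _ _ ?_
    rintro _ ⟨l, rfl⟩
    rw [← NatTrans.naturality_apply, ← NatTrans.naturality_apply, map_coordPt]
    refine hunit _ _ i _ l ?_
    have h3 : toVec (fun i => (loc A (vecEquiv A m (S.j.baseChange A (toVec w)) l)).hom (w i)) =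
        vecMap (locHom (vecEquiv A m (S.j.baseChange A (toVec w)) l)) k (toVec w) :=
      (vecMap_toVec _ _).symm
    rw [h3, ← vecMap_baseChange, vecEquiv_vecMap]
    exact locHom_self_isUnit _
  exact natTrans_ext_of_charts isChartCover_coordPt isZariskiSheaf_grFunctor fun i => hall _ _ i _

lemma IsZeroLocus.of_iso {Z Z' X : SchemeC} {i : Z ⟶ X} {i' : Z' ⟶ X}
    {V : ∀ A : CommAlgCat.{0} ℂ, (points X).obj A → Prop} (h : IsZeroLocus i V) (f : Z' ≅ Z)
    (hf : f.hom ≫ i = i') : IsZeroLocus i' V := by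
  subst hf
  have := h.isClosedImmersion
  have h1 : IsIso f.hom.left := inferInstanceAs (IsIso ((Over.forget _).map f.hom))
  refine ⟨inferInstanceAs (IsClosedImmersion (f.hom.left ≫ i.left)), fun A x => ?_⟩
  rw [← h.exists_iff A x]
  constructor
  · rintro ⟨z, rfl⟩
    exact ⟨(pointsMap f.hom).app A z, Category.assoc (show specC A ⟶ Z' from z) f.hom i⟩
  · rintro ⟨z, rfl⟩
    refine ⟨(pointsMap f.inv).app A z, ?_⟩
    rw [pointsMap_app, pointsMap_app, pointsMap_app]
    exact (Category.assoc (show specC A ⟶ Z from z) f.inv (f.hom ≫ i)).trans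
      (congrArg (fun t => (show specC A ⟶ Z from z) ≫ t) (f.inv_hom_id_assoc i))

/-- A morphism with the same points as a zero locus is that zero locus. -/
lemma isZeroLocus_of_points {Z X : SchemeC} {i : Z ⟶ X}
    {V : ∀ A : CommAlgCat.{0} ℂ, (points X).obj A → Prop} (hV : IsClosedCondition V)
    (hi : ∀ A, Function.Injective ((pointsMap i).app A))
    (h : ∀ (A : CommAlgCat.{0} ℂ) (x : (points X).obj A),
      (∃ z, (pointsMap i).app A z = x) ↔ V A x) : IsZeroLocus i V := by
  obtain ⟨Z', i', hi'⟩ := exists_isZeroLocus hV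
  obtain ⟨e, he⟩ := exists_iso_of_range_eq (pointsMap i) (pointsMap i') hi hi'.injective
    (fun A x => (h A x).trans (hi'.exists_iff A x).symm)
  obtain ⟨f, hf⟩ := exists_iso_of_points_iso e
  refine hi'.of_iso f (pointsMap_injective ?_)
  rw [pointsMap_comp, hf, he]

/-- The lines killed by the linear map `g`. -/
def Killed (g : (Fin m → ℂ) →ₗ[ℂ] (Fin p → ℂ)) (A : CommAlgCat.{0} ℂ) (W : Gr 1 m A) : Prop :=
  W.toSubmodule ≤ LinearMap.ker (g.baseChange A)

lemma isClosedCondition_killed (g : (Fin m → ℂ) →ₗ[ℂ] (Fin p → ℂ)) :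
    IsClosedCondition (G := grFunctor 1 m) (Killed g) := by
  intro A (W : Gr 1 m A)
  refine ⟨Ideal.span {t | ∃ w ∈ W.toSubmodule, ∃ l, vecEquiv A p (g.baseChange A w) l = t},
    fun B f => ?_⟩
  change (Gr.map f.hom W).toSubmodule ≤ LinearMap.ker (g.baseChange B) ↔ _
  rw [grMap_eq_span, Submodule.span_le, Ideal.span_le]
  constructor
  · rintro h _ ⟨w, hw, l, rfl⟩
    have := h ⟨w, hw, rfl⟩
    rw [SetLike.mem_coe, LinearMap.mem_ker, ← vecMap_baseChange] at this
    have h2 := congrFun (congrArg (vecEquiv B p) this) l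
    rw [vecEquiv_vecMap, map_zero] at h2
    exact h2
  · rintro h _ ⟨w, hw, rfl⟩
    rw [SetLike.mem_coe, LinearMap.mem_ker, ← vecMap_baseChange]
    apply (vecEquiv B p).injective
    ext l
    rw [vecEquiv_vecMap, map_zero]
    exact h ⟨w, hw, l, rfl⟩

lemma exists_iso_push (S : Splitting k p m) (hj : Function.Injective S.j) (hk : 1 ≤ k)
    (hm : k + p = m) (e : points (projOf m) ≅ grFunctor 1 m)
    (he : ∀ (A : CommAlgCat.{0} ℂ) (w : Fin m → A) (i : Fin m) (hu : IsUnit (w i)),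
      e.hom.app A (coordPt w i hu) = lineOf w i hu) :
    ∃ e' : points (projOf k) ≅ grFunctor 1 k,
      ∀ (A : CommAlgCat.{0} ℂ) (z : (points (projOf k)).obj A),
        e.hom.app A ((pointsMap (linearEmbeddingC S.j hj)).app A z) =
          (S.push hk hm (e'.hom.app A z) : Gr 1 m A) := by
  obtain ⟨e', he'⟩ := exists_projOf_iso hk
  refine ⟨e', fun A z => ?_⟩
  have hmain := NatTrans.congr_app (pointsMap_linearEmbeddingC S hj hk hm e' he' e he) A
  exact ConcreteCategory.congr_hom hmain z

/-- The linear embedding is the zero locus of the equations of its image. -/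
lemma isZeroLocus_linearEmbeddingC (S : Splitting k p m) (hj : Function.Injective S.j) (hk : 1 ≤ k)
    (hm : k + p = m) (e : points (projOf m) ≅ grFunctor 1 m)
    (he : ∀ (A : CommAlgCat.{0} ℂ) (w : Fin m → A) (i : Fin m) (hu : IsUnit (w i)),
      e.hom.app A (coordPt w i hu) = lineOf w i hu) :
    IsZeroLocus (linearEmbeddingC S.j hj) fun A x => Killed S.π A (e.hom.app A x) := by
  obtain ⟨e', happ⟩ := exists_iso_push S hj hk hm e he
  refine isZeroLocus_of_points ((isClosedCondition_killed S.π).comp e.hom) (fun A x y hxy => ?_)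
    fun A x => ⟨?_, fun h => ?_⟩
  · have h1 := congrArg (e.hom.app A) hxy
    rw [happ, happ] at h1
    exact injective_iso_app e' A (S.push_injective h1)
  · rintro ⟨z, rfl⟩
    have : Killed S.π A (S.push hk hm (e'.hom.app A z) : Gr 1 m A) := fun v hv => (S.mem_push.1 hv).2
    rw [← happ] at this
    exact this
  · obtain ⟨W, hW⟩ := S.exists_eq_push (A := A) hk hm _ h
    refine ⟨e'.inv.app A W, injective_iso_app e A ?_⟩
    rw [happ]
    exact (congrArg (S.push hk hm) (iso_hom_inv_app e' A W)).trans hW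

end EmbeddingLocus

/-! ### Constant sections and their zero loci -/

section ConstSections

/-- The section of `𝒬₂^{⊕ r}` given by constant vectors. -/
def constSection (k₁ k₂ : ℕ) {m r : ℕ} (v : Fin r → Fin m → ℂ) : sectionsQuot k₁ k₂ m r :=
  ⟨fun A _ a => Submodule.Quotient.mk ((1 : A) ⊗ₜ v a), fun A B f W a => by
    rw [quotMap_mk, vecMap_tmul, map_one]⟩

/-- The section of `𝒬(0,1)` given by a linear map. -/
def linSection {p q : ℕ} (g : (Fin (q + 1) → ℂ) →ₗ[ℂ] (Fin (p + 1) → ℂ)) :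
    sectionsTwistedQuot p q :=
  ⟨fun A L M => L.toSubmodule.mkQ ∘ₗ g.baseChange A ∘ₗ M.toSubmodule.subtype,
    fun A B f L M v => by
      simp only [LinearMap.comp_apply, Submodule.mkQ_apply, quotMap_mk, Submodule.subtype_apply,
        subMap, vecMap_baseChange]⟩

lemma constSection_eq_zero_iff {k₁ k₂ m r : ℕ} (v : Fin r → Fin m → ℂ) (A : CommAlgCat.{0} ℂ)
    (W : Flag k₁ k₂ m A) : (constSection k₁ k₂ v).1 A W = 0 ↔
      ∀ a, (1 : A) ⊗ₜ[ℂ] v a ∈ W.W₂.toSubmodule := by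
  rw [funext_iff]
  exact forall_congr' fun a => Submodule.Quotient.mk_eq_zero _

lemma linSection_eq_zero_iff {p q : ℕ} (g : (Fin (q + 1) → ℂ) →ₗ[ℂ] (Fin (p + 1) → ℂ))
    (A : CommAlgCat.{0} ℂ) (L : Gr 1 (p + 1) A) (M : Gr 1 (q + 1) A) :
    (linSection g).1 A L M = 0 ↔ M.toSubmodule ≤ L.toSubmodule.comap (g.baseChange A) := by
  constructor
  · intro h v hv
    exact (Submodule.Quotient.mk_eq_zero L.toSubmodule).1 (LinearMap.congr_fun h ⟨v, hv⟩)
  · intro h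
    ext v
    exact (Submodule.Quotient.mk_eq_zero _).2 (h v.2)

lemma isClosedCondition_constSection {k₁ k₂ m r : ℕ} (v : Fin r → Fin m → ℂ) :
    IsClosedCondition (G := flagFunctor k₁ k₂ m) fun A W => (constSection k₁ k₂ v).1 A W = 0 := by
  intro A (W : Flag k₁ k₂ m A)
  refine ⟨Ideal.span {t | ∃ a, ∃ φ : (Vec A m ⧸ W.W₂.toSubmodule) →ₗ[A] A,
    φ (Submodule.Quotient.mk (1 ⊗ₜ v a)) = t}, fun B f => ?_⟩
  change (constSection k₁ k₂ v).1 B (Flag.map f.hom W) = 0 ↔ _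
  rw [constSection_eq_zero_iff, Ideal.span_le]
  have h1 : ∀ a, (1 : B) ⊗ₜ[ℂ] v a ∈ (Flag.map f.hom W).W₂.toSubmodule ↔
      ∀ φ : (Vec A m ⧸ W.W₂.toSubmodule) →ₗ[A] A,
        f.hom (φ (Submodule.Quotient.mk (1 ⊗ₜ v a))) = 0 := fun a => by
    rw [← vecMap_mem_grMap_iff, vecMap_tmul, map_one]
  constructor
  · rintro h _ ⟨a, φ, rfl⟩
    exact (h1 a).1 (h a) φ
  · exact fun h a => (h1 a).2 fun φ => h ⟨a, φ, rfl⟩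

/-- Incidence of lines along a linear map. -/
def Incident {m q : ℕ} (g : (Fin q → ℂ) →ₗ[ℂ] (Fin m → ℂ)) (A : CommAlgCat.{0} ℂ) (L : Gr 1 m A)
    (M : Gr 1 q A) : Prop :=
  M.toSubmodule ≤ L.toSubmodule.comap (g.baseChange A)

lemma isClosedCondition_incident {m q : ℕ} (g : (Fin q → ℂ) →ₗ[ℂ] (Fin m → ℂ))
    {G : CommAlgCat.{0} ℂ ⥤ Type} (a : G ⟶ grFunctor 1 m) (b : G ⟶ grFunctor 1 q) :
    IsClosedCondition (G := G) fun A x => Incident g A (a.app A x) (b.app A x) := by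
  intro A x
  let L : Gr 1 m A := a.app A x
  let M : Gr 1 q A := b.app A x
  refine ⟨Ideal.span {t | ∃ w ∈ M.toSubmodule, ∃ φ : (Vec A m ⧸ L.toSubmodule) →ₗ[A] A,
    φ (Submodule.Quotient.mk (g.baseChange A w)) = t}, fun B f => ?_⟩
  have h1 : a.app B (G.map f x) = Gr.map f.hom L := NatTrans.naturality_apply a f x
  have h2 : b.app B (G.map f x) = Gr.map f.hom M := NatTrans.naturality_apply b f x
  refine (iff_of_eq (congrArg₂ (Incident g B) h1 h2)).trans ?_
  rw [Incident, grMap_eq_span f.hom M, Submodule.span_le, Ideal.span_le]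
  have h3 : ∀ w, vecMap f.hom q w ∈ (Gr.map f.hom L).toSubmodule.comap (g.baseChange B) ↔
      ∀ φ : (Vec A m ⧸ L.toSubmodule) →ₗ[A] A,
        f.hom (φ (Submodule.Quotient.mk (g.baseChange A w))) = 0 := fun w => by
    rw [Submodule.mem_comap, ← vecMap_baseChange, vecMap_mem_grMap_iff]
  constructor
  · rintro h _ ⟨w, hw, φ, rfl⟩
    exact (h3 w).1 (h ⟨w, hw, rfl⟩) φ
  · rintro h _ ⟨w, hw, rfl⟩
    exact (h3 w).2 fun φ => h ⟨w, hw, φ, rfl⟩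

/-- The zero locus of a constant section. -/
lemma exists_isZeroLocusQuot {k m r : ℕ} {F : SchemeC} (e : points F ≅ flagFunctor 1 k m)
    (v : Fin r → Fin m → ℂ) : ∃ (Z : SchemeC) (i : Z ⟶ F),
      IsZeroLocusQuot e (constSection 1 k v) i ∧ Nonempty (points Z ≅ flagOverFunctor k m v) := by
  obtain ⟨Z, i, hi⟩ := exists_isZeroLocus ((isClosedCondition_constSection v).comp e.hom)
  refine ⟨Z, i, hi, ?_⟩
  have hmem : ∀ (A : CommAlgCat.{0} ℂ) (z : (points Z).obj A) (a : Fin r),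
      (1 : A) ⊗ₜ[ℂ] v a ∈ (Flag.W₂ (e.hom.app A ((pointsMap i).app A z))).toSubmodule :=
    fun A z => (constSection_eq_zero_iff v A _).1 ((hi.exists_iff A _).1 ⟨z, rfl⟩)
  let θ : points Z ⟶ flagOverFunctor k m v :=
    { app := fun A => ↾fun z => ⟨e.hom.app A ((pointsMap i).app A z), hmem A z⟩
      naturality := fun A B f => ConcreteCategory.hom_ext _ _ fun z => FlagOver.ext
        (NatTrans.naturality_apply (pointsMap i ≫ e.hom) f z) }
  have hθ : ∀ A, Function.Bijective (θ.app A) := by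
    intro A
    constructor
    · intro z z' h
      exact hi.injective A (injective_iso_app e A (congrArg FlagOver.W h))
    · intro (y : FlagOver k m v A)
      have h1 : e.hom.app A (e.inv.app A y.W) = y.W := iso_hom_inv_app e A y.W
      obtain ⟨z, hz⟩ := (hi.exists_iff A (e.inv.app A y.W)).2 (by
        rw [h1]
        exact (constSection_eq_zero_iff v A _).2 y.mem)
      exact ⟨z, FlagOver.ext ((congrArg (e.hom.app A) hz).trans h1)⟩
  obtain ⟨E, -⟩ := exists_iso_of_bijective θ hθ
  exact ⟨E⟩

/-- The zero locus of the section given by a linear map. -/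
lemma exists_incidence {m q : ℕ} {X Y : SchemeC} (e₁ : points X ≅ grFunctor 1 m)
    (e₂ : points Y ≅ grFunctor 1 q) (g : (Fin q → ℂ) →ₗ[ℂ] (Fin m → ℂ)) :
    ∃ (Z : SchemeC) (i : Z ⟶ X ⨯ Y),
      (IsZeroLocus i fun A x => Incident g A
        (e₁.hom.app A ((pointsMap Limits.prod.fst).app A x))
        (e₂.hom.app A ((pointsMap Limits.prod.snd).app A x))) ∧
      ∃ E : points Z ≅ linePairFunctor g, ∀ (A : CommAlgCat.{0} ℂ) (z : (points Z).obj A),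
        LinePair.L (E.hom.app A z) =
          e₁.hom.app A ((pointsMap Limits.prod.fst).app A ((pointsMap i).app A z)) ∧
        LinePair.M (E.hom.app A z) =
          e₂.hom.app A ((pointsMap Limits.prod.snd).app A ((pointsMap i).app A z)) := by
  let a : points (X ⨯ Y) ⟶ grFunctor 1 m := pointsMap Limits.prod.fst ≫ e₁.hom
  let b : points (X ⨯ Y) ⟶ grFunctor 1 q := pointsMap Limits.prod.snd ≫ e₂.hom
  obtain ⟨Z, i, hi⟩ := exists_isZeroLocus (isClosedCondition_incident g a b)
  refine ⟨Z, i, hi, ?_⟩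
  have hle : ∀ (A : CommAlgCat.{0} ℂ) (z : (points Z).obj A), Incident g A
      (a.app A ((pointsMap i).app A z)) (b.app A ((pointsMap i).app A z)) :=
    fun A z => (hi.exists_iff A _).1 ⟨z, rfl⟩
  let θ : points Z ⟶ linePairFunctor g :=
    { app := fun A => ↾fun z => ⟨a.app A ((pointsMap i).app A z), b.app A ((pointsMap i).app A z),
        hle A z⟩
      naturality := fun A B f => ConcreteCategory.hom_ext _ _ fun z => LinePair.ext
        (NatTrans.naturality_apply (pointsMap i ≫ a) f z)
        (NatTrans.naturality_apply (pointsMap i ≫ b) f z) }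
  have hθ : ∀ A, Function.Bijective (θ.app A) := by
    intro A
    constructor
    · intro x y hxy
      refine hi.injective A (prod_point_ext (injective_iso_app e₁ A ?_)
        (injective_iso_app e₂ A ?_))
      · exact congrArg LinePair.L hxy
      · exact congrArg LinePair.M hxy
    · intro (W : LinePair g A)
      let x := prodPt (e₁.inv.app A W.L) (e₂.inv.app A W.M)
      have h1 : a.app A x = W.L :=
        (congrArg (e₁.hom.app A) (fst_prodPt _ _)).trans (iso_hom_inv_app e₁ A W.L)
      have h2 : b.app A x = W.M :=
        (congrArg (e₂.hom.app A) (snd_prodPt _ _)).trans (iso_hom_inv_app e₂ A W.M)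
      obtain ⟨z, hz⟩ := (hi.exists_iff A x).2 (by
        rw [h1, h2]; exact W.le)
      exact ⟨z, LinePair.ext ((congrArg (a.app A) hz).trans h1) ((congrArg (b.app A) hz).trans h2)⟩
  obtain ⟨E, hE⟩ := exists_iso_of_bijective θ hθ
  refine ⟨E, fun A z => ?_⟩
  rw [hE]
  exact ⟨rfl, rfl⟩

/-- The zero locus of the section given by a linear map. -/
lemma exists_isZeroLocusTwistedQuot {p q : ℕ} {X Y : SchemeC}
    (e₁ : points X ≅ grFunctor 1 (p + 1)) (e₂ : points Y ≅ grFunctor 1 (q + 1))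
    (g : (Fin (q + 1) → ℂ) →ₗ[ℂ] (Fin (p + 1) → ℂ)) : ∃ (Z : SchemeC) (i : Z ⟶ X ⨯ Y),
      IsZeroLocusTwistedQuot e₁ e₂ (linSection g) i ∧ Nonempty (points Z ≅ linePairFunctor g) := by
  obtain ⟨Z, i, hi, E, -⟩ := exists_incidence e₁ e₂ g
  refine ⟨Z, i, ⟨hi.isClosedImmersion, fun A x => ?_⟩, ⟨E⟩⟩
  rw [hi.exists_iff A x]
  exact (linSection_eq_zero_iff g A _ _).symm

end ConstSections

/-! ### Charts of the incidence functor -/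

section IncidenceCharts

variable {r P m : ℕ} (S : Splitting r P m) {A B : Type} [CommRing A] [Algebra ℂ A] [CommRing B]
  [Algebra ℂ B]

/-- A local generator has a coordinate that is invertible near `𝔭`; in the local ring this says that
the coordinate avoids `𝔭`. -/
lemma exists_coord_notMem (hm : 1 ≤ m) (L : Gr 1 m A) (𝔭 : Ideal A) [𝔭.IsPrime] :
    ∃ v ∈ L.toSubmodule, ∃ i, vecEquiv A m v i ∉ 𝔭 := by
  obtain ⟨h, hh, v, hv, i, hu, -⟩ := exists_local_generator hm L 𝔭
  refine ⟨v, hv, i, fun hi => ?_⟩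
  have h1 : IsUnit (algebraMap A (Localization.AtPrime 𝔭) h) :=
    (IsLocalization.AtPrime.isUnit_to_map_iff (Localization.AtPrime 𝔭) 𝔭 h).2 hh
  have h2 := hu.map (IsLocalization.Away.lift (S := Localization.Away h) h h1)
  have h3 : IsLocalization.Away.lift (S := Localization.Away h) h h1
      (locHom h (vecEquiv A m v i)) = algebraMap A (Localization.AtPrime 𝔭) (vecEquiv A m v i) :=
    IsLocalization.Away.lift_eq h h1 _
  rw [h3, IsLocalization.AtPrime.isUnit_to_map_iff (Localization.AtPrime 𝔭) 𝔭] at h2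
  exact h2 hi

/-- The vector with adapted coordinates `t` with respect to the generator `g` of a line. -/
def pairVec (g : Fin P → A) (t : Option (Fin r) → A) : Vec A m :=
  S.j.baseChange A (toVec fun k => t (some k)) + S.σ.baseChange A (t none • toVec g)

lemma ℓ_pairVec (g : Fin P → A) (t : Option (Fin r) → A) :
    S.ℓ.baseChange A (pairVec S g t) = toVec fun k => t (some k) := by
  rw [pairVec, map_add, S.ℓ_j_apply, S.ℓ_σ_apply, add_zero]

lemma π_pairVec (g : Fin P → A) (t : Option (Fin r) → A) :
    S.π.baseChange A (pairVec S g t) = t none • toVec g := by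
  rw [pairVec, map_add, S.π_j_apply, S.π_σ_apply, zero_add]

lemma pairVec_smul (c : A) (g : Fin P → A) (t : Option (Fin r) → A) :
    pairVec S g (c • t) = c • pairVec S g t := by
  rw [pairVec, pairVec, smul_add, ← map_smul, ← map_smul, smul_smul]
  congr 2
  exact map_smul (vecEquiv A r).symm c fun k => t (some k)

lemma vecMap_pairVec (f : A →ₐ[ℂ] B) (g : Fin P → A) (t : Option (Fin r) → A) :
    vecMap f m (pairVec S g t) = pairVec S (fun i => f (g i)) (fun k => f (t k)) := by
  rw [pairVec, map_add, vecMap_baseChange, vecMap_baseChange, vecMap_smul, vecMap_toVec,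
    vecMap_toVec]
  rfl

/-- The functional extracting an adapted coordinate. -/
def pairCoord (A : Type) [CommRing A] [Algebra ℂ A] (a : Fin P) : Option (Fin r) → (Vec A m →ₗ[A] A)
  | some k => LinearMap.proj k ∘ₗ (vecEquiv A r).toLinearMap ∘ₗ S.ℓ.baseChange A
  | none => LinearMap.proj a ∘ₗ (vecEquiv A P).toLinearMap ∘ₗ S.π.baseChange A

lemma pairCoord_pairVec {a : Fin P} {g : Fin P → A} (hg : g a = 1) (t : Option (Fin r) → A)
    (κ : Option (Fin r)) : pairCoord S A a κ (pairVec S g t) = t κ := by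
  cases κ with
  | some k =>
    change vecEquiv A r (S.ℓ.baseChange A (pairVec S g t)) k = t (some k)
    rw [ℓ_pairVec, vecEquiv_toVec]
  | none =>
    change vecEquiv A P (S.π.baseChange A (pairVec S g t)) a = t none
    rw [π_pairVec, map_smul, vecEquiv_toVec, Pi.smul_apply, hg, smul_eq_mul, mul_one]

/-- The pair of incident lines with given adapted coordinates. -/
def linePairOf {a : Fin P} {κ : Option (Fin r)} (g : Fin P → A) (t : Option (Fin r) → A)
    (hg : g a = 1) (ht : t κ = 1) : LinePair S.π A where
  L := lineOf g a (by rw [hg]; exact isUnit_one)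
  M := grOfUnimodular (pairVec S g t) (pairCoord S A a κ) ((pairCoord_pairVec S hg t κ).trans ht)
  le := by
    rw [grOfUnimodular_toSubmodule, Submodule.span_singleton_le_iff_mem, Submodule.mem_comap,
      π_pairVec, lineOf_toSubmodule]
    exact Submodule.smul_mem _ _ (Submodule.mem_span_singleton_self _)

lemma map_linePairOf (f : A →ₐ[ℂ] B) {a : Fin P} {κ : Option (Fin r)} (g : Fin P → A)
    (t : Option (Fin r) → A) (hg : g a = 1) (ht : t κ = 1) :
    (⟨Gr.map f (linePairOf S g t hg ht).L, Gr.map f (linePairOf S g t hg ht).M,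
      linePair_map_le f _⟩ : LinePair S.π B) =
      linePairOf S (a := a) (κ := κ) (fun i => f (g i)) (fun k => f (t k))
        (by rw [hg, map_one]) (by rw [ht, map_one]) := by
  refine LinePair.ext (grMap_lineOf f g a (by rw [hg]; exact isUnit_one)) ?_
  refine grMap_eq_of_span rfl ?_
  rintro _ rfl
  rw [vecMap_pairVec]
  exact Submodule.mem_span_singleton_self _

/-- Each line determines its generator up to a factor, and the normalizations at `a` and `κ` force
this factor to be `1`. -/
lemma linePairOf_injective {a : Fin P} {κ : Option (Fin r)} {g g' : Fin P → A}
    {t t' : Option (Fin r) → A} {hg : g a = 1} {ht : t κ = 1} {hg' : g' a = 1} {ht' : t' κ = 1}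
    (h : linePairOf S g t hg ht = linePairOf S g' t' hg' ht') : g = g' ∧ t = t' := by
  have hgg : g = g' := by
    have hL : lineOf g a (by rw [hg]; exact isUnit_one) =
        lineOf g' a (by rw [hg']; exact isUnit_one) := congrArg LinePair.L h
    obtain ⟨c, hc⟩ := lineOf_eq_iff.1 hL
    have : c = 1 := by
      have := congrFun hc a
      rw [Pi.smul_apply, hg, hg', smul_eq_mul, mul_one] at this
      exact this.symm
    rw [hc, this, one_smul]
  refine ⟨hgg, ?_⟩
  subst hgg
  have h1 : pairVec S g t' ∈ (linePairOf S g t hg ht).M.toSubmodule := by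
    rw [h]; exact Submodule.mem_span_singleton_self _
  obtain ⟨c, hc⟩ := Submodule.mem_span_singleton.1 h1
  have h2 : ∀ k, c * t k = t' k := fun k => by
    rw [← pairCoord_pairVec S hg t k, ← pairCoord_pairVec S hg t' k, ← hc, map_smul, smul_eq_mul]
  have hc1 : c = 1 := by
    have := h2 κ
    rwa [ht, ht', mul_one] at this
  ext k
  rw [← h2, hc1, one_mul]

/-- Every pair of incident lines locally has adapted coordinates. -/
lemma exists_linePairOf (hP : 1 ≤ P) (hm : 1 ≤ m) (x : LinePair S.π A) (𝔭 : Ideal A) [𝔭.IsPrime] :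
    ∃ h ∉ 𝔭, ∃ (a : Fin P) (κ : Option (Fin r)) (g : Fin P → Localization.Away h)
      (t : Option (Fin r) → Localization.Away h) (hg : g a = 1) (ht : t κ = 1),
      (⟨Gr.map (locHom h) x.L, Gr.map (locHom h) x.M, linePair_map_le (locHom h) x⟩ :
        LinePair S.π (Localization.Away h)) = linePairOf S g t hg ht := by
  obtain ⟨w, hw, a, ha⟩ := exists_coord_notMem hP x.L 𝔭
  obtain ⟨v, hv, i, hi⟩ := exists_coord_notMem hm x.M 𝔭
  -- Otherwise all coordinates of `v = j (ℓ v) + σ (π v)` would lie in `𝔭`.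
  have h3 : (∃ k, vecEquiv A r (S.ℓ.baseChange A v) k ∉ 𝔭) ∨
      ∃ l, vecEquiv A P (S.π.baseChange A v) l ∉ 𝔭 := by
    by_contra! hcon
    obtain ⟨h1, h2⟩ := hcon
    have key : ∀ {m' : ℕ} (ψ : (Fin m' → ℂ) →ₗ[ℂ] (Fin m → ℂ)) (z : Vec A m'),
        (∀ l, vecEquiv A m' z l ∈ 𝔭) → vecEquiv A m (ψ.baseChange A z) i ∈ 𝔭 := by
      intro m' ψ z hz
      have h2 : z = ∑ l, vecEquiv A m' z l • (1 : A) ⊗ₜ[ℂ] (Pi.single l 1 : Fin m' → ℂ) := by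
        apply (vecEquiv A m').injective
        ext i
        simp [Pi.single_apply]
      rw [h2, map_sum, map_sum, Finset.sum_apply]
      refine sum_mem fun l _ => ?_
      rw [map_smul, map_smul, Pi.smul_apply, smul_eq_mul]
      exact Ideal.mul_mem_right _ _ (hz l)
    apply hi
    rw [← S.sum_apply v, map_add, Pi.add_apply]
    exact add_mem (key S.j _ h1) (key S.σ _ h2)
  obtain ⟨κ, b, hb, hκ⟩ : ∃ (κ : Option (Fin r)) (b : A), b ∉ 𝔭 ∧
      match κ with
      | some k => vecEquiv A r (S.ℓ.baseChange A v) k = b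
      | none => ∃ l, vecEquiv A P (S.π.baseChange A v) l = b := by
    rcases h3 with ⟨k, hk⟩ | ⟨l, hl⟩
    · exact ⟨some k, _, hk, rfl⟩
    · exact ⟨none, _, hl, l, rfl⟩
  refine ⟨vecEquiv A P w a * b, fun hmem => (‹𝔭.IsPrime›.mem_or_mem hmem).elim ha hb, a, κ, ?_⟩
  set h := vecEquiv A P w a * b
  have hu : IsUnit (locHom h (vecEquiv A P w a)) ∧ IsUnit (locHom h b) := by
    have := locHom_self_isUnit h
    rw [map_mul] at this
    exact ⟨isUnit_of_mul_isUnit_left this, isUnit_of_mul_isUnit_right this⟩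
  obtain ⟨u, huu⟩ := hu.1.exists_left_inv
  let g : Fin P → Localization.Away h := fun l => u * locHom h (vecEquiv A P w l)
  have hg : g a = 1 := huu
  have hgw : toVec g = u • vecMap (locHom h) P w := by
    apply (vecEquiv _ P).injective
    ext l
    rw [vecEquiv_toVec, map_smul, Pi.smul_apply, vecEquiv_vecMap, smul_eq_mul]
  have hL : lineOf g a (by rw [hg]; exact isUnit_one) = Gr.map (locHom h) x.L := by
    apply gr_eq_of_le
    rw [lineOf_toSubmodule, Submodule.span_singleton_le_iff_mem, hgw]
    exact Submodule.smul_mem _ _ (mem_grMap _ _ hw)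
  have hπ : vecMap (locHom h) P (S.π.baseChange A v) ∈ (Gr.map (locHom h) x.L).toSubmodule :=
    mem_grMap _ _ (x.le hv)
  rw [← hL, lineOf_toSubmodule] at hπ
  obtain ⟨c, hc⟩ := Submodule.mem_span_singleton.1 hπ
  let t' : Option (Fin r) → Localization.Away h := fun k =>
    k.elim c fun k => locHom h (vecEquiv A r (S.ℓ.baseChange A v) k)
  have hv' : pairVec S g t' = vecMap (locHom h) m v := by
    rw [pairVec]
    have h1 : (toVec fun k => t' (some k)) = vecMap (locHom h) r (S.ℓ.baseChange A v) := by
      apply (vecEquiv _ r).injective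
      ext k
      rw [vecEquiv_toVec, vecEquiv_vecMap]
      rfl
    have h2 : t' none • toVec g = vecMap (locHom h) P (S.π.baseChange A v) := hc
    rw [h1, h2, ← vecMap_baseChange, ← vecMap_baseChange, ← map_add, S.sum_apply]
  have ht' : IsUnit (t' κ) := by
    cases κ with
    | some k =>
      change IsUnit (locHom h (vecEquiv A r (S.ℓ.baseChange A v) k))
      rw [hκ]
      exact hu.2
    | none =>
      -- Here `π v = c g` over the localization, so the unit coordinate of `π v` is a multiple of
      -- `c`, which is therefore a unit.
      obtain ⟨l, hl⟩ := hκ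
      have h1 := congrFun (congrArg (vecEquiv _ P) hc) l
      rw [vecEquiv_vecMap, hl, map_smul, vecEquiv_toVec, Pi.smul_apply, smul_eq_mul] at h1
      have h2 := hu.2
      rw [← h1] at h2
      exact isUnit_of_mul_isUnit_left h2
  obtain ⟨s, hs⟩ := ht'.exists_left_inv
  refine ⟨g, s • t', hg, hs, LinePair.ext hL.symm ?_⟩
  symm
  apply gr_eq_of_le
  refine (Submodule.span_singleton_le_iff_mem _ _).2 ?_
  rw [pairVec_smul, hv']
  exact Submodule.smul_mem _ _ (mem_grMap _ _ hv)

/-- The family with value `1` at `a` and prescribed values elsewhere. -/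
def normFun {ι : Type} [DecidableEq ι] (a : ι) (x : {i // i ≠ a} → A) (i : ι) : A :=
  if h : i = a then 1 else x ⟨i, h⟩

lemma normFun_self {ι : Type} [DecidableEq ι] (a : ι) (x : {i // i ≠ a} → A) :
    normFun a x a = 1 := dif_pos rfl

lemma normFun_restrict {ι : Type} [DecidableEq ι] {a : ι} {x : ι → A} (hx : x a = 1) :
    normFun a (fun i => x i.1) = x := by
  ext i
  by_cases h : i = a
  · subst h; rw [normFun_self, hx]
  · exact dif_neg h

lemma normFun_val {ι : Type} [DecidableEq ι] {a : ι} (x : {i // i ≠ a} → A) (i : {i // i ≠ a}) :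
    normFun a x i.1 = x i := dif_neg i.2

lemma map_normFun {ι : Type} [DecidableEq ι] (f : A →ₐ[ℂ] B) (a : ι) (x : {i // i ≠ a} → A) :
    (fun i => f (normFun a x i)) = normFun a fun i => f (x i) := by
  ext i
  by_cases h : i = a
  · subst h; rw [normFun_self, normFun_self, map_one]
  · rw [normFun, normFun, dif_neg h, dif_neg h]

/-- The coordinate ring of a chart of the incidence variety. -/
abbrev pairRing (a : Fin P) (κ : Option (Fin r)) : CommAlgCat.{0} ℂ :=
  CommAlgCat.of ℂ (MvPolynomial ({i : Fin P // i ≠ a} ⊕ {k : Option (Fin r) // k ≠ κ}) ℂ)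

/-- The tautological generator of the first line. -/
def pairG (a : Fin P) (κ : Option (Fin r)) : Fin P → pairRing a κ :=
  normFun a fun i => MvPolynomial.X (Sum.inl i)

/-- The tautological adapted coordinates. -/
def pairT (a : Fin P) (κ : Option (Fin r)) : Option (Fin r) → pairRing a κ :=
  normFun κ fun k => MvPolynomial.X (Sum.inr k)

/-- The tautological point of a chart of the incidence variety. -/
def pairPt (a : Fin P) (κ : Option (Fin r)) : LinePair S.π (pairRing a κ) :=
  linePairOf S (a := a) (κ := κ) (pairG a κ) (pairT a κ) (normFun_self _ _) (normFun_self _ _)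

lemma exists_pairRing_hom {A : CommAlgCat.{0} ℂ} {a : Fin P} {κ : Option (Fin r)} (g : Fin P → A)
    (t : Option (Fin r) → A) (hg : g a = 1) (ht : t κ = 1) : ∃ f : pairRing a κ ⟶ A,
      (linePairFunctor S.π).map f (pairPt S a κ) = linePairOf S g t hg ht := by
  let f : pairRing a κ ⟶ A := CommAlgCat.ofHom
    (MvPolynomial.aeval (Sum.elim (fun i => g i.1) fun k => t k.1))
  refine ⟨f, (map_linePairOf S f.hom _ _ _ _).trans ?_⟩
  have h1 : (fun i => f.hom (pairG a κ i)) = g := by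
    rw [pairG, map_normFun]
    refine Eq.trans ?_ (normFun_restrict hg)
    congr 1
    ext i
    exact MvPolynomial.aeval_X _ _
  have h2 : (fun k => f.hom (pairT a κ k)) = t := by
    rw [pairT, map_normFun]
    refine Eq.trans ?_ (normFun_restrict ht)
    congr 1
    ext i
    exact MvPolynomial.aeval_X _ _
  simp only [h1, h2]

/-- The values of the variables are read off from the normalized generators. Hence the charts are
monomorphisms into the incidence scheme. -/
lemma pairRing_hom_injective {A : CommAlgCat.{0} ℂ} {a : Fin P} {κ : Option (Fin r)}
    {f f' : pairRing a κ ⟶ A} (h : (linePairFunctor S.π).map f (pairPt S a κ) =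
      (linePairFunctor S.π).map f' (pairPt S a κ)) : f = f' := by
  have h1 : linePairOf S _ _ _ _ = linePairOf S _ _ _ _ :=
    (map_linePairOf S f.hom _ _ _ _).symm.trans (h.trans (map_linePairOf S f'.hom _ _ _ _))
  obtain ⟨hg, ht⟩ := linePairOf_injective S h1
  apply CommAlgCat.hom_ext
  apply MvPolynomial.algHom_ext
  rintro (i | k)
  · have := congrFun hg i.1
    rwa [pairG, normFun_val] at this
  · have := congrFun ht k.1
    rwa [pairT, normFun_val] at this

lemma exists_pairPt (hP : 1 ≤ P) (hm : 1 ≤ m) {A : CommAlgCat.{0} ℂ}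
    (x : (linePairFunctor S.π).obj A) (𝔭 : Ideal A) (h𝔭 : 𝔭.IsPrime) :
    ∃ h ∉ 𝔭, ∃ (a : Fin P) (κ : Option (Fin r)) (f : pairRing a κ ⟶ away A h),
      (linePairFunctor S.π).map (loc A h) x = (linePairFunctor S.π).map f (pairPt S a κ) := by
  obtain ⟨h, hh, a, κ, g, t, hg, ht, hx⟩ := exists_linePairOf S hP hm x 𝔭
  obtain ⟨f, hf⟩ := exists_pairRing_hom S (A := away A h) g t hg ht
  refine ⟨h, hh, a, κ, f, ?_⟩
  rw [hf]
  exact hx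

end IncidenceCharts

/-! ### The exceptional divisor -/

section ExceptionalDivisor

variable {m p : ℕ}

/-- The ideal generated by the coordinates of the images of the vectors of a submodule. -/
def coordIdeal {A : Type} [CommRing A] [Algebra ℂ A] (g : (Fin m → ℂ) →ₗ[ℂ] (Fin p → ℂ))
    (W : Submodule A (Vec A m)) : Ideal A :=
  Ideal.span {t | ∃ w ∈ W, ∃ l, vecEquiv A p (g.baseChange A w) l = t}

lemma coord_mem_coordIdeal {A : Type} [CommRing A] [Algebra ℂ A]
    (g : (Fin m → ℂ) →ₗ[ℂ] (Fin p → ℂ)) {W : Submodule A (Vec A m)} {w : Vec A m} (hw : w ∈ W)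
    (l : Fin p) : vecEquiv A p (g.baseChange A w) l ∈ coordIdeal g W :=
  Ideal.subset_span ⟨w, hw, l, rfl⟩

lemma coordIdeal_span_singleton {A : Type} [CommRing A] [Algebra ℂ A]
    (g : (Fin m → ℂ) →ₗ[ℂ] (Fin p → ℂ)) (v : Vec A m) :
    coordIdeal g (Submodule.span A {v}) =
      Ideal.span (Set.range (vecEquiv A p (g.baseChange A v))) := by
  apply le_antisymm
  · refine Ideal.span_le.2 ?_
    rintro _ ⟨w, hw, l, rfl⟩
    obtain ⟨c, rfl⟩ := Submodule.mem_span_singleton.1 hw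
    rw [map_smul, map_smul, Pi.smul_apply, smul_eq_mul]
    exact Ideal.mul_mem_left _ _ (Ideal.subset_span ⟨l, rfl⟩)
  · refine Ideal.span_le.2 ?_
    rintro _ ⟨l, rfl⟩
    exact coord_mem_coordIdeal g (Submodule.mem_span_singleton_self v) l

lemma killed_map_iff (g : (Fin m → ℂ) →ₗ[ℂ] (Fin p → ℂ)) {A B : CommAlgCat.{0} ℂ} (f : A ⟶ B)
    (W : Gr 1 m A) :
    Killed g B (Gr.map f.hom W) ↔ coordIdeal g W.toSubmodule ≤ RingHom.ker f.hom := by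
  rw [Killed, coordIdeal, grMap_eq_span, Submodule.span_le, Ideal.span_le]
  constructor
  · rintro h _ ⟨w, hw, l, rfl⟩
    have := h ⟨w, hw, rfl⟩
    rw [SetLike.mem_coe, LinearMap.mem_ker, ← vecMap_baseChange] at this
    have h2 := congrFun (congrArg (vecEquiv B p) this) l
    rw [vecEquiv_vecMap, map_zero] at h2
    exact h2
  · rintro h _ ⟨w, hw, rfl⟩
    rw [SetLike.mem_coe, LinearMap.mem_ker, ← vecMap_baseChange]
    apply (vecEquiv B p).injective
    ext l
    rw [vecEquiv_vecMap, map_zero]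
    exact h ⟨w, hw, l, rfl⟩

/-- A homomorphism kills either ideal exactly when `g` kills the line after base change along it. -/
lemma coordIdeal_map (g : (Fin m → ℂ) →ₗ[ℂ] (Fin p → ℂ)) {A B : CommAlgCat.{0} ℂ} (f : A ⟶ B)
    (W : Gr 1 m A) : coordIdeal g (Gr.map f.hom W).toSubmodule =
      (coordIdeal g W.toSubmodule).map f.hom.toRingHom := by
  refine eq_of_forall_le_ker_iff fun C h => ?_
  rw [← killed_map_iff, ← grMap_comp, Ideal.map_le_iff_le_comap]
  exact killed_map_iff g (f ≫ h) W

/-- The algebra of sections over an affine open subset. -/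
abbrev secAlg (T : SchemeC) {U : T.left.Opens} (hU : IsAffineOpen U) : CommAlgCat.{0} ℂ :=
  algOf Γ(T.left, U) (hU.fromSpec ≫ T.hom)

/-- Both ideals measure where the line is killed by `g`. This translates Cartier conditions on the
pulled back center into algebra. -/
lemma comap_ker_ideal_eq_coordIdeal {Z Y T : SchemeC} {i : Z ⟶ Y} (e : points Y ≅ grFunctor 1 m)
    (g : (Fin m → ℂ) →ₗ[ℂ] (Fin p → ℂ)) (hi : IsZeroLocus i fun A x => Killed g A (e.hom.app A x))
    (f : T ⟶ Y) {U : T.left.Opens} (hU : IsAffineOpen U) {W : Gr 1 m (secAlg T hU)}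
    (hW : (pointsMap f ≫ e.hom).app (secAlg T hU) (affinePt T hU) = W) :
    (i.left.ker.comap f.left).ideal ⟨U, hU⟩ = coordIdeal g W.toSubmodule := by
  have hV := (isClosedCondition_killed g).comp e.hom
  have h1 := comap_ker_ideal_eq hi hV f hU
  refine h1.trans (eq_of_forall_le_ker_iff (A := secAlg T hU) fun B q => ?_)
  rw [← killed_map_iff]
  have h2 := map_iff_closedIdeal_le hV (affinePt T hU ≫ f) q
  refine h2.symm.trans (iff_of_eq (congrArg (Killed g B) ?_))
  refine (NatTrans.naturality_apply e.hom q _).trans ?_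
  exact congrArg (fun W : Gr 1 m (secAlg T hU) => Gr.map q.hom W) hW

/-- Open immersions are flat, and flat homomorphisms preserve nonzerodivisors. -/
lemma map_mem_nonZeroDivisors {R S : CommRingCat.{0}} (q : R ⟶ S) [IsOpenImmersion (Spec.map q)]
    {d : R} (hd : d ∈ nonZeroDivisors R) : q.hom d ∈ nonZeroDivisors S := by
  have hq : q.hom.Flat := Flat.SpecMap_iff.1 inferInstance
  algebraize [q.hom]
  have h := Module.Flat.isSMulRegular_of_nonZeroDivisors (M := S) hd
  refine mem_nonZeroDivisors_iff_right.2 fun x hx => ?_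
  apply h
  change q.hom d * x = q.hom d * 0
  rw [mul_comm, hx, mul_zero]

lemma exists_restrict (T : SchemeC) {U V : T.left.Opens} (hU : IsAffineOpen U)
    (hV : IsAffineOpen V) (h : U ≤ V) :
    ∃ ρ : secAlg T hV ⟶ secAlg T hU,
      ρ.hom.toRingHom = (T.left.presheaf.map (homOfLE h).op).hom ∧
      (points T).map ρ (affinePt T hV) = affinePt T hU :=
  exists_algHom_of_factor hV (B := secAlg T hU)
    (T.left.presheaf.map (homOfLE h).op) (affinePt T hU) (hV.map_fromSpec hU (homOfLE h).op).symm

lemma isOpenImmersion_restrict {T : Scheme.{0}} {U V : T.Opens} (hU : IsAffineOpen U)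
    (hV : IsAffineOpen V) (h : U ≤ V) :
    IsOpenImmersion (Spec.map (T.presheaf.map (homOfLE h).op)) := by
  have h1 := hV.map_fromSpec hU (homOfLE h).op
  have : IsOpenImmersion (Spec.map (T.presheaf.map (homOfLE h).op) ≫ hV.fromSpec) := by
    rw [h1]; infer_instance
  exact IsOpenImmersion.of_comp _ hV.fromSpec

/-- As `g` is a monomorphism, `f` is the base change of `f ≫ g` along `g`. -/
lemma isOpenImmersion_of_comp_mono {X Y Z : Scheme.{0}} (f : X ⟶ Y) (g : Y ⟶ Z) [Mono g]
    [IsOpenImmersion (f ≫ g)] : IsOpenImmersion f := by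
  have h : IsPullback (𝟙 X) f (f ≫ g) g := by
    refine ⟨⟨by rw [Category.id_comp]⟩, ⟨Limits.PullbackCone.IsLimit.mk _ (fun s => s.fst)
      (fun s => Category.comp_id _) (fun s => ?_) fun s q h1 _ => by
        rw [← h1, Category.comp_id]⟩⟩
    rw [← cancel_mono g, Category.assoc]
    exact s.condition
  exact MorphismProperty.of_isPullback h inferInstance

/-- Two affine points with the same image in `B` have the same structure over `ℂ`, so they are
compared as homomorphisms of algebras. -/
lemma mono_left_of_points {B : SchemeC} {R : CommAlgCat.{0} ℂ} (c : specC R ⟶ B)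
    (h : ∀ (A : CommAlgCat.{0} ℂ) (f f' : R ⟶ A),
      (points B).map f c = (points B).map f' c → f = f') : Mono c.left := by
  refine ⟨fun {W} u v huv => hom_ext_of_spec fun Q a => ?_⟩
  have hB : (c.left ≫ B.hom) = (specC R).hom := Over.w c
  have huv' : a ≫ u ≫ (specC R).hom = a ≫ v ≫ (specC R).hom := by
    rw [← hB, ← Category.assoc u, ← Category.assoc v, huv]
  let a₁ : specC (algOf Q (a ≫ u ≫ (specC R).hom)) ⟶ specC R :=
    mkPt (X := specC R) (a ≫ u) (Category.assoc _ _ _)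
  let a₂ : specC (algOf Q (a ≫ u ≫ (specC R).hom)) ⟶ specC R :=
    mkPt (X := specC R) (a ≫ v) ((Category.assoc _ _ _).trans huv'.symm)
  obtain ⟨f₁, h₁⟩ := specC_map_preimage a₁
  obtain ⟨f₂, h₂⟩ := specC_map_preimage a₂
  have h3 : f₁ = f₂ := by
    refine h _ f₁ f₂ ?_
    change (algSpec (CommRingCat.of ℂ)).map f₁.op ≫ c = (algSpec (CommRingCat.of ℂ)).map f₂.op ≫ c
    rw [h₁, h₂]
    refine Over.OverMorphism.ext ?_
    change (a ≫ u) ≫ c.left = (a ≫ v) ≫ c.left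
    rw [Category.assoc, Category.assoc, huv]
  have h4 : a₁ = a₂ := by rw [← h₁, ← h₂, h3]
  exact congrArg (fun q => q.left) h4

/-- `π` sends the generator of the second line to `t none • g`, and `g` has a coordinate `1`. -/
lemma coordIdeal_pairVec {r P : ℕ} (S : Splitting r P m) {A : Type} [CommRing A] [Algebra ℂ A]
    {a : Fin P} {κ : Option (Fin r)} (g : Fin P → A) (t : Option (Fin r) → A) (hg : g a = 1)
    (ht : t κ = 1) : coordIdeal S.π (linePairOf S g t hg ht).M.toSubmodule = Ideal.span {t none} := by
  have h1 : coordIdeal S.π (linePairOf S g t hg ht).M.toSubmodule =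
      Ideal.span (Set.range (vecEquiv A P (S.π.baseChange A (pairVec S g t)))) :=
    coordIdeal_span_singleton S.π (pairVec S g t)
  rw [h1, π_pairVec, map_smul, vecEquiv_toVec]
  apply le_antisymm
  · refine Ideal.span_le.2 ?_
    rintro _ ⟨l, rfl⟩
    exact Ideal.mul_mem_right _ _ (Ideal.mem_span_singleton_self _)
  · refine (Ideal.span_singleton_le_iff_mem _).2 (Ideal.subset_span ⟨a, ?_⟩)
    rw [Pi.smul_apply, hg, smul_eq_mul, mul_one]

/-- The coordinate is a variable, or the constant `1` on the charts with `κ = none`, which miss the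
exceptional divisor. -/
lemma pairT_none_ne_zero {r P : ℕ} (a : Fin P) (κ : Option (Fin r)) : pairT a κ none ≠ 0 := by
  by_cases h : none = κ
  · subst h
    rw [pairT, normFun_self]
    exact one_ne_zero
  · have : pairT a κ none = MvPolynomial.X (Sum.inr ⟨none, h⟩) :=
      normFun_val (A := pairRing a κ) _ (⟨none, h⟩ : {k : Option (Fin r) // k ≠ κ})
    rw [this]
    exact MvPolynomial.X_ne_zero _

lemma exists_awayLift {A B : CommAlgCat.{0} ℂ} (ρ : A ⟶ B) (h : A) (hu : IsUnit (ρ.hom h)) :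
    ∃ ψ : away A h ⟶ B, loc A h ≫ ψ = ρ :=
  ⟨CommAlgCat.ofHom (awayLift h ρ.hom hu), CommAlgCat.hom_ext (awayLift_comp h ρ.hom hu)⟩

lemma map_comp_eq_map_comp {G : CommAlgCat.{0} ℂ ⥤ Type} {A A' B C : CommAlgCat.{0} ℂ} {f : A ⟶ B}
    {f' : A' ⟶ B} {x : G.obj A} {x' : G.obj A'} (h : G.map f x = G.map f' x') (g : B ⟶ C) :
    G.map (f ≫ g) x = G.map (f' ≫ g) x' := by
  rw [Functor.map_comp_apply, Functor.map_comp_apply, h]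

/-- Locally, a point of the incidence scheme is the pullback of a chart. -/
lemma exists_pairPt_restrict {r P : ℕ} (S : Splitting r P m) (hP : 1 ≤ P) (hm : 1 ≤ m)
    {B : SchemeC} (E : points B ≅ linePairFunctor S.π) (y : B.left) :
    ∃ (U : B.left.Opens) (hU : IsAffineOpen U) (_ : y ∈ U) (a : Fin P) (κ : Option (Fin r))
      (θ : pairRing a κ ⟶ secAlg B hU),
      E.hom.app _ (affinePt B hU) = (linePairFunctor S.π).map θ (pairPt S a κ) := by
  obtain ⟨V, hV, hy, -⟩ := exists_isAffineOpen_mem_and_subset (x := y) (U := ⊤) trivial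
  let 𝔭 := hV.primeIdealOf ⟨y, hy⟩
  obtain ⟨h, hh, a, κ, f, hf⟩ := exists_pairPt S hP hm
    (E.hom.app (secAlg B hV) (affinePt B hV)) 𝔭.asIdeal 𝔭.isPrime
  let h' : Γ(B.left, V) := h
  have hU : IsAffineOpen (B.left.basicOpen h') := hV.basicOpen h'
  have hyU : y ∈ B.left.basicOpen h' := by
    have h1 : hV.fromSpec 𝔭 ∈ B.left.basicOpen h' := by
      have : 𝔭 ∈ hV.fromSpec ⁻¹ᵁ B.left.basicOpen h' := by
        rw [hV.fromSpec_preimage_basicOpen]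
        exact hh
      exact this
    rwa [hV.fromSpec_primeIdealOf] at h1
  obtain ⟨ρ, hρ, hρ'⟩ := exists_restrict B hU hV (B.left.basicOpen_le h')
  have hu : IsUnit (ρ.hom h) := by
    have h1 : ρ.hom h = (B.left.presheaf.map (homOfLE (B.left.basicOpen_le h')).op).hom h' :=
      RingHom.congr_fun hρ h
    rw [h1]
    exact RingedSpace.isUnit_res_basicOpen _ h'
  obtain ⟨ψ, hψ⟩ := exists_awayLift ρ h hu
  refine ⟨_, hU, hyU, a, κ, f ≫ ψ, ?_⟩
  refine Eq.trans ?_ (map_comp_eq_map_comp hf ψ)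
  rw [hψ, ← hρ']
  exact NatTrans.naturality_apply E.hom ρ (affinePt B hV)

/-- On a chart the center pulls back to the ideal of one nonzero polynomial. To carry the
nonzerodivisor to an affine open `U` of `B`, the map from `U` to the chart must be an open
immersion. It is, because its composite with the monomorphism from the chart to `B` is the inclusion
of `U`. -/
lemma isEffectiveCartier_incidence {r P : ℕ} (S : Splitting r P m) (hP : 1 ≤ P) (hm : 1 ≤ m)
    {B Y Z : SchemeC} (E : points B ≅ linePairFunctor S.π) (e : points Y ≅ grFunctor 1 m)
    (b : B ⟶ Y) (hb : ∀ A z, LinePair.M (E.hom.app A z) = (pointsMap b ≫ e.hom).app A z)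
    {i : Z ⟶ Y} (hi : IsZeroLocus i fun A x => Killed S.π A (e.hom.app A x)) :
    IsEffectiveCartier (i.left.ker.comap b.left) := by
  intro y
  obtain ⟨U, hU, hy, a, κ, θ, hθ⟩ := exists_pairPt_restrict S hP hm E y
  refine ⟨⟨U, hU⟩, hy, θ.hom (pairT a κ none), ?_, ?_⟩
  · let c : specC (pairRing a κ) ⟶ B := E.inv.app _ (pairPt S a κ)
    have hc : (points B).map θ c = affinePt B hU := by
      apply injective_iso_app E
      rw [hθ]
      refine (NatTrans.naturality_apply E.hom θ c).trans ?_
      exact congrArg ((linePairFunctor S.π).map θ) (iso_hom_inv_app E _ _)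
    have : Mono c.left := by
      refine mono_left_of_points c fun A f f' hff => pairRing_hom_injective S ?_
      have h1 := congrArg (E.hom.app A) hff
      have h2 : ∀ f : pairRing a κ ⟶ A, E.hom.app A ((points B).map f c) =
          (linePairFunctor S.π).map f (pairPt S a κ) := fun f =>
        (NatTrans.naturality_apply E.hom f c).trans
          (congrArg ((linePairFunctor S.π).map f) (iso_hom_inv_app E _ _))
      rwa [h2, h2] at h1
    have h1 : Spec.map (CommRingCat.ofHom θ.hom.toRingHom) ≫ c.left = hU.fromSpec :=
      congrArg (fun q => q.left) hc
    have h2 : IsOpenImmersion (Spec.map (CommRingCat.ofHom θ.hom.toRingHom) ≫ c.left) := by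
      rw [h1]; exact hU.isOpenImmersion_fromSpec
    have h3 := @isOpenImmersion_of_comp_mono _ _ _
      (Spec.map (CommRingCat.ofHom θ.hom.toRingHom)) c.left this h2
    exact map_mem_nonZeroDivisors (CommRingCat.ofHom θ.hom.toRingHom)
      (mem_nonZeroDivisors_of_ne_zero (pairT_none_ne_zero a κ))
  · have h4 : (pointsMap b ≫ e.hom).app (secAlg B hU) (affinePt B hU) =
        (Gr.map θ.hom (pairPt S a κ).M : Gr 1 m (secAlg B hU)) := by
      refine (hb _ _).symm.trans ?_
      exact congrArg LinePair.M hθ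
    refine (comap_ker_ideal_eq_coordIdeal e S.π hi b hU h4).trans ?_
    have h5 := coordIdeal_pairVec S (a := a) (κ := κ) (pairG a κ) (pairT a κ) (normFun_self _ _)
      (normFun_self _ _)
    refine (coordIdeal_map S.π θ (pairPt S a κ).M).trans ((congrArg _ h5).trans ?_)
    rw [Ideal.map_span, Set.image_singleton]
    rfl

end ExceptionalDivisor

/-! ### The universal property of the blow-up -/

section LiftAlgebra

variable {m p : ℕ} {A : Type} [CommRing A] [Algebra ℂ A]

/-- The quotient is projective, so membership is tested by functionals with values in `A`, where `d`
cancels. -/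
lemma mem_of_nonZeroDivisor_smul_mem {k : ℕ} (W : Gr k m A) {d : A} (hd : d ∈ nonZeroDivisors A)
    {v : Vec A m} (hv : d • v ∈ W.toSubmodule) : v ∈ W.toSubmodule := by
  rw [mem_iff_functional] at hv ⊢
  intro φ
  have h := hv φ
  rw [Submodule.Quotient.mk_smul, map_smul, smul_eq_mul, mul_comm] at h
  exact mem_nonZeroDivisors_iff_right.1 hd _ h

/-- A line containing the image of a line whose image is a line away from a Cartier divisor is
unique. -/
lemma line_eq_of_coordIdeal (hp : 1 ≤ p) (g : (Fin m → ℂ) →ₗ[ℂ] (Fin p → ℂ)) {M : Gr 1 m A}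
    {d : A} (hd : d ∈ nonZeroDivisors A) (hM : coordIdeal g M.toSubmodule = Ideal.span {d})
    {L L' : Gr 1 p A} (hL : M.toSubmodule ≤ L.toSubmodule.comap (g.baseChange A))
    (hL' : M.toSubmodule ≤ L'.toSubmodule.comap (g.baseChange A)) : L = L' := by
  refine grFunctor_sep (CommAlgCat.of ℂ A) _ (span_eq_top_of_forall_prime
    (S := {h | Gr.map (locHom h) L = Gr.map (locHom h) L'}) fun 𝔭 h𝔭 => ?_) L L' fun t ht => ht
  obtain ⟨h, hh, v, hv, i, -, hLv⟩ := exists_local_generator hp L 𝔭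
  refine ⟨h, hh, ?_⟩
  change Gr.map (locHom h) L = Gr.map (locHom h) L'
  apply gr_eq_of_le
  rw [hLv, Submodule.span_singleton_le_iff_mem]
  have hd' : locHom h d ∈ nonZeroDivisors (Localization.Away h) :=
    IsLocalization.map_nonZeroDivisors_le (Submonoid.powers h) (Localization.Away h)
      ⟨d, hd, rfl⟩
  refine mem_of_nonZeroDivisor_smul_mem _ hd' ?_
  -- Since `g w` is a multiple of `v`, its `l`-th coordinate times `v` equals `v_l` times `g w`,
  -- which lies in `L'`. So the whole ideal, and in particular `d`, multiplies `v` into `L'`.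
  have key : ∀ t ∈ coordIdeal g M.toSubmodule,
      locHom h t • vecMap (locHom h) p v ∈ (Gr.map (locHom h) L').toSubmodule := by
    intro t ht
    refine Submodule.span_induction ?_ ?_ ?_ ?_ ht
    · rintro _ ⟨w, hw, l, rfl⟩
      have h1 : vecMap (locHom h) p (g.baseChange A w) ∈ (Gr.map (locHom h) L).toSubmodule :=
        mem_grMap _ _ (hL hw)
      rw [hLv] at h1
      obtain ⟨c, hc⟩ := Submodule.mem_span_singleton.1 h1
      have h2 : locHom h (vecEquiv A p (g.baseChange A w) l) • vecMap (locHom h) p v =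
          locHom h (vecEquiv A p v l) • vecMap (locHom h) p (g.baseChange A w) := by
        rw [← vecEquiv_vecMap, ← vecEquiv_vecMap, ← hc, map_smul, Pi.smul_apply, smul_eq_mul,
          smul_smul, mul_comm]
      rw [h2]
      exact Submodule.smul_mem _ _ (mem_grMap _ _ (hL' hw))
    · rw [map_zero, zero_smul]
      exact zero_mem _
    · intro x y _ _ hx hy
      rw [map_add, add_smul]
      exact add_mem hx hy
    · intro a x _ hx
      rw [smul_eq_mul, map_mul, mul_smul]
      exact Submodule.smul_mem _ _ hx
  exact key d (hM ▸ Ideal.mem_span_singleton_self d)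

/-- The coordinates of `g v` are divisible by `d`, and `d` is a combination of them. Cancelling `d`
shows that `g v / d` is unimodular, so it spans the required line. -/
lemma exists_line_of_coordIdeal (g : (Fin m → ℂ) →ₗ[ℂ] (Fin p → ℂ)) {M : Gr 1 m A} {v : Vec A m}
    (hv : M.toSubmodule = Submodule.span A {v}) {d : A} (hd : d ∈ nonZeroDivisors A)
    (hM : coordIdeal g M.toSubmodule = Ideal.span {d}) :
    ∃ L : Gr 1 p A, M.toSubmodule ≤ L.toSubmodule.comap (g.baseChange A) := by
  rw [hv, coordIdeal_span_singleton] at hM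
  have h1 : ∀ l, ∃ c, d * c = vecEquiv A p (g.baseChange A v) l := fun l => by
    have : vecEquiv A p (g.baseChange A v) l ∈ Ideal.span {d} := hM ▸ Ideal.subset_span ⟨l, rfl⟩
    obtain ⟨c, hc⟩ := Ideal.mem_span_singleton'.1 this
    exact ⟨c, by rw [mul_comm, hc]⟩
  choose w hw using h1
  have h2 : d ∈ Ideal.span (Set.range (vecEquiv A p (g.baseChange A v))) :=
    hM ▸ Ideal.mem_span_singleton_self d
  obtain ⟨t, ht⟩ := Ideal.mem_span_range_iff_exists_fun.1 h2
  have h3 : ∑ l, t l * w l = 1 := by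
    have h4 : (∑ l, t l * w l) * d = 1 * d := by
      rw [one_mul, Finset.sum_mul]
      conv_rhs => rw [← ht]
      refine Finset.sum_congr rfl fun l _ => ?_
      rw [← hw]; ring
    exact mul_cancel_right_mem_nonZeroDivisors hd |>.1 h4
  let φ : Vec A p →ₗ[A] A := ∑ l, t l • (LinearMap.proj l ∘ₗ (vecEquiv A p).toLinearMap)
  refine ⟨grOfUnimodular (toVec w) φ ?_, ?_⟩
  · simp only [φ, LinearMap.sum_apply, LinearMap.smul_apply, LinearMap.comp_apply,
      LinearEquiv.coe_coe, LinearMap.proj_apply, vecEquiv_toVec, smul_eq_mul]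
    exact h3
  · rw [hv, Submodule.span_singleton_le_iff_mem, Submodule.mem_comap, grOfUnimodular_toSubmodule]
    have h5 : g.baseChange A v = d • toVec w := by
      apply (vecEquiv A p).injective
      ext l
      rw [map_smul, vecEquiv_toVec, Pi.smul_apply, smul_eq_mul, hw]
    rw [h5]
    exact Submodule.smul_mem _ _ (Submodule.mem_span_singleton_self _)

end LiftAlgebra

/-! ### Lifting morphisms to the incidence scheme. -/

section UniversalProperty

variable {r P m : ℕ} {S : Splitting r P m}

/-- The family of lines over an affine open subset given by a morphism to projective space. -/
def lineOn {Y T : SchemeC} (e : points Y ≅ grFunctor 1 m) (f : T ⟶ Y) {U : T.left.Opens}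
    (hU : IsAffineOpen U) : Gr 1 m (secAlg T hU) :=
  (pointsMap f ≫ e.hom).app (secAlg T hU) (affinePt T hU)

lemma lineOn_restrict {Y T : SchemeC} (e : points Y ≅ grFunctor 1 m) (f : T ⟶ Y)
    {U V : T.left.Opens} (hU : IsAffineOpen U) (hV : IsAffineOpen V)
    {ρ : secAlg T hV ⟶ secAlg T hU} (hρ : (points T).map ρ (affinePt T hV) = affinePt T hU) :
    lineOn e f hU = Gr.map ρ.hom (lineOn e f hV) := by
  have h := NatTrans.naturality_apply (pointsMap f ≫ e.hom) ρ (affinePt T hV)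
  rw [hρ] at h
  exact h

/-- On this affine open subset, the center pulls back to a principal Cartier divisor. -/
def IsCartierOn (S : Splitting r P m) {Y T : SchemeC} (e : points Y ≅ grFunctor 1 m) (f : T ⟶ Y)
    {U : T.left.Opens} (hU : IsAffineOpen U) : Prop :=
  ∃ d ∈ nonZeroDivisors (secAlg T hU), coordIdeal S.π (lineOn e f hU).toSubmodule = Ideal.span {d}

lemma IsCartierOn.restrict {Y T : SchemeC} {e : points Y ≅ grFunctor 1 m} {f : T ⟶ Y}
    {U V : T.left.Opens} {hV : IsAffineOpen V} (h : IsCartierOn S e f hV) (hU : IsAffineOpen U)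
    (hUV : U ≤ V) : IsCartierOn S e f hU := by
  obtain ⟨d, hd, hdV⟩ := h
  obtain ⟨ρ, hρ, hρ'⟩ := exists_restrict T hU hV hUV
  have := isOpenImmersion_restrict hU hV hUV
  have h1 := map_mem_nonZeroDivisors (T.left.presheaf.map (homOfLE hUV).op) hd
  refine ⟨ρ.hom d, ?_, ?_⟩
  · have h2 : ρ.hom d = (T.left.presheaf.map (homOfLE hUV).op).hom d := RingHom.congr_fun hρ d
    rw [h2]
    exact h1
  · rw [lineOn_restrict e f hU hV hρ', coordIdeal_map, hdV, Ideal.map_span, Set.image_singleton]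
    rfl

variable {B Y T : SchemeC} (E : points B ≅ linePairFunctor S.π) (e : points Y ≅ grFunctor 1 m)
  {b : B ⟶ Y} {f : T ⟶ Y}

/-- The second line is given by the morphism to projective space, and the first is then unique by
`line_eq_of_coordIdeal`. -/
lemma lift_unique_on
    (hb : ∀ A z, LinePair.M (E.hom.app A z) = (pointsMap b ≫ e.hom).app A z) (hP : 1 ≤ P) {U : T.left.Opens} {hU : IsAffineOpen U}
    (hc : IsCartierOn S e f hU) {z z' : (points B).obj (secAlg T hU)}
    (hz : (pointsMap b).app _ z = (pointsMap f).app _ (affinePt T hU))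
    (hz' : (pointsMap b).app _ z' = (pointsMap f).app _ (affinePt T hU)) : z = z' := by
  obtain ⟨d, hd, hdM⟩ := hc
  have h1 : LinePair.M (E.hom.app _ z) = lineOn e f hU :=
    (hb _ z).trans (congrArg (e.hom.app (secAlg T hU)) hz)
  have h2 : LinePair.M (E.hom.app _ z') = lineOn e f hU :=
    (hb _ z').trans (congrArg (e.hom.app (secAlg T hU)) hz')
  apply injective_iso_app E
  refine LinePair.ext (line_eq_of_coordIdeal hP S.π hd hdM ?_ ?_) (h1.trans h2.symm)
  · rw [← h1]; exact (E.hom.app _ z).le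
  · rw [← h2]; exact (E.hom.app _ z').le

lemma exists_lift_on
    (hb : ∀ A z, LinePair.M (E.hom.app A z) = (pointsMap b ≫ e.hom).app A z)
    {U : T.left.Opens} {hU : IsAffineOpen U} (hc : IsCartierOn S e f hU) {v : Vec (secAlg T hU) m}
    (hv : (lineOn e f hU).toSubmodule = Submodule.span (secAlg T hU) {v}) :
    ∃ z : (points B).obj (secAlg T hU),
      (pointsMap b).app _ z = (pointsMap f).app _ (affinePt T hU) := by
  obtain ⟨d, hd, hdM⟩ := hc
  obtain ⟨L, hL⟩ := exists_line_of_coordIdeal S.π hv hd hdM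
  let x : LinePair S.π (secAlg T hU) := ⟨L, lineOn e f hU, hL⟩
  refine ⟨E.inv.app _ x, injective_iso_app e _ ?_⟩
  have h1 := hb _ (E.inv.app _ x)
  refine Eq.trans h1.symm ?_
  exact congrArg LinePair.M (iso_hom_inv_app E _ x)

/-- Locally, the center pulls back to a principal Cartier divisor and the line is spanned by one
vector. -/
lemma exists_isCartierOn (hm : 1 ≤ m) {Z : SchemeC} {i : Z ⟶ Y}
    (hi : IsZeroLocus i fun A x => Killed S.π A (e.hom.app A x))
    (hf : IsEffectiveCartier (i.left.ker.comap f.left)) (y : T.left) :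
    ∃ (U : T.left.Opens) (hU : IsAffineOpen U), y ∈ U ∧ IsCartierOn S e f hU ∧
      ∃ v, (lineOn e f hU).toSubmodule = Submodule.span (secAlg T hU) {v} := by
  obtain ⟨⟨V, hV⟩, hy, d, hd, hdV⟩ := hf y
  have hVc : IsCartierOn S e f hV :=
    ⟨d, hd, (comap_ker_ideal_eq_coordIdeal e S.π hi f hV rfl).symm.trans hdV⟩
  let 𝔭 := hV.primeIdealOf ⟨y, hy⟩
  have h𝔭 : Ideal.IsPrime (α := secAlg T hV) 𝔭.asIdeal := 𝔭.isPrime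
  obtain ⟨h, hh, v, -, -, -, hv⟩ := @exists_local_generator _ _ _ _ hm (lineOn e f hV) 𝔭.asIdeal h𝔭
  let h' : Γ(T.left, V) := h
  have hU : IsAffineOpen (T.left.basicOpen h') := hV.basicOpen h'
  have hyU : y ∈ T.left.basicOpen h' := by
    have h1 : hV.fromSpec 𝔭 ∈ T.left.basicOpen h' := by
      have : 𝔭 ∈ hV.fromSpec ⁻¹ᵁ T.left.basicOpen h' := by
        rw [hV.fromSpec_preimage_basicOpen]
        exact hh
      exact this
    rwa [hV.fromSpec_primeIdealOf] at h1
  obtain ⟨ρ, hρ, hρ'⟩ := exists_restrict T hU hV (T.left.basicOpen_le h')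
  have hu : IsUnit (ρ.hom h) := by
    have h1 : ρ.hom h = (T.left.presheaf.map (homOfLE (T.left.basicOpen_le h')).op).hom h' :=
      RingHom.congr_fun hρ h
    rw [h1]
    exact RingedSpace.isUnit_res_basicOpen _ h'
  refine ⟨_, hU, hyU, hVc.restrict hU (T.left.basicOpen_le h'), vecMap ρ.hom m v, ?_⟩
  rw [lineOn_restrict e f hU hV hρ']
  exact exists_eq_smul_vecMap hv ρ.hom hu

lemma map_comp_of_eq {G : CommAlgCat.{0} ℂ ⥤ Type} {A B C : CommAlgCat.{0} ℂ} {f : A ⟶ B}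
    {x : G.obj A} {y : G.obj B} (h : G.map f x = y) (g : B ⟶ C) :
    G.map (f ≫ g) x = G.map g y := by
  rw [Functor.map_comp_apply, h]

lemma affinePt_map_injective {V : T.left.Opens} {hV : IsAffineOpen V} {A : CommAlgCat.{0} ℂ}
    {g g' : secAlg T hV ⟶ A}
    (h : (points T).map g (affinePt T hV) = (points T).map g' (affinePt T hV)) : g = g' := by
  have h1 : Spec.map (CommRingCat.ofHom g.hom.toRingHom) ≫ hV.fromSpec =
      Spec.map (CommRingCat.ofHom g'.hom.toRingHom) ≫ hV.fromSpec :=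
    congrArg (fun q : specC A ⟶ T => q.left) h
  have hmono : Mono hV.fromSpec := inferInstance
  have h2 := Spec.map_injective (hmono.right_cancellation _ _ h1)
  refine CommAlgCat.hom_ext (AlgHom.ext fun x => ?_)
  exact RingHom.congr_fun (congrArg (fun q => q.hom) h2) x

lemma app_map_eq_of_eq {G G' H : CommAlgCat.{0} ℂ ⥤ Type} {β : G ⟶ H} {φ : G' ⟶ H}
    {A C : CommAlgCat.{0} ℂ} {z : G.obj A} {a : G'.obj A} (h : β.app A z = φ.app A a) {ρ : A ⟶ C}
    {a' : G'.obj C} (ha : G'.map ρ a = a') : β.app C (G.map ρ z) = φ.app C a' := by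
  rw [NatTrans.naturality_apply, h, ← NatTrans.naturality_apply, ha]

/-- The test algebra is covered by localizations that map into affine opens inside `U₁ ⊓ U₂`. On
such an open the restrictions of the two lifts coincide by uniqueness. -/
lemma lift_compatible
    (hb : ∀ A z, LinePair.M (E.hom.app A z) = (pointsMap b ≫ e.hom).app A z) (hP : 1 ≤ P)
    {U₁ U₂ : T.left.Opens} {hU₁ : IsAffineOpen U₁} {hU₂ : IsAffineOpen U₂}
    (hc : IsCartierOn S e f hU₁) {z₁ : (points B).obj (secAlg T hU₁)}
    {z₂ : (points B).obj (secAlg T hU₂)}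
    (hz₁ : (pointsMap b).app _ z₁ = (pointsMap f).app _ (affinePt T hU₁))
    (hz₂ : (pointsMap b).app _ z₂ = (pointsMap f).app _ (affinePt T hU₂))
    {A : CommAlgCat.{0} ℂ} (f₁ : secAlg T hU₁ ⟶ A) (f₂ : secAlg T hU₂ ⟶ A)
    (h : (points T).map f₁ (affinePt T hU₁) = (points T).map f₂ (affinePt T hU₂)) :
    (points B).map f₁ z₁ = (points B).map f₂ z₂ := by
  refine (isZariskiSheaf_points B).sep A _ (span_eq_top_of_forall_prime (S := {t |
    (points B).map (loc A t) ((points B).map f₁ z₁) =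
      (points B).map (loc A t) ((points B).map f₂ z₂)}) fun 𝔭 h𝔭 => ?_) _ _ fun t ht => ht
  let p : specC A ⟶ T := (points T).map f₁ (affinePt T hU₁)
  have hp₁ : p.left = Spec.map (CommRingCat.ofHom f₁.hom.toRingHom) ≫ hU₁.fromSpec := rfl
  have hp₂ : p.left = Spec.map (CommRingCat.ofHom f₂.hom.toRingHom) ≫ hU₂.fromSpec :=
    congrArg (fun q : specC A ⟶ T => q.left) h
  let y : Spec (CommRingCat.of A) := ⟨𝔭, h𝔭⟩
  have hy₁ : p.left y ∈ U₁ := by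
    rw [hp₁, ← SetLike.mem_coe, ← hU₁.range_fromSpec]
    exact ⟨_, (Scheme.Hom.comp_apply _ _ _).symm⟩
  have hy₂ : p.left y ∈ U₂ := by
    rw [hp₂, ← SetLike.mem_coe, ← hU₂.range_fromSpec]
    exact ⟨_, (Scheme.Hom.comp_apply _ _ _).symm⟩
  obtain ⟨t, ht, U, hU, hUle, -, q, hq⟩ := exists_away_factor p.left 𝔭 h𝔭 (U₁ ⊓ U₂) ⟨hy₁, hy₂⟩
  refine ⟨t, ht, ?_⟩
  obtain ⟨f₀, -, hf₀⟩ := exists_algHom_of_factor hU (B := away A t) q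
    ((points T).map (loc A t) p) hq
  have key : ∀ {V : T.left.Opens} (hV : IsAffineOpen V) (hUV : U ≤ V) (g : secAlg T hV ⟶ A)
      (hg : (points T).map g (affinePt T hV) = p) (ρ : secAlg T hV ⟶ secAlg T hU)
      (hρ : (points T).map ρ (affinePt T hV) = affinePt T hU), g ≫ loc A t = ρ ≫ f₀ := by
    intro V hV hUV g hg ρ hρ
    exact affinePt_map_injective ((map_comp_of_eq hg (loc A t)).trans
      (hf₀.symm.trans (map_comp_of_eq hρ f₀).symm))
  obtain ⟨ρ₁, -, hρ₁⟩ := exists_restrict T hU hU₁ (hUle.trans inf_le_left)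
  obtain ⟨ρ₂, -, hρ₂⟩ := exists_restrict T hU hU₂ (hUle.trans inf_le_right)
  have hz : (points B).map ρ₁ z₁ = (points B).map ρ₂ z₂ := by
    refine lift_unique_on E e hb hP (hc.restrict hU (hUle.trans inf_le_left))
      (app_map_eq_of_eq hz₁ hρ₁) (app_map_eq_of_eq hz₂ hρ₂)
  change (points B).map (loc A t) ((points B).map f₁ z₁) =
      (points B).map (loc A t) ((points B).map f₂ z₂)
  rw [← Functor.map_comp_apply, ← Functor.map_comp_apply,
    key hU₁ (hUle.trans inf_le_left) f₁ rfl ρ₁ hρ₁,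
    key hU₂ (hUle.trans inf_le_right) f₂ h.symm ρ₂ hρ₂, Functor.map_comp_apply,
    Functor.map_comp_apply, hz]

lemma exists_lift (hb : ∀ A z, LinePair.M (E.hom.app A z) = (pointsMap b ≫ e.hom).app A z)
    (hP : 1 ≤ P) (h : ∀ y : T.left, ∃ (U : T.left.Opens) (hU : IsAffineOpen U), y ∈ U ∧
      IsCartierOn S e f hU ∧
      ∃ v, (lineOn e f hU).toSubmodule = Submodule.span (secAlg T hU) {v}) :
    ∃ g : T.left ⟶ B.left, g ≫ b.left = f.left := by
  choose U hU hy hc v hv using h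
  choose z hz using fun y => exists_lift_on E e hb (hc y) (hv y)
  have hz' : ∀ y, (show specC (secAlg T (hU y)) ⟶ B from z y).left ≫ b.left =
      (hU y).fromSpec ≫ f.left := fun y =>
    congrArg (fun q : specC (secAlg T (hU y)) ⟶ Y => q.left) (hz y)
  let 𝒰 : T.left.OpenCover := Scheme.Cover.mkOfCovers T.left
    (fun y => Spec Γ(T.left, U y)) (fun y => (hU y).fromSpec)
    (fun y => ⟨y, (hU y).primeIdealOf ⟨y, hy y⟩, (hU y).fromSpec_primeIdealOf ⟨y, hy y⟩⟩)
    (fun y => (hU y).isOpenImmersion_fromSpec)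
  obtain ⟨g, hg⟩ := exists_glue_hom 𝒰 (fun y => (show specC (secAlg T (hU y)) ⟶ B from z y).left)
    (fun i j R a b' hab => by
      have ha : a ≫ (specC (secAlg T (hU i))).hom = (a ≫ 𝒰.f i) ≫ T.hom := by
        rw [specC_algOf_hom]
        exact (Category.assoc _ _ _).symm
      have hb' : b' ≫ (specC (secAlg T (hU j))).hom = (a ≫ 𝒰.f i) ≫ T.hom := by
        rw [hab, specC_algOf_hom]
        exact (Category.assoc _ _ _).symm
      obtain ⟨f₁, h₁⟩ := specC_map_preimage (mkPt (X := specC (secAlg T (hU i))) a ha)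
      obtain ⟨f₂, h₂⟩ := specC_map_preimage (mkPt (X := specC (secAlg T (hU j))) b' hb')
      have key := lift_compatible E e hb hP (hc i) (hz i) (hz j) f₁ f₂ (by
        change (algSpec (CommRingCat.of ℂ)).map f₁.op ≫ affinePt T (hU i) =
          (algSpec (CommRingCat.of ℂ)).map f₂.op ≫ affinePt T (hU j)
        rw [h₁, h₂]
        exact Over.OverMorphism.ext hab)
      rw [points_map, points_map, h₁, h₂] at key
      exact congrArg (fun q : specC _ ⟶ B => q.left) key)
  refine ⟨g, 𝒰.hom_ext _ _ fun y => ?_⟩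
  rw [← Category.assoc, hg]
  exact hz' y

lemma lift_unique (hb : ∀ A z, LinePair.M (E.hom.app A z) = (pointsMap b ≫ e.hom).app A z)
    (hP : 1 ≤ P) (h : ∀ y : T.left, ∃ (U : T.left.Opens) (hU : IsAffineOpen U), y ∈ U ∧
      IsCartierOn S e f hU)
    {g g' : T.left ⟶ B.left} (hg : g ≫ b.left = f.left) (hg' : g' ≫ b.left = f.left) : g = g' := by
  choose U hU hy hc using h
  have hw : ∀ g : T.left ⟶ B.left, g ≫ b.left = f.left → g ≫ B.hom = T.hom := fun g hg => by
    rw [← Over.w b, ← Over.w f, ← hg]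
    exact (Category.assoc _ _ _).symm
  let 𝒰 : T.left.OpenCover := Scheme.Cover.mkOfCovers T.left
    (fun y => Spec Γ(T.left, U y)) (fun y => (hU y).fromSpec)
    (fun y => ⟨y, (hU y).primeIdealOf ⟨y, hy y⟩, (hU y).fromSpec_primeIdealOf ⟨y, hy y⟩⟩)
    (fun y => (hU y).isOpenImmersion_fromSpec)
  have hl : ∀ (g : T.left ⟶ B.left) (hg : g ≫ b.left = f.left) (y : T.left),
      (pointsMap b).app _ ((pointsMap (Over.homMk g (hw g hg))).app _ (affinePt T (hU y))) =
        (pointsMap f).app _ (affinePt T (hU y)) := by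
    intro g hg y
    refine Over.OverMorphism.ext ?_
    exact (Category.assoc _ _ _).trans (congrArg (fun q => (hU y).fromSpec ≫ q) hg)
  refine 𝒰.hom_ext _ _ fun y => ?_
  exact congrArg (fun q : specC _ ⟶ B => q.left)
    (lift_unique_on E e hb hP (hc y) (hl g hg y) (hl g' hg' y))

lemma isBlowup_incidence (hb : ∀ A z, LinePair.M (E.hom.app A z) = (pointsMap b ≫ e.hom).app A z)
    (hP : 1 ≤ P) (hm : 1 ≤ m) {Z : SchemeC} {i : Z ⟶ Y}
    (hi : IsZeroLocus i fun A x => Killed S.π A (e.hom.app A x)) : IsBlowup b.left i.left.ker where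
  isEffectiveCartier := isEffectiveCartier_incidence S hP hm E e b hb hi
  existsUnique_lift T f hf := by
    -- An arbitrary test scheme becomes a scheme over `ℂ` through `f`, so the universal property
    -- over `ℂ` gives the absolute one.
    let f' : Over.mk (f ≫ Y.hom) ⟶ Y := Over.homMk f rfl
    have h := exists_isCartierOn e (f := f') hm hi hf
    obtain ⟨g, hg⟩ := exists_lift E e hb hP h
    refine ⟨g, hg, fun g' hg' => lift_unique E e hb hP (f := f') (fun y => ?_) hg' hg⟩
    obtain ⟨U, hU, hy, hc, -⟩ := h y
    exact ⟨U, hU, hy, hc⟩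

end UniversalProperty

/-! ### Constancy from pencils -/

section ExchangeArgument

variable {K V : Type*} [Field K] [AddCommGroup V] [Module K V] {k : ℕ}

lemma span_range_le_ker_iff {θ : V →ₗ[K] K} {w : Fin k → V} :
    Submodule.span K (Set.range w) ≤ LinearMap.ker θ ↔ ∀ j, θ (w j) = 0 := by
  rw [Submodule.span_le]
  exact Set.range_subset_iff

lemma linearIndependent_update_of_notMem {u : Fin k → V} (hu : LinearIndependent K u) (i : Fin k)
    {q : V} (hq : q ∉ Submodule.span K (Set.range u)) :
    LinearIndependent K (Function.update u i q) := by
  have h := linearIndependent_option'.2 ⟨hu, hq⟩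
  have hinj : Function.Injective fun j => if j = i then none else some j := by
    intro a b hab
    by_cases ha : a = i <;> by_cases hb : b = i <;> simp_all
  convert h.comp _ hinj using 1
  ext j
  by_cases hj : j = i
  · subst hj; simp
  · simp [hj]

lemma span_range_update {u : Fin k → V} {l : Fin k} {c : Fin k → K} (hl : c l ≠ 0) :
    Submodule.span K (Set.range (Function.update u l (∑ j, c j • u j))) =
      Submodule.span K (Set.range u) := by
  have hmem : ∀ j, Function.update u l (∑ j, c j • u j) j ∈
      Submodule.span K (Set.range (Function.update u l (∑ j, c j • u j))) :=
    fun j => Submodule.subset_span ⟨j, rfl⟩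
  have hne : ∀ j, j ≠ l → u j ∈
      Submodule.span K (Set.range (Function.update u l (∑ j, c j • u j))) := fun j hj => by
    have := hmem j
    rwa [Function.update_of_ne hj] at this
  apply le_antisymm
  · refine Submodule.span_le.2 ?_
    rintro _ ⟨j, rfl⟩
    by_cases hj : j = l
    · subst hj
      rw [Function.update_self]
      exact sum_mem fun j _ => Submodule.smul_mem _ _ (Submodule.subset_span ⟨j, rfl⟩)
    · rw [Function.update_of_ne hj]
      exact Submodule.subset_span ⟨j, rfl⟩
  · refine Submodule.span_le.2 ?_
    rintro _ ⟨j, rfl⟩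
    by_cases hj : j = l
    · subst hj
      have h1 := hmem j
      rw [Function.update_self] at h1
      have h2 : ∑ x ∈ Finset.univ.erase j, c x • u x ∈
          Submodule.span K (Set.range (Function.update u j (∑ j, c j • u j))) :=
        sum_mem fun x hx => Submodule.smul_mem _ _ (hne x (Finset.ne_of_mem_erase hx))
      have h3 := sub_mem h1 h2
      rw [← Finset.sum_erase_add _ _ (Finset.mem_univ j), add_sub_cancel_left] at h3
      rw [← Finset.sum_erase_add _ _ (Finset.mem_univ j)]
      exact (Submodule.smul_mem_iff _ hl).1 h3
    · exact hne j hj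

/-- A frame-dependent vector, well defined modulo the span of the frame, that is additive along
pencils in the following sense. -/
structure IsPencilAdditive (f : (Fin k → V) → V) : Prop where
  congr : ∀ {w w' : Fin k → V}, LinearIndependent K w → LinearIndependent K w' →
    Submodule.span K (Set.range w) = Submodule.span K (Set.range w') →
      f w - f w' ∈ Submodule.span K (Set.range w)
  add : ∀ {u : Fin k → V} {i : Fin k} {q : V} {θ₀ θ₁ : V →ₗ[K] K}, LinearIndependent K u →
    q ∉ Submodule.span K (Set.range u) → (∀ j, j ≠ i → θ₀ (u j) = 0) →
    (∀ j, j ≠ i → θ₁ (u j) = 0) → θ₀ (u i) = 0 → θ₁ q = 0 → θ₀ q + θ₁ (u i) = 0 →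
    (θ₀ + θ₁) (f (Function.update u i (u i + q))) = θ₀ (f u) + θ₁ (f (Function.update u i q))

variable {f : (Fin k → V) → V}

/-- Additivity for the pairs `(θ, 0)` and `(0, θ)` equates both values with the one at the member `u
i + q`. -/
lemma IsPencilAdditive.exchange (hf : IsPencilAdditive (K := K) f) {θ : V →ₗ[K] K} {u : Fin k → V}
    (i : Fin k) {q : V} (hu : LinearIndependent K u) (hq : q ∉ Submodule.span K (Set.range u))
    (hθ : ∀ j, θ (u j) = 0) (hθq : θ q = 0) : θ (f (Function.update u i q)) = θ (f u) := by
  have h1 := hf.add (i := i) (θ₀ := θ) (θ₁ := 0) hu hq (fun j _ => hθ j) (fun _ _ => rfl) (hθ i) rfl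
    (by rw [hθq, LinearMap.zero_apply, add_zero])
  have h2 := hf.add (i := i) (θ₀ := 0) (θ₁ := θ) hu hq (fun _ _ => rfl) (fun j _ => hθ j) rfl hθq
    (by rw [hθ, LinearMap.zero_apply, add_zero])
  rw [add_zero, LinearMap.zero_apply, add_zero] at h1
  rw [zero_add, LinearMap.zero_apply, zero_add] at h2
  rw [← h1, ← h2]

/-- A Steinitz exchange inside `ker θ` replaces the vectors of `w` by those of `w'` one at a time.
If the new vector is outside the current span, `exchange` applies. If it is inside, the frame is
changed without changing its span, which `congr` allows. -/
lemma IsPencilAdditive.eq_of_ker (hf : IsPencilAdditive (K := K) f) {θ : V →ₗ[K] K}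
    {w w' : Fin k → V} (hw : LinearIndependent K w) (hw' : LinearIndependent K w')
    (hθ : ∀ j, θ (w j) = 0) (hθ' : ∀ j, θ (w' j) = 0) : θ (f w) = θ (f w') := by
  have key : ∀ T : Finset (Fin k), ∃ u : Fin k → V, LinearIndependent K u ∧ (∀ j, θ (u j) = 0) ∧
      (∀ j ∈ T, u j = w' j) ∧ θ (f u) = θ (f w) := by
    intro T
    induction T using Finset.induction_on with
    | empty => exact ⟨w, hw, hθ, by simp, rfl⟩
    | insert i T hi ih =>
      obtain ⟨u, hu, hθu, huT, hfu⟩ := ih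
      by_cases hq : w' i ∈ Submodule.span K (Set.range u)
      · obtain ⟨c, hc⟩ := (Submodule.mem_span_range_iff_exists_fun K).1 hq
        -- Independence of `w'` provides a vector not yet exchanged on which `w' i` depends. It is
        -- replaced by `w' i`, and a transposition moves the new vector to position `i`.
        obtain ⟨l, hlT, hl⟩ : ∃ l ∉ T, c l ≠ 0 := by
          by_contra! hcon
          have h1 : w' i ∈ Submodule.span K (w' '' (T : Set (Fin k))) := by
            rw [← hc]
            refine sum_mem fun l _ => ?_
            by_cases hl : l ∈ T
            · rw [huT l hl]
              exact Submodule.smul_mem _ _ (Submodule.subset_span ⟨l, hl, rfl⟩)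
            · rw [hcon l hl, zero_smul]
              exact zero_mem _
          exact hw'.notMem_span_image (by simpa using hi) h1
        have hspan := span_range_update (u := u) hl
        rw [hc] at hspan
        let u₁ := Function.update u l (w' i)
        have hu₁ : LinearIndependent K u₁ := by
          rw [linearIndependent_iff_card_eq_finrank_span, Set.finrank, hspan]
          exact linearIndependent_iff_card_eq_finrank_span.1 hu
        have hspan₂ : Set.range (u₁ ∘ Equiv.swap i l) = Set.range u₁ :=
          (Equiv.swap i l).surjective.range_comp u₁
        have hu₂ : LinearIndependent K (u₁ ∘ Equiv.swap i l) := hu₁.comp _ (Equiv.injective _)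
        have hθ₂ : ∀ j, θ ((u₁ ∘ Equiv.swap i l) j) = 0 := by
          rw [← span_range_le_ker_iff, hspan₂, hspan, span_range_le_ker_iff]
          exact hθu
        refine ⟨u₁ ∘ Equiv.swap i l, hu₂, hθ₂, fun j hj => ?_, ?_⟩
        · rcases Finset.mem_insert.1 hj with rfl | hj
          · simp [u₁]
          · have hji : j ≠ i := fun h => hi (h ▸ hj)
            have hjl : j ≠ l := fun h => hlT (h ▸ hj)
            simp [u₁, Equiv.swap_apply_of_ne_of_ne hji hjl, hjl, huT j hj]
        · have h1 := hf.congr hu₂ hu (by rw [hspan₂]; exact hspan)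
          have h2 := span_range_le_ker_iff.2 hθ₂ h1
          rw [LinearMap.mem_ker, map_sub, sub_eq_zero] at h2
          rw [h2, hfu]
      · refine ⟨Function.update u i (w' i), linearIndependent_update_of_notMem hu i hq, ?_, ?_, ?_⟩
        · intro j
          by_cases hj : j = i
          · subst hj; rw [Function.update_self, hθ']
          · rw [Function.update_of_ne hj, hθu]
        · intro j hj
          by_cases hji : j = i
          · subst hji; rw [Function.update_self]
          · rw [Function.update_of_ne hji]
            exact huT j (Finset.mem_of_mem_insert_of_ne hj hji)
        · rw [hf.exchange i hu hq hθu (hθ' i), hfu]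
  obtain ⟨u, -, -, hu, hfu⟩ := key Finset.univ
  rw [← hfu, funext fun j => hu j (Finset.mem_univ j)]

lemma exists_smul_eq_of_ker_le {θ₀ θ₁ : V →ₗ[K] K} (h : LinearMap.ker θ₀ ≤ LinearMap.ker θ₁) :
    ∃ c : K, θ₁ = c • θ₀ := by
  have h1 := mem_span_of_iInf_ker_le_ker (L := fun _ : Unit => θ₀) (K := θ₁) (by simpa using h)
  rw [Set.range_const, Submodule.mem_span_singleton] at h1
  obtain ⟨c, hc⟩ := h1
  exact ⟨c, hc.symm⟩

lemma exists_eq_zero_eq_one {θ₀ θ₁ : V →ₗ[K] K} (h : ¬ ∃ c : K, θ₁ = c • θ₀) :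
    ∃ p, θ₀ p = 0 ∧ θ₁ p = 1 := by
  have h1 : ¬ LinearMap.ker θ₀ ≤ LinearMap.ker θ₁ := fun h1 => h (exists_smul_eq_of_ker_le h1)
  obtain ⟨p, hp, hp'⟩ := SetLike.not_le_iff_exists.1 h1
  refine ⟨(θ₁ p)⁻¹ • p, ?_, ?_⟩
  · rw [map_smul, LinearMap.mem_ker.1 hp, smul_zero]
  · rw [map_smul, smul_eq_mul, inv_mul_cancel₀ hp']

variable [FiniteDimensional K V]

lemma exists_frame_ker (hk : k < Module.finrank K V) (θ : V →ₗ[K] K) :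
    ∃ w : Fin k → V, LinearIndependent K w ∧ ∀ j, θ (w j) = 0 := by
  have h1 : Module.finrank K (LinearMap.range θ) ≤ 1 := by
    have := Submodule.finrank_le (LinearMap.range θ)
    rwa [Module.finrank_self] at this
  have h2 := LinearMap.finrank_range_add_finrank_ker θ
  obtain ⟨w, hw⟩ := exists_linearIndependent_of_le_finrank (R := K) (M := LinearMap.ker θ) (n := k)
    (by omega)
  exact ⟨fun j => w j, hw.map' _ (Submodule.ker_subtype _), fun j => (w j).2⟩

lemma exists_frame_ker_inf (hk : k + 1 < Module.finrank K V) (θ₀ θ₁ : V →ₗ[K] K) :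
    ∃ w : Fin k → V, LinearIndependent K w ∧ (∀ j, θ₀ (w j) = 0) ∧ ∀ j, θ₁ (w j) = 0 := by
  have h1 : Module.finrank K (LinearMap.range (θ₀.prod θ₁)) ≤ 2 := by
    have := Submodule.finrank_le (LinearMap.range (θ₀.prod θ₁))
    rwa [Module.finrank_prod, Module.finrank_self] at this
  have h2 := LinearMap.finrank_range_add_finrank_ker (θ₀.prod θ₁)
  obtain ⟨w, hw⟩ := exists_linearIndependent_of_le_finrank (R := K)
    (M := LinearMap.ker (θ₀.prod θ₁)) (n := k) (by omega)
  have h3 : ∀ j, θ₀ (w j) = 0 ∧ θ₁ (w j) = 0 := fun j => by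
    have := (w j).2
    exact Prod.mk_eq_zero.1 this
  exact ⟨fun j => w j, hw.map' _ (Submodule.ker_subtype _), fun j => (h3 j).1, fun j => (h3 j).2⟩

/-- By `eq_of_ker` the value `θ (f w)` is a function of `θ` alone. It is linear in `θ`, hence is
evaluation at some `v`. A difference `f w - v` outside the span of `w` would be detected by a
functional that kills `w`. -/
lemma IsPencilAdditive.exists_const (hf : IsPencilAdditive (K := K) f) (hk : 1 ≤ k)
    (hkV : k < Module.finrank K V) :
    ∃ v : V, ∀ w : Fin k → V, LinearIndependent K w → f w - v ∈ Submodule.span K (Set.range w) := by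
  choose W hW hWθ using fun θ : V →ₗ[K] K => exists_frame_ker hkV θ
  have hΦ : ∀ (θ : V →ₗ[K] K) (w : Fin k → V), LinearIndependent K w → (∀ j, θ (w j) = 0) →
      θ (f w) = θ (f (W θ)) := fun θ w hw hθ => hf.eq_of_ker hw (hW θ) hθ (hWθ θ)
  have hsmul : ∀ (c : K) (θ : V →ₗ[K] K), (c • θ) (f (W (c • θ))) = c * θ (f (W θ)) := by
    intro c θ
    rw [← hΦ (c • θ) (W θ) (hW θ) fun j => by rw [LinearMap.smul_apply, hWθ, smul_zero]]
    rfl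
  have hadd : ∀ θ₀ θ₁ : V →ₗ[K] K,
      (θ₀ + θ₁) (f (W (θ₀ + θ₁))) = θ₀ (f (W θ₀)) + θ₁ (f (W θ₁)) := by
    intro θ₀ θ₁
    by_cases h01 : ∃ c : K, θ₁ = c • θ₀
    · obtain ⟨c, rfl⟩ := h01
      have h1 : θ₀ + c • θ₀ = (1 + c) • θ₀ := by rw [add_smul, one_smul]
      rw [h1, hsmul, hsmul]; ring
    by_cases h10 : ∃ c : K, θ₀ = c • θ₁
    · obtain ⟨c, rfl⟩ := h10
      have h1 : c • θ₁ + θ₁ = (c + 1) • θ₁ := by rw [add_smul, one_smul]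
      rw [h1, hsmul, hsmul]; ring
    -- For independent functionals the pencil moves one frame vector from `p ∈ ker θ₀` to `-q ∈ ker
    -- θ₁`, the others lying in both kernels. Since `θ₁ p = θ₀ q = 1`, the member with `p - q` lies
    -- in `ker (θ₀ + θ₁)`.
    obtain ⟨p, hp₀, hp₁⟩ := exists_eq_zero_eq_one h01
    obtain ⟨q, hq₁, hq₀⟩ := exists_eq_zero_eq_one h10
    obtain ⟨k, rfl⟩ := Nat.exists_eq_add_of_le' hk
    obtain ⟨w, hw, hw₀, hw₁⟩ := exists_frame_ker_inf hkV θ₀ θ₁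
    let u : Fin (k + 1) → V := Fin.cons p w
    have hu0 : u 0 = p := rfl
    have hus : ∀ j, j ≠ 0 → θ₀ (u j) = 0 ∧ θ₁ (u j) = 0 := by
      intro j hj
      obtain ⟨j, rfl⟩ := Fin.exists_succ_eq.2 hj
      exact ⟨hw₀ j, hw₁ j⟩
    have hu : LinearIndependent K u := by
      refine linearIndependent_finCons.2 ⟨hw, fun hp => ?_⟩
      have := span_range_le_ker_iff.2 hw₁ hp
      rw [LinearMap.mem_ker, hp₁] at this
      exact one_ne_zero this
    have hu₀ : ∀ j, θ₀ (u j) = 0 := fun j => by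
      by_cases hj : j = 0
      · subst hj; exact hp₀
      · exact (hus j hj).1
    have hq : ∀ q, θ₀ q ≠ 0 → q ∉ Submodule.span K (Set.range u) := fun q hq hmem =>
      hq (span_range_le_ker_iff.2 hu₀ hmem)
    have hq' : θ₀ (-q) = -1 := by rw [map_neg, hq₀]
    have hqne : θ₀ (-q) ≠ 0 := by rw [hq']; exact neg_ne_zero.2 one_ne_zero
    have hpqne : θ₀ (p + -q) ≠ 0 := by rw [map_add, hp₀, zero_add]; exact hqne
    have h := hf.add (i := 0) (q := -q) (θ₀ := θ₀) (θ₁ := θ₁) hu (hq _ hqne)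
      (fun j hj => (hus j hj).1) (fun j hj => (hus j hj).2) hp₀ (by rw [map_neg, hq₁, neg_zero])
      (by rw [hq', hu0, hp₁, neg_add_cancel])
    rw [hu0] at h
    rw [← hΦ θ₀ _ hu hu₀, ← hΦ θ₁ _ (linearIndependent_update_of_notMem hu 0 (hq _ hqne)) ?_,
      ← hΦ (θ₀ + θ₁) _ (linearIndependent_update_of_notMem hu 0 (hq _ hpqne)) ?_, h]
    · intro j
      by_cases hj : j = 0
      · subst hj
        rw [Function.update_self, LinearMap.add_apply, map_add, map_add, hp₀, hp₁, hq', map_neg,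
          hq₁]
        ring
      · rw [Function.update_of_ne hj, LinearMap.add_apply, (hus j hj).1, (hus j hj).2, add_zero]
    · intro j
      by_cases hj : j = 0
      · subst hj
        rw [Function.update_self, map_neg, hq₁, neg_zero]
      · rw [Function.update_of_ne hj, (hus j hj).2]
  let Φ : Module.Dual K (Module.Dual K V) :=
    { toFun := fun θ => θ (f (W θ))
      map_add' := hadd
      map_smul' := hsmul }
  refine ⟨(Module.evalEquiv K V).symm Φ, fun w hw => ?_⟩
  by_contra hcon
  obtain ⟨θ, hθ, hθ'⟩ := Submodule.exists_le_ker_of_notMem hcon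
  rw [map_sub, Module.apply_evalEquiv_symm_apply, hΦ θ w hw (span_range_le_ker_iff.1 hθ')] at hθ
  exact hθ (sub_self _)

end ExchangeArgument

/-! ### Sections along pencils of flags -/

section Frames

lemma isCompl_range_ker {R M N : Type*} [CommRing R] [AddCommGroup M] [Module R M] [AddCommGroup N]
    [Module R N] {s : N →ₗ[R] M} {φ : M →ₗ[R] N} (h : ∀ c, φ (s c) = c) :
    IsCompl (LinearMap.range s) (LinearMap.ker φ) := by
  constructor
  · rw [Submodule.disjoint_def]
    rintro _ ⟨c, rfl⟩ hc
    rw [LinearMap.mem_ker, h] at hc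
    rw [hc, map_zero]
  · rw [codisjoint_iff, eq_top_iff]
    intro x _
    rw [← add_sub_cancel (s (φ x)) x]
    refine Submodule.add_mem_sup ⟨_, rfl⟩ ?_
    rw [LinearMap.mem_ker, map_sub, h, sub_self]

variable {k m : ℕ} {A B : Type} [CommRing A] [Algebra ℂ A] [CommRing B] [Algebra ℂ B]

/-- The dual functionals split off the span of the frame, so the quotient is `ker φ`, whose rank
follows from `A^k × ker φ ≃ A^m`. -/
lemma exists_gr_of_frame (w : Fin k → Vec A m) (φ : Vec A m →ₗ[A] (Fin k → A))
    (h : ∀ j, φ (w j) = Pi.single j 1) :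
    ∃ W : Gr k m A, W.toSubmodule = Submodule.span A (Set.range w) := by
  let s : (Fin k → A) →ₗ[A] Vec A m := Fintype.linearCombination A w
  have hs : φ ∘ₗ s = LinearMap.id := by
    refine LinearMap.pi_ext' fun j => LinearMap.ext_ring ?_
    simp [s, Fintype.linearCombination_apply_single, h]
  have hs' : ∀ c, φ (s c) = c := fun c => LinearMap.congr_fun hs c
  have hc : IsCompl (LinearMap.range s) (LinearMap.ker φ) := isCompl_range_ker hs'
  let π : Vec A m →ₗ[A] LinearMap.ker φ := (LinearMap.id - s ∘ₗ φ).codRestrict _ (by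
    intro x; simp [hs'])
  have hπ : π ∘ₗ (LinearMap.ker φ).subtype = LinearMap.id := by
    ext x
    have : φ x = 0 := x.2
    change (x : Vec A m) - s (φ x) = x
    rw [this, map_zero, sub_zero]
  have hp : Module.Projective A (LinearMap.ker φ) := .of_split _ π hπ
  have hf : Module.Finite A (LinearMap.ker φ) :=
    .of_surjective π fun x => ⟨x, LinearMap.congr_fun hπ x⟩
  refine ⟨grOfEquiv (LinearMap.range s) (P := LinearMap.ker φ)
    (Submodule.quotientEquivOfIsCompl _ _ hc).symm (fun p => ?_), Fintype.range_linearCombination A w⟩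
  let e : (Fin k → A) ≃ₗ[A] LinearMap.range s :=
    LinearEquiv.ofInjective s (Function.LeftInverse.injective hs')
  let e' : ((Fin k → A) × LinearMap.ker φ) ≃ₗ[A] (Fin m → A) :=
    (e.prodCongr (LinearEquiv.refl A _)).trans
      ((Submodule.prodEquivOfIsCompl _ _ hc).trans (vecEquiv A m))
  have h1 := congrFun (Module.rankAtStalk_eq_of_equiv (R := A)
    (M := (Fin k → A) × LinearMap.ker φ) (N := Fin m → A) e') p
  rw [Module.rankAtStalk_prod, Pi.add_apply, rankAtStalk_fun (Fintype.card_fin m),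
    rankAtStalk_fun (Fintype.card_fin k)] at h1
  omega

/-- The constant vector with value `v`. -/
def constVec (A : Type) [CommRing A] [Algebra ℂ A] (v : Fin m → ℂ) : Vec A m := (1 : A) ⊗ₜ[ℂ] v

lemma vecMap_constVec (f : A →ₐ[ℂ] B) (v : Fin m → ℂ) :
    vecMap f m (constVec A v) = constVec B v := by
  rw [constVec, vecMap_tmul, map_one, constVec]

lemma constVec_add (v v' : Fin m → ℂ) :
    constVec A (v + v') = constVec A v + constVec A v' := TensorProduct.tmul_add _ _ _

/-- The functional on `A^m` with constant coefficients. -/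
def constDual (A : Type) [CommRing A] [Algebra ℂ A] (θ : (Fin m → ℂ) →ₗ[ℂ] ℂ) : Vec A m →ₗ[A] A :=
  (TensorProduct.AlgebraTensorModule.rid ℂ A A).toLinearMap ∘ₗ θ.baseChange A

lemma constDual_tmul (θ : (Fin m → ℂ) →ₗ[ℂ] ℂ) (a : A) (v : Fin m → ℂ) :
    constDual A θ (a ⊗ₜ v) = θ v • a := by
  simp [constDual]

lemma constDual_constVec (θ : (Fin m → ℂ) →ₗ[ℂ] ℂ) (v : Fin m → ℂ) :
    constDual A θ (constVec A v) = algebraMap ℂ A (θ v) := by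
  rw [constVec, constDual_tmul, Algebra.algebraMap_eq_smul_one]

lemma constDual_vecMap (f : A →ₐ[ℂ] B) (θ : (Fin m → ℂ) →ₗ[ℂ] ℂ) (v : Vec A m) :
    constDual B θ (vecMap f m v) = f (constDual A θ v) := by
  induction v using TensorProduct.induction_on with
  | zero => simp
  | tmul a v => rw [vecMap_tmul, constDual_tmul, constDual_tmul, map_smul]
  | add x y hx hy => rw [map_add, map_add, hx, hy, map_add, map_add]

lemma constDual_complex (θ : (Fin m → ℂ) →ₗ[ℂ] ℂ) (v : Vec ℂ m) :
    constDual ℂ θ v = θ (vecEquiv ℂ m v) := by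
  induction v using TensorProduct.induction_on with
  | zero => simp
  | tmul a v =>
    rw [constDual_tmul]
    have : vecEquiv ℂ m (a ⊗ₜ v) = a • v := by
      ext i
      rw [vecEquiv_tmul]
      simp [mul_comm]
    rw [this, map_smul, smul_eq_mul, smul_eq_mul, mul_comm]
  | add x y hx hy => rw [map_add, map_add, hx, hy, map_add]

lemma exists_dual_frame {ι : Type*} [Fintype ι] [DecidableEq ι] {y : ι → Fin m → ℂ}
    (hy : LinearIndependent ℂ y) :
    ∃ ψ : ι → ((Fin m → ℂ) →ₗ[ℂ] ℂ), ∀ i j, ψ i (y j) = if i = j then 1 else 0 := by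
  obtain ⟨l, hl⟩ := LinearMap.exists_leftInverse_of_injective (Fintype.linearCombination ℂ y)
    (LinearMap.ker_eq_bot.2 (linearIndependent_iff_injective_fintypeLinearCombination.1 hy))
  refine ⟨fun i => LinearMap.proj i ∘ₗ l, fun i j => ?_⟩
  have h := LinearMap.congr_fun hl (Pi.single j 1)
  rw [LinearMap.comp_apply, Fintype.linearCombination_apply_single, one_smul] at h
  rw [LinearMap.comp_apply, h]
  simp [Pi.single_apply]

/-- A flag spanned by a vector and a frame. -/
structure IsSpannedBy (x : Flag 1 k m A) (v : Vec A m) (w : Fin k → Vec A m) : Prop where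
  line : x.W₁.toSubmodule = Submodule.span A {v}
  space : x.W₂.toSubmodule = Submodule.span A (Set.range w)

lemma IsSpannedBy.map {x : Flag 1 k m A} {v : Vec A m} {w : Fin k → Vec A m}
    (h : IsSpannedBy x v w) (f : A →ₐ[ℂ] B) :
    IsSpannedBy (x.map f) (vecMap f m v) fun j => vecMap f m (w j) where
  line := by
    rw [Flag.map, grMap_eq_span, h.line]
    apply le_antisymm
    · refine Submodule.span_le.2 ?_
      rintro _ ⟨z, hz, rfl⟩
      obtain ⟨c, rfl⟩ := Submodule.mem_span_singleton.1 hz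
      rw [vecMap_smul]
      exact Submodule.smul_mem _ _ (Submodule.mem_span_singleton_self _)
    · exact (Submodule.span_singleton_le_iff_mem _ _).2
        (Submodule.subset_span ⟨v, Submodule.mem_span_singleton_self v, rfl⟩)
  space := by
    rw [Flag.map, grMap_eq_span, h.space]
    apply le_antisymm
    · refine Submodule.span_le.2 ?_
      rintro _ ⟨z, hz, rfl⟩
      obtain ⟨c, rfl⟩ := (Submodule.mem_span_range_iff_exists_fun A).1 hz
      rw [map_sum]
      refine sum_mem fun j _ => ?_
      rw [vecMap_smul]
      exact Submodule.smul_mem _ _ (Submodule.subset_span ⟨j, rfl⟩)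
    · refine Submodule.span_le.2 ?_
      rintro _ ⟨j, rfl⟩
      exact Submodule.subset_span ⟨w j, Submodule.subset_span ⟨j, rfl⟩, rfl⟩

lemma IsSpannedBy.eq {x y : Flag 1 k m A} {v v' : Vec A m} {w w' : Fin k → Vec A m}
    (hx : IsSpannedBy x v w) (hy : IsSpannedBy y v' w')
    (hv : Submodule.span A {v} = Submodule.span A {v'})
    (hw : Submodule.span A (Set.range w) = Submodule.span A (Set.range w')) : x = y :=
  Flag.ext (gr_injective (by rw [hx.line, hy.line, hv]))
    (gr_injective (by rw [hx.space, hy.space, hw]))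

lemma exists_isSpannedBy (v : Vec A m) (ψ : Vec A m →ₗ[A] A) (hv : ψ v = 1) (w : Fin k → Vec A m)
    (φ : Vec A m →ₗ[A] (Fin k → A)) (h : ∀ j, φ (w j) = Pi.single j 1)
    (hvw : v ∈ Submodule.span A (Set.range w)) : ∃ x : Flag 1 k m A, IsSpannedBy x v w := by
  obtain ⟨W, hW⟩ := exists_gr_of_frame w φ h
  refine ⟨⟨grOfUnimodular v ψ hv, W, ?_⟩, rfl, hW⟩
  rw [hW, grOfUnimodular_toSubmodule, Submodule.span_singleton_le_iff_mem]
  exact hvw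

/-- The frame of a member of a pencil. -/
def pencilFrame (u : Fin k → Fin m → ℂ) (i : Fin k) (q : Fin m → ℂ) (t : A) (j : Fin k) : Vec A m :=
  constVec A (u j) + if j = i then t • constVec A q else 0

lemma vecMap_pencilFrame (f : A →ₐ[ℂ] B) (u : Fin k → Fin m → ℂ) (i : Fin k) (q : Fin m → ℂ)
    (t : A) (j : Fin k) : vecMap f m (pencilFrame u i q t j) = pencilFrame u i q (f t) j := by
  rw [pencilFrame, map_add, vecMap_constVec, pencilFrame]
  split_ifs with h
  · rw [vecMap_smul, vecMap_constVec]
  · rw [map_zero]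

/-- Functionals dual to `u` that kill `q` stay dual to every member of the pencil, including the one
over the polynomial ring. -/
lemma exists_isSpannedBy_pencilFrame {u : Fin k → Fin m → ℂ} {q : Fin m → ℂ}
    (h : LinearIndependent ℂ fun o : Option (Fin k) => Option.casesOn' o q u) (i l : Fin k) (t : A) :
    ∃ x : Flag 1 k m A, IsSpannedBy x (pencilFrame u i q t l) (pencilFrame u i q t) := by
  obtain ⟨ψ, hψ⟩ := exists_dual_frame h
  have hq : ∀ j, ψ (some j) q = 0 := fun j => (hψ (some j) none).trans (if_neg (by simp))
  have hu : ∀ j j', ψ (some j) (u j') = if j = j' then 1 else 0 := fun j j' =>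
    (hψ (some j) (some j')).trans (by simp)
  have key : ∀ j j', constDual A (ψ (some j)) (pencilFrame u i q t j') = if j = j' then 1 else 0 := by
    intro j j'
    rw [pencilFrame, map_add, constDual_constVec, hu]
    have : constDual A (ψ (some j)) (if j' = i then t • constVec A q else 0) = 0 := by
      split_ifs
      · rw [map_smul, constDual_constVec, hq, map_zero, smul_zero]
      · rw [map_zero]
    rw [this, add_zero]
    split_ifs <;> simp
  refine exists_isSpannedBy _ (constDual A (ψ (some l))) ?_ _
    (LinearMap.pi fun j => constDual A (ψ (some j))) ?_ (Submodule.subset_span ⟨l, rfl⟩)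
  · rw [key, if_pos rfl]
  · intro j
    ext j'
    rw [LinearMap.pi_apply, key, Pi.single_apply]

lemma exists_isSpannedBy_const {w : Fin k → Fin m → ℂ} (hw : LinearIndependent ℂ w) (v : Vec A m)
    (ψ : Vec A m →ₗ[A] A) (hv : ψ v = 1)
    (hvw : v ∈ Submodule.span A (Set.range fun j => constVec A (w j))) :
    ∃ x : Flag 1 k m A, IsSpannedBy x v fun j => constVec A (w j) := by
  obtain ⟨φ, hφ⟩ := exists_dual_frame hw
  refine exists_isSpannedBy v ψ hv _ (LinearMap.pi fun j => constDual A (φ j)) (fun j => ?_) hvw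
  ext j'
  rw [LinearMap.pi_apply, constDual_constVec, hφ, Pi.single_apply]
  split_ifs <;> simp

end Frames

/-! ### Polynomial values along a pencil. -/

section PencilSections

-- Two polynomials related in this way are the two charts of a section of `𝒪(1)` on `ℙ^1`. So `F`
-- has degree at most one, with coefficients `F(0)` and `G(0)`. The relation becomes an identity
-- with the reversed polynomial because it holds at infinitely many points.
open Polynomial in
lemma eval_one_eq_add {F G : ℂ[X]} (h : ∀ c : ℂ, c ≠ 0 → F.eval c = c * G.eval c⁻¹) :
    F.eval 1 = F.eval 0 + G.eval 0 := by
  have h1 : X ^ G.natDegree * F = X * G.reverse := by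
    rw [← sub_eq_zero]
    refine eq_zero_of_infinite_isRoot _ (Set.Infinite.mono (s := {0}ᶜ) (fun c hc => ?_)
      (Set.finite_singleton 0).infinite_compl)
    let : Invertible c⁻¹ := invertibleOfNonzero (inv_ne_zero hc)
    have h2 := eval₂_reverse_mul_pow (RingHom.id ℂ) c⁻¹ G
    rw [invOf_eq_inv, inv_inv] at h2
    have hc' : c ≠ 0 := hc
    change eval c (X ^ G.natDegree * F - X * G.reverse) = 0
    have h3 : G.eval c⁻¹ * c ^ G.natDegree = G.reverse.eval c := by
      change eval c G.reverse * c⁻¹ ^ G.natDegree = eval c⁻¹ G at h2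
      rw [← h2, mul_assoc, ← mul_pow, inv_mul_cancel₀ hc', one_pow, mul_one]
    rw [eval_sub, eval_mul, eval_mul, eval_pow, eval_X, h c hc', ← h3]
    ring
  have hcoeff : ∀ n, F.coeff (n + 1) = G.reverse.coeff (n + G.natDegree) := fun n => by
    have h2 := congrArg (fun p => p.coeff (n + 1 + G.natDegree)) h1
    rw [coeff_X_pow_mul, add_right_comm, coeff_X_mul] at h2
    exact h2
  have hF : F.natDegree ≤ 1 := by
    rw [natDegree_le_iff_coeff_eq_zero]
    intro N hN
    obtain ⟨n, rfl⟩ := Nat.exists_eq_add_of_le' (Nat.one_le_of_lt hN)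
    rw [hcoeff]
    exact coeff_eq_zero_of_natDegree_lt (lt_of_le_of_lt (reverse_natDegree_le G) (by omega))
  have h1' : F.coeff 1 = G.coeff 0 := by
    rw [hcoeff 0, zero_add, coeff_reverse, revAt_le le_rfl, Nat.sub_self]
  rw [eq_X_add_C_of_natDegree_le_one hF]
  simp [← coeff_zero_eq_eval_zero, h1', add_comm]

variable {k m : ℕ}

/-- A family of vectors that defines a section of the tautological quotient bundle. -/
def IsLiftedSection (σ : ∀ A : CommAlgCat.{0} ℂ, Flag 1 k m A → Vec A m) : Prop :=
  ∀ (A B : CommAlgCat.{0} ℂ) (f : A →ₐ[ℂ] B) (W : Flag 1 k m A),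
    vecMap f m (σ A W) - σ B (W.map f) ∈ (W.map f).W₂.toSubmodule

variable {σ : ∀ A : CommAlgCat.{0} ℂ, Flag 1 k m A → Vec A m}

/-- Lifts are compatible with base change only modulo `W₂`; a functional that kills `W₂` does not
see this ambiguity. -/
lemma IsLiftedSection.apply (hσ : IsLiftedSection σ) {A B : CommAlgCat.{0} ℂ} (f : A →ₐ[ℂ] B)
    {W : Flag 1 k m A} {W' : Flag 1 k m B} (hW : W.map f = W') {Θ : Vec A m →ₗ[A] A}
    {Θ' : Vec B m →ₗ[B] B} (hΘ : ∀ v, Θ' (vecMap f m v) = f (Θ v))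
    (hk : W.W₂.toSubmodule ≤ LinearMap.ker Θ) : Θ' (σ B W') = f (Θ (σ A W)) := by
  subst hW
  have h1 : (W.map f).W₂.toSubmodule ≤ LinearMap.ker Θ' := by
    rw [Flag.map, grMap_eq_span, Submodule.span_le]
    rintro _ ⟨v, hv, rfl⟩
    rw [SetLike.mem_coe, LinearMap.mem_ker, hΘ, hk hv, map_zero]
  have h2 := h1 (hσ A B f W)
  rw [LinearMap.mem_ker, map_sub, sub_eq_zero] at h2
  rw [← h2, hΘ]

/-- The ring of the affine line. -/
abbrev lineRing : CommAlgCat.{0} ℂ := CommAlgCat.of ℂ (Polynomial ℂ)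

/-- Evaluation at a point of the affine line. -/
abbrev evalAt (c : ℂ) : lineRing →ₐ[ℂ] (CommAlgCat.of ℂ ℂ : CommAlgCat.{0} ℂ) := Polynomial.aeval c

lemma evalAt_apply (c : ℂ) (F : Polynomial ℂ) : evalAt c F = F.eval c := by
  rw [Polynomial.coe_aeval_eq_eval]

/-- The functional `θ₀ + t θ₁`. -/
def pencilDual (A : Type) [CommRing A] [Algebra ℂ A] (θ₀ θ₁ : (Fin m → ℂ) →ₗ[ℂ] ℂ) (t : A) :
    Vec A m →ₗ[A] A := constDual A θ₀ + t • constDual A θ₁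

lemma pencilDual_vecMap {A B : Type} [CommRing A] [Algebra ℂ A] [CommRing B] [Algebra ℂ B]
    (f : A →ₐ[ℂ] B) (θ₀ θ₁ : (Fin m → ℂ) →ₗ[ℂ] ℂ) (t : A) (v : Vec A m) :
    pencilDual B θ₀ θ₁ (f t) (vecMap f m v) = f (pencilDual A θ₀ θ₁ t v) := by
  simp [pencilDual, constDual_vecMap]

lemma pencilDual_complex (θ₀ θ₁ : (Fin m → ℂ) →ₗ[ℂ] ℂ) (t : ℂ) (v : Vec ℂ m) :
    pencilDual ℂ θ₀ θ₁ t v = θ₀ (vecEquiv ℂ m v) + t * θ₁ (vecEquiv ℂ m v) := by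
  simp [pencilDual, constDual_complex]

/-- A section of the quotient bundle is additive along pencils. -/
lemma IsLiftedSection.add_of_pencil (hσ : IsLiftedSection σ) {x y : Flag 1 k m lineRing}
    (hxy : ∀ c : ℂ, c ≠ 0 → x.map (evalAt c) = y.map (evalAt c⁻¹))
    {θ₀ θ₁ : (Fin m → ℂ) →ₗ[ℂ] ℂ}
    (hx : x.W₂.toSubmodule ≤ LinearMap.ker (pencilDual lineRing θ₀ θ₁ (Polynomial.X : Polynomial ℂ)))
    (hy : y.W₂.toSubmodule ≤ LinearMap.ker (pencilDual lineRing θ₁ θ₀ (Polynomial.X : Polynomial ℂ))) :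
    (θ₀ + θ₁) (vecEquiv ℂ m (σ (CommAlgCat.of ℂ ℂ) (x.map (evalAt 1)))) =
      θ₀ (vecEquiv ℂ m (σ (CommAlgCat.of ℂ ℂ) (x.map (evalAt 0)))) +
      θ₁ (vecEquiv ℂ m (σ (CommAlgCat.of ℂ ℂ) (y.map (evalAt 0)))) := by
  let t : lineRing := (Polynomial.X : Polynomial ℂ)
  let F : Polynomial ℂ := pencilDual lineRing θ₀ θ₁ t (σ lineRing x)
  let G : Polynomial ℂ := pencilDual lineRing θ₁ θ₀ t (σ lineRing y)
  have hev : ∀ c : ℂ, evalAt c t = c := fun c => by rw [evalAt_apply]; exact Polynomial.eval_X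
  have key : ∀ (θ₀ θ₁ : (Fin m → ℂ) →ₗ[ℂ] ℂ) (z : Flag 1 k m lineRing)
      (hz : z.W₂.toSubmodule ≤ LinearMap.ker (pencilDual lineRing θ₀ θ₁ t)) (c : ℂ),
      Polynomial.eval c (pencilDual lineRing θ₀ θ₁ t (σ lineRing z) : Polynomial ℂ) =
        θ₀ (vecEquiv ℂ m (σ (CommAlgCat.of ℂ ℂ) (z.map (evalAt c)))) +
        c * θ₁ (vecEquiv ℂ m (σ (CommAlgCat.of ℂ ℂ) (z.map (evalAt c)))) := by
    intro θ₀ θ₁ z hz c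
    rw [← evalAt_apply]
    have h1 := hσ.apply (evalAt c) (rfl : z.map (evalAt c) = _)
      (Θ' := pencilDual ℂ θ₀ θ₁ (evalAt c t)) (fun v => pencilDual_vecMap (evalAt c) θ₀ θ₁ t v) hz
    refine h1.symm.trans ((pencilDual_complex _ _ _ _).trans ?_)
    rw [hev]
  -- At the common flag of the parameters `c` and `c⁻¹`, the functional `θ₀ + c θ₁` is `c` times `θ₁
  -- + c⁻¹ θ₀`.
  have h := eval_one_eq_add (F := F) (G := G) fun c hc => by
    have h1 := key θ₀ θ₁ x hx c
    have h2 := key θ₁ θ₀ y hy c⁻¹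
    rw [← hxy c hc] at h2
    change Polynomial.eval c F = _ at h1
    change Polynomial.eval c⁻¹ G = _ at h2
    rw [h1, h2, mul_add, mul_inv_cancel_left₀ hc]
    ring
  have h1 := key θ₀ θ₁ x hx 1
  have h2 := key θ₀ θ₁ x hx 0
  have h3 := key θ₁ θ₀ y hy 0
  rw [zero_mul, add_zero] at h2 h3
  rw [one_mul] at h1
  exact h1.symm.trans (h.trans (congrArg₂ _ h2 h3))

lemma span_pencil {ι V : Type*} [AddCommGroup V] [Module ℂ V] {w w' : ι → V} (c : ι → ℂ)
    (hc : ∀ i, c i ≠ 0) (h : ∀ i, w i = c i • w' i) :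
    Submodule.span ℂ (Set.range w) = Submodule.span ℂ (Set.range w') := by
  apply le_antisymm
  · refine Submodule.span_le.2 ?_
    rintro _ ⟨i, rfl⟩
    rw [h]
    exact Submodule.smul_mem _ _ (Submodule.subset_span ⟨i, rfl⟩)
  · refine Submodule.span_le.2 ?_
    rintro _ ⟨i, rfl⟩
    have : w' i = (c i)⁻¹ • w i := by rw [h, inv_smul_smul₀ (hc i)]
    rw [SetLike.mem_coe, this]
    exact Submodule.smul_mem _ _ (Submodule.subset_span ⟨i, rfl⟩)

end PencilSections

/-! ### Complex flags and independence of the line. -/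

section ComplexPoints

variable {k m : ℕ}

/-- The category object of the base field. -/
abbrev baseField : CommAlgCat.{0} ℂ := CommAlgCat.of ℂ ℂ

lemma constVec_complex (v : Fin m → ℂ) : constVec ℂ v = (vecEquiv ℂ m).symm v := by
  apply (vecEquiv ℂ m).injective
  ext i
  rw [LinearEquiv.apply_symm_apply, constVec, vecEquiv_tmul]
  simp

lemma vecEquiv_constVec (v : Fin m → ℂ) : vecEquiv ℂ m (constVec ℂ v) = v := by
  rw [constVec_complex, LinearEquiv.apply_symm_apply]

lemma constVec_vecEquiv (z : Vec ℂ m) : constVec ℂ (vecEquiv ℂ m z) = z := by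
  rw [constVec_complex, LinearEquiv.symm_apply_apply]

lemma span_constVec {ι : Type*} (w : ι → Fin m → ℂ) :
    Submodule.span ℂ (Set.range fun j => constVec ℂ (w j)) =
      (Submodule.span ℂ (Set.range w)).comap (vecEquiv ℂ m).toLinearMap := by
  have h := Submodule.map_equiv_eq_comap_symm (vecEquiv ℂ m).symm (Submodule.span ℂ (Set.range w))
  rw [LinearEquiv.symm_symm] at h
  refine Eq.trans ?_ h
  rw [Submodule.map_span, ← Set.range_comp]
  congr 1
  exact congrArg Set.range (funext fun j => constVec_complex (w j))

lemma mem_span_constVec_iff {ι : Type*} {w : ι → Fin m → ℂ} {z : Vec ℂ m} :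
    z ∈ Submodule.span ℂ (Set.range fun j => constVec ℂ (w j)) ↔
      vecEquiv ℂ m z ∈ Submodule.span ℂ (Set.range w) := by
  rw [span_constVec]; rfl

lemma constVec_mem_span {A : Type} [CommRing A] [Algebra ℂ A] {w : Fin k → Fin m → ℂ}
    {v : Fin m → ℂ} (hv : v ∈ Submodule.span ℂ (Set.range w)) :
    constVec A v ∈ Submodule.span A (Set.range fun j => constVec A (w j)) := by
  obtain ⟨c, rfl⟩ := (Submodule.mem_span_range_iff_exists_fun ℂ).1 hv
  have : constVec A (∑ i, c i • w i) = ∑ i, algebraMap ℂ A (c i) • constVec A (w i) := by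
    rw [constVec, TensorProduct.tmul_sum]
    refine Finset.sum_congr rfl fun i _ => ?_
    rw [TensorProduct.tmul_smul, constVec, algebraMap_smul]
  rw [this]
  exact sum_mem fun i _ => Submodule.smul_mem _ _ (Submodule.subset_span ⟨i, rfl⟩)

lemma exists_frame_gr (hk : k ≤ m) (W : Gr k m ℂ) : ∃ w : Fin k → Fin m → ℂ,
    LinearIndependent ℂ w ∧
      W.toSubmodule = Submodule.span ℂ (Set.range fun j => constVec ℂ (w j)) := by
  have h1 : Module.finrank ℂ (Vec ℂ m ⧸ W.toSubmodule) = m - k := by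
    have h := W.rankAtStalk_eq (⟨⊥, Ideal.isPrime_bot⟩ : PrimeSpectrum ℂ)
    rwa [Module.rankAtStalk_eq_finrank_of_free] at h
  have h2 : Module.finrank ℂ (Vec ℂ m) = m := by
    rw [(vecEquiv ℂ m).finrank_eq, Module.finrank_fin_fun]
  have : Module.Finite ℂ (Vec ℂ m) := Module.Finite.equiv (vecEquiv ℂ m).symm
  have h3 := Submodule.finrank_quotient_add_finrank W.toSubmodule
  let b := Module.finBasisOfFinrankEq ℂ W.toSubmodule (n := k) (by omega)
  refine ⟨fun j => vecEquiv ℂ m (b j), ?_, ?_⟩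
  · exact (b.linearIndependent.map' _ (Submodule.ker_subtype _)).map' (vecEquiv ℂ m).toLinearMap
      (LinearEquiv.ker _)
  · simp only [constVec_vecEquiv]
    have h4 := congrArg (Submodule.map W.toSubmodule.subtype) b.span_eq
    rw [Submodule.map_span, Submodule.map_top, Submodule.range_subtype, ← Set.range_comp] at h4
    exact h4.symm

lemma exists_complexFlag {w : Fin k → Fin m → ℂ} (hw : LinearIndependent ℂ w) (l : Fin k) :
    ∃ x : Flag 1 k m baseField, IsSpannedBy x (constVec ℂ (w l)) fun j => constVec ℂ (w j) := by
  obtain ⟨φ, hφ⟩ := exists_dual_frame hw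
  refine exists_isSpannedBy_const (A := baseField) hw _ (constDual ℂ (φ l)) ?_
    (Submodule.subset_span ⟨l, rfl⟩)
  rw [constDual_constVec, hφ, if_pos rfl, map_one]

lemma vecMap_add_smul_evalAt (c : ℂ) (a b : Fin m → ℂ) :
    vecMap (evalAt c) m (constVec lineRing a + (Polynomial.X : Polynomial ℂ) • constVec lineRing b) =
      constVec ℂ a + c • constVec ℂ b := by
  rw [map_add, vecMap_smul, vecMap_constVec, vecMap_constVec, evalAt_apply, Polynomial.eval_X]

lemma exists_line_pencil {w : Fin k → Fin m → ℂ} (hw : LinearIndependent ℂ w) {a b : Fin m → ℂ}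
    (hab : LinearIndependent ℂ ![a, b]) (ha : a ∈ Submodule.span ℂ (Set.range w))
    (hb : b ∈ Submodule.span ℂ (Set.range w)) : ∃ x : Flag 1 k m lineRing,
      IsSpannedBy x (constVec lineRing a + (Polynomial.X : Polynomial ℂ) • constVec lineRing b)
        (fun j => constVec lineRing (w j)) ∧
      ∀ c, IsSpannedBy (x.map (evalAt c)) (constVec ℂ a + c • constVec ℂ b)
        fun j => constVec ℂ (w j) := by
  obtain ⟨ψ, hψ⟩ := exists_dual_frame hab
  have ha1 : ψ 0 a = 1 := hψ 0 0
  have hb0 : ψ 0 b = 0 := hψ 0 1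
  obtain ⟨x, hx⟩ := exists_isSpannedBy_const (A := lineRing) hw
    (constVec lineRing a + (Polynomial.X : Polynomial ℂ) • constVec lineRing b)
    (constDual lineRing (ψ 0)) (by
      rw [map_add, map_smul, constDual_constVec, constDual_constVec, ha1, hb0, map_one, map_zero,
        smul_zero, add_zero])
    (add_mem (constVec_mem_span ha) (Submodule.smul_mem _ _ (constVec_mem_span hb)))
  refine ⟨x, hx, fun c => ?_⟩
  have h1 := hx.map (B := baseField) (evalAt c)
  rw [vecMap_add_smul_evalAt] at h1
  simp only [vecMap_constVec] at h1
  exact h1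

variable {σ : ∀ A : CommAlgCat.{0} ℂ, Flag 1 k m A → Vec A m}

lemma mem_of_forall_dual {w : Fin k → Fin m → ℂ} {v : Fin m → ℂ}
    (h : ∀ θ : (Fin m → ℂ) →ₗ[ℂ] ℂ, (∀ j, θ (w j) = 0) → θ v = 0) :
    v ∈ Submodule.span ℂ (Set.range w) := by
  by_contra hcon
  obtain ⟨θ, hθ, hθ'⟩ := Submodule.exists_le_ker_of_notMem hcon
  exact hθ (h θ (span_range_le_ker_iff.1 hθ'))

lemma le_ker_pencilDual {A : CommAlgCat.{0} ℂ} {x : Flag 1 k m A} {v : Vec A m}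
    {w : Fin k → Vec A m} (hx : IsSpannedBy x v w) {θ₀ θ₁ : (Fin m → ℂ) →ₗ[ℂ] ℂ} {t : A}
    (h : ∀ j, pencilDual A θ₀ θ₁ t (w j) = 0) :
    x.W₂.toSubmodule ≤ LinearMap.ker (pencilDual A θ₀ θ₁ t) := by
  rw [hx.space, Submodule.span_le]
  rintro _ ⟨j, rfl⟩
  exact h j

/-- A section of the quotient bundle does not depend on the line. -/
lemma IsLiftedSection.sub_mem_of_space_eq (hσ : IsLiftedSection σ) {w : Fin k → Fin m → ℂ}
    (hw : LinearIndependent ℂ w) {a b : Fin m → ℂ} {x y : Flag 1 k m baseField}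
    (hx : IsSpannedBy x (constVec ℂ a) fun j => constVec ℂ (w j))
    (hy : IsSpannedBy y (constVec ℂ b) fun j => constVec ℂ (w j)) (ha : a ≠ 0) (hb : b ≠ 0) :
    vecEquiv ℂ m (σ _ x) - vecEquiv ℂ m (σ _ y) ∈ Submodule.span ℂ (Set.range w) := by
  by_cases hab : LinearIndependent ℂ ![a, b]
  · have ha' : a ∈ Submodule.span ℂ (Set.range w) := by
      rw [← vecEquiv_constVec a, ← mem_span_constVec_iff, ← hx.space]
      exact x.le (hx.line ▸ Submodule.mem_span_singleton_self _)
    have hb' : b ∈ Submodule.span ℂ (Set.range w) := by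
      rw [← vecEquiv_constVec b, ← mem_span_constVec_iff, ← hy.space]
      exact y.le (hy.line ▸ Submodule.mem_span_singleton_self _)
    obtain ⟨X, hX, hX'⟩ := exists_line_pencil hw hab ha' hb'
    obtain ⟨Y, hY, hY'⟩ := exists_line_pencil hw (LinearIndependent.pair_symm_iff.1 hab) hb' ha'
    have hXY : ∀ c : ℂ, c ≠ 0 → X.map (evalAt c) = Y.map (evalAt c⁻¹) := fun c hc => by
      refine (hX' c).eq (hY' c⁻¹) ?_ rfl
      have h1 : constVec ℂ a + c • constVec ℂ b = c • (constVec ℂ b + c⁻¹ • constVec ℂ a) := by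
        rw [smul_add, smul_inv_smul₀ hc, add_comm]
      rw [h1]
      exact Submodule.span_singleton_smul_eq (isUnit_iff_ne_zero.2 hc) _
    have hX0 : X.map (evalAt 0) = x := by
      refine (hX' 0).eq hx ?_ rfl
      rw [zero_smul, add_zero]
    have hY0 : Y.map (evalAt 0) = y := by
      refine (hY' 0).eq hy ?_ rfl
      rw [zero_smul, add_zero]
    refine mem_of_forall_dual fun θ hθ => ?_
    have hk : ∀ (A : CommAlgCat.{0} ℂ) (t : A) (θ₀ θ₁ : (Fin m → ℂ) →ₗ[ℂ] ℂ),
        (∀ j, θ₀ (w j) = 0) → (∀ j, θ₁ (w j) = 0) →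
        ∀ j, pencilDual A θ₀ θ₁ t (constVec A (w j)) = 0 := by
      intro A t θ₀ θ₁ h₀ h₁ j
      rw [pencilDual, LinearMap.add_apply, LinearMap.smul_apply, constDual_constVec,
        constDual_constVec, h₀, h₁, map_zero, smul_zero, add_zero]
    have h0 : ∀ j, (0 : (Fin m → ℂ) →ₗ[ℂ] ℂ) (w j) = 0 := fun _ => rfl
    -- The space is fixed and the line moves from `a` to `b`. The two pairs `(θ, 0)` and `(0, θ)`
    -- equate both end values with the middle one.
    have h1 := hσ.add_of_pencil hXY (θ₀ := θ) (θ₁ := 0) (le_ker_pencilDual hX (hk _ _ _ _ hθ h0))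
      (le_ker_pencilDual hY (hk _ _ _ _ h0 hθ))
    have h2 := hσ.add_of_pencil hXY (θ₀ := 0) (θ₁ := θ) (le_ker_pencilDual hX (hk _ _ _ _ h0 hθ))
      (le_ker_pencilDual hY (hk _ _ _ _ hθ h0))
    rw [hX0, hY0] at h1 h2
    rw [add_zero, LinearMap.zero_apply, add_zero] at h1
    rw [zero_add, LinearMap.zero_apply, zero_add] at h2
    rw [map_sub, ← h1, ← h2, sub_self]
  · rw [LinearIndependent.pair_iff' ha] at hab
    push Not at hab
    obtain ⟨c, hc⟩ := hab
    have hc0 : c ≠ 0 := by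
      rintro rfl
      exact hb (by rw [← hc, zero_smul])
    have hxy : x = y := by
      refine hx.eq hy ?_ rfl
      have : constVec ℂ b = c • constVec ℂ a := by
        rw [← hc, constVec_complex, constVec_complex, map_smul]
      rw [this]
      exact (Submodule.span_singleton_smul_eq (isUnit_iff_ne_zero.2 hc0) _).symm
    rw [hxy, sub_self]
    exact zero_mem _

end ComplexPoints

/-! ### Sections of the quotient bundle are constant at complex points. -/

section ComplexConstancy

variable {k m : ℕ}

lemma pencilFrame_complex (u : Fin k → Fin m → ℂ) (i : Fin k) (q : Fin m → ℂ) (c : ℂ) (j : Fin k) :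
    pencilFrame (A := ℂ) u i q c j = constVec ℂ (Function.update u i (u i + c • q) j) := by
  rw [pencilFrame]
  by_cases h : j = i
  · subst h
    rw [if_pos rfl, Function.update_self, constVec_add, constVec_complex (c • q), map_smul,
      ← constVec_complex]
  · rw [if_neg h, Function.update_of_ne h, add_zero]

lemma linearIndependent_option_swap {u : Fin k → Fin m → ℂ} {q : Fin m → ℂ}
    (h : LinearIndependent ℂ fun o : Option (Fin k) => Option.casesOn' o q u) (i : Fin k) :
    LinearIndependent ℂ fun o : Option (Fin k) =>
      Option.casesOn' o (u i) (Function.update u i q) := by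
  convert h.comp _ (Equiv.swap none (some i)).injective using 1
  ext1 o
  cases o with
  | none => simp
  | some j =>
    by_cases hj : j = i
    · subst hj; simp
    · have : Equiv.swap none (some i) (some j) = some j :=
        Equiv.swap_apply_of_ne_of_ne (by simp) (by simpa using hj)
      simp [this, hj]

lemma exists_pencil {u : Fin k → Fin m → ℂ} {q : Fin m → ℂ}
    (h : LinearIndependent ℂ fun o : Option (Fin k) => Option.casesOn' o q u) (i l : Fin k) :
    ∃ x : Flag 1 k m lineRing, IsSpannedBy x (pencilFrame u i q (Polynomial.X : Polynomial ℂ) l)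
        (pencilFrame u i q (Polynomial.X : Polynomial ℂ)) ∧
      ∀ c : ℂ, IsSpannedBy (x.map (B := baseField) (evalAt c))
        (constVec ℂ (Function.update u i (u i + c • q) l))
        fun j => constVec ℂ (Function.update u i (u i + c • q) j) := by
  obtain ⟨x, hx⟩ := exists_isSpannedBy_pencilFrame (A := lineRing) h i l
    (Polynomial.X : Polynomial ℂ)
  refine ⟨x, hx, fun c => ?_⟩
  have h1 := hx.map (B := baseField) (evalAt c)
  have h2 : ∀ j, vecMap (evalAt c) m (pencilFrame u i q (Polynomial.X : Polynomial ℂ) j) =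
      constVec ℂ (Function.update u i (u i + c • q) j) := fun j => by
    rw [vecMap_pencilFrame, evalAt_apply, Polynomial.eval_X]
    exact pencilFrame_complex u i q c j
  exact ⟨h1.line.trans (congrArg (fun z => Submodule.span ℂ {z}) (h2 l)),
    h1.space.trans (congrArg (fun w => Submodule.span ℂ (Set.range w)) (funext h2))⟩

lemma pencilDual_pencilFrame {A : Type} [CommRing A] [Algebra ℂ A] {u : Fin k → Fin m → ℂ}
    {i : Fin k} {q : Fin m → ℂ} {θ₀ θ₁ : (Fin m → ℂ) →ₗ[ℂ] ℂ} (h₀ : ∀ j, j ≠ i → θ₀ (u j) = 0)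
    (h₁ : ∀ j, j ≠ i → θ₁ (u j) = 0) (hi : θ₀ (u i) = 0) (hq : θ₁ q = 0)
    (hiq : θ₀ q + θ₁ (u i) = 0) (t : A) (j : Fin k) :
    pencilDual A θ₀ θ₁ t (pencilFrame u i q t j) = 0 := by
  rw [pencilFrame, pencilDual, LinearMap.add_apply, LinearMap.smul_apply]
  by_cases h : j = i
  · subst h
    rw [if_pos rfl, map_add, map_add, map_smul, map_smul, constDual_constVec, constDual_constVec,
      constDual_constVec, constDual_constVec, hi, hq, map_zero, zero_add, smul_zero, add_zero,
      ← smul_add, ← map_add, hiq, map_zero, smul_zero]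
  · rw [if_neg h, add_zero, constDual_constVec, constDual_constVec, h₀ j h, h₁ j h, map_zero,
      smul_zero, add_zero]

variable {σ : ∀ A : CommAlgCat.{0} ℂ, Flag 1 (k + 1) m A → Vec A m}

open Classical in
/-- The value of a lifted section at the flag given by a frame. -/
def valueAt (σ : ∀ A : CommAlgCat.{0} ℂ, Flag 1 (k + 1) m A → Vec A m)
    (w : Fin (k + 1) → Fin m → ℂ) : Fin m → ℂ :=
  if h : LinearIndependent ℂ w then vecEquiv ℂ m (σ _ (exists_complexFlag h 0).choose) else 0

lemma valueAt_eq {w : Fin (k + 1) → Fin m → ℂ} (hw : LinearIndependent ℂ w)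
    {x : Flag 1 (k + 1) m baseField}
    (hx : IsSpannedBy x (constVec ℂ (w 0)) fun j => constVec ℂ (w j)) :
    valueAt σ w = vecEquiv ℂ m (σ _ x) := by
  rw [valueAt, dif_pos hw, (exists_complexFlag hw 0).choose_spec.eq hx rfl rfl]

/-- The two charts of the pencil have `i`-th frame vector `u i + t q` and `q + t u i`. At `t = c`
and `t = c⁻¹` these differ by the factor `c`, so the flags agree. -/
lemma IsLiftedSection.isPencilAdditive (hσ : IsLiftedSection σ) :
    IsPencilAdditive (K := ℂ) (valueAt σ) where
  congr {w w'} hw hw' hspan := by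
    obtain ⟨x, hx⟩ := exists_complexFlag hw 0
    obtain ⟨y, hy⟩ := exists_complexFlag hw' 0
    rw [valueAt_eq hw hx, valueAt_eq hw' hy]
    have hy' : IsSpannedBy y (constVec ℂ (w' 0)) fun j => constVec ℂ (w j) :=
      ⟨hy.line, by rw [hy.space, span_constVec, span_constVec, hspan]⟩
    exact hσ.sub_mem_of_space_eq hw hx hy' (hw.ne_zero 0) (hw'.ne_zero 0)
  add {u i q θ₀ θ₁} hu hq h₀ h₁ hi hθq hiq := by
    have h : LinearIndependent ℂ fun o : Option (Fin (k + 1)) => Option.casesOn' o q u :=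
      linearIndependent_option'.2 ⟨hu, hq⟩
    obtain ⟨x, hx, hx'⟩ := exists_pencil h i 0
    obtain ⟨y, hy, hy'⟩ := exists_pencil (linearIndependent_option_swap h i) i 0
    rw [Function.update_self] at hy'
    have e1 : Function.update u i (u i + (1 : ℂ) • q) = Function.update u i (u i + q) := by
      rw [one_smul]
    have e2 : Function.update u i (u i + (0 : ℂ) • q) = u := by
      rw [zero_smul, add_zero, Function.update_eq_self]
    have e3 : Function.update (Function.update u i q) i (q + (0 : ℂ) • u i) =
        Function.update u i q := by
      rw [zero_smul, add_zero, Function.update_idem]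
    have hq' : u i + q ∉ Submodule.span ℂ (Set.range u) := fun hmem => hq
      ((Submodule.add_mem_iff_right _ (Submodule.subset_span (Set.mem_range_self i))).1 hmem)
    have hx1 := hx' 1
    have hx0 := hx' 0
    have hy0 := hy' 0
    rw [e1] at hx1
    rw [e2] at hx0
    rw [e3] at hy0
    rw [valueAt_eq (linearIndependent_update_of_notMem hu i hq') hx1, valueAt_eq hu hx0,
      valueAt_eq (linearIndependent_update_of_notMem hu i hq) hy0]
    refine hσ.add_of_pencil (fun c hc => ?_)
      (le_ker_pencilDual hx (pencilDual_pencilFrame h₀ h₁ hi hθq hiq _))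
      (le_ker_pencilDual hy (pencilDual_pencilFrame (fun j hj => ?_) (fun j hj => ?_) ?_ hi ?_ _))
    · have key : ∀ j, Function.update u i (u i + c • q) j = (if j = i then c else 1) •
          Function.update (Function.update u i q) i (q + c⁻¹ • u i) j := by
        intro j
        by_cases hj : j = i
        · subst hj
          rw [Function.update_self, Function.update_self, if_pos rfl, smul_add, smul_inv_smul₀ hc,
            add_comm]
        · rw [Function.update_of_ne hj, Function.update_of_ne hj, Function.update_of_ne hj,
            if_neg hj, one_smul]
      have hne : ∀ j, (if j = i then c else 1) ≠ 0 := fun j => by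
        split_ifs
        exacts [hc, one_ne_zero]
      refine (hx' c).eq (hy' c⁻¹) ?_ ?_
      · rw [key 0, constVec_complex, map_smul, ← constVec_complex]
        exact Submodule.span_singleton_smul_eq (isUnit_iff_ne_zero.2 (hne 0)) _
      · rw [span_constVec, span_constVec]
        exact congrArg _ (span_pencil _ hne key)
    · rw [Function.update_of_ne hj]; exact h₁ j hj
    · rw [Function.update_of_ne hj]; exact h₀ j hj
    · rw [Function.update_self]; exact hθq
    · rw [Function.update_self, add_comm]; exact hiq

/-- A section of the quotient bundle is constant at complex points. -/
lemma IsLiftedSection.exists_const (hσ : IsLiftedSection σ) (hkm : k + 1 < m) :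
    ∃ v : Fin m → ℂ, ∀ x : Flag 1 (k + 1) m baseField,
      σ _ x - constVec ℂ v ∈ x.W₂.toSubmodule := by
  obtain ⟨v, hv⟩ := hσ.isPencilAdditive.exists_const (Nat.le_add_left 1 k)
    (by rwa [Module.finrank_fin_fun])
  refine ⟨v, fun x => ?_⟩
  obtain ⟨a, ha, hxa⟩ := exists_frame_gr (by omega) x.W₁
  obtain ⟨w, hw, hxw⟩ := exists_frame_gr hkm.le x.W₂
  have hx : IsSpannedBy x (constVec ℂ (a 0)) fun j => constVec ℂ (w j) := by
    refine ⟨hxa.trans ?_, hxw⟩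
    rw [Set.range_unique]
    rfl
  obtain ⟨y, hy⟩ := exists_complexFlag hw 0
  have h1 := hσ.sub_mem_of_space_eq hw hx hy (ha.ne_zero 0) (hw.ne_zero 0)
  have h2 := hv w hw
  rw [valueAt_eq hw hy] at h2
  rw [hx.space, mem_span_constVec_iff, map_sub, vecEquiv_constVec]
  have h3 := add_mem h1 h2
  rwa [sub_add_sub_cancel] at h3

end ComplexConstancy

/-! ### Sections vanishing at complex points -/

section FlagCharts

variable {k m : ℕ} {A B : Type} [CommRing A] [Algebra ℂ A] [CommRing B] [Algebra ℂ B]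

/-- The vector of a chart with given coordinates with respect to its frame. -/
def chartVec (ε : Fin (m - k) ⊕ Fin k ≃ Fin m) (X : Fin (m - k) × Fin k → A) (c : Fin k → A) :
    Vec A m :=
  toVec fun l => Sum.elim (fun i => -∑ j, X (i, j) * c j) c (ε.symm l)

lemma chartVec_mem (ε : Fin (m - k) ⊕ Fin k ≃ Fin m) (X : Fin (m - k) × Fin k → A)
    (c : Fin k → A) : chartVec ε X c ∈ (chartPt ε X).toSubmodule := by
  rw [mem_chartPt]
  intro i
  simp [chartVec]

lemma vecEquiv_chartVec (ε : Fin (m - k) ⊕ Fin k ≃ Fin m) (X : Fin (m - k) × Fin k → A)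
    (c : Fin k → A) (j : Fin k) : vecEquiv A m (chartVec ε X c) (ε (Sum.inr j)) = c j := by
  simp [chartVec]

lemma eq_chartVec {ε : Fin (m - k) ⊕ Fin k ≃ Fin m} {X : Fin (m - k) × Fin k → A} {v : Vec A m}
    (hv : v ∈ (chartPt ε X).toSubmodule) :
    v = chartVec ε X fun j => vecEquiv A m v (ε (Sum.inr j)) := by
  rw [mem_chartPt] at hv
  apply (vecEquiv A m).injective
  ext l
  obtain ⟨l, rfl⟩ := ε.surjective l
  rw [chartVec, vecEquiv_toVec, Equiv.symm_apply_apply]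
  rcases l with i | j
  · exact eq_neg_of_add_eq_zero_left (hv i)
  · rfl

lemma chartVec_smul (ε : Fin (m - k) ⊕ Fin k ≃ Fin m) (X : Fin (m - k) × Fin k → A) (a : A)
    (c : Fin k → A) : chartVec ε X (a • c) = a • chartVec ε X c := by
  have h := eq_chartVec (Submodule.smul_mem _ a (chartVec_mem ε X c))
  simp only [map_smul, Pi.smul_apply, vecEquiv_chartVec] at h
  exact h.symm

lemma vecMap_chartVec (f : A →ₐ[ℂ] B) (ε : Fin (m - k) ⊕ Fin k ≃ Fin m)
    (X : Fin (m - k) × Fin k → A) (c : Fin k → A) :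
    vecMap f m (chartVec ε X c) = chartVec ε (fun p => f (X p)) fun j => f (c j) := by
  have h := mem_grMap f _ (chartVec_mem ε X c)
  rw [grMap_chartPt] at h
  have h1 := eq_chartVec h
  simp only [vecEquiv_vecMap, vecEquiv_chartVec] at h1
  exact h1

/-- The flag of a chart with given coordinates. -/
def chartFlag (ε : Fin (m - k) ⊕ Fin k ≃ Fin m) (X : Fin (m - k) × Fin k → A) (κ : Fin k)
    (c : Fin k → A) (hc : c κ = 1) : Flag 1 k m A where
  W₁ := grOfUnimodular (chartVec ε X c) (LinearMap.proj (ε (Sum.inr κ)) ∘ₗ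
    (vecEquiv A m).toLinearMap) ((vecEquiv_chartVec ε X c κ).trans hc)
  W₂ := chartPt ε X
  le := by
    exact (Submodule.span_singleton_le_iff_mem _ _).2 (chartVec_mem ε X c)

lemma map_chartFlag (f : A →ₐ[ℂ] B) (ε : Fin (m - k) ⊕ Fin k ≃ Fin m)
    (X : Fin (m - k) × Fin k → A) (κ : Fin k) (c : Fin k → A) (hc : c κ = 1) :
    (chartFlag ε X κ c hc).map f =
      chartFlag ε (fun p => f (X p)) κ (fun j => f (c j)) (by rw [hc, map_one]) := by
  refine Flag.ext ?_ (grMap_chartPt f ε X)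
  refine grMap_eq_of_span rfl ?_
  rintro _ rfl
  rw [vecMap_chartVec]
  exact Submodule.mem_span_singleton_self _

lemma exists_polynomial_chartFlag (ε : Fin (m - k) ⊕ Fin k ≃ Fin m) (X : Fin (m - k) × Fin k → A)
    (κ : Fin k) (c : Fin k → A) (hc : c κ = 1) :
    ∃ (ι : Type) (z : Flag 1 k m (MvPolynomial ι ℂ)) (f : MvPolynomial ι ℂ →ₐ[ℂ] A),
      z.map f = chartFlag ε X κ c hc := by
  let ι : Type := (Fin (m - k) × Fin k) ⊕ {j : Fin k // j ≠ κ}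
  let f : MvPolynomial ι ℂ →ₐ[ℂ] A := MvPolynomial.aeval (Sum.elim X fun j => c j.1)
  refine ⟨ι, chartFlag ε (fun p => MvPolynomial.X (Sum.inl p)) κ
    (normFun κ fun j => MvPolynomial.X (Sum.inr j)) (normFun_self _ _), f, ?_⟩
  rw [map_chartFlag]
  have h1 : (fun j => f (normFun κ (fun j => MvPolynomial.X (Sum.inr j)) j)) = c := by
    rw [map_normFun]
    refine Eq.trans ?_ (normFun_restrict hc)
    congr 1
    ext j
    exact MvPolynomial.aeval_X _ _
  have h2 : (fun p => f (MvPolynomial.X (Sum.inl p))) = X :=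
    funext fun p => MvPolynomial.aeval_X _ _
  simp only [h1, h2]

/-- Every flag is locally pulled back from a polynomial ring. -/
lemma exists_polynomial_flag (hk : k ≤ m) (hm : 1 ≤ m) (W : Flag 1 k m A) (𝔭 : Ideal A)
    [𝔭.IsPrime] : ∃ h ∉ 𝔭, ∃ (ι : Type) (z : Flag 1 k m (MvPolynomial ι ℂ))
      (f : MvPolynomial ι ℂ →ₐ[ℂ] Localization.Away h), z.map f = W.map (locHom h) := by
  obtain ⟨h₁, hh₁, ε, X, hX⟩ := exists_chart hk W.W₂ 𝔭
  obtain ⟨v, hv, l, hl⟩ := exists_coord_notMem hm W.W₁ 𝔭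
  have hv₁ : vecMap (locHom h₁) m v ∈ (chartPt ε X).toSubmodule := by
    rw [← hX]
    exact mem_grMap _ _ (W.le hv)
  -- In a chart the first coordinates of a vector are combinations of the last ones. If the last
  -- ones were all zero in the residue field, so would be the coordinate `l`.
  obtain ⟨κ, hκ⟩ : ∃ κ, vecEquiv A m v (ε (Sum.inr κ)) ∉ 𝔭 := by
    by_contra! hcon
    have hu : IsUnit (algebraMap A 𝔭.ResidueField h₁) := by
      rw [isUnit_iff_ne_zero, Ne, Ideal.algebraMap_residueField_eq_zero]
      exact hh₁
    let g : Localization.Away h₁ →+* 𝔭.ResidueField := IsLocalization.Away.lift h₁ hu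
    have hg : ∀ a, g (locHom h₁ a) = algebraMap A 𝔭.ResidueField a :=
      IsLocalization.Away.lift_eq h₁ hu
    have hcon' : ∀ j, g (locHom h₁ (vecEquiv A m v (ε (Sum.inr j)))) = 0 := fun j => by
      rw [hg, Ideal.algebraMap_residueField_eq_zero]
      exact hcon j
    obtain ⟨l, rfl⟩ := ε.surjective l
    rcases l with i | j
    · have h1 := (mem_chartPt ε X _).1 hv₁ i
      simp only [vecEquiv_vecMap] at h1
      have h2 := congrArg g h1
      rw [map_add, map_sum, map_zero, Finset.sum_eq_zero fun j _ => by
        rw [map_mul, hcon' j, mul_zero], add_zero, hg, Ideal.algebraMap_residueField_eq_zero] at h2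
      exact hl h2
    · exact hl (hcon j)
  refine ⟨h₁ * vecEquiv A m v (ε (Sum.inr κ)), fun hmem =>
    (‹𝔭.IsPrime›.mem_or_mem hmem).elim hh₁ hκ, ?_⟩
  set h := h₁ * vecEquiv A m v (ε (Sum.inr κ)) with hdef
  have hu : IsUnit (locHom h h₁) ∧ IsUnit (locHom h (vecEquiv A m v (ε (Sum.inr κ)))) := by
    have := locHom_self_isUnit h
    rw [hdef, map_mul] at this
    exact ⟨isUnit_of_mul_isUnit_left this, isUnit_of_mul_isUnit_right this⟩
  let f₁ := awayLift h₁ (locHom h) hu.1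
  have hf₁ : f₁.comp (locHom h₁) = locHom h := awayLift_comp _ _ _
  obtain ⟨u, huu⟩ := hu.2.exists_left_inv
  have hW₂ : Gr.map (locHom h) W.W₂ = chartPt ε fun p => f₁ (X p) := by
    rw [← grMap_chartPt, ← hX, ← grMap_comp, hf₁]
  let c : Fin k → Localization.Away h := fun j => u * locHom h (vecEquiv A m v (ε (Sum.inr j)))
  have hc : c κ = 1 := huu
  obtain ⟨ι, z, f, hz⟩ := exists_polynomial_chartFlag ε (fun p => f₁ (X p)) κ c hc
  refine ⟨ι, z, f, hz.trans (Flag.ext ?_ hW₂.symm)⟩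
  apply gr_eq_of_le
  have h1 : vecMap (locHom h) m v ∈ (chartPt ε fun p => f₁ (X p)).toSubmodule := by
    rw [← hW₂]
    exact mem_grMap _ _ (W.le hv)
  have h2 : chartVec ε (fun p => f₁ (X p)) c = u • vecMap (locHom h) m v := by
    rw [eq_chartVec h1, ← chartVec_smul]
    simp only [vecEquiv_vecMap]
    rfl
  change Submodule.span _ {chartVec ε (fun p => f₁ (X p)) c} ≤ _
  rw [Submodule.span_singleton_le_iff_mem, h2]
  exact Submodule.smul_mem _ _ (mem_grMap _ _ hv)

lemma exists_polynomial_linePair {p q : ℕ} (hp : 1 ≤ p) (hq : 1 ≤ q) (L : Gr 1 p A) (M : Gr 1 q A)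
    (𝔭 : Ideal A) [𝔭.IsPrime] : ∃ h ∉ 𝔭, ∃ (ι : Type) (L' : Gr 1 p (MvPolynomial ι ℂ))
      (M' : Gr 1 q (MvPolynomial ι ℂ)) (f : MvPolynomial ι ℂ →ₐ[ℂ] Localization.Away h),
      L'.map f = L.map (locHom h) ∧ M'.map f = M.map (locHom h) := by
  obtain ⟨h₁, hh₁, a, w, hw, hL⟩ := exists_lineOf hp L 𝔭
  obtain ⟨h₂, hh₂, b, x, hx, hM⟩ := exists_lineOf hq M 𝔭
  refine ⟨h₁ * h₂, fun hmem => (‹𝔭.IsPrime›.mem_or_mem hmem).elim hh₁ hh₂, ?_⟩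
  set h := h₁ * h₂ with hdef
  have hu : IsUnit (locHom h h₁) ∧ IsUnit (locHom h h₂) := by
    have := locHom_self_isUnit h
    rw [hdef, map_mul] at this
    exact ⟨isUnit_of_mul_isUnit_left this, isUnit_of_mul_isUnit_right this⟩
  let f₁ := awayLift h₁ (locHom h) hu.1
  have hf₁ : f₁.comp (locHom h₁) = locHom h := awayLift_comp _ _ _
  let f₂ := awayLift h₂ (locHom h) hu.2
  have hf₂ : f₂.comp (locHom h₂) = locHom h := awayLift_comp _ _ _
  let ι : Type := {i : Fin p // i ≠ a} ⊕ {i : Fin q // i ≠ b}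
  let f : MvPolynomial ι ℂ →ₐ[ℂ] Localization.Away h :=
    MvPolynomial.aeval (Sum.elim (fun i => f₁ (w i.1)) fun i => f₂ (x i.1))
  let w' : Fin p → MvPolynomial ι ℂ := normFun a fun i => MvPolynomial.X (Sum.inl i)
  let x' : Fin q → MvPolynomial ι ℂ := normFun b fun i => MvPolynomial.X (Sum.inr i)
  have hw' : IsUnit (w' a) := by rw [show w' a = 1 from normFun_self _ _]; exact isUnit_one
  have hx' : IsUnit (x' b) := by rw [show x' b = 1 from normFun_self _ _]; exact isUnit_one
  have h1 : (fun i => f (w' i)) = fun i => f₁ (w i) := by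
    rw [map_normFun]
    refine Eq.trans ?_ (normFun_restrict (a := a) (by rw [hw, map_one]))
    congr 1
    ext i
    exact MvPolynomial.aeval_X _ _
  have h2 : (fun i => f (x' i)) = fun i => f₂ (x i) := by
    rw [map_normFun]
    refine Eq.trans ?_ (normFun_restrict (a := b) (by rw [hx, map_one]))
    congr 1
    ext i
    exact MvPolynomial.aeval_X _ _
  refine ⟨ι, lineOf w' a hw', lineOf x' b hx', f, ?_, ?_⟩
  · rw [← hf₁, grMap_comp, hL, grMap_lineOf, grMap_lineOf]
    simp only [h1]
  · rw [← hf₂, grMap_comp, hM, grMap_lineOf, grMap_lineOf]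
    simp only [h2]

end FlagCharts

/-! ### Sections are determined by their values at complex points. -/

section Density

variable {k m : ℕ}

lemma quot_eq_zero_iff {A : Type} [CommRing A] [Algebra ℂ A] (W : Gr k m A)
    (x : Vec A m ⧸ W.toSubmodule) :
    x = 0 ↔ ∀ φ : (Vec A m ⧸ W.toSubmodule) →ₗ[A] A, φ x = 0 := by
  obtain ⟨v, rfl⟩ := Submodule.Quotient.mk_surjective _ x
  rw [Submodule.Quotient.mk_eq_zero, mem_iff_functional]

lemma quot_eq_zero_of_locally {A : Type} [CommRing A] [Algebra ℂ A] {W : Gr k m A}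
    {x : Vec A m ⧸ W.toSubmodule}
    (h : ∀ 𝔭 : Ideal A, 𝔭.IsPrime → ∃ s ∉ 𝔭, quotMap (locHom s) W x = 0) : x = 0 := by
  rw [quot_eq_zero_iff]
  intro φ
  refine eq_zero_of_locally _ fun 𝔭 h𝔭 => ?_
  obtain ⟨s, hs, hx⟩ := h 𝔭 h𝔭
  exact ⟨s, hs, (quotMap_eq_zero_iff _ W x).1 hx φ⟩

/-- Functionals on the quotient take polynomial values, and a complex polynomial that vanishes
everywhere is zero. -/
lemma quot_eq_zero_of_complex {ι : Type} {W : Gr k m (MvPolynomial ι ℂ)}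
    {x : Vec (MvPolynomial ι ℂ) m ⧸ W.toSubmodule}
    (h : ∀ f : MvPolynomial ι ℂ →ₐ[ℂ] ℂ, quotMap f W x = 0) : x = 0 := by
  rw [quot_eq_zero_iff]
  intro φ
  refine MvPolynomial.funext fun c => ?_
  rw [map_zero, ← MvPolynomial.coe_aeval_eq_eval]
  exact (quotMap_eq_zero_iff _ W x).1 (h (MvPolynomial.aeval c)) φ

/-- Every flag is locally pulled back from a polynomial ring, where the complex points decide. -/
lemma sectionsQuot_eq_zero {r : ℕ} (hk : k ≤ m) (hm : 1 ≤ m) {s : sectionsQuot 1 k m r}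
    (h : ∀ x : Flag 1 k m baseField, s.1 baseField x = 0) : s = 0 := by
  have hs := s.2
  refine Subtype.ext (funext fun A => funext fun W => funext fun a => ?_)
  refine quot_eq_zero_of_locally (W := W.W₂) fun 𝔭 h𝔭 => ?_
  obtain ⟨t, ht, ι, z, f, hz⟩ := exists_polynomial_flag hk hm W 𝔭
  refine ⟨t, ht, ?_⟩
  have h1 : s.1 (CommAlgCat.of ℂ (MvPolynomial ι ℂ)) z a = 0 :=
    quot_eq_zero_of_complex (W := z.W₂) fun g => by
      have h2 := hs (CommAlgCat.of ℂ (MvPolynomial ι ℂ)) baseField g z a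
      exact h2.symm.trans (congrFun (h _) a)
  have h3 : s.1 (away A t) (z.map f) a = 0 := by
    have h2 := hs (CommAlgCat.of ℂ (MvPolynomial ι ℂ)) (away A t) f z a
    rw [h1] at h2
    exact h2.trans (map_zero _)
  have h4 := hs A (away A t) (locHom t) W a
  have h5 : s.1 (away A t) (W.map (locHom t)) a = 0 := by
    rw [← hz]; exact h3
  exact h4.symm.trans h5

lemma sectionsTwistedQuot_map_eq_zero {p q : ℕ} {s : sectionsTwistedQuot p q}
    {A B : CommAlgCat.{0} ℂ} (f : A →ₐ[ℂ] B) {L : Gr 1 (p + 1) A} {M : Gr 1 (q + 1) A}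
    (h : s.1 A L M = 0) : s.1 B (L.map f) (M.map f) = 0 := by
  have hle : (M.map f).toSubmodule ≤
      (LinearMap.ker (s.1 B (L.map f) (M.map f))).map (M.map f).toSubmodule.subtype := by
    refine (grMap_eq_span f M).le.trans (Submodule.span_le.2 ?_)
    rintro _ ⟨w, hw, rfl⟩
    refine ⟨subMap f M ⟨w, hw⟩, ?_, rfl⟩
    rw [SetLike.mem_coe, LinearMap.mem_ker, s.2 A B f L M, h, LinearMap.zero_apply, map_zero]
  refine LinearMap.ext fun v => ?_
  obtain ⟨v', hv', hvv⟩ := hle v.2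
  rw [← Subtype.ext hvv]
  exact hv'

lemma sectionsTwistedQuot_eq_zero_of_complex {p q : ℕ} {s : sectionsTwistedQuot p q}
    (h : ∀ L M, s.1 baseField L M = 0) {ι : Type} (L : Gr 1 (p + 1) (MvPolynomial ι ℂ))
    (M : Gr 1 (q + 1) (MvPolynomial ι ℂ)) : s.1 (CommAlgCat.of ℂ (MvPolynomial ι ℂ)) L M = 0 := by
  refine LinearMap.ext fun w => quot_eq_zero_of_complex (W := L) fun g => ?_
  have h2 := s.2 (CommAlgCat.of ℂ (MvPolynomial ι ℂ)) baseField g L M w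
  rw [h] at h2
  exact h2.symm

lemma sectionsTwistedQuot_eq_zero_of_locally {p q : ℕ} {s : sectionsTwistedQuot p q}
    {A : CommAlgCat.{0} ℂ} {L : Gr 1 (p + 1) A} {M : Gr 1 (q + 1) A}
    (h : ∀ 𝔭 : Ideal A, 𝔭.IsPrime → ∃ t ∉ 𝔭,
      s.1 (away A t) (L.map (locHom t)) (M.map (locHom t)) = 0) : s.1 A L M = 0 := by
  refine LinearMap.ext fun v => quot_eq_zero_of_locally (W := L) fun 𝔭 h𝔭 => ?_
  obtain ⟨t, ht, h1⟩ := h 𝔭 h𝔭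
  refine ⟨t, ht, ?_⟩
  have h2 := s.2 A (away A t) (locHom t) L M v
  rw [h1] at h2
  exact h2.symm

lemma sectionsTwistedQuot_eq_zero {p q : ℕ} {s : sectionsTwistedQuot p q}
    (h : ∀ L M, s.1 baseField L M = 0) : s = 0 := by
  refine Subtype.ext (funext fun A => funext fun L => funext fun M =>
    sectionsTwistedQuot_eq_zero_of_locally fun 𝔭 h𝔭 => ?_)
  obtain ⟨t, ht, ι, L', M', f, hL, hM⟩ :=
    exists_polynomial_linePair (Nat.le_add_left 1 p) (Nat.le_add_left 1 q) L M 𝔭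
  refine ⟨t, ht, ?_⟩
  have h3 := sectionsTwistedQuot_map_eq_zero (A := CommAlgCat.of ℂ (MvPolynomial ι ℂ))
    (B := away A t) f (sectionsTwistedQuot_eq_zero_of_complex h L' M')
  rw [hL, hM] at h3
  exact h3

end Density

/-! ### Global sections -/

section GlobalSections

variable {k m r p q : ℕ}

/-- This settles the degenerate case in which the quotient bundle has rank zero. -/
lemma eq_top_of_gr_self (W : Gr m m ℂ) : W.toSubmodule = ⊤ := by
  obtain ⟨w, hw, h⟩ := exists_frame_gr le_rfl W
  rw [h, span_constVec, hw.span_eq_top_of_card_eq_finrank' (by simp), Submodule.comap_top]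

lemma exists_constVec_eq (hkm : k + 1 < m) (s : sectionsQuot 1 (k + 1) m r) (a : Fin r) :
    ∃ v : Fin m → ℂ, ∀ x : Flag 1 (k + 1) m baseField,
      s.1 baseField x a = Submodule.Quotient.mk (constVec ℂ v) := by
  choose σ hσ using fun (A : CommAlgCat.{0} ℂ) (W : Flag 1 (k + 1) m A) =>
    Submodule.Quotient.mk_surjective _ (s.1 A W a)
  have h : IsLiftedSection σ := fun A B f W => by
    rw [← Submodule.Quotient.eq, hσ, s.2 A B f W a, ← hσ A W, quotMap_mk]
  obtain ⟨v, hv⟩ := h.exists_const hkm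
  refine ⟨v, fun x => ?_⟩
  rw [← hσ]
  exact (Submodule.Quotient.eq _).2 (hv x)

/-- The global sections of `𝒬₂^{⊕ r}` are given by vectors. -/
lemma exists_eq_constSection (hkm : k + 1 ≤ m) (s : sectionsQuot 1 (k + 1) m r) :
    ∃ v : Fin r → Fin m → ℂ, s = constSection 1 (k + 1) v := by
  obtain ⟨v, hv⟩ : ∃ v : Fin r → Fin m → ℂ, ∀ (x : Flag 1 (k + 1) m baseField) (a : Fin r),
      s.1 baseField x a = Submodule.Quotient.mk (constVec ℂ (v a)) := by
    rcases hkm.eq_or_lt with rfl | hlt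
    · refine ⟨0, fun x a => ?_⟩
      obtain ⟨z, hz⟩ := Submodule.Quotient.mk_surjective _ (s.1 baseField x a)
      rw [← hz, Submodule.Quotient.eq]
      have h : x.W₂.toSubmodule = ⊤ := eq_top_of_gr_self x.W₂
      rw [h]
      exact Submodule.mem_top
    · choose v hv using exists_constVec_eq hlt s
      exact ⟨v, fun x a => hv a x⟩
  refine ⟨v, sub_eq_zero.1 (sectionsQuot_eq_zero hkm (by omega) fun x => funext fun a => ?_)⟩
  exact sub_eq_zero.2 (hv x a)

lemma exists_dual_eq_one {v : Fin m → ℂ} (hv : v ≠ 0) :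
    ∃ ψ : (Fin m → ℂ) →ₗ[ℂ] ℂ, ψ v = 1 := by
  obtain ⟨ψ, hψ⟩ := exists_dual_frame (LinearIndependent.of_subsingleton (v := fun _ : Fin 1 => v) 0 hv)
  exact ⟨ψ 0, hψ 0 0⟩

/-- The constant line spanned by a nonzero vector. -/
def constLine (A : Type) [CommRing A] [Algebra ℂ A] {v : Fin m → ℂ} (hv : v ≠ 0) : Gr 1 m A :=
  grOfUnimodular (constVec A v) (constDual A (exists_dual_eq_one hv).choose)
    (by rw [constDual_constVec, (exists_dual_eq_one hv).choose_spec, map_one])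

lemma constVec_mem_constLine (A : Type) [CommRing A] [Algebra ℂ A] {v : Fin m → ℂ} (hv : v ≠ 0) :
    constVec A v ∈ (constLine A hv).toSubmodule :=
  Submodule.mem_span_singleton_self _

lemma map_constLine {A B : Type} [CommRing A] [Algebra ℂ A] [CommRing B] [Algebra ℂ B]
    (f : A →ₐ[ℂ] B) {v : Fin m → ℂ} (hv : v ≠ 0) :
    (constLine A hv).map f = constLine B hv := by
  refine grMap_eq_of_span rfl ?_
  rintro _ rfl
  rw [vecMap_constVec]
  exact constVec_mem_constLine B hv

lemma constLine_eq {A : Type} [CommRing A] [Algebra ℂ A] {v : Fin m → ℂ} (hv : v ≠ 0)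
    {M : Gr 1 m A} (h : constVec A v ∈ M.toSubmodule) : constLine A hv = M :=
  gr_eq_of_le ((Submodule.span_singleton_le_iff_mem _ _).2 h)

/-- The section `s` of `𝒬(0,1)` takes the value `u` at `v`, at all complex points. -/
def HasValue (s : sectionsTwistedQuot p q) (v : Fin (q + 1) → ℂ) (u : Fin (p + 1) → ℂ) : Prop :=
  ∀ (L : Gr 1 (p + 1) ℂ) (M : Gr 1 (q + 1) ℂ) (h : constVec ℂ v ∈ M.toSubmodule),
    s.1 baseField L M ⟨constVec ℂ v, h⟩ = Submodule.Quotient.mk (constVec ℂ u)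

/-- For fixed `v`, the values at `v` form a section in `L` of the quotient bundle on lines. Lines
are treated as flags with `W₁ ⊆ W₂` both of rank one, so that the constancy result applies. -/
lemma exists_hasValue (hp : 1 ≤ p) (s : sectionsTwistedQuot p q) {v : Fin (q + 1) → ℂ}
    (hv : v ≠ 0) : ∃ u, HasValue s v u := by
  choose σ hσ using fun (A : CommAlgCat.{0} ℂ) (W : Flag 1 (0 + 1) (p + 1) A) =>
    Submodule.Quotient.mk_surjective _
      (s.1 A W.W₂ (constLine A hv) ⟨constVec A v, constVec_mem_constLine A hv⟩)
  have h : IsLiftedSection σ := fun A B f W => by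
    rw [← Submodule.Quotient.eq, hσ, ← quotMap_mk, hσ A W]
    refine Eq.trans (s.2 A B f W.W₂ (constLine A hv) _).symm ?_
    have key : ∀ (M : Gr 1 (q + 1) B) (w : M.toSubmodule), M = constLine B hv →
        w.1 = constVec B v → s.1 B (W.W₂.map f) M w = s.1 B (W.map f).W₂ (constLine B hv)
          ⟨constVec B v, constVec_mem_constLine B hv⟩ := by
      rintro M ⟨w, hw⟩ rfl rfl
      rfl
    exact key _ _ (map_constLine f hv) (vecMap_constVec f v)
  obtain ⟨u, hu⟩ := h.exists_const (by omega)
  refine ⟨u, fun L M hM => ?_⟩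
  obtain rfl := constLine_eq hv hM
  have h1 := hu ⟨L, L, le_rfl⟩
  exact (hσ baseField ⟨L, L, le_rfl⟩).symm.trans ((Submodule.Quotient.eq _).2 h1)

lemma hasValue_zero (s : sectionsTwistedQuot p q) : HasValue s 0 0 := fun L M h => by
  have h0 : (⟨constVec ℂ 0, h⟩ : M.toSubmodule) = 0 := Subtype.ext (TensorProduct.tmul_zero _ _)
  have h1 : constVec ℂ (0 : Fin (p + 1) → ℂ) = 0 := TensorProduct.tmul_zero _ _
  exact (congrArg (s.1 baseField L M) h0).trans ((map_zero _).trans (by rw [h1]; rfl))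

lemma constVec_smul (c : ℂ) (v : Fin m → ℂ) : constVec ℂ (c • v) = c • constVec ℂ v := by
  rw [constVec_complex, map_smul, ← constVec_complex]

lemma HasValue.smul {s : sectionsTwistedQuot p q} {v : Fin (q + 1) → ℂ} {u : Fin (p + 1) → ℂ}
    (h : HasValue s v u) (c : ℂ) : HasValue s (c • v) (c • u) := by
  rcases eq_or_ne c 0 with rfl | hc
  · rw [zero_smul, zero_smul]
    exact hasValue_zero s
  intro L M hM
  have hM' : constVec ℂ v ∈ M.toSubmodule := by
    rw [constVec_smul] at hM
    exact (Submodule.smul_mem_iff _ hc).1 hM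
  have h0 : (⟨constVec ℂ (c • v), hM⟩ : M.toSubmodule) = c • ⟨constVec ℂ v, hM'⟩ :=
    Subtype.ext (constVec_smul c v)
  refine (congrArg (s.1 baseField L M) h0).trans (((s.1 baseField L M).map_smul c _).trans ?_)
  rw [constVec_smul, Submodule.Quotient.mk_smul]
  exact congrArg (c • ·) (h L M hM')

lemma HasValue.unique_dual {s : sectionsTwistedQuot p q} {v : Fin (q + 1) → ℂ}
    {w : Vec ℂ (p + 1)} {u : Fin (p + 1) → ℂ} {L : Gr 1 (p + 1) ℂ} {M : Gr 1 (q + 1) ℂ}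
    {z : M.toSubmodule} (hz : z.1 = constVec ℂ v) (hu : HasValue s v u)
    (hw : s.1 baseField L M z = Submodule.Quotient.mk w) {θ : (Fin (p + 1) → ℂ) →ₗ[ℂ] ℂ}
    (hθ : L.toSubmodule ≤ LinearMap.ker (constDual ℂ θ)) : constDual ℂ θ w = θ u := by
  obtain ⟨z, hzM⟩ := z
  obtain rfl := hz
  have h1 := (Submodule.Quotient.eq _).1 (hw.symm.trans (hu L M hzM))
  have h2 := hθ h1
  rw [LinearMap.mem_ker, map_sub, constDual_constVec] at h2
  exact sub_eq_zero.1 h2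

lemma exists_mem_ker (hp : 1 ≤ p) (θ : (Fin (p + 1) → ℂ) →ₗ[ℂ] ℂ) : ∃ l, l ≠ 0 ∧ θ l = 0 := by
  obtain ⟨l, hl, h0⟩ := Submodule.exists_mem_ne_zero_of_ne_bot
    (LinearMap.ker_ne_bot_of_finrank_lt (f := θ) (by simp; omega))
  exact ⟨l, h0, hl⟩

lemma constLine_le_ker {A : Type} [CommRing A] [Algebra ℂ A] {l : Fin m → ℂ} (hl : l ≠ 0)
    {θ : (Fin m → ℂ) →ₗ[ℂ] ℂ} (h : θ l = 0) :
    (constLine A hl).toSubmodule ≤ LinearMap.ker (constDual A θ) := by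
  refine (Submodule.span_singleton_le_iff_mem _ _).2 ?_
  rw [LinearMap.mem_ker, constDual_constVec, h, map_zero]

/-- Since `p ≥ 1`, every functional on `ℂ^(p+1)` kills some line, and modulo that line it compares
the two values. -/
lemma HasValue.unique (hp : 1 ≤ p) {s : sectionsTwistedQuot p q} {v : Fin (q + 1) → ℂ}
    (hv : v ≠ 0) {u u' : Fin (p + 1) → ℂ} (hu : HasValue s v u) (hu' : HasValue s v u') :
    u = u' := by
  rw [← sub_eq_zero, ← Module.forall_dual_apply_eq_zero_iff ℂ]
  intro θ
  obtain ⟨l, hl, hθ⟩ := exists_mem_ker hp θ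
  have h := hu.unique_dual (z := ⟨_, constVec_mem_constLine ℂ hv⟩) rfl
    (hu' (constLine ℂ hl) (constLine ℂ hv) (constVec_mem_constLine ℂ hv)) (constLine_le_ker hl hθ)
  rw [constDual_constVec] at h
  rw [map_sub, ← h]
  exact sub_self _

/-- Over the affine line the section is evaluated at the generator `v + t v'`, modulo a constant
line in `ker θ`. Applying `θ` gives a polynomial in `t`. -/
lemma exists_polynomial_value (hp : 1 ≤ p) (s : sectionsTwistedQuot p q)
    {g : (Fin (q + 1) → ℂ) → Fin (p + 1) → ℂ} (hg : ∀ v, HasValue s v (g v))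
    {v v' : Fin (q + 1) → ℂ} (h : LinearIndependent ℂ ![v, v'])
    (θ : (Fin (p + 1) → ℂ) →ₗ[ℂ] ℂ) :
    ∃ F : Polynomial ℂ, ∀ c, F.eval c = θ (g (v + c • v')) := by
  obtain ⟨ψ, hψ⟩ := exists_dual_frame h
  have ha1 : ψ 0 v = 1 := hψ 0 0
  have hb0 : ψ 0 v' = 0 := hψ 0 1
  obtain ⟨l, hl, hθ⟩ := exists_mem_ker hp θ
  let y : Vec lineRing (q + 1) :=
    constVec lineRing v + (Polynomial.X : Polynomial ℂ) • constVec lineRing v'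
  let M : Gr 1 (q + 1) lineRing := grOfUnimodular y (constDual lineRing (ψ 0)) (by
    rw [map_add, map_smul, constDual_constVec, constDual_constVec, ha1, hb0, map_one, map_zero,
      smul_zero, add_zero])
  have hy : y ∈ M.toSubmodule := Submodule.mem_span_singleton_self _
  obtain ⟨w, hw⟩ := Submodule.Quotient.mk_surjective _
    (s.1 lineRing (constLine lineRing hl) M ⟨y, hy⟩)
  refine ⟨constDual lineRing θ w, fun c => ?_⟩
  have h1 := s.2 lineRing baseField (evalAt c) (constLine lineRing hl) M ⟨y, hy⟩
  rw [← hw, quotMap_mk] at h1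
  have h2 := (hg (v + c • v')).unique_dual (z := subMap (evalAt c) M ⟨y, hy⟩) (by
    refine (vecMap_add_smul_evalAt c v v').trans ?_
    rw [constVec_add, constVec_smul]) h1 (θ := θ) (by
    rw [map_constLine]
    exact constLine_le_ker hl hθ)
  rw [← h2, ← evalAt_apply]
  exact (constDual_vecMap (evalAt c) θ w).symm

/-- For independent vectors, homogeneity relates the polynomials along `v + t v'` and `v' + t v` as
`eval_one_eq_add` requires. Dependent vectors need only homogeneity. -/
lemma value_add (hp : 1 ≤ p) {s : sectionsTwistedQuot p q}
    {g : (Fin (q + 1) → ℂ) → Fin (p + 1) → ℂ} (hg : ∀ v, HasValue s v (g v))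
    (hsmul : ∀ (c : ℂ) v, g (c • v) = c • g v) (v v' : Fin (q + 1) → ℂ) :
    g (v + v') = g v + g v' := by
  by_cases h : LinearIndependent ℂ ![v, v']
  · rw [← sub_eq_zero, ← Module.forall_dual_apply_eq_zero_iff ℂ]
    intro θ
    obtain ⟨F, hF⟩ := exists_polynomial_value hp s hg h θ
    obtain ⟨G, hG⟩ := exists_polynomial_value hp s hg (LinearIndependent.pair_symm_iff.1 h) θ
    have h1 := eval_one_eq_add (F := F) (G := G) fun c hc => by
      rw [hF, hG, ← smul_eq_mul, ← map_smul, ← hsmul, smul_add, smul_inv_smul₀ hc, add_comm v]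
    rw [hF, hF, hG, one_smul, zero_smul, zero_smul, add_zero, add_zero] at h1
    rw [map_sub, map_add, h1]
    exact sub_self _
  · rcases eq_or_ne v 0 with rfl | hv
    · have h0 : g 0 = 0 := by simpa using hsmul 0 0
      rw [h0, zero_add, zero_add]
    · rw [LinearIndependent.pair_iff' hv] at h
      push Not at h
      obtain ⟨c, rfl⟩ := h
      have h1 : v + c • v = (1 + c) • v := by rw [add_smul, one_smul]
      rw [h1, hsmul, hsmul, add_smul, one_smul]

lemma exists_linear_value (hp : 1 ≤ p) (s : sectionsTwistedQuot p q) :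
    ∃ g : (Fin (q + 1) → ℂ) →ₗ[ℂ] (Fin (p + 1) → ℂ), ∀ v, HasValue s v (g v) := by
  -- Uniqueness of values is available only for `v ≠ 0`, so the value at `0` is fixed to be `0`.
  have hex : ∀ v : Fin (q + 1) → ℂ, ∃ u, HasValue s v u ∧ (v = 0 → u = 0) := fun v => by
    rcases eq_or_ne v 0 with rfl | hv
    · exact ⟨0, hasValue_zero s, fun _ => rfl⟩
    · obtain ⟨u, hu⟩ := exists_hasValue hp s hv
      exact ⟨u, hu, fun h => (hv h).elim⟩
  choose g hg hg0 using hex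
  have hsmul : ∀ (c : ℂ) v, g (c • v) = c • g v := fun c v => by
    by_cases h : c • v = 0
    · rw [hg0 _ h]
      rcases smul_eq_zero.1 h with rfl | hv
      · rw [zero_smul]
      · rw [hg0 _ hv, smul_zero]
    · exact (hg _).unique hp h ((hg v).smul c)
  exact ⟨{ toFun := g, map_add' := value_add hp hg hsmul, map_smul' := hsmul }, hg⟩

lemma eq_linSection {s : sectionsTwistedQuot p q} {g : (Fin (q + 1) → ℂ) →ₗ[ℂ] (Fin (p + 1) → ℂ)}
    (hg : ∀ v, HasValue s v (g v)) : s = linSection g := by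
  refine sub_eq_zero.1 (sectionsTwistedQuot_eq_zero fun L M => LinearMap.ext fun z => ?_)
  obtain ⟨z, hz⟩ := z
  obtain ⟨v, rfl⟩ : ∃ v, constVec ℂ v = z := ⟨_, constVec_vecEquiv z⟩
  refine sub_eq_zero.2 ((hg v L M hz).trans ?_)
  exact congrArg Submodule.Quotient.mk (LinearMap.baseChange_tmul g 1 v).symm

/-- The global sections of `𝒬(0,1)` are given by linear maps. -/
lemma exists_eq_linSection (s : sectionsTwistedQuot p q) :
    ∃ g : (Fin (q + 1) → ℂ) →ₗ[ℂ] (Fin (p + 1) → ℂ), s = linSection g := by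
  rcases p.eq_zero_or_pos with rfl | hp
  -- On `ℙ^0` the quotient bundle is zero, so any linear map gives the section.
  · refine ⟨0, eq_linSection fun v L M h => ?_⟩
    obtain ⟨z, hz⟩ := Submodule.Quotient.mk_surjective _
      (s.1 baseField L M ⟨constVec ℂ v, h⟩)
    rw [← hz, Submodule.Quotient.eq]
    have h1 : L.toSubmodule = ⊤ := eq_top_of_gr_self (m := 1) L
    rw [h1]
    exact Submodule.mem_top
  · obtain ⟨g, hg⟩ := exists_linear_value hp s
    exact ⟨g, eq_linSection hg⟩

end GlobalSections

/-! ### General sections -/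

section GeneralSections

variable {k m r p q : ℕ}

lemma ForGeneral.mono {H : Type*} [AddCommGroup H] [Module ℂ H] {P Q : H → Prop}
    (hP : ForGeneral P) (h : ∀ s, P s → Q s) : ForGeneral Q := by
  obtain ⟨f, hf, hf0, hfP⟩ := hP
  exact ⟨f, hf, hf0, fun x hx => h x (hfP x hx)⟩

lemma forGeneral_of_forall {H : Type*} [AddCommGroup H] [Module ℂ H] {P : H → Prop}
    (h : ∀ s, P s) : ForGeneral P :=
  ⟨1, one_mem _, one_ne_zero, fun s _ => h s⟩

/-- A general family of vectors is linearly independent. -/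
lemma forGeneral_linearIndependent {H : Type*} [AddCommGroup H] [Module ℂ H]
    (R : H ≃ₗ[ℂ] (Fin r → Fin m → ℂ)) (h : r ≤ m) :
    ForGeneral fun s => LinearIndependent ℂ (R s) := by
  let ℓ : Fin r → Fin r → Module.Dual ℂ H := fun i j =>
    LinearMap.proj (Fin.castLE h j) ∘ₗ LinearMap.proj i ∘ₗ R.toLinearMap
  -- The determinant of `D` is the leading `r × r` minor as a polynomial function on `H`; it takes
  -- the value `1` at the standard vectors.
  let D : Matrix (Fin r) (Fin r) (H → ℂ) := Matrix.of fun i j x => ℓ i j x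
  have hD : ∀ x, D.det x = (Matrix.of fun i j => R x i (Fin.castLE h j)).det := fun x =>
    RingHom.map_det (Pi.evalRingHom (fun _ : H => ℂ) x) D
  refine ⟨D.det, ?_, ?_, fun x hx => ?_⟩
  · rw [Matrix.det_apply]
    refine sum_mem fun σ _ => ?_
    rw [Units.smul_def]
    refine zsmul_mem (Subalgebra.prod_mem _ fun i _ => Algebra.subset_adjoin ?_) _
    exact ⟨ℓ (σ i) i, rfl⟩
  · obtain ⟨x, hx⟩ := R.surjective fun i j => if j = Fin.castLE h i then 1 else 0
    intro h0
    have h1 := hD x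
    have h2 : (Matrix.of fun i j => R x i (Fin.castLE h j)) = (1 : Matrix (Fin r) (Fin r) ℂ) := by
      ext i j
      rw [Matrix.of_apply, hx, Matrix.one_apply]
      exact if_congr ((Fin.castLE_injective h).eq_iff.trans eq_comm) rfl rfl
    rw [h0, h2, Matrix.det_one] at h1
    exact zero_ne_one h1
  · rw [hD] at hx
    have h1 := Matrix.linearIndependent_rows_of_det_ne_zero hx
    exact LinearIndependent.of_comp (LinearMap.funLeft ℂ ℂ (Fin.castLE h)) h1

/-- The linear map assigning to vectors the section of the quotient bundle they define. -/
def constSectionHom (k₁ k₂ m r : ℕ) : (Fin r → Fin m → ℂ) →ₗ[ℂ] sectionsQuot k₁ k₂ m r where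
  toFun v := constSection k₁ k₂ v
  map_add' v w := Subtype.ext <| funext fun _ => funext fun _ => funext fun a =>
    congrArg Submodule.Quotient.mk (TensorProduct.tmul_add _ (v a) (w a))
  map_smul' c v := Subtype.ext <| funext fun A => funext fun _ => funext fun a =>
    congrArg Submodule.Quotient.mk (TensorProduct.tmul_smul c (1 : A) (v a))

/-- The linear map assigning to a linear map the section of `𝒬(0,1)` it defines. -/
def linSectionHom (p q : ℕ) :
    ((Fin (q + 1) → ℂ) →ₗ[ℂ] (Fin (p + 1) → ℂ)) →ₗ[ℂ] sectionsTwistedQuot p q where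
  toFun g := linSection g
  map_add' g g' := Subtype.ext <| funext fun A => funext fun L => funext fun M =>
    LinearMap.ext fun v => by
      simp only [linSection, LinearMap.baseChange_add, LinearMap.add_comp, LinearMap.comp_add]
      rfl
  map_smul' c g := Subtype.ext <| funext fun A => funext fun L => funext fun M =>
    LinearMap.ext fun v => by
      simp only [linSection, LinearMap.baseChange_smul, LinearMap.smul_comp, LinearMap.comp_smul]
      rfl

lemma exists_frame_notMem (hkm : k < m) {u : Fin m → ℂ} (hu : u ≠ 0) :
    ∃ w : Fin k → Fin m → ℂ, LinearIndependent ℂ w ∧ u ∉ Submodule.span ℂ (Set.range w) := by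
  obtain ⟨θ, hθ⟩ := exists_dual_eq_one hu
  have h1 : k ≤ Module.finrank ℂ (LinearMap.ker θ) := by
    have h2 := LinearMap.finrank_range_add_finrank_ker θ
    have h3 := Submodule.finrank_le (LinearMap.range θ)
    rw [Module.finrank_self] at h3
    rw [Module.finrank_fin_fun] at h2
    omega
  obtain ⟨b, hb⟩ : ∃ b : Fin k → LinearMap.ker θ, LinearIndependent ℂ b :=
    ⟨_, (Module.finBasis ℂ (LinearMap.ker θ)).linearIndependent.comp _ (Fin.castLE_injective h1)⟩
  refine ⟨fun i => (b i).1, hb.map' _ (Submodule.ker_subtype _), fun hmem => ?_⟩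
  have h2 := (span_range_le_ker_iff (θ := θ)).2 (fun i => (b i).2) hmem
  rw [LinearMap.mem_ker, hθ] at h2
  exact one_ne_zero h2

/-- A nonzero vector avoids some subspace of dimension `k + 1 < m`, and the section does not vanish
at a flag with that subspace. -/
lemma constSectionHom_injective (hkm : k + 1 < m) :
    Function.Injective (constSectionHom 1 (k + 1) m r) := by
  rw [injective_iff_map_eq_zero]
  intro v hv
  funext a
  by_contra hva
  obtain ⟨w, hw, hwa⟩ := exists_frame_notMem hkm hva
  obtain ⟨x, hx⟩ := exists_complexFlag hw 0
  have h1 : (constSection 1 (k + 1) v).1 baseField x = 0 :=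
    congrFun (congrFun (congrArg Subtype.val hv) baseField) x
  have h2 : constVec ℂ (v a) ∈ x.W₂.toSubmodule :=
    (constSection_eq_zero_iff v baseField x).1 h1 a
  rw [hx.space, mem_span_constVec_iff, vecEquiv_constVec] at h2
  exact hwa h2

lemma hasValue_linSection (g : (Fin (q + 1) → ℂ) →ₗ[ℂ] (Fin (p + 1) → ℂ)) (v : Fin (q + 1) → ℂ) :
    HasValue (linSection g) v (g v) := fun _ _ _ =>
  congrArg Submodule.Quotient.mk (LinearMap.baseChange_tmul g 1 v)

lemma linSectionHom_injective (hp : 1 ≤ p) : Function.Injective (linSectionHom p q) := by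
  rw [injective_iff_map_eq_zero]
  intro g hg
  refine LinearMap.ext fun v => ?_
  rcases eq_or_ne v 0 with rfl | hv
  · rw [map_zero, map_zero]
  · have h0 : linSection g = linSection 0 := hg.trans (map_zero (linSectionHom p q)).symm
    have h1 := hasValue_linSection g v
    rw [h0] at h1
    exact h1.unique hp hv (hasValue_linSection 0 v)

/-- A general section of `𝒬₂^{⊕ r}` is given by linearly independent vectors. -/
lemma forGeneral_constSection (hkm : k + 1 ≤ m) (hrm : r ≤ m) :
    ForGeneral fun s : sectionsQuot 1 (k + 1) m r =>
      ∃ v : Fin r → Fin m → ℂ, LinearIndependent ℂ v ∧ s = constSection 1 (k + 1) v := by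
  rcases hkm.eq_or_lt with rfl | hlt
  · refine forGeneral_of_forall fun s => ?_
    -- The bundle is zero here, so any independent family represents the section.
    refine ⟨fun i => Pi.single (Fin.castLE hrm i) 1, ?_, ?_⟩
    · exact (Pi.linearIndependent_single_one (Fin (k + 1)) ℂ).comp _ (Fin.castLE_injective hrm)
    · refine sub_eq_zero.1 (sectionsQuot_eq_zero le_rfl (by omega) fun x => funext fun a => ?_)
      obtain ⟨z, hz⟩ := Submodule.Quotient.mk_surjective _
        ((s - constSection 1 (k + 1) _).1 baseField x a)
      rw [← hz]
      refine (Submodule.Quotient.mk_eq_zero _).2 ?_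
      have h : x.W₂.toSubmodule = ⊤ := eq_top_of_gr_self x.W₂
      rw [h]
      exact Submodule.mem_top
  · let e := LinearEquiv.ofBijective (constSectionHom 1 (k + 1) m r)
      ⟨constSectionHom_injective hlt, fun s => by
        obtain ⟨v, hv⟩ := exists_eq_constSection hkm s
        exact ⟨v, hv.symm⟩⟩
    exact (forGeneral_linearIndependent e.symm hrm).mono
      fun s hs => ⟨_, hs, (e.apply_symm_apply s).symm⟩

/-- The rows of the matrix of a linear map. -/
def matrixEquiv : ((Fin q → ℂ) →ₗ[ℂ] (Fin p → ℂ)) ≃ₗ[ℂ] (Fin p → Fin q → ℂ) :=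
  LinearMap.toMatrix'

lemma matrixEquiv_apply (g : (Fin q → ℂ) →ₗ[ℂ] (Fin p → ℂ)) (i : Fin p) (j : Fin q) :
    matrixEquiv g i j = g (Pi.single j 1) i := LinearMap.toMatrix'_apply g i j

/-- A functional that vanishes on the image is a linear relation between the rows. -/
lemma surjective_of_linearIndependent {g : (Fin q → ℂ) →ₗ[ℂ] (Fin p → ℂ)}
    (h : LinearIndependent ℂ (matrixEquiv g)) : Function.Surjective g := by
  rw [← LinearMap.range_eq_top]
  by_contra hcon
  obtain ⟨θ, hθ, hle⟩ := Submodule.exists_le_ker_of_lt_top _ (lt_top_iff_ne_top.2 hcon)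
  refine hθ (LinearMap.pi_ext' fun i => LinearMap.ext_ring ?_)
  refine Fintype.linearIndependent_iff.1 h (fun i => θ (Pi.single i 1)) ?_ i
  funext j
  have h1 : θ (g (Pi.single j 1)) = 0 := hle ⟨_, rfl⟩
  rw [LinearMap.pi_apply_eq_sum_univ θ] at h1
  rw [Finset.sum_apply, Pi.zero_apply, ← h1]
  refine Finset.sum_congr rfl fun i _ => ?_
  have hs : (fun x => if i = x then (1 : ℂ) else 0) = Pi.single i 1 := by
    ext x
    simp [Pi.single_apply, eq_comm]
  rw [hs, Pi.smul_apply, matrixEquiv_apply, smul_eq_mul, smul_eq_mul, mul_comm]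

/-- A general section of `𝒬(0,1)` is given by a surjective linear map. -/
lemma forGeneral_linSection (hpq : p ≤ q) : ForGeneral fun s : sectionsTwistedQuot p q =>
    ∃ g : (Fin (q + 1) → ℂ) →ₗ[ℂ] (Fin (p + 1) → ℂ), Function.Surjective g ∧
      s = linSection g := by
  rcases p.eq_zero_or_pos with rfl | hp
  · refine forGeneral_of_forall fun s => ?_
    let g : (Fin (q + 1) → ℂ) →ₗ[ℂ] (Fin (0 + 1) → ℂ) := LinearMap.pi fun _ => LinearMap.proj 0
    refine ⟨g, fun y => ⟨fun _ => y 0, funext fun i => ?_⟩, ?_⟩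
    · exact congrArg y (Fin.ext (by omega))
    · refine sub_eq_zero.1 (sectionsTwistedQuot_eq_zero fun L M => LinearMap.ext fun v => ?_)
      obtain ⟨z, hz⟩ := Submodule.Quotient.mk_surjective _ ((s - linSection g).1 baseField L M v)
      rw [← hz]
      refine (Submodule.Quotient.mk_eq_zero _).2 ?_
      have h : L.toSubmodule = ⊤ := eq_top_of_gr_self (m := 1) L
      rw [h]
      exact Submodule.mem_top
  · let e := LinearEquiv.ofBijective (linSectionHom p q)
      ⟨linSectionHom_injective hp, fun s => by
        obtain ⟨v, hv⟩ := exists_eq_linSection s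
        exact ⟨v, hv.symm⟩⟩
    have h := forGeneral_linearIndependent (H := sectionsTwistedQuot p q)
      (e.symm.trans matrixEquiv) (show p + 1 ≤ q + 1 by omega)
    refine h.mono fun s hs => ⟨e.symm s, surjective_of_linearIndependent hs, ?_⟩
    exact (e.apply_symm_apply s).symm

/-- In suitable coordinates both maps are the projection from `ℂ^m` times a kernel, and the kernels
have equal dimension. -/
lemma exists_equiv_of_surjective {g g' : (Fin q → ℂ) →ₗ[ℂ] (Fin m → ℂ)}
    (hg : Function.Surjective g) (hg' : Function.Surjective g') :
    ∃ h : (Fin q → ℂ) ≃ₗ[ℂ] (Fin q → ℂ), g' = g ∘ₗ h.toLinearMap := by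
  have key : ∀ f : (Fin q → ℂ) →ₗ[ℂ] (Fin m → ℂ), Function.Surjective f →
      ∃ e : (Fin q → ℂ) ≃ₗ[ℂ] (Fin m → ℂ) × LinearMap.ker f, ∀ x, (e x).1 = f x := fun f hf => by
    obtain ⟨π, hπ⟩ := (LinearMap.ker f).subtype.exists_leftInverse_of_injective
      (LinearMap.ker f).ker_subtype
    refine ⟨LinearMap.equivProdOfSurjectiveOfIsCompl f π (LinearMap.range_eq_top.2 hf)
      (LinearMap.range_eq_top.2 fun y => ⟨y, LinearMap.congr_fun hπ y⟩)
      (LinearMap.isCompl_of_proj (LinearMap.congr_fun hπ)), fun x => rfl⟩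
  obtain ⟨e, he⟩ := key g hg
  obtain ⟨e', he'⟩ := key g' hg'
  have hd : Module.finrank ℂ (LinearMap.ker g') = Module.finrank ℂ (LinearMap.ker g) := by
    have h1 := e.finrank_eq
    have h2 := e'.finrank_eq
    rw [Module.finrank_prod] at h1 h2
    omega
  refine ⟨e'.trans (((LinearEquiv.refl ℂ _).prodCongr (LinearEquiv.ofFinrankEq _ _ hd)).trans e.symm),
    LinearMap.ext fun x => ?_⟩
  rw [LinearMap.comp_apply, ← he, ← he']
  simp

lemma nonempty_linePair_iso_of_surjective {g g' : (Fin q → ℂ) →ₗ[ℂ] (Fin m → ℂ)}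
    (hg : Function.Surjective g) (hg' : Function.Surjective g') :
    Nonempty (linePairFunctor g ≅ linePairFunctor g') := by
  obtain ⟨h, hh⟩ := exists_equiv_of_surjective hg hg'
  exact nonempty_linePair_iso h hh

end GeneralSections

/-! ### The blow-up as the zero locus of a general section. -/

section ZeroLoci

variable {n r : ℕ} {B : SchemeC}

lemma nonempty_iso_of_points_iso {X Y : SchemeC} (e : points X ≅ points Y) : Nonempty (X ≅ Y) :=
  let ⟨f, _⟩ := exists_iso_of_points_iso e
  ⟨f⟩

/-- The incidence scheme of a surjective linear map is the zero locus of a general section of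
`𝒬₂^{⊕ r}`. -/
lemma forGeneral_isZeroLocusQuot (hrn : r ≤ n) {F : SchemeC}
    (e : points F ≅ flagFunctor 1 (r + 1) (n + 1))
    {g : (Fin (n + 1) → ℂ) →ₗ[ℂ] (Fin (n - r + 1) → ℂ)} (hg : Function.Surjective g)
    (E : points B ≅ linePairFunctor g) :
    ForGeneral fun s : sectionsQuot 1 (r + 1) (n + 1) r =>
      ∃ (Z : SchemeC) (i : Z ⟶ F), IsZeroLocusQuot e s i ∧ Nonempty (B ≅ Z) := by
  refine (forGeneral_constSection (by omega) (by omega)).mono ?_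
  rintro _ ⟨v, hv, rfl⟩
  obtain ⟨Z, i, hi, ⟨e₁⟩⟩ := exists_isZeroLocusQuot e v
  -- Splitting the injection defined by the independent vectors yields a projection whose kernel is
  -- exactly their span.
  obtain ⟨S, hS⟩ := exists_splitting (p := n - r + 1) (Fintype.linearCombination ℂ v)
    (linearIndependent_iff_injective_fintypeLinearCombination.1 hv) (by omega)
  obtain ⟨e₂⟩ := nonempty_linePair_iso_of_surjective hg S.π_surjective
  obtain ⟨e₃⟩ := nonempty_linePair_iso_flagOver (k := r + 1) S.π_surjective (v := v)
    (by rw [S.ker_π, hS, Fintype.range_linearCombination]) (by omega)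
  exact ⟨Z, i, hi, nonempty_iso_of_points_iso (E ≪≫ e₂ ≪≫ e₃ ≪≫ e₁.symm)⟩

/-- The incidence scheme of a surjective linear map is the zero locus of a general section of
`𝒬(0,1)`. -/
lemma forGeneral_isZeroLocusTwistedQuot {p q : ℕ} (hpq : p ≤ q) {X Y : SchemeC}
    (e₁ : points X ≅ grFunctor 1 (p + 1)) (e₂ : points Y ≅ grFunctor 1 (q + 1))
    {g : (Fin (q + 1) → ℂ) →ₗ[ℂ] (Fin (p + 1) → ℂ)} (hg : Function.Surjective g)
    (E : points B ≅ linePairFunctor g) :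
    ForGeneral fun s : sectionsTwistedQuot p q => ∃ (Z : SchemeC) (i : Z ⟶ X ⨯ Y),
      IsZeroLocusTwistedQuot e₁ e₂ s i ∧ Nonempty (B ≅ Z) := by
  refine (forGeneral_linSection hpq).mono ?_
  rintro _ ⟨g', hg', rfl⟩
  obtain ⟨Z, i, hi, ⟨e₃⟩⟩ := exists_isZeroLocusTwistedQuot e₁ e₂ g'
  obtain ⟨e₄⟩ := nonempty_linePair_iso_of_surjective hg hg'
  exact ⟨Z, i, hi, nonempty_iso_of_points_iso (E ≪≫ e₄ ≪≫ e₃.symm)⟩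

/-- The incidence scheme of a linear projection is the blow-up along the center. -/
lemma exists_isBlowup {p : ℕ} (S : Splitting r p (n + 1)) (hj : Function.Injective S.j) (hr : 1 ≤ r)
    (hp : 1 ≤ p) (hm : r + p = n + 1) : ∃ (B : SchemeC) (b : B ⟶ projectiveSpace n),
      IsBlowup b.left (linearEmbedding S.j hj).ker ∧ Nonempty (points B ≅ linePairFunctor S.π) := by
  obtain ⟨e₁, -⟩ := exists_projOf_iso hp
  obtain ⟨e₂, he₂⟩ := exists_projOf_iso (m := n + 1) (by omega)
  obtain ⟨B, i, -, E, hE⟩ := exists_incidence e₁ e₂ S.π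
  have hb : ∀ (A : CommAlgCat.{0} ℂ) (z : (points B).obj A), LinePair.M (E.hom.app A z) =
      (pointsMap (i ≫ Limits.prod.snd) ≫ e₂.hom).app A z := fun A z => (hE A z).2
  have hi := isZeroLocus_linearEmbeddingC S hj hr hm e₂ he₂
  have h := isBlowup_incidence E e₂ hb hp (Nat.le_add_left 1 n) hi
  exact ⟨B, i ≫ Limits.prod.snd, h, ⟨E⟩⟩

end ZeroLoci

end BlowupFlag

end

theorem corollary2p7 (n r : ℕ) (hr : 1 ≤ r) (hrn : r ≤ n)
    (j : (Fin r → ℂ) →ₗ[ℂ] (Fin (n + 1) → ℂ)) (hj : Function.Injective j) :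
    ∃ (B : BlowupFlag.SchemeC) (b : B ⟶ BlowupFlag.projectiveSpace n),
      BlowupFlag.IsBlowup b.left (BlowupFlag.linearEmbedding j hj).ker ∧
      (∃ (F : BlowupFlag.SchemeC)
        (e : BlowupFlag.points F ≅ BlowupFlag.flagFunctor 1 (r + 1) (n + 1)),
        BlowupFlag.ForGeneral fun s : BlowupFlag.sectionsQuot 1 (r + 1) (n + 1) r =>
          ∃ (Z : BlowupFlag.SchemeC) (i : Z ⟶ F),
            BlowupFlag.IsZeroLocusQuot e s i ∧ Nonempty (B ≅ Z)) ∧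
      (∃ (e₁ : BlowupFlag.points (BlowupFlag.projectiveSpace (n - r)) ≅
            BlowupFlag.grFunctor 1 (n - r + 1))
        (e₂ : BlowupFlag.points (BlowupFlag.projectiveSpace n) ≅ BlowupFlag.grFunctor 1 (n + 1)),
        BlowupFlag.ForGeneral fun s : BlowupFlag.sectionsTwistedQuot (n - r) n =>
          ∃ (Z : BlowupFlag.SchemeC)
            (i : Z ⟶ (BlowupFlag.projectiveSpace (n - r) ⨯ BlowupFlag.projectiveSpace n :
              BlowupFlag.SchemeC)),
            BlowupFlag.IsZeroLocusTwistedQuot e₁ e₂ s i ∧ Nonempty (B ≅ Z)) := by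
  -- The same projection `S.π` produces the blow-up and is compared with both kinds of zero loci.
  obtain ⟨S, rfl⟩ := BlowupFlag.exists_splitting (p := n - r + 1) j hj (by omega)
  obtain ⟨B, b, hb, ⟨E⟩⟩ := BlowupFlag.exists_isBlowup S hj hr (by omega) (by omega)
  obtain ⟨F, ⟨e⟩⟩ := BlowupFlag.exists_flagScheme (k₁ := 1) (k₂ := r + 1) (m := n + 1) le_rfl
    (by omega) (by omega) (by omega)
  obtain ⟨e₁, -⟩ := BlowupFlag.exists_projOf_iso (m := n - r + 1) (by omega)
  obtain ⟨e₂, -⟩ := BlowupFlag.exists_projOf_iso (m := n + 1) (by omega)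
  exact ⟨B, b, hb, ⟨F, e, BlowupFlag.forGeneral_isZeroLocusQuot hrn e S.π_surjective E⟩, e₁, e₂,
    BlowupFlag.forGeneral_isZeroLocusTwistedQuot (Nat.sub_le n r) e₁ e₂ S.π_surjective E⟩
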